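/- **Setting.** Let $d\ge1$, $k_0>0$. The covariance function $R:\mathbb R^d\to\mathbb R$ is even, continuous, bounded and integrable, with power spectrum $\hat R(k)=\int R(x)e^{-ik\cdot x}dx\ge0$. We assume that $\hat R\le\hat{\mathsf R}$ for some radially symmetric $\hat{\mathsf R}\in L^1(\mathbb R^d)$, that $s\mapsto R(\tau+se)$ is integrable for all $\tau\in\mathbb R^d$ and all unit vectors $e$, and that $(1+|\xi|^2)^{(d-2)/2}\hat R(\xi)$ is bounded if $d\ge3$. Either $\eta(\varepsilon)=1$ and $0<\varepsilon\le1$ (kinetic regime), or $\eta(\varepsilon)=(\ln|\ln\varepsilon|)^{-1}$ and $0<\varepsilon<1/e$ (diffusive regime); in the diffusive regime $R$ is moreover maximal at $0$, where its Hessian is defined and negative definite. For $X=(x_1,\dots,x_p)\in\mathbb R^{pd}$, $Y=(y_1,\dots,y_q)\in\mathbb R^{qd}$, $v=(\xi_1,\dots,\xi_p,\zeta_1,\dots,\zeta_q)$, the $(p,q)$-moment equation is $$\partial_z\mu_{p,q}^\varepsilon=\frac{i\eta}{2k_0\varepsilon}\Big(\sum_j\Delta_{x_j}-\sum_l\Delta_{y_l}\Big)\mu_{p,q}^\varepsilon+\frac{k_0^2}{4\eta^2}\,\mathcal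 U_{p,q}\,\mu_{p,q}^\varepsilon,\qquad(1)$$ $$\mathcal U_{p,q}=\sum_{j,l}R(x_j-y_l)-\sum_{j<j'}R(x_j-x_{j'})-\sum_{l<l'}R(y_l-y_{l'})-\tfrac{p+q}2R(0).$$ Its solutions are weak (tested against Schwartz functions), of the form $\mu(z,X,Y)=\int e^{i(\sum_j\xi_j\cdot x_j-\sum_l\zeta_l\cdot y_l)}\,\frac{\hat\mu(z,dv)}{(2\pi)^{(p+q)d}}$ with $\hat\mu(z)$ a finite complex measure whose total variation $\|\hat\mu(z)\|$ is locally bounded in $z\ge0$. For $\gamma=(j,l)$, $1\le j\le p$, $1\le l\le q$, let $A_\gamma k$ be the vector whose blocks $\xi_j,\zeta_l$ equal $k\in\mathbb R^d$ and whose other blocks vanish, let $$L_\gamma(z)\rho(v)=\frac{k_0^2}{4\eta^2}\int\hat R(k)\,\rho(v-A_\gamma k)\,e^{\frac{iz\eta}{k_0\varepsilon}k\cdot(\xi_j-\zeta_l)}\frac{dk}{(2\pi)^d}$$ on finite complex measures, and let $U_\gamma$ be its solution operator: $\partial_zU_\gamma=L_\gamma U_\gamma$, $U_\gamma(0)=\mathbb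 I$. Let $\Lambda_\kappa$, $1\le\kappa\le K$, be the nonempty sets of pairs $(j,l)$ in which no two different pairs share a component, and let $\Lambda_{\kappa,1},\Lambda_{\kappa,2}$ be the sets of first and second components of $\Lambda_\kappa$. With $U_\eta(z)=e^{-k_0^2R(0)z/(4\eta^2)}$ put $$N^\varepsilon_{p,q}=U_\eta^{\frac{p+q}2}\Big(\sum_{\kappa=1}^K\prod_{\gamma\in\Lambda_\kappa}(U_\gamma-\mathbb I)+\mathbb I\Big),$$ $$\mathscr N^\varepsilon_{p,q}(z,X,Y)=\int e^{i(\sum_j\xi_j\cdot x_j-\sum_l\zeta_l\cdot y_l)}e^{-\frac{iz\eta}{2k_0\varepsilon}(\sum_j|\xi_j|^2-\sum_l|\zeta_l|^2)}\,\frac{[N^\varepsilon_{p,q}(z)\hat\mu^\varepsilon_{p,q}(0)](dv)}{(2\pi)^{(p+q)d}},$$ and $\mathscr E^\varepsilon_{p,q}=\mu^\varepsilon_{p,q}-\mathscr N^\varepsilon_{p,q}$. Define $$\mathscr F(h,h',g)=\sum_{\kappa=1}^K\prod_{\gamma\in\Lambda_\kappa}[g_\gamma-h_{\gamma_1}h'_{\gamma_2}]\prod_{j\notin\Lambda_{\kappa,1}}h_j\prod_{l\notin\Lambda_{\kappa,2}}h'_l+\prod_jh_j\prod_lh'_l,$$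 and $\widetilde{\mathscr F}(g)=\sum_\pi\prod_{j=1}^pg_{j,\pi(j)}$ (sum over all permutations of $\{1,\dots,p\}$) if $p=q$, $\widetilde{\mathscr F}(g)=0$ if $p\ne q$. **Theorem.** Let $p,q\ge0$. The solution operators $U_\gamma$ exist, and the following holds. (i) For each $Z\ge0$ there is $c=c(p,q,Z)$ (depending also on $d,k_0,R$ and the regime) such that for all admissible $\varepsilon$, all solutions $\mu^\varepsilon_{p,q}$ of (1) and all $z\in[0,Z]$, $$\|\mu^\varepsilon_{p,q}(z)\|_\infty\le c\,\|\hat\mu^\varepsilon_{p,q}(0)\|,\qquad\|\mathscr E^\varepsilon_{p,q}(z)\|_\infty\le c\,\varepsilon^{1/3}\,\|\hat\mu^\varepsilon_{p,q}(0)\|.$$ In particular, if $\|\hat\mu^\varepsilon_{p,q}(0)\|\le C$ uniformly in $\varepsilon$, these bounds are uniform in $\varepsilon$. (ii) Suppose that, for all $p,q\ge0$, $\mu^\varepsilon_{p,q}$ solves (1) with $\mu^\varepsilon_{p,q}(0,X,Y)=\prod_ju_0^\varepsilon(x_j)\prod_lu_0^{\varepsilon*}(y_l)$, where $\hat u_0^\varepsilon\in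 L^1(\mathbb R^d)$. Then $$\mu^\varepsilon_{p,q}(z,X,Y)=\mathscr F\big((\mu^\varepsilon_{1,0}(z,x_j))_j,(\mu^\varepsilon_{0,1}(z,y_l))_l,(\mu^\varepsilon_{1,1}(z,x_j,y_l))_{j,l}\big)+\mathscr E^\varepsilon_{p,q}(z,X,Y)$$ with the same $\mathscr E^\varepsilon_{p,q}$ as in (i). (iii) For $\mu^\varepsilon_{p,q}$ as in (ii) let $\tilde\mu^\varepsilon_{p,q}=\mathbb E\big[\prod_j(u-\mathbb Eu)(z,x_j)\prod_l(u-\mathbb Eu)^*(z,y_l)\big]$ be the centered moments, i.e. $$\tilde\mu^\varepsilon_{p,q}(z,X,Y)=\sum_{S,T}(-1)^{p+q-|S|-|T|}\mu^\varepsilon_{|S|,|T|}(z,X_S,Y_T)\prod_{j\notin S}\mu^\varepsilon_{1,0}(z,x_j)\prod_{l\notin T}\mu^\varepsilon_{0,1}(z,y_l),$$ the sum being over $S\subseteq\{1,\dots,p\}$, $T\subseteq\{1,\dots,q\}$. For each $Z\ge0$ there is $\varepsilon_0(p,q,Z)>0$ (depending also on $d,k_0,R$ and the regime, not on $u_0^\varepsilon$)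 such that for all admissible $\varepsilon<\varepsilon_0$, all $z\in[0,Z]$ and all $X,Y$, $$\big|\tilde\mu^\varepsilon_{p,q}(z,X,Y)-\widetilde{\mathscr F}\big((\tilde\mu^\varepsilon_{1,1}(z,x_j,y_l))_{j,l}\big)\big|\le\|\hat\mu^\varepsilon_{p,q}(0)\|\,\varepsilon^{1/3}.$$ The same bound holds for $\mathbb E[\prod_j(a_j-\mathbb Ea_j)\prod_l(b_l-\mathbb Eb_l)^*]$ and $\mathbb E[(a_j-\mathbb Ea_j)(b_l-\mathbb Eb_l)^*]$ in place of $\tilde\mu^\varepsilon_{p,q}$ and $\tilde\mu^\varepsilon_{1,1}$ whenever $a_j=u(z,x_j)$, $b_l=u(z,y_l)$ are complex random variables on some probability space whose mixed moments are $\mathbb E[\prod_{j\in S}a_j\prod_{l\in T}b_l^*]=\mu^\varepsilon_{|S|,|T|}(z,X_S,Y_T)$ for all $S,T$. -/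

import Mathlib

open MeasureTheory Set Filter Topology
open scoped ComplexConjugate RealInnerProductSpace SchwartzMap

universe u

noncomputable section

namespace Speckle

/-- The lateral space `ℝ^d`. -/
abbrev Lat (d : ℕ) := EuclideanSpace ℝ (Fin d)

/-- `ℝ^{(p+q)d}`, as tuples indexed by `Fin p ⊕ Fin q`. It is used both for the physical variables
`(X, Y) = (x_1, …, x_p, y_1, …, y_q)` and for the dual variables
`v = (ξ_1, …, ξ_p, ζ_1, …, ζ_q)`; the first `p` blocks are those indexed by `Sum.inl`. -/
abbrev Config (p q d : ℕ) := Fin p ⊕ Fin q → Lat d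

/-! ### The scaling regimes -/

/-- The two scaling regimes. -/
inductive Regime
  | kinetic
  | diffusive

/-- The scale `η(ε)`: equal to `1` in the kinetic regime, and with `η⁻¹ = ln |ln ε|` in the
diffusive regime. -/
def Regime.eta : Regime → ℝ → ℝ
  | .kinetic, _ => 1
  | .diffusive, ε => (Real.log |Real.log ε|)⁻¹

/-- The values of `ε` that are considered: `0 < ε ≤ 1` in the kinetic regime, and those
`ε ∈ (0, 1/e)`, for which `ln ln (1/ε)` is positive, in the diffusive regime. -/
def Regime.range : Regime → Set ℝ
  | .kinetic => Ioc 0 1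
  | .diffusive => Ioo 0 (Real.exp (-1))

/-! ### The covariance function of the medium -/

/-- The power spectrum `R̂(k) = ∫ R(x) e^{-i k·x} dx`. It is real as `R` is even. -/
def spectrum {d : ℕ} (R : Lat d → ℝ) (k : Lat d) : ℝ :=
  (∫ x : Lat d, (R x : ℂ) * Complex.exp (-(Complex.I * (⟪k, x⟫ : ℝ)))).re

/-- The standing assumptions on the lateral covariance function `R`. -/
structure IsCovariance {d : ℕ} (reg : Regime) (R : Lat d → ℝ) : Prop where
  even : ∀ x, R (-x) = R x
  continuous : Continuous R
  integrable : Integrable R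
  bounded : ∃ C : ℝ, ∀ x, |R x| ≤ C
  spectrum_nonneg : ∀ k, 0 ≤ spectrum R k
  /-- the spectrum is dominated by a radially symmetric integrable function -/
  radial_bound : ∃ S : ℝ → ℝ, Integrable (fun k : Lat d => S ‖k‖) ∧ ∀ k, spectrum R k ≤ S ‖k‖
  integrable_line : ∀ e : Lat d, ‖e‖ = 1 → ∀ τ : Lat d, Integrable (fun s : ℝ => R (τ + s • e))
  /-- `⟨ξ⟩^{d-2} R̂(ξ)` is bounded when `d ≥ 3` -/
  weighted_bound : 3 ≤ d → ∃ C : ℝ, ∀ k, Real.sqrt (1 + ‖k‖ ^ 2) ^ (d - 2) * spectrum R k ≤ C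
  /-- in the diffusive regime, `R` is maximal at `0`, where its Hessian is defined and negative
  definite -/
  diffusive : reg = Regime.diffusive →
    (∀ x, R x ≤ R 0) ∧ (∀ᶠ x in 𝓝 (0 : Lat d), DifferentiableAt ℝ R x) ∧
      DifferentiableAt ℝ (fderiv ℝ R) 0 ∧ ∀ v : Lat d, v ≠ 0 → fderiv ℝ (fderiv ℝ R) 0 v v < 0

/-! ### Complex measures and their inverse Fourier transforms -/

/-- The total variation `|m|(Ω)` of a complex measure. -/
def tv {Ω : Type*} [MeasurableSpace Ω] (m : ComplexMeasure Ω) : ℝ :=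
  (m.variation univ).toReal

/-- The integral `∫ f dm` of a complex function against a complex measure. -/
def cint {Ω : Type*} [MeasurableSpace Ω] (m : ComplexMeasure Ω) (f : Ω → ℂ) : ℂ :=
  m.integral f (ContinuousLinearMap.mul ℝ ℂ)

variable {d p q : ℕ}

/-- The symmetrized pairing `∑_j ξ_j·x_j - ∑_l ζ_l·y_l` of `v = (ξ, ζ)` and `(X, Y)`. -/
def pairing (v X : Config p q d) : ℝ :=
  ∑ j : Fin p, ⟪v (Sum.inl j), X (Sum.inl j)⟫ - ∑ l : Fin q, ⟪v (Sum.inr l), X (Sum.inr l)⟫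

/-- The inverse Fourier transform
`∫ e^{i(∑ ξ_j·x_j - ∑ ζ_l·y_l)} m(dv) / (2π)^{(p+q)d}` of a complex measure. -/
def invFourier (m : ComplexMeasure (Config p q d)) (X : Config p q d) : ℂ :=
  ((2 * Real.pi) ^ ((p + q) * d) : ℝ)⁻¹ * cint m fun v => Complex.exp (Complex.I * pairing v X)

/-! ### The moment equation -/

/-- The Laplacian in the block of variables with index `a`. -/
def blockLaplacian (Φ : Config p q d → ℂ) (a : Fin p ⊕ Fin q) (X : Config p q d) : ℂ :=
  Laplacian.laplacian (fun x : Lat d => Φ (Function.update X a x)) (X a)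

/-- The potential `𝒰_{p,q}(X, Y)`. -/
def potential (R : Lat d → ℝ) (X : Config p q d) : ℝ :=
  ∑ j : Fin p, ∑ l : Fin q, R (X (Sum.inl j) - X (Sum.inr l))
    - ∑ j : Fin p, ∑ j' ∈ Finset.Ioi j, R (X (Sum.inl j) - X (Sum.inl j'))
    - ∑ l : Fin q, ∑ l' ∈ Finset.Ioi l, R (X (Sum.inr l) - X (Sum.inr l'))
    - ((p : ℝ) + q) / 2 * R 0

/-- The operator `ℒ = (iη / 2k₀ε) (∑_j Δ_{x_j} - ∑_l Δ_{y_l}) + (k₀² / 4η²) 𝒰_{p,q}`. -/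
def momentOp (k₀ : ℝ) (R : Lat d → ℝ) (η ε : ℝ) (Φ : Config p q d → ℂ) (X : Config p q d) : ℂ :=
  Complex.I * (η / (2 * k₀ * ε) : ℝ) *
      (∑ j : Fin p, blockLaplacian Φ (Sum.inl j) X - ∑ l : Fin q, blockLaplacian Φ (Sum.inr l) X)
    + (k₀ ^ 2 / (4 * η ^ 2) : ℝ) * (potential R X : ℂ) * Φ X

/-- `m z`, for `z ≥ 0`, is the Fourier transform `μ̂_{p,q}(z)`, a finite complex measure, of a
solution `μ_{p,q}(z, X, Y) = invFourier (m z) (X, Y)` of the moment equation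
`∂_z μ_{p,q} = ℒ μ_{p,q}`, with `m 0` the Fourier transform of the incident condition. The equation
is understood in the weak sense: it is tested against Schwartz functions `Φ` of `(X, Y)`. Note that
`ℒ` is its own transpose for the pairing `∫ μ Φ`. -/
structure IsMomentSolution (k₀ : ℝ) (R : Lat d → ℝ) (η ε : ℝ)
    (m : ℝ → ComplexMeasure (Config p q d)) : Prop where
  bounded : ∀ Z : ℝ, ∃ C : ℝ, ∀ z ∈ Icc 0 Z, tv (m z) ≤ C
  equation : ∀ Φ : 𝓢(Config p q d, ℂ), ∀ z : ℝ, 0 ≤ z →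
    HasDerivWithinAt (fun s => ∫ X, invFourier (m s) X * Φ X)
      (∫ X, invFourier (m z) X * momentOp k₀ R η ε Φ X) (Ici 0) z

/-! ### The Gaussian part of the solution -/

/-- The vector `A_γ k`, whose blocks `j` and `p + l` are `k` and whose other blocks vanish, for
`γ = (j, l)`. -/
def pairShift (γ : Fin p × Fin q) (k : Lat d) : Config p q d :=
  Pi.single (Sum.inl γ.1) k + Pi.single (Sum.inr γ.2) k

/-- The transpose of the operator
`L_γ(z) ρ(v) = (k₀² / 4η²) ∫ R̂(k) ρ(v - A_γ k) e^{i(zη/k₀ε) k·(ξ_j - ζ_l)} dk / (2π)^d`,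
`γ = (j, l)`, on complex measures: `∫ f d(L_γ(z) ρ) = ∫ (pairOpTranspose … γ z f) dρ`. It uses that
`ξ_j - ζ_l` does not change when `v` is translated by `A_γ k`. -/
def pairOpTranspose (k₀ : ℝ) (R : Lat d → ℝ) (η ε : ℝ) (γ : Fin p × Fin q) (z : ℝ)
    (f : Config p q d → ℂ) (v : Config p q d) : ℂ :=
  (k₀ ^ 2 / (4 * η ^ 2) * ((2 * Real.pi) ^ d)⁻¹ : ℝ) *
    ∫ k : Lat d, (spectrum R k : ℂ) *
      Complex.exp (Complex.I * (z * η / (k₀ * ε) * ⟪k, v (Sum.inl γ.1) - v (Sum.inr γ.2)⟫ : ℝ)) *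
        f (v + pairShift γ k)

/-- `U z`, `z ≥ 0`, is the solution operator of `∂_z U_γ = L_γ U_γ`, `U_γ(0) = 𝕀`, on the space of
complex measures. -/
structure IsPairPropagator (k₀ : ℝ) (R : Lat d → ℝ) (η ε : ℝ) (γ : Fin p × Fin q)
    (U : ℝ → Module.End ℂ (ComplexMeasure (Config p q d))) : Prop where
  initial : U 0 = 1
  bounded : ∀ ρ : ComplexMeasure (Config p q d), ∀ Z : ℝ, ∃ C : ℝ, ∀ z ∈ Icc 0 Z, tv (U z ρ) ≤ C
  equation : ∀ ρ : ComplexMeasure (Config p q d), ∀ f : Config p q d → ℂ, Measurable f →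
    (∃ C : ℝ, ∀ v, ‖f v‖ ≤ C) → ∀ z : ℝ, 0 ≤ z →
      HasDerivWithinAt (fun s => cint (U s ρ) f)
        (cint (U z ρ) (pairOpTranspose k₀ R η ε γ z f)) (Ici 0) z

open Classical in
/-- The sets `Λ_κ` of pairs `(j, l)` in which no two different pairs share a component. The empty
set is included; it accounts for the last term of `gaussianOp` and of `gaussianF`. -/
def matchings (p q : ℕ) : Finset (Finset (Fin p × Fin q)) :=
  Finset.univ.filter fun κ => ∀ γ ∈ κ, ∀ γ' ∈ κ, γ ≠ γ' → γ.1 ≠ γ'.1 ∧ γ.2 ≠ γ'.2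

/-- The pairs of `κ`, listed in lexicographic order. -/
def pairList (κ : Finset (Fin p × Fin q)) : List (Fin p × Fin q) :=
  ((List.finRange p).product (List.finRange q)).filter fun γ => γ ∈ κ

/-- The operator `N_{p,q}(z) = U_η^{(p+q)/2} (∑_κ ∏_{γ ∈ Λ_κ} (U_γ - 𝕀) + 𝕀)`, where
`U_η(z) = e^{-C₀z/η²}` and `C₀ = k₀² R(0) / 4`. The operators in each product commute. -/
def gaussianOp (k₀ : ℝ) (R : Lat d → ℝ) (η : ℝ)
    (U : Fin p × Fin q → ℝ → Module.End ℂ (ComplexMeasure (Config p q d))) (z : ℝ) :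
    Module.End ℂ (ComplexMeasure (Config p q d)) :=
  ((Real.exp (-(k₀ ^ 2 * R 0 / 4 * z / η ^ 2)) ^ (((p : ℝ) + q) / 2) : ℝ) : ℂ) •
    ∑ κ ∈ matchings p q, ((pairList κ).map fun γ => U γ z - 1).prod

/-- The free propagator `Π_{p,q}(z, v) = e^{-(izη/2k₀ε)(∑ |ξ_j|² - ∑ |ζ_l|²)}`. -/
def freePhase (k₀ η ε z : ℝ) (v : Config p q d) : ℂ :=
  Complex.exp (-(Complex.I * (z * η / (2 * k₀ * ε) * pairing v v : ℝ)))

/-- The main term `𝒩_{p,q}(z, X, Y)`: the inverse Fourier transform of `Π_{p,q}(z) N_{p,q}(z) m₀`,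
where `m₀` is the Fourier transform of the incident condition. -/
def mainTerm (k₀ : ℝ) (R : Lat d → ℝ) (η ε : ℝ)
    (U : Fin p × Fin q → ℝ → Module.End ℂ (ComplexMeasure (Config p q d)))
    (m₀ : ComplexMeasure (Config p q d)) (z : ℝ) (X : Config p q d) : ℂ :=
  ((2 * Real.pi) ^ ((p + q) * d) : ℝ)⁻¹ *
    cint (gaussianOp k₀ R η U z m₀)
      fun v => Complex.exp (Complex.I * pairing v X) * freePhase k₀ η ε z v

/-- The error term `ℰ_{p,q} = μ_{p,q} - 𝒩_{p,q}` of a solution of the moment equation. -/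
def errorTerm (k₀ : ℝ) (R : Lat d → ℝ) (η ε : ℝ)
    (U : Fin p × Fin q → ℝ → Module.End ℂ (ComplexMeasure (Config p q d)))
    (m : ℝ → ComplexMeasure (Config p q d)) (z : ℝ) (X : Config p q d) : ℂ :=
  invFourier (m z) X - mainTerm k₀ R η ε U (m 0) z X

/-! ### Gaussian functionals -/

/-- The functional `𝓕(h, h', g)` that gives the `(p, q)` moment of complex Gaussian variables in
terms of first and second moments. -/
def gaussianF (h : Fin p → ℂ) (h' : Fin q → ℂ) (g : Fin p → Fin q → ℂ) : ℂ :=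
  ∑ κ ∈ matchings p q,
    (∏ γ ∈ κ, (g γ.1 γ.2 - h γ.1 * h' γ.2)) *
      (∏ j ∈ (κ.image Prod.fst)ᶜ, h j) * ∏ l ∈ (κ.image Prod.snd)ᶜ, h' l

/-- The functional `𝓕̃(g)` for centered variables: `0` if `p ≠ q`, and
`∑_π ∏_j g_{j,π(j)}` over all permutations `π` if `p = q`. -/
def centeredF (g : Fin p → Fin q → ℂ) : ℂ :=
  if h : p = q then ∑ π : Equiv.Perm (Fin p), ∏ j, g j (Fin.cast h (π j)) else 0

/-! ### Product incident conditions and centered moments -/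

/-- The density `∏_j û₀(ξ_j) ∏_l û₀(ζ_l)^*`. -/
def productDensity (f : Lat d → ℂ) (p q : ℕ) (v : Config p q d) : ℂ :=
  (∏ j : Fin p, f (v (Sum.inl j))) * ∏ l : Fin q, conj (f (v (Sum.inr l)))

/-- `M p q` is, for all `p` and `q`, the Fourier transform of the solution `μ_{p,q}` of the
`(p, q)` moment equation with incident condition `∏_j u₀(x_j) ∏_l u₀(y_l)^*`, where the Fourier
transform of `u₀` is `f`. -/
def IsMomentFamily (k₀ : ℝ) (R : Lat d → ℝ) (η ε : ℝ) (f : Lat d → ℂ)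
    (M : ∀ p q : ℕ, ℝ → ComplexMeasure (Config p q d)) : Prop :=
  ∀ p q : ℕ, IsMomentSolution k₀ R η ε (M p q) ∧
    M p q 0 = (volume : Measure (Config p q d)).withDensityᵥ (productDensity f p q)

/-- The moment `μ_{p,q}(z, X, Y)` of a family. -/
def moment (M : ∀ p q : ℕ, ℝ → ComplexMeasure (Config p q d)) (z : ℝ) (p q : ℕ)
    (X : Fin p → Lat d) (Y : Fin q → Lat d) : ℂ :=
  invFourier (M p q z) (Sum.elim X Y)

/-- The moment `μ_{m,n}(z, X_S, Y_T)` at the points with indices in `S` and `T`, `m = |S|`,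
`n = |T|`. -/
def submoment (M : ∀ p q : ℕ, ℝ → ComplexMeasure (Config p q d)) (z : ℝ)
    (X : Fin p → Lat d) (Y : Fin q → Lat d) (S : Finset (Fin p)) (T : Finset (Fin q)) : ℂ :=
  moment M z S.card T.card (X ∘ S.orderEmbOfFin rfl) (Y ∘ T.orderEmbOfFin rfl)

/-- The first moment `μ_{1,0}(z, x)`. -/
def moment10 (M : ∀ p q : ℕ, ℝ → ComplexMeasure (Config p q d)) (z : ℝ) (x : Lat d) : ℂ :=
  moment M z 1 0 ![x] ![]

/-- The first moment `μ_{0,1}(z, y)`. -/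
def moment01 (M : ∀ p q : ℕ, ℝ → ComplexMeasure (Config p q d)) (z : ℝ) (y : Lat d) : ℂ :=
  moment M z 0 1 ![] ![y]

/-- The second moment `μ_{1,1}(z, x, y)`. -/
def moment11 (M : ∀ p q : ℕ, ℝ → ComplexMeasure (Config p q d)) (z : ℝ) (x y : Lat d) : ℂ :=
  moment M z 1 1 ![x] ![y]

/-- The centered moment `μ̃_{p,q}(z, X, Y) = 𝔼[∏_j (u - 𝔼u)(z, x_j) ∏_l (u - 𝔼u)^*(z, y_l)]`, with
the product expanded and each expectation expressed through the moments:
`∑_{S,T} (-1)^{p+q-|S|-|T|} μ_{|S|,|T|}(z, X_S, Y_T) ∏_{j ∉ S} μ_{1,0}(z, x_j)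
∏_{l ∉ T} μ_{0,1}(z, y_l)`. -/
def centeredMoment (M : ∀ p q : ℕ, ℝ → ComplexMeasure (Config p q d)) (z : ℝ) (p q : ℕ)
    (X : Fin p → Lat d) (Y : Fin q → Lat d) : ℂ :=
  ∑ S : Finset (Fin p), ∑ T : Finset (Fin q),
    (-1) ^ (Sᶜ.card + Tᶜ.card) * submoment M z X Y S T *
      (∏ j ∈ Sᶜ, moment10 M z (X j)) * ∏ l ∈ Tᶜ, moment01 M z (Y l)

/-- The centered second moment `μ̃_{1,1}(z, x, y)`. -/
def centeredMoment11 (M : ∀ p q : ℕ, ℝ → ComplexMeasure (Config p q d)) (z : ℝ)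
    (x y : Lat d) : ℂ :=
  centeredMoment M z 1 1 ![x] ![y]

/-- The random variables `a j` and `b l` are the values `u(z, x_j)` and `u(z, y_l)` of a random
field whose mixed moments are those of the family `M`. -/
def HasFieldMoments {Ω : Type*} [MeasurableSpace Ω] (P : Measure Ω)
    (M : ∀ p q : ℕ, ℝ → ComplexMeasure (Config p q d)) (z : ℝ)
    (X : Fin p → Lat d) (Y : Fin q → Lat d) (a : Fin p → Ω → ℂ) (b : Fin q → Ω → ℂ) : Prop :=
  ∀ (S : Finset (Fin p)) (T : Finset (Fin q)),
    Integrable (fun ω => (∏ j ∈ S, a j ω) * ∏ l ∈ T, conj (b l ω)) P ∧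
      ∫ ω, (∏ j ∈ S, a j ω) * ∏ l ∈ T, conj (b l ω) ∂P = submoment M z X Y S T

/-- The value `a - 𝔼[a]` of the centered variable. -/
def centered {Ω : Type*} [MeasurableSpace Ω] (P : Measure Ω) (a : Ω → ℂ) (ω : Ω) : ℂ :=
  a ω - ∫ ω', a ω' ∂P

end Speckle

end

/-! # Moments of the field and the Gaussian functional

In the dual variables, and in the frame of the free propagation, the moment equation becomes a linear
equation whose generator is a finite sum: an interaction of each pair `(ξ_j, ζ_l)`, with a positive
sign, an interaction of each two blocks of one kind (twins), with a negative sign, and a damping. Every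
interaction is an average, with density `R̂`, of shifts composed with an oscillating phase. The shifts
of a pair leave the relative momentum `ξ_j - ζ_l` in its own phase unchanged, so the interaction of a
pair commutes with itself at different times, and it is solved exactly by the exponential of its time
integral (`Interaction.prop`). The shifts of two pairs without common block leave both phases unchanged,
too, and the product of their solutions solves the sum. What the Gaussian functional leaves out are
therefore the twins and the products of two pairs that share one block.

These terms are small because their phases oscillate. The shift of a twin changes the relative momentum
in its phase, which makes the phase quadratic in the momentum transfer; for two pairs sharing one block
the transfer of one pair enters the phase of the other. Where a phase rate is `a`, the time
integral of the phase is at most a multiple of `|κ a|^{-2/5}`, `κ = η / (k₀ ε)`, and the singular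
weights `|a|^{-2/5}` are integrable against `R̂` uniformly in the remaining variables
(`IsCovariance.exists_smallness`); this is where the radial majorant and the decay of `R̂` enter. So
the time-integrated defect is `O(κ^{-2/5})`, although the defect itself is not small. Adding the defect, integrated in time,
to the Gaussian approximation (`correctedDual`) gives a family that solves the equation up to a small
`residual` (`wDerivAt_correctedDual`), and Gronwall's inequality bounds its distance to the solution
(`gronwall_functional`, `exists_dual_error`).

Operators act here on bounded measurable functions of the dual variables, as transposes of the operators
on measures. Families with oscillating phases are not differentiable in norm, since the phase rates
are unbounded; they are differentiable weakly (`WDerivAt`), which suffices for product rules, for the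
exponential of a commuting family, and for pairings with finite measures.

The constants grow exponentially in `1 / η²`. In the diffusive regime `1 / η = ln |ln ε|`, so they are
smaller than any negative power of `ε` (`ExpGrowth.exists_scaling_bound`), and the error is
`O(ε^{11/30})`, an exponent between `1/3` and `2/5` (`exists_error_bound`). The spare factor `ε^{1/30}`
absorbs the constants that the centered moments require.

With at most one block of each kind there are neither twins nor two different pairs, and the
approximation is exact (`errorTerm_eq_zero`). This identifies the first moments and the second moments
of the field. For product incident data, Fubini's theorem over the pairs of a matching
(`IsMatching.integral_prod`) then writes the main term as the Gaussian functional of the first and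
second moments (`IsMomentFamily.moment_eq_gaussianF_add`). Centering is inclusion and exclusion: in the alternating sum
of Gaussian functionals only the perfect matchings remain (`sum_gaussianF_centered`), and the alternating
sum of the errors is bounded term by term (`exists_centeredMoment_bound`). Random variables with the
given mixed moments have the same centered moments (`HasFieldMoments.integral_centered`).
-/

noncomputable section

namespace Speckle

/-! ### Integration against complex measures -/

section ComplexMeasures

variable {Ω : Type*} [MeasurableSpace Ω]

/-- Induction principle for bounded measurable functions: indicators, sums, and bounded pointwise
limits. -/
theorem bddMeasurable_induction {P : (Ω → ℂ) → Prop}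
    (ind : ∀ (c : ℂ) (A : Set Ω), MeasurableSet A → P (A.indicator fun _ => c))
    (add : ∀ f g : Ω → ℂ, Measurable f → Measurable g → (∃ C : ℝ, ∀ x, ‖f x‖ ≤ C) →
      (∃ C : ℝ, ∀ x, ‖g x‖ ≤ C) → P f → P g → P (f + g))
    (lim : ∀ (F : ℕ → Ω → ℂ) (f : Ω → ℂ) (C : ℝ), (∀ n, Measurable (F n)) → Measurable f →
      (∀ n x, ‖F n x‖ ≤ C) → (∀ n, P (F n)) →
      (∀ x, Tendsto (fun n => F n x) atTop (𝓝 (f x))) → P f)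
    {f : Ω → ℂ} (hf : Measurable f) {C : ℝ} (hC : ∀ x, ‖f x‖ ≤ C) : P f := by
  classical
  have simple : ∀ s : SimpleFunc Ω ℂ, P s := by
    intro s
    induction s using SimpleFunc.induction with
    | const c hA =>
      rw [SimpleFunc.coe_piecewise, SimpleFunc.coe_const, SimpleFunc.coe_const]
      convert ind c _ hA using 1
      ext x; simp [Set.indicator, Set.piecewise]
    | add _ ih₁ ih₂ =>
      rw [SimpleFunc.coe_add]
      exact add _ _ (SimpleFunc.measurable _) (SimpleFunc.measurable _)
        (SimpleFunc.exists_forall_norm_le _) (SimpleFunc.exists_forall_norm_le _) ih₁ ih₂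
  have hs : StronglyMeasurable f := hf.stronglyMeasurable
  refine lim (fun n => hs.approxBounded |C| n) f |C| (fun n => SimpleFunc.measurable _) hf
    (fun n x => StronglyMeasurable.norm_approxBounded_le hs (abs_nonneg _) n x)
    (fun n => simple _) fun x => ?_
  exact StronglyMeasurable.tendsto_approxBounded_of_norm_le hs ((hC x).trans (le_abs_self C))

/-- Every complex measure has a density with respect to some finite positive measure. -/
theorem exists_density (m : ComplexMeasure Ω) :
    ∃ (μ : Measure Ω) (g : Ω → ℂ), IsFiniteMeasure μ ∧ Measurable g ∧ Integrable g μ ∧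
      m = μ.withDensityᵥ g := by
  -- the sum of the total variations of the real and imaginary parts dominates both of them
  set μ : Measure Ω := (ComplexMeasure.re m).totalVariation + (ComplexMeasure.im m).totalVariation
  have fin : IsFiniteMeasure μ := by
    have h1 : IsFiniteMeasure (ComplexMeasure.re m).totalVariation := by
      unfold SignedMeasure.totalVariation; infer_instance
    have h2 : IsFiniteMeasure (ComplexMeasure.im m).totalVariation := by
      unfold SignedMeasure.totalVariation; infer_instance
    infer_instance
  have key : ∀ s : SignedMeasure Ω, s.totalVariation ≤ μ → μ.withDensityᵥ (s.rnDeriv μ) = s := by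
    intro s hs
    refine SignedMeasure.withDensityᵥ_rnDeriv_eq s μ ?_
    have h : μ.toENNRealVectorMeasure.ennrealToMeasure = μ :=
      VectorMeasure.equivMeasure.right_inv μ
    rw [SignedMeasure.absolutelyContinuous_ennreal_iff, h]
    exact Measure.absolutelyContinuous_of_le hs
  have hre := key (ComplexMeasure.re m) (Measure.le_add_right le_rfl)
  have him := key (ComplexMeasure.im m) (Measure.le_add_left le_rfl)
  refine ⟨μ, m.rnDeriv μ, fin, ?_, m.integrable_rnDeriv μ, ?_⟩
  · have h : m.rnDeriv μ = fun x => ((((ComplexMeasure.re m).rnDeriv μ x : ℝ) : ℂ)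
        + (((ComplexMeasure.im m).rnDeriv μ x : ℝ) : ℂ) * Complex.I) := by
      ext x; apply Complex.ext <;> simp [ComplexMeasure.rnDeriv]
    rw [h]
    have h1 := SignedMeasure.measurable_rnDeriv (ComplexMeasure.re m) μ
    have h2 := SignedMeasure.measurable_rnDeriv (ComplexMeasure.im m) μ
    fun_prop
  · ext A hA
    rw [withDensityᵥ_apply (m.integrable_rnDeriv μ) hA]
    have h1 : ((ComplexMeasure.re m) A : ℝ) = (m A).re := rfl
    have h2 : ((ComplexMeasure.im m) A : ℝ) = (m A).im := rfl
    apply Complex.ext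
    · rw [← h1, ← RCLike.re_eq_complex_re, ← integral_re (m.integrable_rnDeriv μ).integrableOn]
      conv_lhs => rw [← hre]
      rw [withDensityᵥ_apply (SignedMeasure.integrable_rnDeriv _ _) hA]
      rfl
    · rw [← h2, ← RCLike.im_eq_complex_im, ← integral_im (m.integrable_rnDeriv μ).integrableOn]
      conv_lhs => rw [← him]
      rw [withDensityᵥ_apply (SignedMeasure.integrable_rnDeriv _ _) hA]
      rfl

instance instIsFiniteMeasureVariation (m : ComplexMeasure Ω) : IsFiniteMeasure m.variation := by
  obtain ⟨μ, g, _, _, hg, rfl⟩ := exists_density m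
  rw [Measure.variation_withDensityᵥ hg]
  exact ⟨by simpa using! hg.2⟩

theorem tv_nonneg (m : ComplexMeasure Ω) : 0 ≤ tv m := ENNReal.toReal_nonneg

theorem norm_cint_le (m : ComplexMeasure Ω) {f : Ω → ℂ} {C : ℝ} (hC : ∀ x, ‖f x‖ ≤ C) :
    ‖cint m f‖ ≤ C * tv m := by
  have h := VectorMeasure.norm_integral_le_of_norm_le_const (μ := m)
    (B := ContinuousLinearMap.mul ℝ ℂ) (Eventually.of_forall hC)
  rw [ContinuousLinearMap.opNorm_mul, mul_one] at h
  exact h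

theorem cint_tendsto {ι : Type*} {l : Filter ι} [l.IsCountablyGenerated] (m : ComplexMeasure Ω)
    {F : ι → Ω → ℂ} {f : Ω → ℂ} {C : ℝ} (hm : ∀ᶠ n in l, Measurable (F n))
    (hC : ∀ᶠ n in l, ∀ x, ‖F n x‖ ≤ C) (h : ∀ x, Tendsto (fun n => F n x) l (𝓝 (f x))) :
    Tendsto (fun n => cint m (F n)) l (𝓝 (cint m f)) := by
  refine VectorMeasure.tendsto_integral_filter_of_norm_le_const
    (hm.mono fun n hn => hn.aestronglyMeasurable)
    ⟨C, hC.mono fun n hn => Eventually.of_forall hn⟩ (Eventually.of_forall h)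

theorem integrable_variation (m : ComplexMeasure Ω) {f : Ω → ℂ} (hf : Measurable f) {C : ℝ}
    (hC : ∀ x, ‖f x‖ ≤ C) : m.Integrable f :=
  Integrable.of_bound (μ := m.variation) hf.aestronglyMeasurable C (Eventually.of_forall hC)

theorem cint_add (m : ComplexMeasure Ω) {f g : Ω → ℂ} (hf : Measurable f) (hg : Measurable g)
    (hf' : ∃ C : ℝ, ∀ x, ‖f x‖ ≤ C) (hg' : ∃ C : ℝ, ∀ x, ‖g x‖ ≤ C) :
    cint m (f + g) = cint m f + cint m g := by
  obtain ⟨C, hC⟩ := hf'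
  obtain ⟨D, hD⟩ := hg'
  exact VectorMeasure.integral_add (integrable_variation m hf hC) (integrable_variation m hg hD)

theorem cint_indicator (m : ComplexMeasure Ω) (c : ℂ) {A : Set Ω} (hA : MeasurableSet A) :
    cint m (A.indicator fun _ => c) = c * m A := by
  unfold cint
  rw [VectorMeasure.integral_indicator_const c hA]
  rfl

/-- Integration against a complex measure given by a density. -/
theorem cint_withDensityᵥ {μ : Measure Ω} {g : Ω → ℂ} (hg : Integrable g μ) {f : Ω → ℂ}
    (hf : Measurable f) {C : ℝ} (hC : ∀ x, ‖f x‖ ≤ C) :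
    cint (μ.withDensityᵥ g) f = ∫ x, f x * g x ∂μ := by
  have int : ∀ f : Ω → ℂ, Measurable f → (∃ C : ℝ, ∀ x, ‖f x‖ ≤ C) →
      Integrable (fun x => f x * g x) μ := fun f hf ⟨C, hC⟩ =>
    hg.bdd_mul hf.aestronglyMeasurable (Eventually.of_forall hC)
  refine bddMeasurable_induction (P := fun f => cint (μ.withDensityᵥ g) f = ∫ x, f x * g x ∂μ)
    ?_ ?_ ?_ hf hC
  · intro c A hA
    rw [cint_indicator _ _ hA, withDensityᵥ_apply hg hA, ← integral_const_mul,
      ← integral_indicator hA]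
    congr 1; ext x
    by_cases hx : x ∈ A <;> simp [hx]
  · intro f h hf hh hf' hh' e₁ e₂
    rw [cint_add _ hf hh hf' hh', e₁, e₂, ← integral_add (int f hf hf') (int h hh hh')]
    simp [add_mul]
  · intro F f C hF hf hC e h
    refine tendsto_nhds_unique (cint_tendsto _ (Eventually.of_forall hF)
      (Eventually.of_forall hC) h) ?_
    simp_rw [e]
    refine tendsto_integral_of_dominated_convergence (fun x => C * ‖g x‖)
      (fun n => ((hF n).aestronglyMeasurable.mul hg.aestronglyMeasurable)) (hg.norm.const_mul C)
      (fun n => Eventually.of_forall fun x => ?_)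
      (Eventually.of_forall fun x => (h x).mul_const _)
    rw [norm_mul]
    exact mul_le_mul_of_nonneg_right (hC n x) (norm_nonneg _)

theorem cint_smul (m : ComplexMeasure Ω) (c : ℂ) {f : Ω → ℂ} (hf : Measurable f)
    (hf' : ∃ C : ℝ, ∀ x, ‖f x‖ ≤ C) : cint m (c • f) = c * cint m f := by
  obtain ⟨μ, g, _, _, hg, rfl⟩ := exists_density m
  obtain ⟨C, hC⟩ := hf'
  rw [cint_withDensityᵥ hg hf hC, cint_withDensityᵥ hg (hf.const_smul c) (C := ‖c‖ * C),
    ← integral_const_mul]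
  · simp [mul_assoc]
  · intro x
    simpa using mul_le_mul_of_nonneg_left (hC x) (norm_nonneg c)

theorem cint_add_measure (m m' : ComplexMeasure Ω) {f : Ω → ℂ} (hf : Measurable f)
    (hf' : ∃ C : ℝ, ∀ x, ‖f x‖ ≤ C) : cint (m + m') f = cint m f + cint m' f := by
  obtain ⟨C, hC⟩ := hf'
  exact VectorMeasure.integral_add_vectorMeasure (integrable_variation m hf hC)
    (integrable_variation m' hf hC)

theorem cint_smul_measure (m : ComplexMeasure Ω) (c : ℂ) {f : Ω → ℂ} (hf : Measurable f)
    (hf' : ∃ C : ℝ, ∀ x, ‖f x‖ ≤ C) : cint (c • m) f = c * cint m f := by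
  obtain ⟨μ, g, _, _, hg, rfl⟩ := exists_density m
  obtain ⟨C, hC⟩ := hf'
  rw [← withDensityᵥ_smul, cint_withDensityᵥ hg hf hC, cint_withDensityᵥ (hg.smul c) hf hC,
    ← integral_const_mul]
  congr 1; ext x; simp; ring

theorem tv_withDensityᵥ {μ : Measure Ω} {g : Ω → ℂ} (hg : Integrable g μ) :
    tv (μ.withDensityᵥ g) = ∫ x, ‖g x‖ ∂μ := by
  rw [tv, Measure.variation_withDensityᵥ hg, withDensity_apply _ MeasurableSet.univ,
    setLIntegral_univ, integral_norm_eq_lintegral_enorm hg.aestronglyMeasurable]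

/-- The total variation is the norm of the functional on bounded measurable functions. -/
theorem tv_le_of_forall (m : ComplexMeasure Ω) {B : ℝ}
    (h : ∀ f : Ω → ℂ, Measurable f → (∀ x, ‖f x‖ ≤ 1) → ‖cint m f‖ ≤ B) : tv m ≤ B := by
  obtain ⟨μ, g, _, hgm, hg, rfl⟩ := exists_density m
  -- test with `conj g / |g|`, which is `0` where `g` vanishes because the inverse of `0` is `0`
  have hb : ∀ x, ‖conj (g x) * ((‖g x‖⁻¹ : ℝ) : ℂ)‖ ≤ 1 := fun x => by
    simp only [norm_mul, RCLike.norm_conj, Complex.norm_real, norm_inv, norm_norm]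
    exact mul_inv_le_one
  have hm : Measurable fun x => conj (g x) * ((‖g x‖⁻¹ : ℝ) : ℂ) := by
    have : Measurable fun x => conj (g x) := Complex.continuous_conj.measurable.comp hgm
    fun_prop
  have := h _ hm hb
  rw [cint_withDensityᵥ hg hm hb] at this
  rw [tv_withDensityᵥ hg]
  have e : (∫ x, conj (g x) * ((‖g x‖⁻¹ : ℝ) : ℂ) * g x ∂μ) = ((∫ x, ‖g x‖ ∂μ : ℝ) : ℂ) := by
    rw [← integral_complex_ofReal]
    congr 1; ext x
    rw [mul_right_comm, mul_comm (conj (g x)), Complex.mul_conj, Complex.normSq_eq_norm_sq]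
    by_cases hx : ‖g x‖ = 0
    · simp [hx]
    · push_cast
      have : (‖g x‖ : ℂ) ≠ 0 := by exact_mod_cast hx
      field_simp
  rw [e, Complex.norm_real, Real.norm_of_nonneg (integral_nonneg fun _ => norm_nonneg _)] at this
  exact this

theorem ext_of_cint {m m' : ComplexMeasure Ω}
    (h : ∀ f : Ω → ℂ, Measurable f → (∀ x, ‖f x‖ ≤ 1) → cint m f = cint m' f) : m = m' := by
  ext A hA
  have := h (A.indicator fun _ => 1) (measurable_const.indicator hA) fun x => by
    by_cases hx : x ∈ A <;> simp [hx]
  simpa [cint_indicator _ _ hA] using this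

/-- A functional on bounded measurable functions that is continuous for bounded pointwise
convergence is the integral against a complex measure. -/
theorem exists_measure_of_functional (Λ : (Ω → ℂ) → ℂ)
    (add : ∀ f g : Ω → ℂ, Measurable f → Measurable g → (∃ C : ℝ, ∀ x, ‖f x‖ ≤ C) →
      (∃ C : ℝ, ∀ x, ‖g x‖ ≤ C) → Λ (f + g) = Λ f + Λ g)
    (smul : ∀ (c : ℂ) (f : Ω → ℂ), Measurable f → (∃ C : ℝ, ∀ x, ‖f x‖ ≤ C) →
      Λ (c • f) = c * Λ f)
    (lim : ∀ (F : ℕ → Ω → ℂ) (f : Ω → ℂ) (C : ℝ), (∀ n, Measurable (F n)) → Measurable f →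
      (∀ n x, ‖F n x‖ ≤ C) → (∀ x, Tendsto (fun n => F n x) atTop (𝓝 (f x))) →
      Tendsto (fun n => Λ (F n)) atTop (𝓝 (Λ f))) :
    ∃ m : ComplexMeasure Ω, ∀ f : Ω → ℂ, Measurable f → (∃ C : ℝ, ∀ x, ‖f x‖ ≤ C) →
      cint m f = Λ f := by
  classical
  have bi : ∀ A : Set Ω, ∃ C : ℝ, ∀ x, ‖A.indicator (fun _ => (1 : ℂ)) x‖ ≤ C := fun A =>
    ⟨1, fun x => by by_cases hx : x ∈ A <;> simp [hx]⟩
  have mi : ∀ A : Set Ω, MeasurableSet A → Measurable (A.indicator (fun _ => (1 : ℂ))) :=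
    fun A hA => measurable_const.indicator hA
  have zero : Λ 0 = 0 := by
    have := smul 0 0 measurable_const ⟨0, fun x => by simp⟩
    simpa using this
  let m : ComplexMeasure Ω :=
    { measureOf' := fun A => if MeasurableSet A then Λ (A.indicator fun _ => 1) else 0
      empty' := by
        rw [if_pos MeasurableSet.empty, Set.indicator_empty]
        exact zero
      not_measurable' := fun A hA => by simp [hA]
      m_iUnion' := by
        intro A hA hd
        have hfin : ∀ s : Finset ℕ, (∑ n ∈ s, Λ ((A n).indicator fun _ => 1)) =
            Λ ((⋃ n ∈ s, A n).indicator fun _ => 1) := by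
          intro s
          induction s using Finset.induction_on with
          | empty =>
            simp only [Finset.sum_empty, Finset.notMem_empty, iUnion_of_empty, iUnion_empty,
              Set.indicator_empty]
            exact zero.symm
          | insert a s ha ih =>
            rw [Finset.sum_insert ha, ih, Finset.set_biUnion_insert,
              Set.indicator_union_of_disjoint]
            · exact (add _ _ (mi _ (hA a)) (mi _ (s.measurableSet_biUnion fun n _ => hA n))
                (bi _) (bi _)).symm
            · rw [Set.disjoint_iUnion₂_right]
              intro n hn
              exact hd (fun h => ha (h ▸ hn))
        have hU : MeasurableSet (⋃ n, A n) := MeasurableSet.iUnion hA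
        simp only [hA, if_true, hU]
        rw [HasSum, SummationFilter.unconditional_filter]
        simp_rw [hfin]
        refine tendsto_of_seq_tendsto fun u hu => ?_
        refine lim _ _ 1 (fun n => mi _ ((u n).measurableSet_biUnion fun n _ => hA n))
          (mi _ hU) (fun n x => ?_) fun x => ?_
        · by_cases hx : x ∈ ⋃ k ∈ u n, A k <;> simp [Set.indicator, hx]
        · by_cases hx : x ∈ ⋃ n, A n
          · obtain ⟨k, hk⟩ := mem_iUnion.1 hx
            have : ∀ᶠ n in atTop, k ∈ u n := by
              have := hu.eventually (eventually_ge_atTop {k})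
              filter_upwards [this] with n hn
              exact hn (Finset.mem_singleton_self k)
            rw [Set.indicator_of_mem hx]
            refine tendsto_const_nhds.congr' ?_
            filter_upwards [this] with n hn
            rw [Set.indicator_of_mem (mem_iUnion₂.2 ⟨k, hn, hk⟩)]
          · rw [Set.indicator_of_notMem hx]
            refine tendsto_const_nhds.congr fun n => ?_
            rw [Set.indicator_of_notMem]
            intro h
            obtain ⟨k, _, hk⟩ := mem_iUnion₂.1 h
            exact hx (mem_iUnion.2 ⟨k, hk⟩) }
  refine ⟨m, fun f hf ⟨C, hC⟩ => ?_⟩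
  refine bddMeasurable_induction (P := fun f => cint m f = Λ f) ?_ ?_ ?_ hf hC
  · intro c A hA
    have h1 : m A = Λ (A.indicator fun _ => 1) := if_pos hA
    rw [cint_indicator _ _ hA, h1, ← smul c _ (mi A hA) (bi A)]
    congr 1; ext x
    by_cases hx : x ∈ A <;> simp [hx]
  · intro f g hf hg hf' hg' e₁ e₂
    rw [cint_add _ hf hg hf' hg', add _ _ hf hg hf' hg', e₁, e₂]
  · intro F f C hF hf hC e h
    refine tendsto_nhds_unique (cint_tendsto _ (Eventually.of_forall hF)
      (Eventually.of_forall hC) h) ?_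
    simp_rw [e]
    exact lim F f C hF hf hC h

end ComplexMeasures


/-! ### Bounded measurable functions and operators continuous for bounded convergence -/

section Operators

variable {Ω : Type*} [MeasurableSpace Ω]

/-- The space of bounded measurable complex functions, as a subspace of `ℓ^∞`; the norm is the
supremum norm. -/
def bddMeas (Ω : Type*) [MeasurableSpace Ω] : Submodule ℂ (lp (fun _ : Ω => ℂ) ⊤) where
  carrier := {f | Measurable fun x => f x}
  add_mem' {f g} hf hg := Measurable.add (f := fun x => f x) (g := fun x => g x) hf hg
  zero_mem' := measurable_const (a := (0 : ℂ))
  smul_mem' c f hf := Measurable.const_smul (g := fun x => f x) hf c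

/-- The Banach space of bounded measurable functions. -/
def Bdd (Ω : Type*) [MeasurableSpace Ω] : Type _ := ↥(bddMeas Ω)

instance : NormedAddCommGroup (Bdd Ω) := inferInstanceAs (NormedAddCommGroup ↥(bddMeas Ω))

instance : NormedSpace ℂ (Bdd Ω) := inferInstanceAs (NormedSpace ℂ ↥(bddMeas Ω))

instance : CoeFun (Bdd Ω) fun _ => Ω → ℂ := ⟨fun f => f.1⟩

theorem Bdd.measurable (f : Bdd Ω) : Measurable f := f.2

theorem Bdd.norm_apply_le (f : Bdd Ω) (x : Ω) : ‖f x‖ ≤ ‖f‖ :=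
  lp.norm_apply_le_norm (by simp) f.1 x

theorem Bdd.norm_le {f : Bdd Ω} {C : ℝ} (hC : 0 ≤ C) (h : ∀ x, ‖f x‖ ≤ C) : ‖f‖ ≤ C :=
  lp.norm_le_of_forall_le hC h

theorem Bdd.bounded (f : Bdd Ω) : ∃ C : ℝ, ∀ x, ‖f x‖ ≤ C := ⟨‖f‖, f.norm_apply_le⟩

/-- The bounded measurable function with given underlying function. -/
def Bdd.mk (f : Ω → ℂ) (hf : Measurable f) (hb : ∃ C : ℝ, ∀ x, ‖f x‖ ≤ C) : Bdd Ω :=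
  ⟨⟨f, memℓp_infty (by obtain ⟨C, hC⟩ := hb; exact ⟨C, by rintro _ ⟨x, rfl⟩; exact hC x⟩)⟩, hf⟩

@[simp] theorem Bdd.mk_apply (f : Ω → ℂ) (hf : Measurable f) (hb : ∃ C : ℝ, ∀ x, ‖f x‖ ≤ C)
    (x : Ω) : Bdd.mk f hf hb x = f x := rfl

@[ext] theorem Bdd.ext {f g : Bdd Ω} (h : ∀ x, f x = g x) : f = g :=
  Subtype.ext (lp.ext (funext h))

@[simp] theorem Bdd.add_apply (f g : Bdd Ω) (x : Ω) : (f + g) x = f x + g x := rfl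
@[simp] theorem Bdd.sub_apply (f g : Bdd Ω) (x : Ω) : (f - g) x = f x - g x := rfl
@[simp] theorem Bdd.smul_apply (c : ℂ) (f : Bdd Ω) (x : Ω) : (c • f) x = c * f x := rfl
@[simp] theorem Bdd.zero_apply (x : Ω) : (0 : Bdd Ω) x = 0 := rfl

@[simp] theorem Bdd.sum_apply {ι : Type*} (s : Finset ι) (F : ι → Bdd Ω) (x : Ω) :
    (∑ i ∈ s, F i) x = ∑ i ∈ s, F i x := by
  classical
  induction s using Finset.induction_on with
  | empty => simp
  | insert a s ha ih => rw [Finset.sum_insert ha, Finset.sum_insert ha, Bdd.add_apply, ih]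

theorem isClosed_bddMeas : IsClosed (bddMeas Ω : Set (lp (fun _ : Ω => ℂ) ⊤)) := by
  refine isClosed_of_closure_subset fun f hf => ?_
  obtain ⟨F, hF, hlim⟩ := mem_closure_iff_seq_limit.1 hf
  refine measurable_of_tendsto_metrizable (f := fun n x => F n x) (fun n => hF n) ?_
  rw [tendsto_pi_nhds]
  intro x
  rw [tendsto_iff_norm_sub_tendsto_zero] at hlim ⊢
  refine squeeze_zero (fun n => norm_nonneg _) (fun n => ?_) hlim
  exact lp.norm_apply_le_norm (by simp) (F n - f) x

instance : CompleteSpace (Bdd Ω) :=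
  (isClosed_bddMeas (Ω := Ω)).isComplete.completeSpace_coe

/-- The Banach algebra of bounded operators on the space of bounded measurable functions. -/
def Op (Ω : Type*) [MeasurableSpace Ω] : Type _ := Bdd Ω →L[ℂ] Bdd Ω

instance : NormedRing (Op Ω) := inferInstanceAs (NormedRing (Bdd Ω →L[ℂ] Bdd Ω))

instance : NormedAlgebra ℂ (Op Ω) := inferInstanceAs (NormedAlgebra ℂ (Bdd Ω →L[ℂ] Bdd Ω))

instance : NormedAlgebra ℚ (Op Ω) := NormedAlgebra.restrictScalars ℚ ℂ (Op Ω)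

instance : CompleteSpace (Op Ω) := inferInstanceAs (CompleteSpace (Bdd Ω →L[ℂ] Bdd Ω))

instance : CoeFun (Op Ω) fun _ => Bdd Ω → Bdd Ω :=
  ⟨fun T f => (show Bdd Ω →L[ℂ] Bdd Ω from T) f⟩

/-- An operator from a linear map and a bound. -/
def Op.mk (T : Bdd Ω →ₗ[ℂ] Bdd Ω) (C : ℝ) (h : ∀ f, ‖T f‖ ≤ C * ‖f‖) : Op Ω :=
  T.mkContinuous C h

theorem Op.ext {S T : Op Ω} (h : ∀ f, S f = T f) : S = T := ContinuousLinearMap.ext h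

theorem Op.le_norm (T : Op Ω) (f : Bdd Ω) : ‖T f‖ ≤ ‖T‖ * ‖f‖ :=
  ContinuousLinearMap.le_opNorm T f

theorem Op.norm_le {T : Op Ω} {C : ℝ} (hC : 0 ≤ C) (h : ∀ f x, ‖T f x‖ ≤ C * ‖f‖) : ‖T‖ ≤ C :=
  ContinuousLinearMap.opNorm_le_bound T hC fun f =>
    Bdd.norm_le (mul_nonneg hC (norm_nonneg f)) (h f)

theorem Op.norm_apply_apply_le (T : Op Ω) (f : Bdd Ω) (x : Ω) : ‖T f x‖ ≤ ‖T‖ * ‖f‖ :=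
  (Bdd.norm_apply_le _ x).trans (T.le_norm f)

@[simp] theorem Op.mul_apply (S T : Op Ω) (f : Bdd Ω) : (S * T) f = S (T f) := rfl
@[simp] theorem Op.add_apply (S T : Op Ω) (f : Bdd Ω) : (S + T) f = S f + T f := rfl
@[simp] theorem Op.sub_apply (S T : Op Ω) (f : Bdd Ω) : (S - T) f = S f - T f := rfl
@[simp] theorem Op.smul_apply (c : ℂ) (T : Op Ω) (f : Bdd Ω) : (c • T) f = c • T f := rfl
@[simp] theorem Op.one_apply (f : Bdd Ω) : (1 : Op Ω) f = f := rfl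
@[simp] theorem Op.zero_apply (f : Bdd Ω) : (0 : Op Ω) f = 0 := rfl

@[simp] theorem Op.sum_apply {ι : Type*} (s : Finset ι) (T : ι → Op Ω) (f : Bdd Ω) :
    (∑ i ∈ s, T i) f = ∑ i ∈ s, T i f := by
  classical
  induction s using Finset.induction_on with
  | empty => simp
  | insert a s ha ih => rw [Finset.sum_insert ha, Finset.sum_insert ha, Op.add_apply, ih]

theorem Op.map_add (T : Op Ω) (f g : Bdd Ω) : T (f + g) = T f + T g :=
  ContinuousLinearMap.map_add T f g

theorem Op.map_smul (T : Op Ω) (c : ℂ) (f : Bdd Ω) : T (c • f) = c • T f :=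
  ContinuousLinearMap.map_smul T c f

theorem Op.norm_one_le : ‖(1 : Op Ω)‖ ≤ 1 :=
  ContinuousLinearMap.norm_id_le (𝕜 := ℂ) (E := Bdd Ω)

/-- The algebra of operators that are continuous for bounded pointwise convergence of sequences;
their transposes act on complex measures. -/
def sigmaCont (Ω : Type*) [MeasurableSpace Ω] : Subalgebra ℂ (Op Ω) where
  carrier := {T | ∀ (F : ℕ → Bdd Ω) (f : Bdd Ω) (C : ℝ), (∀ n, ‖F n‖ ≤ C) →
    (∀ x, Tendsto (fun n => F n x) atTop (𝓝 (f x))) →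
    ∀ x, Tendsto (fun n => T (F n) x) atTop (𝓝 (T f x))}
  mul_mem' {_ T} hS hT F f C hC h x :=
    hS (fun n => T (F n)) (T f) (‖T‖ * C)
      (fun n => (T.le_norm _).trans (mul_le_mul_of_nonneg_left (hC n) (norm_nonneg _)))
      (fun x => hT F f C hC h x) x
  add_mem' hS hT F f C hC h x := (hS F f C hC h x).add (hT F f C hC h x)
  algebraMap_mem' c _ _ _ _ h x := (h x).const_mul c

theorem isClosed_sigmaCont : IsClosed (sigmaCont Ω : Set (Op Ω)) := by
  refine isClosed_of_closure_subset fun T hT F f C hC h x => ?_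
  have hfC : ‖f‖ ≤ C := Bdd.norm_le ((norm_nonneg _).trans (hC 0)) fun x =>
    le_of_tendsto (h x).norm (Eventually.of_forall fun n => ((F n).norm_apply_le x).trans (hC n))
  rw [Metric.tendsto_atTop]
  intro ε hε
  have hC0 : 0 ≤ C := (norm_nonneg _).trans (hC 0)
  obtain ⟨S, hS, hST⟩ := Metric.mem_closure_iff.1 hT (ε / (3 * (C + 1))) (by positivity)
  obtain ⟨N, hN⟩ := Metric.tendsto_atTop.1 (hS F f C hC h x) (ε / 3) (by positivity)
  refine ⟨N, fun n hn => ?_⟩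
  have b : ∀ g : Bdd Ω, ‖g‖ ≤ C → dist (T g x) (S g x) ≤ ε / 3 := by
    intro g hg
    have h1 : dist (T g x) (S g x) ≤ ‖T - S‖ * ‖g‖ := by
      rw [dist_eq_norm]
      exact Op.norm_apply_apply_le (T - S) g x
    rw [dist_eq_norm] at hST
    calc dist (T g x) (S g x) ≤ ‖T - S‖ * ‖g‖ := h1
      _ ≤ (ε / (3 * (C + 1))) * C := by gcongr
      _ ≤ ε / 3 := by
        rw [div_mul_eq_mul_div, div_le_div_iff₀ (by positivity) (by positivity)]
        nlinarith
  have h1 := b (F n) (hC n)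
  have h2 := b f hfC
  have h3 := hN n hn
  rw [dist_comm] at h2
  linarith [dist_triangle4 (T (F n) x) (S (F n) x) (S f x) (T f x)]

theorem exp_mem_sigmaCont {T : Op Ω} (hT : T ∈ sigmaCont Ω) :
    NormedSpace.exp T ∈ sigmaCont Ω := by
  have h := NormedSpace.exp_series_hasSum_exp' (𝕂 := ℂ) T
  refine isClosed_sigmaCont.mem_of_tendsto h (Eventually.of_forall fun s => ?_)
  exact Subalgebra.sum_mem _ fun n _ => Subalgebra.smul_mem _ (Subalgebra.pow_mem _ hT n) _

theorem tendsto_of_sigmaCont {ι : Type*} {l : Filter ι} [l.IsCountablyGenerated] {T : Op Ω}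
    (hT : T ∈ sigmaCont Ω) {F : ι → Bdd Ω} {f : Bdd Ω} {C : ℝ} (hC : ∀ᶠ i in l, ‖F i‖ ≤ C)
    (h : ∀ x, Tendsto (fun i => F i x) l (𝓝 (f x))) (x : Ω) :
    Tendsto (fun i => T (F i) x) l (𝓝 (T f x)) := by
  refine tendsto_of_seq_tendsto fun u hu => ?_
  obtain ⟨N, hN⟩ := (hu.eventually hC).exists_forall_of_atTop
  rw [← tendsto_add_atTop_iff_nat N]
  refine hT (fun n => F (u (n + N))) f C (fun n => hN _ (Nat.le_add_left _ _)) (fun x => ?_) x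
  exact (tendsto_add_atTop_iff_nat N).2 ((h x).comp hu)

/-! ### Exponentials -/

theorem hasSum_real_exp (t : ℝ) : HasSum (fun n : ℕ => t ^ n / n.factorial) (Real.exp t) := by
  rw [Real.exp_eq_exp_ℝ]
  have := NormedSpace.exp_series_hasSum_exp' (𝕂 := ℝ) t
  simpa [div_eq_inv_mul] using this

/-- `‖(e^X - 1) Y‖ ≤ e^{‖X‖} ‖X Y‖`, from the power series. -/
theorem norm_exp_sub_one_mul_le {A : Type*} [NormedRing A] [NormedAlgebra ℂ A] [CompleteSpace A]
    (X Y : A) : ‖(NormedSpace.exp X - 1) * Y‖ ≤ Real.exp ‖X‖ * ‖X * Y‖ := by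
  have h := NormedSpace.exp_series_hasSum_exp' (𝕂 := ℂ) X
  have h1 : HasSum (fun n : ℕ => ((n + 1).factorial⁻¹ : ℂ) • X ^ (n + 1))
      (NormedSpace.exp X - 1) := by
    have := (hasSum_nat_add_iff' 1).2 h
    simpa using this
  have h2 := h1.mul_right Y
  have h3 : HasSum (fun n : ℕ => (‖X‖ ^ n / n.factorial) * ‖X * Y‖)
      (Real.exp ‖X‖ * ‖X * Y‖) := by
    exact (hasSum_real_exp ‖X‖).mul_right _
  rw [← h2.tsum_eq]
  refine tsum_of_norm_bounded h3 fun n => ?_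
  rw [smul_mul_assoc, norm_smul, pow_succ, mul_assoc]
  have e1 : ‖((n + 1).factorial⁻¹ : ℂ)‖ ≤ (n.factorial : ℝ)⁻¹ := by
    rw [norm_inv, Complex.norm_natCast]
    gcongr
    omega
  have e2 : ‖X ^ n * (X * Y)‖ ≤ ‖X‖ ^ n * ‖X * Y‖ := by
    rcases Nat.eq_zero_or_pos n with rfl | hn
    · simp
    · exact (norm_mul_le _ _).trans
        (mul_le_mul_of_nonneg_right (norm_pow_le' _ hn) (norm_nonneg _))
  calc _ ≤ (n.factorial : ℝ)⁻¹ * (‖X‖ ^ n * ‖X * Y‖) := by gcongr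
    _ = _ := by ring

theorem norm_exp_sub_one_le (X : Op Ω) : ‖NormedSpace.exp X - 1‖ ≤ Real.exp ‖X‖ * ‖X‖ := by
  simpa using norm_exp_sub_one_mul_le X 1

theorem norm_exp_le (X : Op Ω) : ‖NormedSpace.exp X‖ ≤ Real.exp ‖X‖ := by
  have h := NormedSpace.exp_series_hasSum_exp' (𝕂 := ℂ) X
  rw [← h.tsum_eq]
  refine tsum_of_norm_bounded (hasSum_real_exp ‖X‖) fun n => ?_
  rw [norm_smul, norm_inv, Complex.norm_natCast, div_eq_inv_mul]
  gcongr
  rcases Nat.eq_zero_or_pos n with rfl | hn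
  · simpa using Op.norm_one_le
  · exact norm_pow_le' _ hn

/-! ### Weak differentiability of families of operators -/

/-- The operator `T'` is the weak derivative at `z` of the family `T` of operators: the family is
Lipschitz in norm at `z`, and `w ↦ (T w f)(x)` has derivative `(T' f)(x)` at `z` for all `f` and `x`.
The oscillating families considered here are not differentiable in norm, as their phase rates are
unbounded. -/
structure WDerivAt (T : ℝ → Op Ω) (T' : Op Ω) (z : ℝ) : Prop where
  mem : T z ∈ sigmaCont Ω
  lip : ∃ C : ℝ, ∀ᶠ w in 𝓝 z, ‖T w - T z‖ ≤ C * |w - z|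
  deriv : ∀ (f : Bdd Ω) (x : Ω), HasDerivAt (fun w => T w f x) (T' f x) z

theorem WDerivAt.const {T : Op Ω} (hT : T ∈ sigmaCont Ω) (z : ℝ) :
    WDerivAt (fun _ => T) 0 z :=
  ⟨hT, ⟨0, by simp⟩, fun f x => hasDerivAt_const _ _⟩

theorem WDerivAt.add {S T : ℝ → Op Ω} {S' T' : Op Ω} {z : ℝ} (hS : WDerivAt S S' z)
    (hT : WDerivAt T T' z) : WDerivAt (fun w => S w + T w) (S' + T') z := by
  obtain ⟨C, hC⟩ := hS.lip
  obtain ⟨D, hD⟩ := hT.lip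
  refine ⟨add_mem hS.mem hT.mem, ⟨C + D, ?_⟩, fun f x => (hS.deriv f x).add (hT.deriv f x)⟩
  filter_upwards [hC, hD] with w h1 h2
  rw [add_sub_add_comm, add_mul]
  exact (norm_add_le _ _).trans (add_le_add h1 h2)

theorem WDerivAt.sum {ι : Type*} (s : Finset ι) {T : ι → ℝ → Op Ω} {T' : ι → Op Ω} {z : ℝ}
    (h : ∀ i ∈ s, WDerivAt (T i) (T' i) z) :
    WDerivAt (fun w => ∑ i ∈ s, T i w) (∑ i ∈ s, T' i) z := by
  classical
  induction s using Finset.induction_on with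
  | empty => simpa using WDerivAt.const (zero_mem _) z
  | insert a s ha ih =>
    simp_rw [Finset.sum_insert ha]
    exact (h a (Finset.mem_insert_self _ _)).add
      (ih fun i hi => h i (Finset.mem_insert_of_mem hi))

/-- The product rule. In the term `S z * (T w - T z)` the difference quotients of `T w f` converge
only pointwise, but boundedly, which is enough because `S z` is continuous for such limits. -/
theorem WDerivAt.mul {S T : ℝ → Op Ω} {S' T' : Op Ω} {z : ℝ} (hS : WDerivAt S S' z)
    (hT : WDerivAt T T' z) : WDerivAt (fun w => S w * T w) (S' * T z + S z * T') z := by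
  obtain ⟨C, hC⟩ := hS.lip
  obtain ⟨D, hD⟩ := hT.lip
  have near : ∀ᶠ w in 𝓝 z, |w - z| < 1 := by
    have := Metric.ball_mem_nhds z one_pos
    filter_upwards [this] with w hw
    simpa [Real.dist_eq] using hw
  have split : ∀ w, S w * T w - S z * T z =
      (S w - S z) * (T w - T z) + S z * (T w - T z) + (S w - S z) * T z := fun w => by
    simp only [sub_mul, mul_sub]; abel
  -- the term of second order is negligible in norm
  have quad : ∀ᶠ w in 𝓝 z, ‖(S w - S z) * (T w - T z)‖ ≤ C * D * |w - z| ^ 2 := by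
    filter_upwards [hC, hD] with w h1 h2
    calc _ ≤ ‖S w - S z‖ * ‖T w - T z‖ := norm_mul_le _ _
      _ ≤ (C * |w - z|) * (D * |w - z|) :=
        mul_le_mul h1 h2 (norm_nonneg _) ((norm_nonneg _).trans h1)
      _ = _ := by ring
  refine ⟨mul_mem hS.mem hT.mem, ⟨|C * D| + ‖S z‖ * D + C * ‖T z‖, ?_⟩, fun f x => ?_⟩
  · filter_upwards [hC, hD, quad, near] with w h1 h2 h3 h4
    rw [split]
    have e1 : C * D * |w - z| ^ 2 ≤ |C * D| * |w - z| := by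
      have : |w - z| ^ 2 ≤ |w - z| := by nlinarith [abs_nonneg (w - z)]
      calc _ ≤ |C * D| * |w - z| ^ 2 := by gcongr; exact le_abs_self _
        _ ≤ _ := by gcongr
    have e2 : ‖S z * (T w - T z)‖ ≤ ‖S z‖ * (D * |w - z|) :=
      (norm_mul_le _ _).trans (by gcongr)
    have e3 : ‖(S w - S z) * T z‖ ≤ (C * |w - z|) * ‖T z‖ :=
      (norm_mul_le _ _).trans (by gcongr)
    calc _ ≤ ‖(S w - S z) * (T w - T z)‖ + ‖S z * (T w - T z)‖ + ‖(S w - S z) * T z‖ :=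
        norm_add₃_le
      _ ≤ |C * D| * |w - z| + ‖S z‖ * (D * |w - z|) + (C * |w - z|) * ‖T z‖ := by
        gcongr; exact h3.trans e1
      _ = _ := by ring
  · have d1 : HasDerivAt (fun w => ((S w - S z) * (T w - T z)) f x) 0 z := by
      rw [hasDerivAt_iff_isLittleO]
      have : (fun w => ((S w - S z) * (T w - T z)) f x) =O[𝓝 z] fun w => (w - z) ^ 2 := by
        refine Asymptotics.IsBigO.of_bound (C * D * ‖f‖) ?_
        filter_upwards [quad] with w hw
        have := (Op.norm_apply_apply_le ((S w - S z) * (T w - T z)) f x).trans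
          (mul_le_mul_of_nonneg_right hw (norm_nonneg f))
        rw [norm_pow, Real.norm_eq_abs]
        linarith
      have h2 : (fun w : ℝ => (w - z) ^ 2) =o[𝓝 z] fun w => w - z := by
        have : Tendsto (fun w : ℝ => w - z) (𝓝 z) (𝓝 0) := by
          have h : Continuous fun w : ℝ => w - z := by fun_prop
          simpa using h.tendsto z
        exact (Asymptotics.isLittleO_pow_id (by norm_num : 1 < 2)).comp_tendsto this
      simpa using this.trans_isLittleO h2
    have d3 : HasDerivAt (fun w => ((S w - S z) * T z) f x) (S' (T z f) x) z := by
      have := (hS.deriv (T z f) x).sub_const (S z (T z f) x)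
      exact this
    have d2 : HasDerivAt (fun w => (S z * (T w - T z)) f x) (S z (T' f) x) z := by
      rw [hasDerivAt_iff_tendsto_slope]
      have hq : ∀ y, Tendsto (fun w => ((((w - z : ℝ) : ℂ)⁻¹) • ((T w - T z) f)) y) (𝓝[≠] z)
          (𝓝 (T' f y)) := by
        intro y
        have := hasDerivAt_iff_tendsto_slope.1 (hT.deriv f y)
        refine this.congr fun w => ?_
        simp only [slope, vsub_eq_sub, Bdd.smul_apply, Op.sub_apply, Bdd.sub_apply]
        rw [Complex.real_smul]; push_cast; rfl
      have hb : ∀ᶠ w in 𝓝[≠] z, ‖(((w - z : ℝ) : ℂ)⁻¹) • ((T w - T z) f)‖ ≤ D * ‖f‖ := by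
        filter_upwards [hD.filter_mono nhdsWithin_le_nhds, self_mem_nhdsWithin] with w hw hne
        have hpos : 0 < |w - z| := abs_pos.2 (sub_ne_zero.2 hne)
        rw [norm_smul, norm_inv, Complex.norm_real, Real.norm_eq_abs, inv_mul_le_iff₀ hpos]
        calc _ ≤ ‖T w - T z‖ * ‖f‖ := Op.le_norm _ _
          _ ≤ (D * |w - z|) * ‖f‖ := by gcongr
          _ = _ := by ring
      refine (tendsto_of_sigmaCont hS.mem hb hq x).congr fun w => ?_
      rw [Op.map_smul]
      simp only [slope, vsub_eq_sub, Bdd.smul_apply, sub_self, mul_zero, Op.mul_apply,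
        Op.zero_apply, Bdd.zero_apply, sub_zero]
      rw [Complex.real_smul]; push_cast; rfl
    have := ((d1.add d2).add d3).add_const ((S z * T z) f x)
    refine (this.congr_deriv ?_).congr_of_eventuallyEq (Eventually.of_forall fun w => ?_)
    · simp only [Op.mul_apply, Op.add_apply, Bdd.add_apply]; ring
    · have h : S w * T w = (S w - S z) * (T w - T z) + S z * (T w - T z) + (S w - S z) * T z
          + S z * T z := by rw [← split]; abel
      simp only [Pi.add_apply]
      rw [h]; rfl

theorem WDerivAt.smul {T : ℝ → Op Ω} {T' : Op Ω} {z : ℝ} {c : ℝ → ℂ} {c' : ℂ}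
    (hc : HasDerivAt c c' z) (hT : WDerivAt T T' z) :
    WDerivAt (fun w => c w • T w) (c' • T z + c z • T') z := by
  have h1 : WDerivAt (fun w => c w • (1 : Op Ω)) (c' • 1) z := by
    refine ⟨Subalgebra.smul_mem _ (one_mem _) _, ?_, fun f x => ?_⟩
    · have hl := hc.isBigO_sub
      obtain ⟨C, hC⟩ := hl.bound
      refine ⟨|C|, hC.mono fun w hw => ?_⟩
      rw [← sub_smul, norm_smul]
      calc _ ≤ ‖c w - c z‖ * 1 := by gcongr; exact Op.norm_one_le
        _ ≤ C * |w - z| := by rw [mul_one]; simpa using hw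
        _ ≤ _ := by gcongr; exact le_abs_self _
    · exact hc.mul_const (f x)
  have := h1.mul hT
  simpa [smul_mul_assoc] using this

theorem WDerivAt.congr_deriv {T : ℝ → Op Ω} {T' T'' : Op Ω} {z : ℝ} (hT : WDerivAt T T' z)
    (h : T' = T'') : WDerivAt T T'' z := h ▸ hT

/-- The exponential of a commuting family. -/
theorem WDerivAt.exp {T : ℝ → Op Ω} {T' : Op Ω} {z : ℝ} (hT : WDerivAt T T' z)
    (hmem : ∀ w, T w ∈ sigmaCont Ω) (hcomm : ∀ w w', Commute (T w) (T w')) :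
    WDerivAt (fun w => NormedSpace.exp (T w)) (NormedSpace.exp (T z) * T') z := by
  obtain ⟨C, hC⟩ := hT.lip
  -- as the family commutes, `exp (T w) = exp (T z) * exp (T w - T z)`, and the last factor is
  -- expanded at `0`
  have key : WDerivAt (fun w => NormedSpace.exp (T w - T z)) T' z := by
    have hlim : Tendsto (fun w => T w - T z) (𝓝 z) (𝓝 0) := by
      rw [tendsto_zero_iff_norm_tendsto_zero]
      have : Tendsto (fun w => C * |w - z|) (𝓝 z) (𝓝 0) := by
        have h : Continuous fun w : ℝ => C * |w - z| := by fun_prop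
        simpa using h.tendsto z
      exact tendsto_of_tendsto_of_tendsto_of_le_of_le' tendsto_const_nhds this
        (Eventually.of_forall fun _ => norm_nonneg _) hC
    refine ⟨exp_mem_sigmaCont (sub_mem (hmem z) (hmem z)), ⟨Real.exp 1 * C, ?_⟩, fun f x => ?_⟩
    · have h1 : ∀ᶠ w in 𝓝 z, ‖T w - T z‖ ≤ 1 := by
        have := hlim.norm
        rw [norm_zero] at this
        exact (this.eventually (gt_mem_nhds one_pos)).mono fun w hw => le_of_lt hw
      filter_upwards [hC, h1] with w hw hw1
      rw [sub_self, NormedSpace.exp_zero]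
      calc _ ≤ Real.exp ‖T w - T z‖ * ‖T w - T z‖ := norm_exp_sub_one_le _
        _ ≤ Real.exp 1 * (C * |w - z|) := by gcongr
        _ = _ := by ring
    · have he := (hasFDerivAt_exp_zero (𝕂 := ℂ) (𝔸 := Op Ω)).isLittleO.comp_tendsto hlim
      have hO : (fun w => T w - T z) =O[𝓝 z] fun w => w - z :=
        Asymptotics.IsBigO.of_bound C (by simpa using hC)
      have ho : (fun w => NormedSpace.exp (T w - T z) - 1 - (T w - T z)) =o[𝓝 z]
          fun w => w - z := by
        have h2 := he.trans_isBigO (k := fun w => w - z) (by simpa [Function.comp_def] using hO)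
        refine h2.congr (fun w => ?_) (fun w => rfl)
        simp
      have d1 : HasDerivAt (fun w => (NormedSpace.exp (T w - T z) - 1 - (T w - T z)) f x) 0 z := by
        rw [hasDerivAt_iff_isLittleO]
        have : (fun w => (NormedSpace.exp (T w - T z) - 1 - (T w - T z)) f x) =O[𝓝 z]
            fun w => NormedSpace.exp (T w - T z) - 1 - (T w - T z) := by
          refine Asymptotics.IsBigO.of_bound ‖f‖ (Eventually.of_forall fun w => ?_)
          rw [mul_comm]
          exact Op.norm_apply_apply_le _ f x
        simpa using this.trans_isLittleO ho
      have d2 : HasDerivAt (fun w => (T w - T z) f x) (T' f x) z :=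
        (hT.deriv f x).sub_const (T z f x)
      have := (d1.add d2).add_const (f x)
      refine (this.congr_deriv (by ring)).congr_of_eventuallyEq
        (Eventually.of_forall fun w => ?_)
      simp only [Pi.add_apply, Op.sub_apply, Bdd.sub_apply, Op.one_apply]
      ring
  have := (WDerivAt.const (exp_mem_sigmaCont (hmem z)) z).mul key
  rw [zero_mul, zero_add] at this
  refine ⟨exp_mem_sigmaCont (hmem z), ?_, ?_⟩
  · convert this.lip using 6 with D w
    · rw [← NormedSpace.exp_add_of_commute ((hcomm z w).sub_right (hcomm z z))]; simp
  · intro f x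
    convert this.deriv f x using 4 with w
    rw [← NormedSpace.exp_add_of_commute ((hcomm z w).sub_right (hcomm z z))]; simp

/-- Weak differentiability passes to integrals against a complex measure. -/
theorem WDerivAt.cint {T : ℝ → Op Ω} {T' : Op Ω} {z : ℝ} (hT : WDerivAt T T' z)
    (m : ComplexMeasure Ω) (f : Bdd Ω) :
    HasDerivAt (fun w => Speckle.cint m (T w f)) (Speckle.cint m (T' f)) z := by
  obtain ⟨C, hC⟩ := hT.lip
  rw [hasDerivAt_iff_tendsto_slope]
  have hlim : Tendsto (fun w => Speckle.cint m ((((w - z : ℝ) : ℂ)⁻¹) • ((T w - T z) f) : Bdd Ω))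
      (𝓝[≠] z) (𝓝 (Speckle.cint m (T' f))) := by
    refine cint_tendsto m (C := C * ‖f‖) (Eventually.of_forall fun w => Bdd.measurable _) ?_ ?_
    · filter_upwards [hC.filter_mono nhdsWithin_le_nhds, self_mem_nhdsWithin] with w hw hne
      intro x
      refine (Bdd.norm_apply_le _ x).trans ?_
      have hpos : 0 < |w - z| := abs_pos.2 (sub_ne_zero.2 hne)
      rw [norm_smul, norm_inv, Complex.norm_real, Real.norm_eq_abs, inv_mul_le_iff₀ hpos]
      calc _ ≤ ‖T w - T z‖ * ‖f‖ := Op.le_norm _ _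
        _ ≤ (C * |w - z|) * ‖f‖ := by gcongr
        _ = _ := by ring
    · intro y
      refine (hasDerivAt_iff_tendsto_slope.1 (hT.deriv f y)).congr fun w => ?_
      simp only [slope, vsub_eq_sub, Bdd.smul_apply, Op.sub_apply, Bdd.sub_apply]
      rw [Complex.real_smul]; push_cast; rfl
  refine hlim.congr fun w => ?_
  have e1 : ⇑((((w - z : ℝ) : ℂ)⁻¹) • ((T w - T z) f) : Bdd Ω).1 = (((w - z : ℝ) : ℂ)⁻¹) •
      (((T w f : Bdd Ω) : Ω → ℂ) + ((-1 : ℂ) • (T z f : Bdd Ω) : Bdd Ω)) := by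
    ext x
    simp only [Pi.smul_apply, Pi.add_apply, smul_eq_mul]
    change _ * (T w f x - T z f x) = _ * (T w f x + -1 * T z f x)
    ring
  have e2 : ⇑((-1 : ℂ) • (T z f : Bdd Ω) : Bdd Ω).1 = (-1 : ℂ) • ((T z f : Bdd Ω) : Ω → ℂ) := rfl
  rw [e1, cint_smul, cint_add, e2, cint_smul]
  · simp only [slope, vsub_eq_sub]
    rw [Complex.real_smul]; push_cast; ring
  · exact Bdd.measurable _
  · exact Bdd.bounded _
  · exact Bdd.measurable _
  · exact Bdd.measurable _
  · exact Bdd.bounded _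
  · exact Bdd.bounded _
  · exact (Bdd.measurable _).add (Bdd.measurable _)
  · exact Bdd.bounded (T w f + (-1 : ℂ) • (T z f : Bdd Ω))

end Operators


/-! ### Kernel operators and oscillatory interactions -/

section Kernels

variable {Ω Θ : Type*} [MeasurableSpace Ω] [MeasurableSpace Θ]

/-- The operator `f ↦ (x ↦ ∫ a(x, k) f(S(x, k)) ν(dk))`, for a bounded amplitude `a`. -/
def kerOp (ν : Measure Θ) [IsFiniteMeasure ν] (S : Ω → Θ → Ω)
    (hS : Measurable (Function.uncurry S)) (a : Ω → Θ → ℂ) (ha : Measurable (Function.uncurry a))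
    (C : ℝ) (hC : ∀ x k, ‖a x k‖ ≤ C) : Op Ω :=
  have meas : ∀ f : Bdd Ω, Measurable (Function.uncurry fun x k => a x k * f (S x k)) := fun f =>
    ha.mul (f.measurable.comp hS)
  have bd : ∀ (f : Bdd Ω) x k, ‖a x k * f (S x k)‖ ≤ C * ‖f‖ := fun f x k => by
    rw [norm_mul]
    exact mul_le_mul (hC x k) (f.norm_apply_le _) (norm_nonneg _)
      ((norm_nonneg _).trans (hC x k))
  have int : ∀ (f : Bdd Ω) x, Integrable (fun k => a x k * f (S x k)) ν := fun f x =>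
    Integrable.of_bound ((meas f).comp measurable_prodMk_left).aestronglyMeasurable _
      (Eventually.of_forall (bd f x))
  have bd' : ∀ (f : Bdd Ω) x, ‖∫ k, a x k * f (S x k) ∂ν‖ ≤ |C| * ν.real univ * ‖f‖ :=
    fun f x => by
      refine (norm_integral_le_of_norm_le_const (Eventually.of_forall (bd f x))).trans ?_
      have : C ≤ |C| := le_abs_self C
      calc C * ‖f‖ * ν.real univ ≤ |C| * ‖f‖ * ν.real univ := by gcongr
        _ = _ := by ring
  Op.mk
    { toFun := fun f => Bdd.mk (fun x => ∫ k, a x k * f (S x k) ∂ν)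
        (meas f).stronglyMeasurable.integral_prod_right.measurable ⟨_, bd' f⟩
      map_add' := fun f g => by
        ext x
        simp only [Bdd.mk_apply, Bdd.add_apply, mul_add]
        exact integral_add (int f x) (int g x)
      map_smul' := fun c f => by
        ext x
        simp only [Bdd.mk_apply, Bdd.smul_apply, RingHom.id_apply]
        rw [← integral_const_mul]
        congr 1; ext k; ring }
    (|C| * ν.real univ) fun f => Bdd.norm_le (by positivity) (bd' f)

section

variable {ν : Measure Θ} [IsFiniteMeasure ν] {S : Ω → Θ → Ω}
    {hS : Measurable (Function.uncurry S)} {a : Ω → Θ → ℂ} {ha : Measurable (Function.uncurry a)}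
    {C : ℝ} {hC : ∀ x k, ‖a x k‖ ≤ C}

theorem kerOp_apply (f : Bdd Ω) (x : Ω) :
    kerOp ν S hS a ha C hC f x = ∫ k, a x k * f (S x k) ∂ν := rfl

theorem integrable_kernel {S : Ω → Θ → Ω} (hS : Measurable (Function.uncurry S)) {a : Ω → Θ → ℂ}
    (ha : Measurable (Function.uncurry a)) {C : ℝ} (hC : ∀ x k, ‖a x k‖ ≤ C) (f : Bdd Ω) (x : Ω) :
    Integrable (fun k => a x k * f (S x k)) ν := by
  refine Integrable.of_bound
    ((ha.mul (f.measurable.comp hS)).comp measurable_prodMk_left).aestronglyMeasurable (C * ‖f‖)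
    (Eventually.of_forall fun k => ?_)
  refine (norm_mul _ _).trans_le ?_
  exact mul_le_mul (hC x k) (f.norm_apply_le _) (norm_nonneg _) ((norm_nonneg _).trans (hC x k))

theorem norm_kerOp_apply_le (f : Bdd Ω) (x : Ω) :
    ‖kerOp ν S hS a ha C hC f x‖ ≤ (∫ k, ‖a x k‖ ∂ν) * ‖f‖ := by
  rw [kerOp_apply, ← integral_mul_const]
  refine norm_integral_le_of_norm_le ?_ (Eventually.of_forall fun k => ?_)
  · refine Integrable.mul_const (Integrable.norm (Integrable.of_bound
      (ha.comp measurable_prodMk_left).aestronglyMeasurable C (Eventually.of_forall (hC x)))) _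
  · rw [norm_mul]
    exact mul_le_mul_of_nonneg_left (f.norm_apply_le _) (norm_nonneg _)

theorem norm_kerOp_le {M : ℝ} (hM : 0 ≤ M) (h : ∀ x, ∫ k, ‖a x k‖ ∂ν ≤ M) :
    ‖kerOp ν S hS a ha C hC‖ ≤ M :=
  Op.norm_le hM fun f x => (norm_kerOp_apply_le f x).trans
    (mul_le_mul_of_nonneg_right (h x) (norm_nonneg _))

theorem kerOp_mem_sigmaCont : kerOp ν S hS a ha C hC ∈ sigmaCont Ω := by
  intro F f D hD h x
  simp_rw [kerOp_apply]
  refine tendsto_integral_of_dominated_convergence (fun _ => C * D)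
    (fun n => (integrable_kernel hS ha hC (F n) x).aestronglyMeasurable)
    (integrable_const _) (fun n => Eventually.of_forall fun k => ?_)
    (Eventually.of_forall fun k => (h _).const_mul _)
  rw [norm_mul]
  exact mul_le_mul (hC x k) (((F n).norm_apply_le _).trans (hD n)) (norm_nonneg _)
    ((norm_nonneg _).trans (hC x k))

/-- The norm of a product of two kernel operators is controlled by the iterated integral of the
amplitudes, the second one being evaluated at the shifted point. -/
theorem norm_kerOp_mul_le {S' : Ω → Θ → Ω} {hS' : Measurable (Function.uncurry S')}
    {a' : Ω → Θ → ℂ} {ha' : Measurable (Function.uncurry a')} {C' : ℝ}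
    {hC' : ∀ x k, ‖a' x k‖ ≤ C'} {M : ℝ} (hM : 0 ≤ M)
    (h : ∀ x, ∫ k, ‖a x k‖ * ∫ k', ‖a' (S x k) k'‖ ∂ν ∂ν ≤ M) :
    ‖kerOp ν S hS a ha C hC * kerOp ν S' hS' a' ha' C' hC'‖ ≤ M := by
  refine Op.norm_le hM fun f x => ?_
  rw [Op.mul_apply, kerOp_apply]
  have m1 : Measurable fun k => ‖a x k‖ := (ha.comp measurable_prodMk_left).norm
  have m2 : Measurable fun y => ∫ k', ‖a' y k'‖ ∂ν :=
    (StronglyMeasurable.integral_prod_right (f := fun y k' => ‖a' y k'‖)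
      ha'.norm.stronglyMeasurable).measurable
  have m3 : Measurable fun k => S x k := hS.comp measurable_prodMk_left
  have b2 : ∀ y, ∫ k', ‖a' y k'‖ ∂ν ≤ C' * ν.real univ := fun y => by
    have := norm_integral_le_of_norm_le_const (μ := ν) (f := fun k' => ‖a' y k'‖) (C := C')
      (Eventually.of_forall fun k => by simpa using hC' y k)
    exact (le_abs_self _).trans this
  have n2 : ∀ y, 0 ≤ ∫ k', ‖a' y k'‖ ∂ν := fun y => integral_nonneg fun _ => norm_nonneg _
  calc ‖∫ k, a x k * kerOp ν S' hS' a' ha' C' hC' f (S x k) ∂ν‖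
      ≤ ∫ k, (‖a x k‖ * ∫ k', ‖a' (S x k) k'‖ ∂ν) * ‖f‖ ∂ν := by
        refine norm_integral_le_of_norm_le (Integrable.mul_const (Integrable.of_bound
          (m1.mul (m2.comp m3)).aestronglyMeasurable (C * (C' * ν.real univ))
          (Eventually.of_forall fun k => ?_)) _) (Eventually.of_forall fun k => ?_)
        · simp only [Pi.mul_apply, Function.comp_apply, Real.norm_eq_abs, abs_mul, abs_norm,
            abs_of_nonneg (n2 _)]
          exact mul_le_mul (hC x k) (b2 _) (n2 _) ((norm_nonneg _).trans (hC x k))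
        · rw [norm_mul, mul_assoc]
          exact mul_le_mul_of_nonneg_left (norm_kerOp_apply_le f _) (norm_nonneg _)
    _ ≤ M * ‖f‖ := by
        rw [integral_mul_const]
        exact mul_le_mul_of_nonneg_right (h x) (norm_nonneg _)

theorem commute_kerOp {S' : Ω → Θ → Ω} {hS' : Measurable (Function.uncurry S')}
    {a' : Ω → Θ → ℂ} {ha' : Measurable (Function.uncurry a')} {C' : ℝ}
    {hC' : ∀ x k, ‖a' x k‖ ≤ C'} (hSS : ∀ x k k', S' (S x k) k' = S (S' x k') k)
    (h1 : ∀ x k k', a' (S x k) k' = a' x k') (h2 : ∀ x k k', a (S' x k') k = a x k) :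
    Commute (kerOp ν S hS a ha C hC) (kerOp ν S' hS' a' ha' C' hC') := by
  refine Op.ext fun f => Bdd.ext fun x => ?_
  simp only [Op.mul_apply, kerOp_apply, h1, h2, ← integral_const_mul]
  rw [integral_integral_swap]
  · congr 1; ext k'; congr 1; ext k
    rw [hSS]; ring
  · refine Integrable.of_bound (C := C * (C' * ‖f‖)) ?_ (Eventually.of_forall fun y => ?_)
    · refine Measurable.aestronglyMeasurable ?_
      refine Measurable.mul (ha.comp (measurable_const.prodMk measurable_fst))
        (Measurable.mul (ha'.comp (measurable_const.prodMk measurable_snd))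
          (f.measurable.comp (hS'.comp (Measurable.prodMk
            (hS.comp (measurable_const.prodMk measurable_fst)) measurable_snd))))
    · simp only [Function.uncurry, norm_mul]
      have := (norm_nonneg _).trans (hC x y.1)
      have := (norm_nonneg _).trans (hC' x y.2)
      exact mul_le_mul (hC _ _) (mul_le_mul (hC' _ _) (f.norm_apply_le _) (norm_nonneg _) this)
        (by positivity) ‹_›

end

/-! ### Oscillatory integrals in time -/

/-- The integral `∫_0^z e^{isθ} ds`, in closed form. -/
def oscInt (z θ : ℝ) : ℂ :=
  if θ = 0 then (z : ℂ) else (Complex.exp (Complex.I * (z * θ : ℝ)) - 1) / (Complex.I * θ)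

theorem measurable_oscInt (z : ℝ) : Measurable (oscInt z) := by
  unfold oscInt
  refine Measurable.ite (measurableSet_singleton 0) measurable_const ?_
  fun_prop

theorem norm_exp_I_mul (t : ℝ) : ‖Complex.exp (Complex.I * t)‖ = 1 := by
  rw [mul_comm]; exact Complex.norm_exp_ofReal_mul_I t

theorem hasDerivAt_oscInt (z θ : ℝ) :
    HasDerivAt (fun w => oscInt w θ) (Complex.exp (Complex.I * (z * θ : ℝ))) z := by
  by_cases hθ : θ = 0
  · subst hθ
    simp only [oscInt, if_true, mul_zero, Complex.ofReal_zero, Complex.exp_zero]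
    exact HasDerivAt.ofReal_comp (hasDerivAt_id z)
  · simp only [oscInt, if_neg hθ]
    have hθ' : (θ : ℂ) ≠ 0 := by exact_mod_cast hθ
    have h1 : HasDerivAt (fun w : ℝ => Complex.I * ((w * θ : ℝ) : ℂ)) (Complex.I * θ) z := by
      have := ((hasDerivAt_id z).mul_const θ).ofReal_comp.const_mul Complex.I
      simpa using this
    have h2 := (h1.cexp.sub_const 1).div_const (Complex.I * θ)
    refine h2.congr_deriv ?_
    have := Complex.I_ne_zero
    field_simp

@[simp] theorem oscInt_zero (θ : ℝ) : oscInt 0 θ = 0 := by simp [oscInt]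

theorem norm_oscInt_sub_le (z w θ : ℝ) : ‖oscInt w θ - oscInt z θ‖ ≤ |w - z| := by
  have := Convex.norm_image_sub_le_of_norm_hasDerivWithin_le (f := fun w => oscInt w θ)
    (f' := fun w => Complex.exp (Complex.I * (w * θ : ℝ))) (s := univ) (C := 1) (x := z) (y := w)
    (fun x _ => (hasDerivAt_oscInt x θ).hasDerivWithinAt)
    (fun x _ => (norm_exp_I_mul _).le) convex_univ (mem_univ _) (mem_univ _)
  simpa using this

theorem norm_oscInt_le (z θ : ℝ) : ‖oscInt z θ‖ ≤ |z| := by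
  simpa using norm_oscInt_sub_le 0 z θ

theorem norm_oscInt_mul_le (z θ : ℝ) : ‖oscInt z θ‖ * |θ| ≤ 2 := by
  by_cases hθ : θ = 0
  · simp [hθ]
  · simp only [oscInt, if_neg hθ, norm_div, norm_mul, Complex.norm_I, Complex.norm_real,
      Real.norm_eq_abs, one_mul]
    rw [div_mul_cancel₀ _ (abs_ne_zero.2 hθ)]
    refine (norm_sub_le _ _).trans ?_
    rw [norm_exp_I_mul, norm_one]; norm_num

/-! ### Interactions -/

/-- An interaction is given by a shift of the state by a momentum transfer `k` and by the phase
rate that goes with it. -/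
structure Interaction (Ω Θ : Type*) [MeasurableSpace Ω] [MeasurableSpace Θ] where
  /-- the shifted state -/
  shift : Ω → Θ → Ω
  /-- the phase rate -/
  phase : Ω → Θ → ℝ
  measurable_shift : Measurable (Function.uncurry shift)
  measurable_phase : Measurable (Function.uncurry phase)

namespace Interaction

variable (I J : Interaction Ω Θ) (ν : Measure Θ) [IsFiniteMeasure ν]

/-- The generator at `z`: `f ↦ ∫ e^{iz·phase} f(shift) dν`. -/
def gen (z : ℝ) : Op Ω :=
  kerOp ν I.shift I.measurable_shift (fun x k => Complex.exp (Complex.I * (z * I.phase x k : ℝ)))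
    (by
      have := I.measurable_phase
      exact Complex.measurable_exp.comp (measurable_const.mul
        (Complex.measurable_ofReal.comp (measurable_const.mul this))))
    1 (fun _ _ => (norm_exp_I_mul _).le)

/-- The integral over `[0, z]` of the generator. -/
def int (z : ℝ) : Op Ω :=
  kerOp ν I.shift I.measurable_shift (fun x k => oscInt z (I.phase x k))
    ((measurable_oscInt z).comp I.measurable_phase) |z| (fun _ _ => norm_oscInt_le _ _)

theorem gen_apply (z : ℝ) (f : Bdd Ω) (x : Ω) : I.gen ν z f x =
    ∫ k, Complex.exp (Complex.I * (z * I.phase x k : ℝ)) * f (I.shift x k) ∂ν := rfl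

theorem int_apply (z : ℝ) (f : Bdd Ω) (x : Ω) : I.int ν z f x =
    ∫ k, oscInt z (I.phase x k) * f (I.shift x k) ∂ν := rfl

theorem norm_gen_le (z : ℝ) : ‖I.gen ν z‖ ≤ ν.real univ := by
  refine norm_kerOp_le measureReal_nonneg fun x => ?_
  simp only [norm_exp_I_mul]
  simp

theorem norm_int_le (z : ℝ) : ‖I.int ν z‖ ≤ |z| * ν.real univ := by
  refine norm_kerOp_le (by positivity) fun x => ?_
  have := norm_integral_le_of_norm_le_const (μ := ν) (f := fun k => ‖oscInt z (I.phase x k)‖)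
    (C := |z|) (Eventually.of_forall fun k => by simpa using norm_oscInt_le _ _)
  exact (le_abs_self _).trans this

theorem int_mem (z : ℝ) : I.int ν z ∈ sigmaCont Ω := kerOp_mem_sigmaCont

@[simp] theorem int_zero : I.int ν 0 = 0 := by
  refine Op.ext fun f => Bdd.ext fun x => ?_
  rw [int_apply]; simp

theorem wDerivAt_int (z : ℝ) : WDerivAt (I.int ν) (I.gen ν z) z := by
  refine ⟨I.int_mem ν z, ⟨ν.real univ, Eventually.of_forall fun w => ?_⟩, fun f x => ?_⟩
  · refine Op.norm_le (by positivity) fun f x => ?_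
    rw [Op.sub_apply, Bdd.sub_apply, int_apply, int_apply, ← integral_sub]
    · refine (norm_integral_le_of_norm_le_const (C := |w - z| * ‖f‖)
        (Eventually.of_forall fun k => ?_)).trans (by linarith)
      rw [← sub_mul, norm_mul]
      exact mul_le_mul (norm_oscInt_sub_le _ _ _) (f.norm_apply_le _) (norm_nonneg _)
        (abs_nonneg _)
    · exact integrable_kernel I.measurable_shift (a := fun x k => oscInt w (I.phase x k))
        ((measurable_oscInt w).comp I.measurable_phase) (fun x k => norm_oscInt_le _ _) f x
    · exact integrable_kernel I.measurable_shift (a := fun x k => oscInt z (I.phase x k))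
        ((measurable_oscInt z).comp I.measurable_phase) (fun x k => norm_oscInt_le _ _) f x
  · have hm : ∀ w, Measurable fun k => oscInt w (I.phase x k) * f (I.shift x k) := fun w =>
      ((measurable_oscInt w).comp (I.measurable_phase.comp measurable_prodMk_left)).mul
        (f.measurable.comp (I.measurable_shift.comp measurable_prodMk_left))
    refine (hasDerivAt_integral_of_dominated_loc_of_deriv_le (s := univ)
      (F := fun w k => oscInt w (I.phase x k) * f (I.shift x k))
      (F' := fun w k => Complex.exp (Complex.I * (w * I.phase x k : ℝ)) * f (I.shift x k))
      (bound := fun _ => ‖f‖) univ_mem (Eventually.of_forall fun w => (hm w).aestronglyMeasurable)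
      ?_ ?_ (Eventually.of_forall fun k w _ => ?_) (integrable_const _)
      (Eventually.of_forall fun k w _ => ?_)).2
    · exact integrable_kernel I.measurable_shift (a := fun x k => oscInt z (I.phase x k))
        ((measurable_oscInt z).comp I.measurable_phase) (fun x k => norm_oscInt_le _ _) f x
    · have h1 : Measurable fun k => I.phase x k := I.measurable_phase.comp measurable_prodMk_left
      have h2 : Measurable fun k => f (I.shift x k) :=
        f.measurable.comp (I.measurable_shift.comp measurable_prodMk_left)
      exact ((Complex.measurable_exp.comp (measurable_const.mul (Complex.measurable_ofReal.comp
        (measurable_const.mul h1)))).mul h2).aestronglyMeasurable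
    · rw [norm_mul, norm_exp_I_mul, one_mul]
      exact f.norm_apply_le _
    · exact (hasDerivAt_oscInt w _).mul_const _

/-- Two interactions are independent if their shifts commute and neither shift changes the phase
rate of the other one. -/
structure Indep : Prop where
  shift : ∀ x k k', J.shift (I.shift x k) k' = I.shift (J.shift x k') k
  left : ∀ x k k', I.phase (J.shift x k') k = I.phase x k
  right : ∀ x k k', J.phase (I.shift x k) k' = J.phase x k'

variable {I J}

theorem Indep.commute_int (h : Indep I J) (z w : ℝ) : Commute (I.int ν z) (J.int ν w) :=
  commute_kerOp h.shift (fun x k k' => by rw [h.right]) (fun x k k' => by rw [h.left])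

theorem Indep.commute_gen (h : Indep I J) (z w : ℝ) : Commute (I.gen ν z) (J.int ν w) :=
  commute_kerOp h.shift (fun x k k' => by rw [h.right]) (fun x k k' => by rw [h.left])

variable (I J)

/-- The (transposed) solution operator of a self-independent interaction. -/
def prop (z : ℝ) : Op Ω := NormedSpace.exp (I.int ν z)

theorem prop_mem (z : ℝ) : I.prop ν z ∈ sigmaCont Ω := exp_mem_sigmaCont (I.int_mem ν z)

@[simp] theorem prop_zero : I.prop ν 0 = 1 := by simp [prop]

theorem norm_prop_le (z : ℝ) : ‖I.prop ν z‖ ≤ Real.exp (|z| * ν.real univ) :=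
  (norm_exp_le _).trans (Real.exp_le_exp.2 (I.norm_int_le ν z))

variable {I J}

theorem Indep.commute_prop (h : Indep I J) (z w : ℝ) : Commute (I.prop ν z) (J.prop ν w) :=
  (h.commute_int ν z w).exp

theorem wDerivAt_prop (h : Indep I I) (z : ℝ) :
    WDerivAt (I.prop ν) (I.prop ν z * I.gen ν z) z :=
  (I.wDerivAt_int ν z).exp (I.int_mem ν) fun w w' => h.commute_int ν w w'

theorem Indep.commute_gen_prop (h : Indep I J) (z w : ℝ) : Commute (I.gen ν z) (J.prop ν w) :=
  (h.commute_gen ν z w).exp_right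

end Interaction

end Kernels


/-! ### Singular integrals against radially dominated densities -/

section Estimates

/-- The singular weight `|x|^{-s}`, infinite at `0`. It is used with `s = 2/5` and with its square,
`s = 4/5`: the latter is still integrable over the line, and `2/5 > 1/3`, so that the bounds leave
some room above the rate that is to be proved. -/
def sing (s x : ℝ) : ENNReal := (‖x‖ₑ ^ s)⁻¹

theorem measurable_sing (s : ℝ) : Measurable (sing s) := by unfold sing; fun_prop

theorem measurable_sing_comp {α : Type*} [MeasurableSpace α] {f : α → ℝ} (hf : Measurable f)
    (s : ℝ) : Measurable fun x => sing s (f x) := (measurable_sing s).comp hf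

theorem sing_anti {s x y : ℝ} (hs : 0 ≤ s) (h : |x| ≤ |y|) : sing s y ≤ sing s x := by
  unfold sing
  gcongr
  rw [← ofReal_norm, ← ofReal_norm]
  exact ENNReal.ofReal_le_ofReal h

theorem sing_mul {s : ℝ} (hs : 0 ≤ s) (x y : ℝ) : sing s (x * y) = sing s x * sing s y := by
  unfold sing
  rw [enorm_mul, ENNReal.mul_rpow_of_nonneg _ _ hs, ENNReal.mul_inv]
  · exact Or.inr (ENNReal.rpow_ne_top_of_nonneg hs enorm_ne_top)
  · exact Or.inl (ENNReal.rpow_ne_top_of_nonneg hs enorm_ne_top)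

theorem sing_ne_top {s x : ℝ} (hs : 0 ≤ s) (hx : x ≠ 0) : sing s x ≠ ⊤ := by
  unfold sing
  simp [ENNReal.rpow_eq_zero_iff, hx, hs.not_gt]

theorem sing_le_one {s x : ℝ} (hs : 0 ≤ s) (hx : 1 ≤ |x|) : sing s x ≤ 1 := by
  have := sing_anti (s := s) (x := 1) (y := x) hs (by simpa using hx)
  simpa [sing] using this

theorem sing_sq (s x : ℝ) (hs : 0 ≤ s) : sing s x * sing s x = sing (2 * s) x := by
  unfold sing
  rw [two_mul, ENNReal.rpow_add_of_nonneg _ _ hs hs, ENNReal.mul_inv]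
  · exact Or.inr (ENNReal.rpow_ne_top_of_nonneg hs enorm_ne_top)
  · exact Or.inl (ENNReal.rpow_ne_top_of_nonneg hs enorm_ne_top)

theorem sing_mul_le {s : ℝ} (hs : 0 ≤ s) (x y : ℝ) :
    sing s x * sing s y ≤ sing (2 * s) x + sing (2 * s) y := by
  rcases le_total |x| |y| with h | h
  · calc _ ≤ sing s x * sing s x := by gcongr; exact sing_anti hs h
      _ = sing (2 * s) x := sing_sq _ _ hs
      _ ≤ _ := le_self_add
  · calc _ ≤ sing s y * sing s y := by gcongr; exact sing_anti hs h
      _ = sing (2 * s) y := sing_sq _ _ hs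
      _ ≤ _ := le_add_self

theorem sing_neg (s x : ℝ) : sing s (-x) = sing s x := by simp [sing]

theorem sing_le_one_add (s x : ℝ) (hs : 0 ≤ s) : sing s x ≤ 1 + sing (2 * s) x := by
  rcases le_total 1 |x| with h | h
  · exact (sing_le_one hs h).trans le_self_add
  · have : sing s x ≤ sing (2 * s) x := by
      unfold sing
      gcongr ?_⁻¹
      refine ENNReal.rpow_le_rpow_of_exponent_ge ?_ (by linarith)
      rw [← ofReal_norm]
      exact ENNReal.ofReal_le_one.2 h
    exact this.trans le_add_self

theorem lintegral_sing_near_zero_ne_top : ∫⁻ t in Icc (-1 : ℝ) 1, sing (4 / 5) t ≠ ⊤ := by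
  have h1 : ∫⁻ t in Ioc (0 : ℝ) 1, sing (4 / 5) t < ⊤ := by
    have hi : IntegrableOn (fun x : ℝ => x ^ (-(4 / 5) : ℝ)) (Ioc 0 1) :=
      (intervalIntegrable_iff_integrableOn_Ioc_of_le zero_le_one).1
        (intervalIntegral.intervalIntegrable_rpow' (by norm_num))
    have := hi.2
    rw [hasFiniteIntegral_iff_enorm] at this
    refine lt_of_le_of_lt (le_of_eq ?_) this
    refine setLIntegral_congr_fun measurableSet_Ioc fun t ht => ?_
    simp only [sing]
    rw [Real.rpow_neg ht.1.le, enorm_inv (Real.rpow_pos_of_pos ht.1 _).ne',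
      Real.enorm_rpow_of_nonneg ht.1.le (by norm_num)]
  have h2 : ∫⁻ t in Ico (-1 : ℝ) 0, sing (4 / 5) t < ⊤ := by
    have e := (Measure.measurePreserving_neg (volume : Measure ℝ)).setLIntegral_comp_preimage
      (s := Ioc (0 : ℝ) 1) measurableSet_Ioc (measurable_sing (4 / 5))
    simp only [sing_neg, neg_preimage, neg_Ioc, neg_zero] at e
    rw [e]; exact h1
  have hsub : Icc (-1 : ℝ) 1 ⊆ (Ico (-1 : ℝ) 0 ∪ Ioc 0 1) ∪ {0} := by
    intro t ht
    rcases lt_trichotomy t 0 with h | h | h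
    · exact Or.inl (Or.inl ⟨ht.1, h⟩)
    · exact Or.inr h
    · exact Or.inl (Or.inr ⟨h, ht.2⟩)
  refine ne_of_lt (lt_of_le_of_lt (lintegral_mono_set hsub) ?_)
  refine lt_of_le_of_lt (lintegral_union_le _ _ _) ?_
  have h0 : ∫⁻ t in ({0} : Set ℝ), sing (4 / 5) t = 0 := by
    rw [Measure.restrict_singleton]; simp
  rw [h0, add_zero]
  exact lt_of_le_of_lt (lintegral_union_le _ _ _) (ENNReal.add_lt_top.2 ⟨h2, h1⟩)

theorem exists_lintegral_sing_sub_le :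
    ∃ K : ENNReal, K ≠ ⊤ ∧ ∀ a : ℝ, ∫⁻ t in Icc (-2 : ℝ) 2, sing (4 / 5) (t - a) ≤ K := by
  refine ⟨(∫⁻ t in Icc (-1 : ℝ) 1, sing (4 / 5) t) + volume (Icc (-2 : ℝ) 2),
    ENNReal.add_ne_top.2 ⟨lintegral_sing_near_zero_ne_top, by simp⟩, fun a => ?_⟩
  have hp : ∀ t, sing (4 / 5) (t - a) ≤
      (Icc (-1 : ℝ) 1).indicator (sing (4 / 5)) (t - a) + 1 := by
    intro t
    by_cases h : t - a ∈ Icc (-1 : ℝ) 1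
    · rw [indicator_of_mem h]; exact le_self_add
    · rw [indicator_of_notMem h, zero_add]
      refine sing_le_one (by norm_num) ?_
      by_contra hlt
      exact h (abs_le.1 (not_le.1 hlt).le)
  calc ∫⁻ t in Icc (-2 : ℝ) 2, sing (4 / 5) (t - a)
      ≤ ∫⁻ t in Icc (-2 : ℝ) 2, ((Icc (-1 : ℝ) 1).indicator (sing (4 / 5)) (t - a) + 1) :=
        lintegral_mono hp
    _ = (∫⁻ t in Icc (-2 : ℝ) 2, (Icc (-1 : ℝ) 1).indicator (sing (4 / 5)) (t - a))
        + volume (Icc (-2 : ℝ) 2) := by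
        rw [lintegral_add_right _ measurable_const]; simp
    _ ≤ _ := by
        refine add_le_add ((setLIntegral_le_lintegral _ _).trans (le_of_eq ?_)) le_rfl
        rw [lintegral_sub_right_eq_self (fun t => (Icc (-1 : ℝ) 1).indicator (sing (4 / 5)) t),
          lintegral_indicator measurableSet_Icc]

/-- The weight `|t² - D|^{-2/5}` is integrable over `[-2, 2]`, uniformly in `D`: for `D ≥ 0` it is a
product of two weights with exponent `2/5`, hence bounded by a sum of two with exponent `4/5`. -/
theorem exists_lintegral_sing_quad_le :
    ∃ K : ENNReal, K ≠ ⊤ ∧ ∀ D : ℝ, ∫⁻ t in Icc (-2 : ℝ) 2, sing (2 / 5) (t ^ 2 - D) ≤ K := by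
  obtain ⟨K, hK, h⟩ := exists_lintegral_sing_sub_le
  refine ⟨K + K, ENNReal.add_ne_top.2 ⟨hK, hK⟩, fun D => ?_⟩
  have key : ∃ a : ℝ, ∀ t : ℝ,
      sing (2 / 5) (t ^ 2 - D) ≤ sing (4 / 5) (t - a) + sing (4 / 5) (t - -a) := by
    have e : (2 : ℝ) * (2 / 5) = 4 / 5 := by norm_num
    rcases le_total 0 D with hD | hD
    · refine ⟨Real.sqrt D, fun t => ?_⟩
      have : t ^ 2 - D = (t - Real.sqrt D) * (t - -Real.sqrt D) := by
        have := Real.sq_sqrt hD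
        linear_combination this
      rw [this, sing_mul (by norm_num), ← e]
      exact sing_mul_le (by norm_num) _ _
    · refine ⟨0, fun t => ?_⟩
      have h1 : sing (2 / 5) (t ^ 2 - D) ≤ sing (2 / 5) (t * t) := by
        refine sing_anti (by norm_num) ?_
        rw [abs_of_nonneg (mul_self_nonneg t), abs_of_nonneg (by nlinarith [sq_nonneg t])]
        nlinarith
      refine h1.trans ?_
      rw [sing_mul (by norm_num), sing_sq _ _ (by norm_num), e]
      simp
  obtain ⟨a, ha⟩ := key
  calc _ ≤ ∫⁻ t in Icc (-2 : ℝ) 2, (sing (4 / 5) (t - a) + sing (4 / 5) (t - -a)) :=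
        lintegral_mono ha
    _ = (∫⁻ t in Icc (-2 : ℝ) 2, sing (4 / 5) (t - a))
        + ∫⁻ t in Icc (-2 : ℝ) 2, sing (4 / 5) (t - -a) := by
        rw [lintegral_add_left]
        exact (measurable_sing _).comp (measurable_id.sub_const a)
    _ ≤ _ := add_le_add (h a) (h (-a))

/-- A bound for the integrals over the slices of a cube in one coordinate bounds the integral over
the cube. -/
theorem lintegral_cube_le {d : ℕ} (i : Fin d) {F : (Fin d → ℝ) → ENNReal} (hF : Measurable F)
    {K : ENNReal}
    (h : ∀ x, ∫⁻ t in Icc (-2 : ℝ) 2, F (Function.update x i t) ≤ K) :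
    ∫⁻ x in Set.pi univ (fun _ : Fin d => Icc (-2 : ℝ) 2), F x ≤
      K * volume (Set.pi univ (fun _ : Fin d => Icc (-2 : ℝ) 2)) := by
  set Q := Set.pi univ (fun _ : Fin d => Icc (-2 : ℝ) 2) with hQ
  have mQ : MeasurableSet Q := MeasurableSet.univ_pi fun _ => measurableSet_Icc
  rw [← lintegral_indicator mQ, ← setLIntegral_const, ← lintegral_indicator mQ, volume_pi]
  refine lintegral_le_of_lmarginal_le {i} (hF.indicator mQ) (measurable_const.indicator mQ) ?_
  rw [lmarginal_singleton, lmarginal_singleton]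
  intro x
  let P : Prop := ∀ j, j ≠ i → x j ∈ Icc (-2 : ℝ) 2
  have hmem : ∀ t, Function.update x i t ∈ Q ↔ t ∈ Icc (-2 : ℝ) 2 ∧ P := by
    intro t
    simp only [hQ, Set.mem_univ_pi]
    constructor
    · intro h
      refine ⟨by simpa using h i, fun j hj => by simpa [hj] using h j⟩
    · rintro ⟨h1, h2⟩ j
      by_cases hj : j = i
      · subst hj; simpa using h1
      · simpa [hj] using h2 j hj
  by_cases hP : P
  · have e : ∀ G : (Fin d → ℝ) → ENNReal, (fun t => Q.indicator G (Function.update x i t)) =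
        (Icc (-2 : ℝ) 2).indicator fun t => G (Function.update x i t) := by
      intro G; ext t
      by_cases ht : t ∈ Icc (-2 : ℝ) 2
      · rw [indicator_of_mem ht, indicator_of_mem ((hmem t).2 ⟨ht, hP⟩)]
      · rw [indicator_of_notMem ht, indicator_of_notMem fun h => ht ((hmem t).1 h).1]
    simp only [e]
    rw [lintegral_indicator measurableSet_Icc, lintegral_indicator measurableSet_Icc,
      setLIntegral_const]
    refine (h x).trans ?_
    rw [Real.volume_Icc]
    have : (1 : ENNReal) ≤ ENNReal.ofReal (2 - -2) := by norm_num
    calc K = K * 1 := (mul_one K).symm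
      _ ≤ _ := by gcongr
  · have e : ∀ G : (Fin d → ℝ) → ENNReal,
        (fun t => Q.indicator G (Function.update x i t)) = 0 := by
      intro G; ext t
      rw [indicator_of_notMem fun h => hP ((hmem t).1 h).2]; rfl
    simp only [e]
    simp

theorem cube_volume_ne_top (d : ℕ) :
    volume (Set.pi univ (fun _ : Fin d => Icc (-2 : ℝ) 2)) ≠ ⊤ := by
  rw [volume_pi_pi]
  exact ENNReal.prod_ne_top fun i _ => by simp

/-- The ball of radius `2` lies in the cube. -/
theorem lintegral_ball_le {d : ℕ} {F : Lat d → ENNReal} {B : Set (Lat d)} (mB : MeasurableSet B)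
    (hB : ∀ k ∈ B, ‖k‖ ≤ 2) {G : (Fin d → ℝ) → ENNReal} (hG : Measurable G)
    (h : ∀ k ∈ B, F k ≤ G k.ofLp) :
    ∫⁻ k in B, F k ≤ ∫⁻ x in Set.pi univ (fun _ : Fin d => Icc (-2 : ℝ) 2), G x := by
  have mp := PiLp.volume_preserving_ofLp (Fin d)
  have mQ : MeasurableSet (Set.pi univ (fun _ : Fin d => Icc (-2 : ℝ) 2)) :=
    MeasurableSet.univ_pi fun _ => measurableSet_Icc
  rw [← mp.setLIntegral_comp_preimage mQ hG]
  have hsub : B ⊆ (WithLp.ofLp : Lat d → _) ⁻¹' Set.pi univ (fun _ : Fin d => Icc (-2 : ℝ) 2) := by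
    intro k hk
    simp only [mem_preimage, Set.mem_univ_pi]
    intro j
    have h1 : ‖k j‖ ≤ ‖k‖ := PiLp.norm_apply_le k j
    exact abs_le.1 (h1.trans (hB k hk))
  exact (setLIntegral_mono' mB h).trans (lintegral_mono_set hsub)

/-- On the annulus `1 ≤ |k| ≤ 2`, the level sets of `k·e/|k| + b` are those of a quadratic
polynomial with a leading coefficient bounded below in one of two coordinates. -/
theorem exists_lintegral_annulus_le {d : ℕ} (hd : 2 ≤ d) :
    ∃ K : ENNReal, K ≠ ⊤ ∧ ∀ (e : Lat d) (b : ℝ), ‖e‖ = 1 → |b| ≤ 2 →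
      ∫⁻ k in {k : Lat d | 1 ≤ ‖k‖ ∧ ‖k‖ ≤ 2}, sing (2 / 5) (⟪k, e⟫ / ‖k‖ + b) ≤ K := by
  obtain ⟨K, hK, hquad⟩ := exists_lintegral_sing_quad_le
  refine ⟨sing (2 / 5) (1 / 24) * K * volume (Set.pi univ (fun _ : Fin d => Icc (-2 : ℝ) 2)),
    ENNReal.mul_ne_top (ENNReal.mul_ne_top (sing_ne_top (by norm_num) (by norm_num)) hK)
      (cube_volume_ne_top d), fun e b he hb => ?_⟩
  set i₀ : Fin d := ⟨0, by omega⟩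
  set i₁ : Fin d := ⟨1, by omega⟩
  have hne : i₀ ≠ i₁ := by simp [i₀, i₁]
  obtain ⟨B, hBe⟩ := Orthonormal.exists_orthonormalBasis_extension_of_card_eq (𝕜 := ℝ)
    (E := Lat d) (ι := Fin d) (by simp) (v := fun _ => e) (s := {i₀}) (by
      rw [orthonormal_iff_ite]
      rintro ⟨i, hi⟩ ⟨j, hj⟩
      have : i = j := by rw [mem_singleton_iff.1 hi, mem_singleton_iff.1 hj]
      subst this
      simp [Set.domRestrict, he])
  have hB0 : B i₀ = e := hBe i₀ rfl
  have hinner : ∀ k : Lat d, ⟪k, e⟫ = B.repr k i₀ := fun k => by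
    rw [B.repr_apply_apply, hB0, real_inner_comm]
  have mA : MeasurableSet {k : Lat d | 1 ≤ ‖k‖ ∧ ‖k‖ ≤ 2} :=
    (measurableSet_le measurable_const measurable_norm).inter
      (measurableSet_le measurable_norm measurable_const)
  have mF : Measurable fun y : Lat d => sing (2 / 5) (y i₀ / ‖y‖ + b) := by
    refine (measurable_sing _).comp ?_
    fun_prop
  have rot : ∫⁻ k in {k : Lat d | 1 ≤ ‖k‖ ∧ ‖k‖ ≤ 2}, sing (2 / 5) (⟪k, e⟫ / ‖k‖ + b) =
      ∫⁻ y in {k : Lat d | 1 ≤ ‖k‖ ∧ ‖k‖ ≤ 2}, sing (2 / 5) (y i₀ / ‖y‖ + b) := by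
    rw [← B.measurePreserving_repr.setLIntegral_comp_preimage mA mF]
    have : (B.repr : Lat d → Lat d) ⁻¹' {k : Lat d | 1 ≤ ‖k‖ ∧ ‖k‖ ≤ 2} =
        {k : Lat d | 1 ≤ ‖k‖ ∧ ‖k‖ ≤ 2} := by
      ext k; simp
    rw [this]
    simp only [hinner, LinearIsometryEquiv.norm_map]
  rw [rot]
  -- `|y₀/n + b| ≥ |y₀² - b²n²| / 12` on the annulus
  have lower : ∀ y : Lat d, y ∈ {k : Lat d | 1 ≤ ‖k‖ ∧ ‖k‖ ≤ 2} →
      |y i₀ ^ 2 - b ^ 2 * ∑ j, y j ^ 2| ≤ 12 * |y i₀ / ‖y‖ + b| := by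
    intro y hy
    have hn : 0 < ‖y‖ := lt_of_lt_of_le one_pos hy.1
    have hs : ∑ j, y j ^ 2 = ‖y‖ ^ 2 := by
      rw [EuclideanSpace.norm_sq_eq]; simp
    have h0 : |y i₀| ≤ ‖y‖ := PiLp.norm_apply_le y i₀
    have e1 : y i₀ ^ 2 - b ^ 2 * ∑ j, y j ^ 2 =
        (y i₀ / ‖y‖ + b) * (‖y‖ * (y i₀ - b * ‖y‖)) := by
      rw [hs]; field_simp; ring
    rw [e1, abs_mul, mul_comm]
    refine mul_le_mul_of_nonneg_right ?_ (abs_nonneg _)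
    rw [abs_mul, abs_norm]
    have h2 : |y i₀ - b * ‖y‖| ≤ 6 := by
      refine (abs_sub _ _).trans ?_
      rw [abs_mul, abs_norm]
      nlinarith [hy.2, abs_nonneg b]
    calc ‖y‖ * |y i₀ - b * ‖y‖| ≤ 2 * 6 := mul_le_mul hy.2 h2 (abs_nonneg _) (by norm_num)
      _ = 12 := by norm_num
  -- choice of the coordinate in which the quadratic polynomial is nondegenerate
  have choice : ∃ (i : Fin d) (D : (Fin d → ℝ) → ℝ), Measurable D ∧
      (∀ x t, D (Function.update x i t) = D x) ∧
      ∀ x : Fin d → ℝ, |x i ^ 2 - D x| ≤ 2 * |x i₀ ^ 2 - b ^ 2 * ∑ j, x j ^ 2| := by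
    rcases le_total (1 / 2) (b ^ 2) with hb2 | hb2
    · refine ⟨i₁, fun x => x i₀ ^ 2 / b ^ 2 - ∑ j ∈ Finset.univ.erase i₁, x j ^ 2, by fun_prop,
        fun x t => ?_, fun x => ?_⟩
      · simp only [Function.update_of_ne hne]
        congr 1
        exact Finset.sum_congr rfl fun j hj => by
          rw [Function.update_of_ne (Finset.ne_of_mem_erase hj)]
      · have hb0 : b ^ 2 ≠ 0 := by positivity
        have hdiv : b ^ 2 * (x i₀ ^ 2 / b ^ 2) = x i₀ ^ 2 := mul_div_cancel₀ _ hb0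
        have hsum := Finset.add_sum_erase Finset.univ (fun j => x j ^ 2) (Finset.mem_univ i₁)
        have : x i₀ ^ 2 - b ^ 2 * ∑ j, x j ^ 2 = -(b ^ 2) *
            (x i₁ ^ 2 - (x i₀ ^ 2 / b ^ 2 - ∑ j ∈ Finset.univ.erase i₁, x j ^ 2)) := by
          rw [← hsum]; linear_combination -hdiv
        rw [this, abs_mul, abs_neg, abs_of_nonneg (sq_nonneg b)]
        nlinarith [abs_nonneg
          (x i₁ ^ 2 - (x i₀ ^ 2 / b ^ 2 - ∑ j ∈ Finset.univ.erase i₁, x j ^ 2))]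
    · refine ⟨i₀, fun x => b ^ 2 / (1 - b ^ 2) * ∑ j ∈ Finset.univ.erase i₀, x j ^ 2, by fun_prop,
        fun x t => ?_, fun x => ?_⟩
      · simp only
        congr 1
        exact Finset.sum_congr rfl fun j hj => by
          rw [Function.update_of_ne (Finset.ne_of_mem_erase hj)]
      · have hb0 : 1 - b ^ 2 ≠ 0 := by linarith
        have hsum := Finset.add_sum_erase Finset.univ (fun j => x j ^ 2) (Finset.mem_univ i₀)
        have : x i₀ ^ 2 - b ^ 2 * ∑ j, x j ^ 2 = (1 - b ^ 2) *
            (x i₀ ^ 2 - b ^ 2 / (1 - b ^ 2) * ∑ j ∈ Finset.univ.erase i₀, x j ^ 2) := by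
          rw [← hsum]; field_simp; ring
        rw [this, abs_mul, abs_of_nonneg (by linarith : 0 ≤ 1 - b ^ 2)]
        nlinarith [abs_nonneg
          (x i₀ ^ 2 - b ^ 2 / (1 - b ^ 2) * ∑ j ∈ Finset.univ.erase i₀, x j ^ 2)]
  obtain ⟨i, D, mD, hD, hle⟩ := choice
  have mG : Measurable fun x : Fin d → ℝ =>
      sing (2 / 5) (1 / 24) * sing (2 / 5) (x i ^ 2 - D x) := by
    refine Measurable.const_mul ((measurable_sing _).comp ?_) _
    fun_prop
  refine (lintegral_ball_le mA (fun k hk => hk.2) mG fun y hy => ?_).trans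
    (lintegral_cube_le i mG fun x => ?_)
  · rw [← sing_mul (by norm_num)]
    refine sing_anti (by norm_num) ?_
    have h1 := hle y.ofLp
    have h2 := lower y hy
    rw [abs_mul, abs_of_pos (by norm_num : (0 : ℝ) < 1 / 24)]
    linarith
  · simp only [hD, Function.update_self]
    have hm : Measurable fun t : ℝ => sing (2 / 5) (t ^ 2 - D x) :=
      measurable_sing_comp (by fun_prop) _
    rw [lintegral_const_mul _ hm]
    gcongr
    exact hquad _

/-- Integration in polar coordinates. -/
theorem lintegral_polar {d : ℕ} (hd : 1 ≤ d) {H : Lat d → ENNReal} (hH : Measurable H) :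
    ∫⁻ k, H k = ∫⁻ r : Ioi (0 : ℝ), (∫⁻ ω : Metric.sphere (0 : Lat d) 1, H (r.1 • ω.1)
      ∂(volume : Measure (Lat d)).toSphere) ∂Measure.volumeIoiPow (d - 1) := by
  have : Nonempty (Fin d) := ⟨⟨0, by omega⟩⟩
  have mp := Measure.measurePreserving_homeomorphUnitSphereProd (volume : Measure (Lat d))
  rw [finrank_euclideanSpace_fin] at mp
  have h1 : ∫⁻ k, H k = ∫⁻ k : ({0}ᶜ : Set (Lat d)), H k
      ∂Measure.comap Subtype.val (volume : Measure (Lat d)) := by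
    rw [lintegral_subtype_comap (measurableSet_singleton (0 : Lat d)).compl,
      restrict_compl_singleton]
  have mH : Measurable fun x : Metric.sphere (0 : Lat d) 1 × Ioi (0 : ℝ) => H (x.2.1 • x.1.1) := by
    refine hH.comp ?_
    fun_prop
  have h2 : ∀ k : ({0}ᶜ : Set (Lat d)), H k =
      (fun x : Metric.sphere (0 : Lat d) 1 × Ioi (0 : ℝ) => H (x.2.1 • x.1.1))
        (homeomorphUnitSphereProd (Lat d) k) := by
    intro k
    have hk : ‖(k : Lat d)‖ ≠ 0 := norm_ne_zero_iff.2 k.2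
    simp [smul_smul, hk]
  rw [h1]
  simp_rw [h2]
  rw [mp.lintegral_comp mH, lintegral_prod_symm _ mH.aemeasurable]

/-- Comparison of integrals against a radial density through averages over spheres. -/
theorem lintegral_radial_le {d : ℕ} (hd : 1 ≤ d) {s : ℝ → ENNReal} (hs : Measurable s)
    {H : Lat d → ENNReal} {c : ℝ → ENNReal} (hH : Measurable H) (hc : Measurable c)
    (h : ∀ r : ℝ, 0 < r → ∫⁻ ω : Metric.sphere (0 : Lat d) 1, H (r • ω.1)
        ∂(volume : Measure (Lat d)).toSphere ≤ c r * (volume : Measure (Lat d)).toSphere univ) :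
    ∫⁻ k : Lat d, s ‖k‖ * H k ≤ ∫⁻ k : Lat d, s ‖k‖ * c ‖k‖ := by
  have m : Measurable fun k : Lat d => s ‖k‖ := hs.comp measurable_norm
  have m1 : Measurable fun k : Lat d => s ‖k‖ * H k := m.mul hH
  have m2 : Measurable fun k : Lat d => s ‖k‖ * c ‖k‖ := m.mul (hc.comp measurable_norm)
  rw [lintegral_polar hd m1, lintegral_polar hd m2]
  refine lintegral_mono fun r => ?_
  have hn : ∀ ω : Metric.sphere (0 : Lat d) 1, ‖r.1 • ω.1‖ = r.1 := fun ω => by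
    have h1 : ‖ω.1‖ = 1 := by simp
    rw [norm_smul, h1, mul_one, Real.norm_of_nonneg (le_of_lt r.2)]
  simp only [hn]
  have mω : Measurable fun ω : Metric.sphere (0 : Lat d) 1 => H (r.1 • ω.1) :=
    hH.comp (by fun_prop)
  rw [lintegral_const_mul _ mω, lintegral_const, mul_assoc]
  gcongr
  exact h r.1 r.2

/-- For `d ≥ 2`, `|ω·e + b|^{-2/5}` is integrable over the unit sphere, uniformly in `e` and `b`. -/
theorem exists_sphere_bound {d : ℕ} (hd : 2 ≤ d) :
    ∃ K : ENNReal, K ≠ ⊤ ∧ ∀ (e : Lat d) (b : ℝ), ‖e‖ = 1 →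
      ∫⁻ ω : Metric.sphere (0 : Lat d) 1, sing (2 / 5) (⟪ω.1, e⟫ + b)
        ∂(volume : Measure (Lat d)).toSphere ≤
      K * (volume : Measure (Lat d)).toSphere univ := by
  obtain ⟨K, hK, h⟩ := exists_lintegral_annulus_le hd
  set σ := (volume : Measure (Lat d)).toSphere
  have : Nonempty (Fin d) := ⟨⟨0, by omega⟩⟩
  have hσ : σ univ ≠ 0 := by
    rw [Measure.toSphere_apply_univ, finrank_euclideanSpace_fin]
    refine mul_ne_zero (by simp; omega) ?_
    exact (Metric.measure_ball_pos _ _ one_pos).ne'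
  refine ⟨(K + σ univ) / σ univ, ENNReal.div_ne_top
    (ENNReal.add_ne_top.2 ⟨hK, measure_ne_top _ _⟩) hσ, fun e b he => ?_⟩
  rw [ENNReal.div_mul_cancel hσ (measure_ne_top _ _)]
  rcases le_total |b| 2 with hb | hb
  · refine le_trans ?_ le_self_add
    refine le_trans ?_ (h e b he hb)
    set A := {k : Lat d | 1 ≤ ‖k‖ ∧ ‖k‖ ≤ 2}
    have mA : MeasurableSet A :=
      (measurableSet_le measurable_const measurable_norm).inter
        (measurableSet_le measurable_norm measurable_const)
    have mH : Measurable fun k : Lat d => sing (2 / 5) (⟪k, e⟫ / ‖k‖ + b) :=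
      measurable_sing_comp (by fun_prop) _
    rw [← lintegral_indicator mA, lintegral_polar (by omega) (mH.indicator mA)]
    set V : Measure (Ioi (0 : ℝ)) := Measure.volumeIoiPow (d - 1)
    have hV : 1 ≤ V {r | 1 ≤ r.1 ∧ r.1 ≤ 2} := by
      have mS : MeasurableSet {r : Ioi (0 : ℝ) | 1 ≤ r.1 ∧ r.1 ≤ 2} :=
        (measurableSet_le measurable_const measurable_subtype_coe).inter
          (measurableSet_le measurable_subtype_coe measurable_const)
      simp only [V, Measure.volumeIoiPow]
      rw [withDensity_apply _ mS]
      calc (1 : ENNReal) = volume (Icc (1 : ℝ) 2) := by rw [Real.volume_Icc]; norm_num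
        _ = (Measure.comap Subtype.val volume : Measure (Ioi (0 : ℝ))) {r | 1 ≤ r.1 ∧ r.1 ≤ 2} := by
          rw [comap_subtype_coe_apply measurableSet_Ioi]
          congr 1
          ext t
          simp only [mem_image, Subtype.exists, exists_and_right, exists_eq_right]
          constructor
          · intro ht; exact ⟨lt_of_lt_of_le one_pos ht.1, ht⟩
          · rintro ⟨_, ht⟩; exact ht
        _ = ∫⁻ r in {r : Ioi (0 : ℝ) | 1 ≤ r.1 ∧ r.1 ≤ 2}, 1
            ∂Measure.comap Subtype.val volume := by simp
        _ ≤ _ := by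
          refine setLIntegral_mono' mS fun r hr => ?_
          rw [← ENNReal.ofReal_one]
          exact ENNReal.ofReal_le_ofReal (one_le_pow₀ hr.1)
    set I := ∫⁻ ω : Metric.sphere (0 : Lat d) 1, sing (2 / 5) (⟪ω.1, e⟫ + b) ∂σ
    calc I ≤ I * V {r | 1 ≤ r.1 ∧ r.1 ≤ 2} := by
          calc I = I * 1 := (mul_one I).symm
            _ ≤ _ := by gcongr
      _ = ∫⁻ r in {r : Ioi (0 : ℝ) | 1 ≤ r.1 ∧ r.1 ≤ 2}, I ∂V := by rw [setLIntegral_const]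
      _ ≤ ∫⁻ r in {r : Ioi (0 : ℝ) | 1 ≤ r.1 ∧ r.1 ≤ 2}, (∫⁻ ω : Metric.sphere (0 : Lat d) 1,
            A.indicator (fun k : Lat d => sing (2 / 5) (⟪k, e⟫ / ‖k‖ + b)) (r.1 • ω.1) ∂σ) ∂V := by
          refine setLIntegral_mono' ((measurableSet_le measurable_const
            measurable_subtype_coe).inter (measurableSet_le measurable_subtype_coe
            measurable_const)) fun r hr => ?_
          refine lintegral_mono fun ω => ?_
          have h1 : ‖ω.1‖ = 1 := by simp
          have h2 : ‖r.1 • ω.1‖ = r.1 := by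
            rw [norm_smul, h1, mul_one, Real.norm_of_nonneg (le_of_lt r.2)]
          rw [indicator_of_mem (show r.1 • ω.1 ∈ A by simp only [A, mem_ofPred_eq, h2]; exact hr), h2,
            inner_smul_left]
          have hr0 : r.1 ≠ 0 := ne_of_gt r.2
          simp [hr0]
      _ ≤ _ := setLIntegral_le_lintegral _ _
  · -- there is no singularity, as `|ω·e| ≤ 1`
    refine le_trans ?_ le_add_self
    calc _ ≤ ∫⁻ ω : Metric.sphere (0 : Lat d) 1, 1 ∂σ := by
          refine lintegral_mono fun ω => sing_le_one (by norm_num) ?_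
          have h1 : ‖ω.1‖ = 1 := by simp
          have h2 : |⟪ω.1, e⟫| ≤ 1 := by
            have := abs_real_inner_le_norm ω.1 e
            rwa [h1, he, mul_one] at this
          have := abs_sub_abs_le_abs_sub b (-⟪ω.1, e⟫)
          rw [abs_neg, sub_neg_eq_add, add_comm b] at this
          linarith
      _ = σ univ := by simp

variable {d : ℕ} {s : ℝ → ENNReal} {C : ENNReal}

/-- A bounded integrable radial density `s` integrates `|k + w|^{-4/5}`, uniformly in `w`. -/
theorem exists_sing_norm_bound (hd : 1 ≤ d) (hs : Measurable s) (hC : C ≠ ⊤) (hsC : ∀ r, s r ≤ C)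
    (hI : ∫⁻ k : Lat d, s ‖k‖ ≠ ⊤) :
    ∃ M : ENNReal, M ≠ ⊤ ∧ ∀ w : Lat d, ∫⁻ k : Lat d, s ‖k‖ * sing (4 / 5) ‖k + w‖ ≤ M := by
  obtain ⟨K, hK, h⟩ := exists_lintegral_sing_sub_le
  set Q := volume (Set.pi univ (fun _ : Fin d => Icc (-2 : ℝ) 2))
  have m : Measurable fun k : Lat d => s ‖k‖ := hs.comp measurable_norm
  have mB : MeasurableSet {k : Lat d | ‖k‖ ≤ 1} := measurableSet_le measurable_norm measurable_const
  have mS : Measurable fun k : Lat d => sing (4 / 5) ‖k‖ := measurable_sing_comp measurable_norm _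
  refine ⟨C * (K * Q) + ∫⁻ k : Lat d, s ‖k‖, ENNReal.add_ne_top.2 ⟨ENNReal.mul_ne_top hC
    (ENNReal.mul_ne_top hK (cube_volume_ne_top d)), hI⟩, fun w => ?_⟩
  set J : Lat d → ENNReal := {k : Lat d | ‖k‖ ≤ 1}.indicator fun k => sing (4 / 5) ‖k‖
  have mJ : Measurable J := mS.indicator mB
  have hp : ∀ k : Lat d, s ‖k‖ * sing (4 / 5) ‖k + w‖ ≤ C * J (k + w) + s ‖k‖ := by
    intro k
    by_cases hk : k + w ∈ {k : Lat d | ‖k‖ ≤ 1}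
    · rw [show J (k + w) = _ from indicator_of_mem hk _]
      refine le_trans ?_ le_self_add
      gcongr
      exact hsC _
    · refine le_trans ?_ le_add_self
      calc _ ≤ s ‖k‖ * 1 := by
            gcongr
            refine sing_le_one (by norm_num) ?_
            rw [abs_norm]
            exact (not_le.1 hk).le
        _ = _ := mul_one _
  refine (lintegral_mono hp).trans ?_
  have mJw : Measurable fun k => J (k + w) := mJ.comp (measurable_add_const w)
  rw [lintegral_add_right _ m, lintegral_const_mul _ mJw, lintegral_add_right_eq_self,
    lintegral_indicator mB]
  gcongr
  have hi : 0 < d := hd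
  refine (lintegral_ball_le (G := fun x => sing (4 / 5) (x ⟨0, hi⟩)) mB (fun k hk => ?_)
    (measurable_sing_comp (measurable_pi_apply _) _) fun k _ => ?_).trans
    (lintegral_cube_le ⟨0, hi⟩ (measurable_sing_comp (measurable_pi_apply _) _) fun x => ?_)
  · exact le_trans hk (by norm_num)
  · refine sing_anti (by norm_num) ?_
    rw [abs_norm]
    exact PiLp.norm_apply_le k _
  · simpa using h 0

/-- A bounded integrable radial density `s` integrates `|k + w|^{-2/5}`, uniformly in `w`. -/
theorem exists_sing_norm_bound' (hd : 1 ≤ d) (hs : Measurable s) (hC : C ≠ ⊤)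
    (hsC : ∀ r, s r ≤ C) (hI : ∫⁻ k : Lat d, s ‖k‖ ≠ ⊤) :
    ∃ M : ENNReal, M ≠ ⊤ ∧ ∀ w : Lat d, ∫⁻ k : Lat d, s ‖k‖ * sing (2 / 5) ‖k + w‖ ≤ M := by
  obtain ⟨M, hM, h⟩ := exists_sing_norm_bound hd hs hC hsC hI
  have m : Measurable fun k : Lat d => s ‖k‖ := hs.comp measurable_norm
  refine ⟨(∫⁻ k : Lat d, s ‖k‖) + M, ENNReal.add_ne_top.2 ⟨hI, hM⟩, fun w => ?_⟩
  calc _ ≤ ∫⁻ k : Lat d, (s ‖k‖ + s ‖k‖ * sing (4 / 5) ‖k + w‖) := by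
        refine lintegral_mono fun k => ?_
        have := sing_le_one_add (2 / 5) ‖k + w‖ (by norm_num)
        rw [show (2 : ℝ) * (2 / 5) = 4 / 5 by norm_num] at this
        calc _ ≤ s ‖k‖ * (1 + sing (4 / 5) ‖k + w‖) := by gcongr
          _ = _ := by rw [mul_add, mul_one]
    _ ≤ _ := by
        rw [lintegral_add_left m]
        gcongr
        exact h w

theorem abs_inner_of_dim_one (h : d = 1) (k u : Lat d) : |⟪k, u⟫| = |‖k‖ * ‖u‖| := by
  subst h
  simp [EuclideanSpace.norm_eq, PiLp.inner_apply, Real.sqrt_sq_eq_abs, abs_mul, mul_comm]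

/-- A bounded integrable radial density `s` integrates `|k·u|^{-2/5}`, with the dependence on `|u|`
that scaling dictates. In dimension one `|k·u| = |k| |u|`; in higher dimension the direction of `k` is
integrated out first. -/
theorem exists_sing_inner_bound (hd : 1 ≤ d) (hs : Measurable s) (hC : C ≠ ⊤)
    (hsC : ∀ r, s r ≤ C) (hI : ∫⁻ k : Lat d, s ‖k‖ ≠ ⊤) :
    ∃ M : ENNReal, M ≠ ⊤ ∧ ∀ u : Lat d,
      ∫⁻ k : Lat d, s ‖k‖ * sing (2 / 5) ⟪k, u⟫ ≤ M * sing (2 / 5) ‖u‖ := by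
  obtain ⟨M, hM, h⟩ := exists_sing_norm_bound' hd hs hC hsC hI
  have mS : Measurable fun k : Lat d => s ‖k‖ * sing (2 / 5) ‖k‖ :=
    (hs.comp measurable_norm).mul (measurable_sing_comp measurable_norm _)
  have h0 : ∫⁻ k : Lat d, s ‖k‖ * sing (2 / 5) ‖k‖ ≤ M := by simpa using h 0
  rcases eq_or_lt_of_le hd with hd1 | hd2
  · refine ⟨M, hM, fun u => ?_⟩
    calc _ ≤ ∫⁻ k : Lat d, s ‖k‖ * sing (2 / 5) ‖k‖ * sing (2 / 5) ‖u‖ := by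
          refine lintegral_mono fun k => ?_
          rw [mul_assoc, ← sing_mul (by norm_num)]
          gcongr
          exact sing_anti (by norm_num) (abs_inner_of_dim_one hd1.symm k u).ge
      _ = (∫⁻ k : Lat d, s ‖k‖ * sing (2 / 5) ‖k‖) * sing (2 / 5) ‖u‖ := lintegral_mul_const _ mS
      _ ≤ _ := by gcongr
  · obtain ⟨K, hK, hsph⟩ := exists_sphere_bound hd2
    refine ⟨K * M + 1, by finiteness, fun u => ?_⟩
    rcases eq_or_ne u 0 with rfl | hu
    · simp [sing]
    have hun : ‖u‖ ≠ 0 := norm_ne_zero_iff.2 hu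
    refine (lintegral_radial_le hd hs (c := fun r => sing (2 / 5) r * (sing (2 / 5) ‖u‖ * K))
      (measurable_sing_comp (by fun_prop) _) ((measurable_sing _).mul_const _)
      fun r hr => ?_).trans ?_
    · have e : ∀ ω : Metric.sphere (0 : Lat d) 1, sing (2 / 5) ⟪r • ω.1, u⟫ =
          (sing (2 / 5) r * sing (2 / 5) ‖u‖) * sing (2 / 5) (⟪ω.1, (‖u‖⁻¹ : ℝ) • u⟫ + 0) := by
        intro ω
        rw [← sing_mul (by norm_num), ← sing_mul (by norm_num), inner_smul_left, inner_smul_right]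
        congr 1
        simp only [conj_trivial]
        field_simp
        ring
      simp only [e]
      rw [lintegral_const_mul _ (measurable_sing_comp (by fun_prop) _)]
      refine (mul_le_mul_right (hsph ((‖u‖⁻¹ : ℝ) • u) 0 (by simp [norm_smul, hun])) _).trans
        (le_of_eq ?_)
      ring
    · have : ∀ k : Lat d, s ‖k‖ * (sing (2 / 5) ‖k‖ * (sing (2 / 5) ‖u‖ * K)) =
          (s ‖k‖ * sing (2 / 5) ‖k‖) * (sing (2 / 5) ‖u‖ * K) := fun k => by ring
      simp only [this]
      rw [lintegral_mul_const _ mS]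
      calc _ ≤ M * (sing (2 / 5) ‖u‖ * K) := by gcongr
        _ = K * M * sing (2 / 5) ‖u‖ := by ring
        _ ≤ _ := by gcongr; exact le_self_add

/-- A bounded integrable radial density `s` integrates `|k·(w + k)|^{-2/5}`, uniformly in `w`. As the
form is quadratic in `k`, its singularity at `k = 0` is that of `|k|^{-4/5}`. -/
theorem exists_sing_inner_add_bound (hd : 1 ≤ d) (hs : Measurable s) (hC : C ≠ ⊤)
    (hsC : ∀ r, s r ≤ C) (hI : ∫⁻ k : Lat d, s ‖k‖ ≠ ⊤) :
    ∃ M : ENNReal, M ≠ ⊤ ∧ ∀ w : Lat d,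
      ∫⁻ k : Lat d, s ‖k‖ * sing (2 / 5) ⟪k, w + k⟫ ≤ M := by
  obtain ⟨M, hM, h⟩ := exists_sing_norm_bound hd hs hC hsC hI
  have mS : Measurable fun k : Lat d => s ‖k‖ * sing (4 / 5) ‖k‖ :=
    (hs.comp measurable_norm).mul (measurable_sing_comp measurable_norm _)
  have h0 : ∫⁻ k : Lat d, s ‖k‖ * sing (4 / 5) ‖k‖ ≤ M := by simpa using h 0
  have e45 : (2 : ℝ) * (2 / 5) = 4 / 5 := by norm_num
  rcases eq_or_lt_of_le hd with hd1 | hd2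
  · refine ⟨M + M, by finiteness, fun w => ?_⟩
    calc _ ≤ ∫⁻ k : Lat d, (s ‖k‖ * sing (4 / 5) ‖k‖ + s ‖k‖ * sing (4 / 5) ‖k + w‖) := by
          refine lintegral_mono fun k => ?_
          rw [← mul_add, ← e45]
          gcongr
          refine le_trans ?_ (sing_mul_le (by norm_num) _ _)
          rw [← sing_mul (by norm_num), add_comm w]
          exact sing_anti (by norm_num) (abs_inner_of_dim_one hd1.symm k _).ge
      _ ≤ _ := by
          rw [lintegral_add_left mS]
          exact add_le_add h0 (h w)
  · obtain ⟨K, hK, hsph⟩ := exists_sphere_bound hd2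
    have hhalf : sing (2 / 5) (1 / 2) ≠ ⊤ := sing_ne_top (by norm_num) (by norm_num)
    refine ⟨M * (sing (2 / 5) (1 / 2) * (K + 1)), by finiteness, fun w => ?_⟩
    refine (lintegral_radial_le hd hs
      (c := fun r => sing (4 / 5) r * (sing (2 / 5) (1 / 2) * (K + 1)))
      (measurable_sing_comp (by fun_prop) _) ((measurable_sing _).mul_const _)
      fun r hr => ?_).trans ?_
    · have hr2 : sing (4 / 5) r = sing (2 / 5) (r * r) := by
        rw [sing_mul (by norm_num), sing_sq _ _ (by norm_num), e45]
      have hin : ∀ ω : Metric.sphere (0 : Lat d) 1,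
          ⟪r • ω.1, w + r • ω.1⟫ = r * (⟪ω.1, w⟫ + r) := by
        intro ω
        have h1 : ‖ω.1‖ = 1 := by simp
        rw [inner_add_right, inner_smul_left, inner_smul_left, inner_smul_right,
          real_inner_self_eq_norm_sq, h1]
        simp only [conj_trivial]
        ring
      rcases lt_or_ge ‖w‖ (r / 2) with hw | hw
      · -- the quadratic term dominates
        calc _ ≤ ∫⁻ _ : Metric.sphere (0 : Lat d) 1, sing (2 / 5) (1 / 2) * sing (2 / 5) (r * r)
              ∂(volume : Measure (Lat d)).toSphere := by
              refine lintegral_mono fun ω => ?_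
              rw [hin, ← sing_mul (by norm_num)]
              refine sing_anti (by norm_num) ?_
              have h1 : ‖ω.1‖ = 1 := by simp
              have h2 := abs_real_inner_le_norm ω.1 w
              rw [h1, one_mul] at h2
              have h3 := (abs_le.1 h2).1
              rw [abs_of_pos (by positivity), abs_of_pos (mul_pos hr (by linarith))]
              nlinarith
          _ = sing (4 / 5) r * (sing (2 / 5) (1 / 2) * 1)
              * (volume : Measure (Lat d)).toSphere univ := by
              rw [lintegral_const, hr2]; ring
          _ ≤ _ := by gcongr; exact le_add_self
      · -- the linear term dominates, up to the bound over the sphere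
        have hwn : ‖w‖ ≠ 0 := by linarith
        have e : ∀ ω : Metric.sphere (0 : Lat d) 1, sing (2 / 5) ⟪r • ω.1, w + r • ω.1⟫ =
            (sing (2 / 5) r * sing (2 / 5) ‖w‖) *
              sing (2 / 5) (⟪ω.1, (‖w‖⁻¹ : ℝ) • w⟫ + r / ‖w‖) := by
          intro ω
          rw [hin, ← sing_mul (by norm_num), ← sing_mul (by norm_num), inner_smul_right]
          congr 1
          field_simp
        simp only [e]
        rw [lintegral_const_mul _ (measurable_sing_comp (by fun_prop) _)]
        calc _ ≤ (sing (2 / 5) r * sing (2 / 5) (1 / 2 * r)) *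
              (K * (volume : Measure (Lat d)).toSphere univ) := by
              gcongr
              · refine sing_anti (by norm_num) ?_
                rw [abs_norm, abs_of_pos (by positivity)]
                linarith
              · exact hsph ((‖w‖⁻¹ : ℝ) • w) _ (by simp [norm_smul, hwn])
          _ = sing (4 / 5) r * (sing (2 / 5) (1 / 2) * K)
              * (volume : Measure (Lat d)).toSphere univ := by
              rw [hr2, sing_mul (by norm_num), sing_mul (by norm_num)]; ring
          _ ≤ _ := by gcongr; exact le_self_add
    · have : ∀ k : Lat d, s ‖k‖ * (sing (4 / 5) ‖k‖ * (sing (2 / 5) (1 / 2) * (K + 1))) =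
          (s ‖k‖ * sing (4 / 5) ‖k‖) * (sing (2 / 5) (1 / 2) * (K + 1)) := fun k => by ring
      simp only [this]
      rw [lintegral_mul_const _ mS]
      gcongr

end Estimates


/-! ### The power spectrum as a measure -/

section Spectrum

open scoped FourierTransform

variable {d : ℕ} {reg : Regime} {R : Lat d → ℝ}

theorem spectrum_eq_fourier (k : Lat d) :
    spectrum R k = (𝓕 (fun x => (R x : ℂ)) ((2 * Real.pi)⁻¹ • k)).re := by
  rw [spectrum, Real.fourier_eq']
  congr 1
  refine integral_congr_ae (Eventually.of_forall fun x => ?_)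
  simp only [smul_eq_mul]
  rw [mul_comm, inner_smul_right, real_inner_comm]
  congr 2
  have := Real.pi_ne_zero
  push_cast
  field_simp

theorem IsCovariance.fourier_im (h : IsCovariance reg R) (w : Lat d) :
    (𝓕 (fun x => (R x : ℂ)) w).im = 0 := by
  have e : conj (𝓕 (fun x => (R x : ℂ)) w) = 𝓕 (fun x => (R x : ℂ)) w := by
    rw [Real.fourier_eq', ← integral_conj, ← integral_neg_eq_self]
    refine integral_congr_ae (Eventually.of_forall fun x => ?_)
    simp only [smul_eq_mul, map_mul, h.even, Complex.conj_ofReal, ← Complex.exp_conj,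
      Complex.conj_I, inner_neg_left]
    congr 2
    push_cast
    ring
  exact Complex.conj_eq_iff_im.1 e

theorem IsCovariance.ofReal_spectrum (h : IsCovariance reg R) (k : Lat d) :
    (spectrum R k : ℂ) = 𝓕 (fun x => (R x : ℂ)) ((2 * Real.pi)⁻¹ • k) := by
  rw [spectrum_eq_fourier]
  refine Complex.ext ?_ ?_
  · simp
  · simp [h.fourier_im]

theorem IsCovariance.continuous_spectrum (h : IsCovariance reg R) : Continuous (spectrum R) := by
  have : Continuous (𝓕 (fun x => (R x : ℂ)) : Lat d → ℂ) :=
    VectorFourier.fourierIntegral_continuous Real.continuous_fourierChar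
      (by exact continuous_inner) h.integrable.ofReal
  rw [show spectrum R = fun k => (𝓕 (fun x => (R x : ℂ)) ((2 * Real.pi)⁻¹ • k)).re from
    funext spectrum_eq_fourier]
  fun_prop

theorem spectrum_le (k : Lat d) : spectrum R k ≤ ∫ x, ‖R x‖ := by
  refine (Complex.re_le_norm _).trans ((norm_integral_le_integral_norm _).trans (le_of_eq ?_))
  refine integral_congr_ae (Eventually.of_forall fun x => ?_)
  simp only [norm_mul, Complex.norm_real]
  rw [show -(Complex.I * ((⟪k, x⟫ : ℝ) : ℂ)) = Complex.I * ((-⟪k, x⟫ : ℝ) : ℂ) by push_cast; ring,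
    norm_exp_I_mul, mul_one]

/-- A radial majorant of the spectrum which is lower semicontinuous, hence measurable: the supremum
over spheres. -/
def radialSup (R : Lat d → ℝ) (r : ℝ) : ENNReal :=
  ⨆ ω : Metric.sphere (0 : Lat d) 1, ENNReal.ofReal (spectrum R (r • ω.1))

theorem IsCovariance.measurable_radialSup (h : IsCovariance reg R) : Measurable (radialSup R) := by
  refine (lowerSemicontinuous_iSup fun ω => ?_).measurable
  refine Continuous.lowerSemicontinuous ?_
  exact ENNReal.continuous_ofReal.comp (h.continuous_spectrum.comp (by fun_prop))

theorem le_radialSup (hd : 1 ≤ d) (k : Lat d) :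
    ENNReal.ofReal (spectrum R k) ≤ radialSup R ‖k‖ := by
  have : Nonempty (Fin d) := ⟨⟨0, by omega⟩⟩
  obtain ⟨ω, hω⟩ : ∃ ω : Metric.sphere (0 : Lat d) 1, ‖k‖ • ω.1 = k := by
    rcases eq_or_ne k 0 with rfl | hk
    · obtain ⟨e, he⟩ := exists_norm_eq (Lat d) (zero_le_one (α := ℝ))
      exact ⟨⟨e, by simpa using he⟩, by simp⟩
    · have hk' : ‖k‖ ≠ 0 := norm_ne_zero_iff.2 hk
      exact ⟨⟨(‖k‖⁻¹ : ℝ) • k, by simp [norm_smul, hk']⟩, by simp [smul_smul, hk']⟩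
  refine le_trans (le_of_eq ?_)
    (le_iSup (fun ω : Metric.sphere (0 : Lat d) 1 => ENNReal.ofReal (spectrum R (‖k‖ • ω.1))) ω)
  rw [hω]

theorem radialSup_le (r : ℝ) : radialSup R r ≤ ENNReal.ofReal (∫ x, ‖R x‖) :=
  iSup_le fun _ => ENNReal.ofReal_le_ofReal (spectrum_le _)

theorem IsCovariance.lintegral_radialSup_ne_top (h : IsCovariance reg R) :
    ∫⁻ k : Lat d, radialSup R ‖k‖ ≠ ⊤ := by
  obtain ⟨S, hS, hle⟩ := h.radial_bound
  refine ne_of_lt (lt_of_le_of_lt (lintegral_mono fun k => ?_) hS.2)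
  refine iSup_le fun ω => ?_
  have h1 : ‖ω.1‖ = 1 := by simp
  have h2 := hle (‖k‖ • ω.1)
  rw [norm_smul, h1, mul_one, norm_norm] at h2
  rw [← ofReal_norm]
  exact ENNReal.ofReal_le_ofReal (h2.trans (le_abs_self _))

theorem IsCovariance.integrable_spectrum (hd : 1 ≤ d) (h : IsCovariance reg R) :
    Integrable (spectrum R) := by
  refine ⟨h.continuous_spectrum.aestronglyMeasurable, ?_⟩
  refine lt_of_le_of_lt (lintegral_mono fun k => ?_) h.lintegral_radialSup_ne_top.lt_top
  rw [← ofReal_norm, Real.norm_of_nonneg (h.spectrum_nonneg k)]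
  exact le_radialSup hd k

/-- Fourier inversion for the covariance function. -/
theorem IsCovariance.inversion (hd : 1 ≤ d) (h : IsCovariance reg R) (x : Lat d) :
    ∫ k : Lat d, ((((2 * Real.pi) ^ d)⁻¹ * spectrum R k : ℝ) : ℂ) *
      Complex.exp (Complex.I * (⟪k, x⟫ : ℝ)) = R x := by
  have h2π : (0 : ℝ) < 2 * Real.pi := by positivity
  set F : Lat d → ℂ := 𝓕 (fun x => (R x : ℂ)) with hF
  have hFs : ∀ w, F w = (spectrum R ((2 * Real.pi) • w) : ℂ) := fun w => by
    rw [h.ofReal_spectrum, smul_smul, inv_mul_cancel₀ h2π.ne', one_smul]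
  have hFi : Integrable F := by
    rw [show F = fun w => (spectrum R ((2 * Real.pi) • w) : ℂ) from funext hFs]
    exact ((h.integrable_spectrum hd).comp_smul h2π.ne').ofReal
  have hinv := congrFun (Continuous.fourierInv_fourier_eq (f := fun x => (R x : ℂ))
    (Complex.continuous_ofReal.comp h.continuous) h.integrable.ofReal hFi) x
  rw [Real.fourierInv_eq'] at hinv
  rw [← hinv]
  have key := Measure.integral_comp_smul (volume : Measure (Lat d))
    (fun k : Lat d => Complex.exp (Complex.I * (⟪k, x⟫ : ℝ)) * (spectrum R k : ℂ)) (2 * Real.pi)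
  rw [finrank_euclideanSpace_fin, abs_of_pos (by positivity)] at key
  calc _ = (((2 * Real.pi) ^ d)⁻¹ : ℝ) • ∫ k : Lat d, Complex.exp (Complex.I * (⟪k, x⟫ : ℝ)) *
        (spectrum R k : ℂ) := by
        rw [← integral_smul]
        refine integral_congr_ae (Eventually.of_forall fun k => ?_)
        simp only [Complex.real_smul]
        push_cast
        ring
    _ = _ := by
        rw [← key]
        refine integral_congr_ae (Eventually.of_forall fun k => ?_)
        simp only [smul_eq_mul, ← hF, hFs, inner_smul_left]
        congr 2
        push_cast
        simp
        ring

/-- The measure `c (2π)^{-d} R̂(k) dk` of momentum transfers. -/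
def medium (c : ℝ) (R : Lat d → ℝ) : Measure (Lat d) :=
  volume.withDensity fun k => ENNReal.ofReal (c * (((2 * Real.pi) ^ d)⁻¹ * spectrum R k))

theorem IsCovariance.isFiniteMeasure_medium (hd : 1 ≤ d) (h : IsCovariance reg R) (c : ℝ) :
    IsFiniteMeasure (medium c R) :=
  isFiniteMeasure_withDensity_ofReal (((h.integrable_spectrum hd).const_mul _).const_mul _).2

theorem IsCovariance.integral_medium (h : IsCovariance reg R) {c : ℝ} (hc : 0 ≤ c)
    (f : Lat d → ℂ) :
    ∫ k, f k ∂medium c R = ∫ k, ((c * (((2 * Real.pi) ^ d)⁻¹ * spectrum R k) : ℝ) : ℂ) * f k := by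
  have hm := h.continuous_spectrum.measurable
  rw [medium, integral_withDensity_eq_integral_toReal_smul (by fun_prop)
    (Eventually.of_forall fun k => ENNReal.ofReal_lt_top)]
  refine integral_congr_ae (Eventually.of_forall fun k => ?_)
  have h0 := h.spectrum_nonneg k
  simp only
  rw [ENNReal.toReal_ofReal (by positivity), Complex.real_smul]

/-- The characteristic function of the medium is the covariance function. -/
theorem IsCovariance.integral_exp_medium (hd : 1 ≤ d) (h : IsCovariance reg R) {c : ℝ} (hc : 0 ≤ c)
    (x : Lat d) : ∫ k, Complex.exp (Complex.I * (⟪k, x⟫ : ℝ)) ∂medium c R = (c * R x : ℝ) := by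
  rw [h.integral_medium hc]
  push_cast
  rw [← h.inversion hd x, ← integral_const_mul]
  refine integral_congr_ae (Eventually.of_forall fun k => ?_)
  push_cast
  ring

theorem IsCovariance.medium_real_univ (hd : 1 ≤ d) (h : IsCovariance reg R) {c : ℝ} (hc : 0 ≤ c) :
    (medium c R).real univ = c * R 0 := by
  have := h.integral_exp_medium hd hc 0
  simp only [inner_zero_right, Complex.ofReal_zero, mul_zero, Complex.exp_zero, integral_const,
    Complex.real_smul, mul_one] at this
  exact_mod_cast this

theorem IsCovariance.apply_zero_nonneg (hd : 1 ≤ d) (h : IsCovariance reg R) : 0 ≤ R 0 := by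
  have := h.medium_real_univ hd zero_le_one
  rw [one_mul] at this
  rw [← this]
  exact measureReal_nonneg

theorem IsCovariance.lintegral_medium_le (hd : 1 ≤ d) (h : IsCovariance reg R) {c : ℝ} (hc : 0 ≤ c)
    {f : Lat d → ENNReal} (hf : Measurable f) :
    ∫⁻ k, f k ∂medium c R ≤ ENNReal.ofReal c * ∫⁻ k : Lat d, radialSup R ‖k‖ * f k := by
  have hm := h.continuous_spectrum.measurable
  have hr : Measurable fun k : Lat d => radialSup R ‖k‖ * f k :=
    (h.measurable_radialSup.comp measurable_norm).mul hf
  rw [medium, lintegral_withDensity_eq_lintegral_mul _ (by fun_prop) hf, ← lintegral_const_mul _ hr]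
  refine lintegral_mono fun k => ?_
  simp only [Pi.mul_apply]
  rw [ENNReal.ofReal_mul hc, mul_assoc]
  gcongr
  refine le_trans (ENNReal.ofReal_le_ofReal ?_) (le_radialSup hd k)
  refine mul_le_of_le_one_left (h.spectrum_nonneg k) (inv_le_one_of_one_le₀ (one_le_pow₀ ?_))
  linarith [Real.pi_gt_three]

/-- Interpolation between the bounds `|z|` and `2 / |θ|` of the oscillatory integral. -/
theorem enorm_oscInt_le {Z z θ : ℝ} (hz : z ∈ Icc 0 Z) :
    ‖oscInt z θ‖ₑ ≤ ENNReal.ofReal (Z + 2) * sing (2 / 5) θ := by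
  have hZ : 0 ≤ Z := hz.1.trans hz.2
  rcases eq_or_ne θ 0 with rfl | hθ
  · have h0 : sing (2 / 5) 0 = ⊤ := by simp [sing]
    rw [h0, ENNReal.mul_top]
    · exact le_top
    · simp; linarith
  have h1 := norm_oscInt_le z θ
  rw [abs_of_nonneg hz.1] at h1
  have h2 := norm_oscInt_mul_le z θ
  have hpos : 0 < |θ| := abs_pos.2 hθ
  have e : sing (2 / 5) θ = ENNReal.ofReal (|θ| ^ (-(2 / 5) : ℝ)) := by
    rw [sing, Real.rpow_neg hpos.le, ENNReal.ofReal_inv_of_pos (by positivity), ← ofReal_norm,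
      Real.norm_eq_abs, ENNReal.ofReal_rpow_of_pos hpos]
  rw [e, ← ENNReal.ofReal_mul (by positivity), ← ofReal_norm]
  refine ENNReal.ofReal_le_ofReal ?_
  rcases le_total |θ| 1 with h | h
  · have : 1 ≤ |θ| ^ (-(2 / 5) : ℝ) :=
      Real.one_le_rpow_of_pos_of_le_one_of_nonpos hpos h (by norm_num)
    nlinarith [hz.2]
  · have h3 : ‖oscInt z θ‖ ≤ 2 * |θ| ^ (-1 : ℝ) := by
      rw [Real.rpow_neg_one, ← div_eq_mul_inv, le_div_iff₀ hpos]; exact h2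
    have h4 : |θ| ^ (-1 : ℝ) ≤ |θ| ^ (-(2 / 5) : ℝ) :=
      Real.rpow_le_rpow_of_exponent_le h (by norm_num)
    have h5 : (0 : ℝ) ≤ |θ| ^ (-(2 / 5) : ℝ) := by positivity
    nlinarith

theorem sing_pos_eq {s x : ℝ} (hx : 0 < x) : sing s x = ENNReal.ofReal (x ^ (-s)) := by
  rw [sing, Real.rpow_neg hx.le, ENNReal.ofReal_inv_of_pos (by positivity), ← ofReal_norm,
    Real.norm_of_nonneg hx.le, ENNReal.ofReal_rpow_of_pos hx]

/-- Decay in the oscillation rate `κ` of the time-integrated phases which are integrated over one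
momentum transfer, quadratically, or over two momentum transfers. -/
theorem IsCovariance.exists_oscillation_bound (hd : 1 ≤ d) (h : IsCovariance reg R) :
    ∃ B : ℝ, 0 ≤ B ∧ ∀ c : ℝ, 0 ≤ c → ∀ Z z : ℝ, z ∈ Icc 0 Z → ∀ κ : ℝ, 0 < κ → ∀ w : Lat d,
      (∀ θ : Lat d → ℝ, Measurable θ → (∀ k, |θ k| = κ * |⟪k, w + k⟫|) →
        ∫ k, ‖oscInt z (θ k)‖ ∂medium c R ≤ B * (Z + 2) * c * κ ^ (-(2 / 5) : ℝ)) ∧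
      (∀ u : Lat d → Lat d, Measurable u → (∀ k, ‖u k‖ = ‖k + w‖) →
        ∫ k, ∫ k', ‖oscInt z (κ * ⟪k', u k⟫)‖ ∂medium c R ∂medium c R
          ≤ B * (Z + 2) * c ^ 2 * κ ^ (-(2 / 5) : ℝ)) := by
  have hC : ENNReal.ofReal (∫ x, ‖R x‖) ≠ ⊤ := ENNReal.ofReal_ne_top
  obtain ⟨M₀, hM₀, h₀⟩ := exists_sing_norm_bound' hd h.measurable_radialSup hC radialSup_le
    h.lintegral_radialSup_ne_top
  obtain ⟨M₁, hM₁, h₁⟩ := exists_sing_inner_add_bound hd h.measurable_radialSup hC radialSup_le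
    h.lintegral_radialSup_ne_top
  obtain ⟨M₂, hM₂, h₂⟩ := exists_sing_inner_bound hd h.measurable_radialSup hC radialSup_le
    h.lintegral_radialSup_ne_top
  refine ⟨M₁.toReal + M₂.toReal * M₀.toReal, by positivity,
    fun c hc Z z hz κ hκ w => ⟨fun θ hθ hθw => ?_, fun u hu huw => ?_⟩⟩
  · have hZ : 0 ≤ Z := hz.1.trans hz.2
    have := h.isFiniteMeasure_medium hd c
    have mi : Measurable fun k : Lat d => sing (2 / 5) ⟪k, w + k⟫ :=
      measurable_sing_comp (by fun_prop) _
    have mo : Measurable fun k => oscInt z (θ k) := (measurable_oscInt z).comp hθ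
    have key : ∫⁻ k, ‖oscInt z (θ k)‖ₑ ∂medium c R ≤
        ENNReal.ofReal ((Z + 2) * κ ^ (-(2 / 5) : ℝ) * c * M₁.toReal) := by
      calc _ ≤ ∫⁻ k, ENNReal.ofReal (Z + 2) * (sing (2 / 5) κ * sing (2 / 5) ⟪k, w + k⟫)
            ∂medium c R := by
            refine lintegral_mono fun k => (enorm_oscInt_le hz).trans ?_
            rw [← sing_mul (by norm_num)]
            gcongr
            refine sing_anti (by norm_num) ?_
            rw [hθw, abs_mul, abs_of_pos hκ]
        _ = ENNReal.ofReal (Z + 2) * (sing (2 / 5) κ *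
            ∫⁻ k, sing (2 / 5) ⟪k, w + k⟫ ∂medium c R) := by
            rw [lintegral_const_mul _ (mi.const_mul _), lintegral_const_mul _ mi]
        _ ≤ ENNReal.ofReal (Z + 2) * (sing (2 / 5) κ * (ENNReal.ofReal c * M₁)) := by
            gcongr
            exact (h.lintegral_medium_le hd hc mi).trans (by gcongr; exact h₁ w)
        _ = _ := by
            rw [sing_pos_eq hκ, ← ENNReal.ofReal_toReal hM₁, ENNReal.toReal_ofReal (by positivity),
              ← ENNReal.ofReal_mul hc, ← ENNReal.ofReal_mul (by positivity),
              ← ENNReal.ofReal_mul (by positivity)]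
            congr 1; ring
    rw [integral_norm_eq_lintegral_enorm mo.aestronglyMeasurable]
    refine (ENNReal.toReal_mono ENNReal.ofReal_ne_top key).trans ?_
    rw [ENNReal.toReal_ofReal (by positivity)]
    have : 0 ≤ (Z + 2) * κ ^ (-(2 / 5) : ℝ) * c * (M₂.toReal * M₀.toReal) := by positivity
    linarith
  · have hZ : 0 ≤ Z := hz.1.trans hz.2
    have := h.isFiniteMeasure_medium hd c
    have mo : Measurable fun x : Lat d × Lat d => ‖oscInt z (κ * ⟪x.2, u x.1⟫)‖ :=
      ((measurable_oscInt z).comp (by fun_prop)).norm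
    have inner_le : ∀ k : Lat d, ∫ k', ‖oscInt z (κ * ⟪k', u k⟫)‖ ∂medium c R =
        (∫⁻ k', ‖oscInt z (κ * ⟪k', u k⟫)‖ₑ ∂medium c R).toReal := fun k => by
      rw [integral_norm_eq_lintegral_enorm]
      exact ((measurable_oscInt z).comp (by fun_prop)).aestronglyMeasurable
    have e1 : ∀ k : Lat d, ∫⁻ k', ‖oscInt z (κ * ⟪k', u k⟫)‖ₑ ∂medium c R ≤
        ENNReal.ofReal ((Z + 2) * κ ^ (-(2 / 5) : ℝ) * c * M₂.toReal) * sing (2 / 5) ‖k + w‖ := by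
      intro k
      have mi : Measurable fun k' : Lat d => sing (2 / 5) ⟪k', u k⟫ :=
        measurable_sing_comp (by fun_prop) _
      calc _ ≤ ∫⁻ k', ENNReal.ofReal (Z + 2) * (sing (2 / 5) κ * sing (2 / 5) ⟪k', u k⟫)
            ∂medium c R := by
            refine lintegral_mono fun k' => (enorm_oscInt_le hz).trans ?_
            rw [← sing_mul (by norm_num)]
        _ = ENNReal.ofReal (Z + 2) * (sing (2 / 5) κ *
            ∫⁻ k', sing (2 / 5) ⟪k', u k⟫ ∂medium c R) := by
            rw [lintegral_const_mul _ (mi.const_mul _), lintegral_const_mul _ mi]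
        _ ≤ ENNReal.ofReal (Z + 2) * (sing (2 / 5) κ * (ENNReal.ofReal c *
            (M₂ * sing (2 / 5) ‖k + w‖))) := by
            gcongr
            refine (h.lintegral_medium_le hd hc mi).trans ?_
            gcongr
            rw [← huw k]
            exact h₂ _
        _ = _ := by
            rw [sing_pos_eq hκ, ← ENNReal.ofReal_toReal hM₂, ENNReal.toReal_ofReal (by positivity)]
            rw [ENNReal.ofReal_mul (by positivity), ENNReal.ofReal_mul (by positivity),
              ENNReal.ofReal_mul (by positivity)]
            ring
    have mk : Measurable fun k : Lat d => sing (2 / 5) ‖k + w‖ :=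
      measurable_sing_comp (by fun_prop) _
    have mI : Measurable fun k => ∫ k', ‖oscInt z (κ * ⟪k', u k⟫)‖ ∂medium c R :=
      (StronglyMeasurable.integral_prod_right (f := fun k k' => ‖oscInt z (κ * ⟪k', u k⟫)‖)
        mo.stronglyMeasurable).measurable
    rw [integral_eq_lintegral_of_nonneg_ae
      (Eventually.of_forall fun k => integral_nonneg fun _ => norm_nonneg _)
      mI.aestronglyMeasurable]
    have key : ∫⁻ k, ENNReal.ofReal (∫ k', ‖oscInt z (κ * ⟪k', u k⟫)‖ ∂medium c R) ∂medium c R ≤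
        ENNReal.ofReal ((Z + 2) * κ ^ (-(2 / 5) : ℝ) * c * M₂.toReal * (c * M₀.toReal)) := by
      calc _ ≤ ∫⁻ k, ENNReal.ofReal ((Z + 2) * κ ^ (-(2 / 5) : ℝ) * c * M₂.toReal) *
            sing (2 / 5) ‖k + w‖ ∂medium c R := by
            refine lintegral_mono fun k => le_trans ?_ (e1 k)
            rw [inner_le]
            exact ENNReal.ofReal_toReal_le
        _ = ENNReal.ofReal ((Z + 2) * κ ^ (-(2 / 5) : ℝ) * c * M₂.toReal) *
            ∫⁻ k, sing (2 / 5) ‖k + w‖ ∂medium c R := lintegral_const_mul _ mk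
        _ ≤ ENNReal.ofReal ((Z + 2) * κ ^ (-(2 / 5) : ℝ) * c * M₂.toReal) *
            (ENNReal.ofReal c * M₀) := by
            gcongr
            exact (h.lintegral_medium_le hd hc mk).trans (by gcongr; exact h₀ w)
        _ = _ := by
            rw [← ENNReal.ofReal_toReal hM₀, ENNReal.toReal_ofReal (by positivity),
              ← ENNReal.ofReal_mul hc, ← ENNReal.ofReal_mul (by positivity)]
    refine (ENNReal.toReal_mono ENNReal.ofReal_ne_top key).trans ?_
    rw [ENNReal.toReal_ofReal (by positivity)]
    have : 0 ≤ (Z + 2) * κ ^ (-(2 / 5) : ℝ) * c ^ 2 * M₁.toReal := by positivity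
    linarith

end Spectrum


/-! ### Elementary interactions of the blocks -/

namespace Interaction

variable {Ω Θ : Type*} [MeasurableSpace Ω] [MeasurableSpace Θ] (I J : Interaction Ω Θ)
  (ν : Measure Θ) [IsFiniteMeasure ν]

theorem measurable_phase_right (x : Ω) : Measurable (I.phase x) :=
  I.measurable_phase.comp measurable_prodMk_left

theorem norm_int_le_of {z M : ℝ} (hM : 0 ≤ M)
    (h : ∀ x, ∫ k, ‖oscInt z (I.phase x k)‖ ∂ν ≤ M) : ‖I.int ν z‖ ≤ M :=
  norm_kerOp_le hM h

theorem norm_gen_mul_int_le_of {z M : ℝ} (hM : 0 ≤ M)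
    (h : ∀ x, ∫ k, ∫ k', ‖oscInt z (J.phase (I.shift x k) k')‖ ∂ν ∂ν ≤ M) :
    ‖I.gen ν z * J.int ν z‖ ≤ M := by
  refine norm_kerOp_mul_le hM fun x => ?_
  simp only [norm_exp_I_mul, one_mul]
  exact h x

theorem norm_int_mul_int_le_of {Z z M : ℝ} (hz : z ∈ Icc 0 Z) (hM : 0 ≤ M)
    (h : ∀ x, ∫ k, ∫ k', ‖oscInt z (J.phase (I.shift x k) k')‖ ∂ν ∂ν ≤ M) :
    ‖I.int ν z * J.int ν z‖ ≤ Z * M := by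
  have hZ : 0 ≤ Z := hz.1.trans hz.2
  refine norm_kerOp_mul_le (mul_nonneg hZ hM) fun x => ?_
  have mo : Measurable fun y : Θ × Θ => ‖oscInt z (J.phase (I.shift x y.1) y.2)‖ := by
    refine ((measurable_oscInt z).comp (J.measurable_phase.comp
      (Measurable.prodMk ?_ measurable_snd))).norm
    exact I.measurable_shift.comp (measurable_const.prodMk measurable_fst)
  have mI : Measurable fun k => ∫ k', ‖oscInt z (J.phase (I.shift x k) k')‖ ∂ν :=
    (StronglyMeasurable.integral_prod_right
      (f := fun k k' => ‖oscInt z (J.phase (I.shift x k) k')‖) mo.stronglyMeasurable).measurable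
  have hI0 : ∀ k, 0 ≤ ∫ k', ‖oscInt z (J.phase (I.shift x k) k')‖ ∂ν :=
    fun k => integral_nonneg fun _ => norm_nonneg _
  have hIb : ∀ k, ∫ k', ‖oscInt z (J.phase (I.shift x k) k')‖ ∂ν ≤ |z| * ν.real univ := fun k => by
    have := norm_integral_le_of_norm_le_const (μ := ν) (f := fun k' =>
      ‖oscInt z (J.phase (I.shift x k) k')‖) (C := |z|)
      (Eventually.of_forall fun k => by simpa using norm_oscInt_le _ _)
    exact (le_abs_self _).trans this
  calc _ ≤ ∫ k, Z * ∫ k', ‖oscInt z (J.phase (I.shift x k) k')‖ ∂ν ∂ν := by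
        refine integral_mono_of_nonneg (Eventually.of_forall fun k =>
            mul_nonneg (norm_nonneg _) (hI0 k))
          (Integrable.const_mul (Integrable.of_bound mI.aestronglyMeasurable (|z| * ν.real univ)
            (Eventually.of_forall fun k => ?_)) _) (Eventually.of_forall fun k => ?_)
        · rw [Real.norm_of_nonneg (hI0 k)]; exact hIb k
        · refine mul_le_mul_of_nonneg_right ((norm_oscInt_le _ _).trans ?_) (hI0 k)
          rw [abs_of_nonneg hz.1]; exact hz.2
    _ ≤ _ := by
        rw [integral_const_mul]
        exact mul_le_mul_of_nonneg_left (h x) hZ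

end Interaction

section Edges

variable {d p q : ℕ}

/-- The sign of a block in the pairing: `1` for the blocks `ξ_j` and `-1` for the blocks `ζ_l`. -/
def sgn : Fin p ⊕ Fin q → ℝ := Sum.elim (fun _ => 1) fun _ => -1

@[simp] theorem sgn_inl (j : Fin p) : sgn (Sum.inl j : Fin p ⊕ Fin q) = 1 := rfl

@[simp] theorem sgn_inr (l : Fin q) : sgn (Sum.inr l : Fin p ⊕ Fin q) = -1 := rfl

theorem sgn_mul_self (a : Fin p ⊕ Fin q) : sgn a * sgn a = 1 := by
  cases a <;> simp

theorem abs_sgn (a : Fin p ⊕ Fin q) : |sgn a| = 1 := by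
  cases a <;> simp

theorem pairing_eq_sum (v X : Config p q d) : pairing v X = ∑ a, sgn a * ⟪v a, X a⟫ := by
  rw [pairing, Fintype.sum_sum_type]
  simp [sub_eq_add_neg]

theorem continuous_pairing {α : Type*} [TopologicalSpace α] {f g : α → Config p q d}
    (hf : Continuous f) (hg : Continuous g) : Continuous fun x => pairing (f x) (g x) := by
  simp only [pairing_eq_sum]
  fun_prop

theorem pairing_add_left (v w X : Config p q d) :
    pairing (v + w) X = pairing v X + pairing w X := by
  simp only [pairing_eq_sum, Pi.add_apply, inner_add_left, mul_add, Finset.sum_add_distrib]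

theorem pairing_comm (v X : Config p q d) : pairing v X = pairing X v := by
  simp only [pairing_eq_sum, real_inner_comm]

/-- The shift of the blocks `a` and `b` by opposite (for blocks of equal sign) or equal (for blocks
of opposite sign) momenta. -/
def edgeShift (a b : Fin p ⊕ Fin q) (k : Lat d) : Config p q d :=
  (Pi.single a k : Config p q d) - (sgn a * sgn b) • (Pi.single b k : Config p q d)

theorem continuous_edgeShift (a b : Fin p ⊕ Fin q) :
    Continuous (edgeShift a b : Lat d → Config p q d) := by
  refine continuous_pi fun c => ?_
  simp only [edgeShift, Pi.sub_apply, Pi.smul_apply, Pi.single_apply]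
  split_ifs <;> fun_prop

theorem edgeShift_inl_inr (γ : Fin p × Fin q) :
    (edgeShift (Sum.inl γ.1) (Sum.inr γ.2) : Lat d → Config p q d) = pairShift γ := by
  ext1 k
  simp [edgeShift, pairShift]

theorem pairing_single (a : Fin p ⊕ Fin q) (k : Lat d) (X : Config p q d) :
    pairing (Pi.single a k) X = sgn a * ⟪k, X a⟫ := by
  rw [pairing_eq_sum, Finset.sum_eq_single a]
  · simp
  · intro b _ hb; simp [hb]
  · simp

theorem pairing_edgeShift (a b : Fin p ⊕ Fin q) (k : Lat d) (X : Config p q d) :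
    pairing (edgeShift a b k) X = sgn a * ⟪k, X a - X b⟫ := by
  have h : pairing (edgeShift a b k) X =
      pairing (Pi.single a k) X - sgn a * sgn b * pairing (Pi.single b k) X := by
    simp only [edgeShift, pairing_eq_sum, Pi.sub_apply, Pi.smul_apply, inner_sub_left,
      inner_smul_left, Finset.mul_sum, ← Finset.sum_sub_distrib, conj_trivial]
    exact Finset.sum_congr rfl fun c _ => by ring
  rw [h, pairing_single, pairing_single, inner_sub_right]
  linear_combination -(sgn a * ⟪k, X b⟫) * sgn_mul_self b

theorem edgeShift_apply_sub (a b : Fin p ⊕ Fin q) (hab : a ≠ b) (k : Lat d) :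
    edgeShift a b k a - edgeShift a b k b = (1 + sgn a * sgn b) • k := by
  simp only [edgeShift, Pi.sub_apply, Pi.smul_apply, Pi.single_eq_same,
    Pi.single_eq_of_ne hab, Pi.single_eq_of_ne hab.symm]
  module

theorem pairing_self_add (v w : Config p q d) :
    pairing (v + w) (v + w) = pairing v v + 2 * pairing w v + pairing w w := by
  rw [pairing_add_left, pairing_comm v, pairing_comm w, pairing_add_left, pairing_add_left,
    pairing_comm v w]
  ring

theorem continuous_shift (a b : Fin p ⊕ Fin q) :
    Continuous fun x : Config p q d × Lat d => x.1 + edgeShift a b x.2 :=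
  continuous_fst.add ((continuous_edgeShift a b).comp continuous_snd)

theorem continuous_phase (κ : ℝ) (a b : Fin p ⊕ Fin q) :
    Continuous fun x : Config p q d × Lat d =>
      κ * (pairing (edgeShift a b x.2) x.1 +
        pairing (edgeShift a b x.2 : Config p q d) (edgeShift a b x.2) / 2) := by
  have h : Continuous fun x : Config p q d × Lat d => (edgeShift a b x.2 : Config p q d) :=
    (continuous_edgeShift a b).comp continuous_snd
  exact continuous_const.mul
    ((continuous_pairing h continuous_fst).add ((continuous_pairing h h).div_const 2))

/-- The interaction of the blocks `a` and `b`. The phase rate is the increment of the kinetic phase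
`κ (∑ |ξ_j|² - ∑ |ζ_l|²) / 2`. -/
def edge (κ : ℝ) (a b : Fin p ⊕ Fin q) : Interaction (Config p q d) (Lat d) where
  shift v k := v + edgeShift a b k
  phase v k := κ * (pairing (edgeShift a b k) v + pairing (edgeShift a b k) (edgeShift a b k) / 2)
  measurable_shift := (continuous_shift a b).measurable
  measurable_phase := (continuous_phase κ a b).measurable

variable {κ : ℝ} {a b a' b' : Fin p ⊕ Fin q}

theorem edge_phase_eq_sub (v : Config p q d) (k : Lat d) :
    (edge κ a b).phase v k =
      κ * (pairing (v + edgeShift a b k) (v + edgeShift a b k) / 2 - pairing v v / 2) := by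
  rw [pairing_self_add, edge]
  ring

theorem edge_phase (hab : a ≠ b) (v : Config p q d) (k : Lat d) :
    (edge κ a b).phase v k =
      κ * (sgn a * (⟪k, v a - v b⟫ + (1 + sgn a * sgn b) / 2 * ⟪k, k⟫)) := by
  simp only [edge, pairing_edgeShift, edgeShift_apply_sub a b hab, inner_smul_right]
  ring

theorem edge_phase_pair (γ : Fin p × Fin q) (v : Config p q d) (k : Lat d) :
    (edge κ (Sum.inl γ.1) (Sum.inr γ.2)).phase v k =
      κ * ⟪k, v (Sum.inl γ.1) - v (Sum.inr γ.2)⟫ := by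
  rw [edge_phase (by simp)]
  simp

theorem edge_phase_twin (hab : a ≠ b) (hs : sgn a = sgn b) (v : Config p q d) (k : Lat d) :
    (edge κ a b).phase v k = κ * (sgn a * ⟪k, v a - v b + k⟫) := by
  rw [edge_phase hab, ← hs, sgn_mul_self, inner_add_right]
  ring

/-- Two interactions are independent if each of them leaves the relative momentum of the blocks of
the other one unchanged. -/
theorem edge_indep (hab : a ≠ b) (hab' : a' ≠ b')
    (h : ∀ k : Lat d, edgeShift a' b' k a = edgeShift a' b' k b)
    (h' : ∀ k : Lat d, edgeShift a b k a' = edgeShift a b k b') :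
    (edge κ a b : Interaction (Config p q d) (Lat d)).Indep (edge κ a' b') where
  shift v k k' := by simp only [edge]; abel
  left v k k' := by
    rw [edge_phase hab, edge_phase hab]
    simp only [edge, Pi.add_apply, h k', add_sub_add_right_eq_sub]
  right v k k' := by
    rw [edge_phase hab', edge_phase hab']
    simp only [edge, Pi.add_apply, h' k, add_sub_add_right_eq_sub]

/-- The interaction of the blocks `ξ_j` and `ζ_l`, for `γ = (j, l)`. -/
abbrev pair (d : ℕ) (κ : ℝ) (γ : Fin p × Fin q) : Interaction (Config p q d) (Lat d) :=
  edge κ (Sum.inl γ.1) (Sum.inr γ.2)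

theorem pair_indep_self (γ : Fin p × Fin q) : (pair d κ γ).Indep (pair d κ γ) :=
  edge_indep (by simp) (by simp) (fun k => by simp [edgeShift]) fun k => by simp [edgeShift]

theorem pair_indep {γ γ' : Fin p × Fin q} (h1 : γ.1 ≠ γ'.1) (h2 : γ.2 ≠ γ'.2) :
    (pair d κ γ).Indep (pair d κ γ') :=
  edge_indep (by simp) (by simp) (fun k => by simp [edgeShift, h1, h2])
    fun k => by simp [edgeShift, h1.symm, h2.symm]

variable {reg : Regime} {R : Lat d → ℝ}

/-- The interactions that are not resonant are small, and so is the product of two resonant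
interactions that share one block. -/
theorem IsCovariance.exists_smallness (hd : 1 ≤ d) (h : IsCovariance reg R) (p q : ℕ) :
    ∃ B : ℝ, 0 ≤ B ∧ ∀ c : ℝ, 0 ≤ c → ∀ _ : IsFiniteMeasure (medium c R),
      ∀ Z z : ℝ, z ∈ Icc 0 Z → ∀ κ : ℝ, 0 < κ →
      (∀ a b : Fin p ⊕ Fin q, a ≠ b → sgn a = sgn b →
        ‖(edge κ a b).int (medium c R) z‖ ≤ B * (Z + 2) * c * κ ^ (-(2 / 5) : ℝ)) ∧
      (∀ γ γ' : Fin p × Fin q, γ ≠ γ' → (γ.1 = γ'.1 ∨ γ.2 = γ'.2) →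
        ‖(pair d κ γ').gen (medium c R) z * (pair d κ γ).int (medium c R) z‖ ≤
            B * (Z + 2) * c ^ 2 * κ ^ (-(2 / 5) : ℝ) ∧
        ‖(pair d κ γ').int (medium c R) z * (pair d κ γ).int (medium c R) z‖ ≤
            Z * (B * (Z + 2) * c ^ 2 * κ ^ (-(2 / 5) : ℝ))) := by
  obtain ⟨B, hB, hosc⟩ := h.exists_oscillation_bound hd
  refine ⟨B, hB, fun c hc _ Z z hz κ hκ => ⟨fun a b hab hs => ?_, fun γ γ' hne hshare => ?_⟩⟩
  · have hZ : 0 ≤ Z := hz.1.trans hz.2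
    refine Interaction.norm_int_le_of _ _ (by positivity) fun v => ?_
    refine (hosc c hc Z z hz κ hκ (v a - v b)).1 _ ?_ fun k => ?_
    · exact (edge κ a b).measurable_phase_right v
    · rw [edge_phase_twin hab hs, abs_mul, abs_of_pos hκ, abs_mul, abs_sgn, one_mul]
  · have hZ : 0 ≤ Z := hz.1.trans hz.2
    have key : ∀ v : Config p q d, ∫ k, ∫ k', ‖oscInt z ((pair d κ γ).phase
        ((pair d κ γ').shift v k) k')‖ ∂medium c R ∂medium c R ≤
          B * (Z + 2) * c ^ 2 * κ ^ (-(2 / 5) : ℝ) := by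
      intro v
      -- `u k` is the relative momentum of the pair `γ` after a transfer `k` by the pair `γ'`; as
      -- the pairs share exactly one block, it depends on `k`, so that the phase oscillates
      set w : Lat d := v (Sum.inl γ.1) - v (Sum.inr γ.2)
      set u : Lat d → Lat d := fun k => w + (edgeShift (Sum.inl γ'.1) (Sum.inr γ'.2) k (Sum.inl γ.1)
          - edgeShift (Sum.inl γ'.1) (Sum.inr γ'.2) k (Sum.inr γ.2))
      have hu : Measurable u := by
        have := continuous_edgeShift (d := d) (Sum.inl γ'.1 : Fin p ⊕ Fin q) (Sum.inr γ'.2)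
        exact (continuous_const.add ((continuous_pi_iff.1 this _).sub
            (continuous_pi_iff.1 this _))).measurable
      have hph : ∀ k k', (pair d κ γ).phase ((pair d κ γ').shift v k) k' = κ * ⟪k', u k⟫ := by
        intro k k'
        rw [edge_phase_pair]
        simp only [edge, Pi.add_apply, w, u]
        congr 2
        abel
      simp only [hph]
      rcases hshare with h1 | h2
      · have h2 : γ.2 ≠ γ'.2 := fun h2 => hne (Prod.ext h1 h2)
        refine (hosc c hc Z z hz κ hκ w).2 u hu fun k => ?_
        simp [u, edgeShift, h1, h2, add_comm]
      · have h1 : γ.1 ≠ γ'.1 := fun h1 => hne (Prod.ext h1 h2)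
        refine (hosc c hc Z z hz κ hκ (-w)).2 u hu fun k => ?_
        rw [← norm_neg]
        congr 1
        simp [u, edgeShift, h1, h2]
    have hpos : 0 ≤ B * (Z + 2) * c ^ 2 * κ ^ (-(2 / 5) : ℝ) := by positivity
    exact ⟨Interaction.norm_gen_mul_int_le_of _ _ _ hpos key,
      Interaction.norm_int_mul_int_le_of _ _ _ hz hpos key⟩

end Edges

/-! ### A Gronwall estimate -/

section Gronwall

variable {Ω : Type*} [MeasurableSpace Ω]

/-- A Gronwall estimate for functionals which are differentiable only on a class `D` that is not
invariant under the generators, but dense, in a weak sense, in an invariant class `G`. -/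
theorem gronwall_functional {e : ℝ → Bdd Ω → ℂ} {L : ℝ → Bdd Ω → Bdd Ω} {s : ℝ → Bdd Ω → ℂ}
    {D G : Set (Bdd Ω)} {Z M Λ φ : ℝ} (hM0 : 0 ≤ M) (hΛ : 0 ≤ Λ) (hφ : 0 ≤ φ)
    (h0 : ∀ f ∈ D, e 0 f = 0) (hM : ∀ z ∈ Icc 0 Z, ∀ f ∈ G, ‖e z f‖ ≤ M * ‖f‖)
    (hL : ∀ z ∈ Icc 0 Z, ∀ f ∈ D, L z f ∈ G ∧ ‖L z f‖ ≤ Λ * ‖f‖)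
    (hs : ∀ z ∈ Icc 0 Z, ∀ f ∈ D, ‖s z f‖ ≤ φ * ‖f‖)
    (hderiv : ∀ f ∈ D, ∀ z : ℝ, 0 ≤ z →
      HasDerivWithinAt (fun z => e z f) (e z (L z f) + s z f) (Ici 0) z)
    (happrox : ∀ f ∈ G, ∀ z ∈ Icc 0 Z, ∃ F : ℕ → Bdd Ω, (∀ n, F n ∈ D ∧ ‖F n‖ ≤ ‖f‖) ∧
      Tendsto (fun n => e z (F n)) atTop (𝓝 (e z f))) :
    ∀ z ∈ Icc 0 Z, ∀ f ∈ G, ‖e z f‖ ≤ φ * z * Real.exp (Λ * z) * ‖f‖ := by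
  -- iteration of the integrated inequality on `D`, extended to `G` by approximation in each step;
  -- the crude bound `M` contributes `M (Λ z)^n / n!`, which tends to `0`
  have step : ∀ n : ℕ, ∀ z ∈ Icc 0 Z, ∀ f ∈ G,
      ‖e z f‖ ≤ (φ * z * Real.exp (Λ * z) + M * ((Λ * z) ^ n / n.factorial)) * ‖f‖ := by
    intro n
    induction n with
    | zero =>
      intro z hz f hf
      refine (hM z hz f hf).trans (mul_le_mul_of_nonneg_right ?_ (norm_nonneg _))
      have := hz.1
      simp only [pow_zero, Nat.factorial_zero, Nat.cast_one, div_one, mul_one]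
      have : 0 ≤ φ * z * Real.exp (Λ * z) := by positivity
      linarith
    | succ n ih =>
      have onD : ∀ z ∈ Icc 0 Z, ∀ f ∈ D, ‖e z f‖ ≤
          (φ * z * Real.exp (Λ * z) + M * ((Λ * z) ^ (n + 1) / (n + 1).factorial)) * ‖f‖ := by
        intro z hz f hf
        set B : ℝ → ℝ := fun z =>
          (φ * z * Real.exp (Λ * z) + M * ((Λ * z) ^ (n + 1) / (n + 1).factorial)) * ‖f‖
        set B' : ℝ → ℝ := fun z =>
          (φ * Real.exp (Λ * z) + φ * z * (Real.exp (Λ * z) * Λ)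
            + M * (Λ * ((Λ * z) ^ n / n.factorial))) * ‖f‖
        have hB : ∀ x, HasDerivAt B (B' x) x := by
          intro x
          have e0 : HasDerivAt (fun z : ℝ => Λ * z) Λ x := by
            simpa using (hasDerivAt_id x).const_mul Λ
          have e1 : HasDerivAt (fun z : ℝ => φ * z) φ x := by
            simpa using (hasDerivAt_id x).const_mul φ
          have e2 := (e1.mul e0.exp).add (((e0.pow (n + 1)).div_const
            ((n + 1).factorial : ℝ)).const_mul M)
          refine (e2.mul_const ‖f‖).congr_deriv ?_
          have hn : (n.factorial : ℝ) ≠ 0 := by positivity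
          simp only [B', Nat.factorial_succ, Nat.cast_mul, Nat.add_sub_cancel]
          field_simp
        refine image_norm_le_of_norm_deriv_right_le_deriv_boundary (a := 0) (b := Z)
          (f := fun z => e z f) (f' := fun z => e z (L z f) + s z f) (B := B) (B' := B')
          (fun x hx => ((hderiv f hf x hx.1).mono Icc_subset_Ici_self).continuousWithinAt)
          (fun x hx => (hderiv f hf x hx.1).mono (Ici_subset_Ici.2 hx.1))
          ?_ hB (fun x hx => ?_) hz
        · simp [h0 f hf, B]
        · have hx' : x ∈ Icc 0 Z := Ico_subset_Icc_self hx
          have h1 := ih x hx' _ (hL x hx' f hf).1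
          have h2 := (hL x hx' f hf).2
          have h3 := hs x hx' f hf
          have hx0 := hx.1
          have h4 : 0 ≤ φ * x * Real.exp (Λ * x) + M * ((Λ * x) ^ n / n.factorial) := by positivity
          have h5 : φ ≤ φ * Real.exp (Λ * x) :=
            le_mul_of_one_le_right hφ (Real.one_le_exp (by positivity))
          have h6 := norm_nonneg f
          calc ‖e x (L x f) + s x f‖ ≤ ‖e x (L x f)‖ + ‖s x f‖ := norm_add_le _ _
            _ ≤ (φ * x * Real.exp (Λ * x) + M * ((Λ * x) ^ n / n.factorial)) * (Λ * ‖f‖)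
                + φ * Real.exp (Λ * x) * ‖f‖ := by
                refine add_le_add (h1.trans (mul_le_mul_of_nonneg_left h2 h4)) (h3.trans ?_)
                exact mul_le_mul_of_nonneg_right h5 h6
            _ = B' x := by simp only [B']; ring
      intro z hz f hf
      obtain ⟨F, hF, hlim⟩ := happrox f hf z hz
      have hz0 := hz.1
      refine le_of_tendsto hlim.norm (Eventually.of_forall fun m => ?_)
      refine (onD z hz _ (hF m).1).trans (mul_le_mul_of_nonneg_left (hF m).2 (by positivity))
  intro z hz f hf
  have hlim : Tendsto (fun n : ℕ =>
      (φ * z * Real.exp (Λ * z) + M * ((Λ * z) ^ n / n.factorial)) * ‖f‖) atTop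
      (𝓝 ((φ * z * Real.exp (Λ * z) + M * 0) * ‖f‖)) :=
    ((tendsto_const_nhds.add ((FloorSemiring.tendsto_pow_div_factorial_atTop _).const_mul
      M)).mul_const _)
  rw [mul_zero, add_zero] at hlim
  exact ge_of_tendsto' hlim fun n => step n z hz f hf

end Gronwall


/-! ### Transposes of operators and the pair propagators -/

section Duality

variable {Ω : Type*} [MeasurableSpace Ω]

/-- The integral against a complex measure, as a linear functional on bounded measurable
functions. -/
def integ (ρ : ComplexMeasure Ω) : Bdd Ω →ₗ[ℂ] ℂ where
  toFun f := cint ρ f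
  map_add' f g := cint_add ρ f.measurable g.measurable f.bounded g.bounded
  map_smul' c f := cint_smul ρ c f.measurable f.bounded

theorem integ_apply (ρ : ComplexMeasure Ω) (f : Bdd Ω) : integ ρ f = cint ρ f := rfl

theorem norm_integ_le (ρ : ComplexMeasure Ω) (f : Bdd Ω) : ‖integ ρ f‖ ≤ tv ρ * ‖f‖ := by
  rw [mul_comm]
  exact norm_cint_le ρ f.norm_apply_le

theorem ext_of_integ {ρ ρ' : ComplexMeasure Ω} (h : ∀ f, integ ρ f = integ ρ' f) : ρ = ρ' :=
  ext_of_cint fun f hf hb => h (Bdd.mk f hf ⟨1, hb⟩)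

/-- The functional `integ ρ` depends linearly on `ρ`. -/
def integHom : ComplexMeasure Ω →ₗ[ℂ] (Bdd Ω →ₗ[ℂ] ℂ) where
  toFun := integ
  map_add' ρ ρ' := LinearMap.ext fun f => cint_add_measure ρ ρ' f.measurable f.bounded
  map_smul' c ρ := LinearMap.ext fun f => cint_smul_measure ρ c f.measurable f.bounded

theorem integHom_apply (ρ : ComplexMeasure Ω) : integHom ρ = integ ρ := rfl

/-- Operators that are continuous for bounded pointwise convergence are transposes of operators on
complex measures. -/
theorem exists_dual {T : Op Ω} (hT : T ∈ sigmaCont Ω) (ρ : ComplexMeasure Ω) :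
    ∃ m : ComplexMeasure Ω, ∀ f, integ m f = integ ρ (T f) := by
  classical
  let Λ : (Ω → ℂ) → ℂ := fun f =>
    if h : Measurable f ∧ ∃ C : ℝ, ∀ x, ‖f x‖ ≤ C then integ ρ (T (Bdd.mk f h.1 h.2)) else 0
  have hΛ : ∀ f (h1 : Measurable f) (h2 : ∃ C : ℝ, ∀ x, ‖f x‖ ≤ C),
      Λ f = integ ρ (T (Bdd.mk f h1 h2)) := fun f h1 h2 => dif_pos ⟨h1, h2⟩
  obtain ⟨m, hm⟩ := exists_measure_of_functional Λ
    (fun f g hf hg hf' hg' => by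
      have hfg := (Bdd.mk f hf hf' + Bdd.mk g hg hg').bounded
      have e : Bdd.mk (f + g) (hf.add hg) hfg = Bdd.mk f hf hf' + Bdd.mk g hg hg' :=
        Bdd.ext fun x => rfl
      rw [hΛ f hf hf', hΛ g hg hg', hΛ _ (hf.add hg) hfg, e, Op.map_add, map_add])
    (fun c f hf hf' => by
      have hcf := (c • Bdd.mk f hf hf').bounded
      have e : Bdd.mk (c • f) (hf.const_smul c) hcf = c • Bdd.mk f hf hf' := Bdd.ext fun x => rfl
      rw [hΛ f hf hf', hΛ _ (hf.const_smul c) hcf, e, Op.map_smul, map_smul, smul_eq_mul])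
    (fun F f C hF hf hC h => by
      have hfb : ∀ x, ‖f x‖ ≤ C := fun x => le_of_tendsto' (h x).norm fun n => hC n x
      rw [hΛ f hf ⟨C, hfb⟩]
      simp_rw [fun n => hΛ (F n) (hF n) ⟨C, hC n⟩]
      rcases isEmpty_or_nonempty Ω with he | ⟨⟨x₀⟩⟩
      · have : ∀ g : Bdd Ω, g = 0 := fun g => Bdd.ext fun x => he.elim x
        simp [this]
      have hC0 : 0 ≤ C := (norm_nonneg _).trans (hC 0 x₀)
      have hn : ∀ n, ‖Bdd.mk (F n) (hF n) ⟨C, hC n⟩‖ ≤ C := fun n => Bdd.norm_le hC0 (hC n)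
      refine cint_tendsto ρ (C := ‖T‖ * C) (Eventually.of_forall fun n => Bdd.measurable _)
        (Eventually.of_forall fun n x => ?_) fun x => ?_
      · exact (Op.norm_apply_apply_le _ _ x).trans
          (mul_le_mul_of_nonneg_left (hn n) (norm_nonneg _))
      · exact hT (fun n => Bdd.mk (F n) (hF n) ⟨C, hC n⟩) (Bdd.mk f hf ⟨C, hfb⟩) C hn h x)
  refine ⟨m, fun f => ?_⟩
  rw [integ_apply, hm f f.measurable f.bounded, hΛ f f.measurable f.bounded]
  rfl

/-- The operator on complex measures of which `T` is the transpose. -/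
def dual (T : Op Ω) (hT : T ∈ sigmaCont Ω) : Module.End ℂ (ComplexMeasure Ω) where
  toFun ρ := (exists_dual hT ρ).choose
  map_add' ρ ρ' := ext_of_integ fun f => by
    have h := cint_add_measure (exists_dual hT ρ).choose (exists_dual hT ρ').choose f.measurable
      f.bounded
    rw [(exists_dual hT _).choose_spec f, integ_apply _ f, h, ← integ_apply, ← integ_apply,
      (exists_dual hT ρ).choose_spec f, (exists_dual hT ρ').choose_spec f]
    exact cint_add_measure ρ ρ' (Bdd.measurable _) (Bdd.bounded _)
  map_smul' c ρ := ext_of_integ fun f => by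
    have h := cint_smul_measure (exists_dual hT ρ).choose c f.measurable f.bounded
    rw [(exists_dual hT _).choose_spec f, RingHom.id_apply, integ_apply _ f, h, ← integ_apply,
      (exists_dual hT ρ).choose_spec f]
    exact cint_smul_measure ρ c (Bdd.measurable _) (Bdd.bounded _)

theorem integ_dual (T : Op Ω) (hT : T ∈ sigmaCont Ω) (ρ : ComplexMeasure Ω) (f : Bdd Ω) :
    integ (dual T hT ρ) f = integ ρ (T f) := (exists_dual hT ρ).choose_spec f

theorem tv_dual_le (T : Op Ω) (hT : T ∈ sigmaCont Ω) (ρ : ComplexMeasure Ω) :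
    tv (dual T hT ρ) ≤ tv ρ * ‖T‖ := by
  refine tv_le_of_forall _ fun f hf hb => ?_
  have h := integ_dual T hT ρ (Bdd.mk f hf ⟨1, hb⟩)
  rw [integ_apply] at h
  have h1 : ‖Bdd.mk f hf ⟨1, hb⟩‖ ≤ 1 := Bdd.norm_le zero_le_one hb
  calc _ = ‖integ ρ (T (Bdd.mk f hf ⟨1, hb⟩))‖ := congrArg norm h
    _ ≤ tv ρ * (‖T‖ * 1) := (norm_integ_le _ _).trans (mul_le_mul_of_nonneg_left
        ((Op.le_norm _ _).trans (mul_le_mul_of_nonneg_left h1 (norm_nonneg _))) (tv_nonneg _))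
    _ = _ := by ring

end Duality

section Propagators

variable {d p q : ℕ} {reg : Regime} {R : Lat d → ℝ}

/-- The transposed pair operator is the generator of the interaction of a pair of blocks. -/
theorem pairOpTranspose_eq (h : IsCovariance reg R) (k₀ η ε : ℝ)
    [IsFiniteMeasure (medium (k₀ ^ 2 / (4 * η ^ 2)) R)] (γ : Fin p × Fin q) (z : ℝ)
    (f : Bdd (Config p q d)) :
    pairOpTranspose k₀ R η ε γ z f =
      (pair d (η / (k₀ * ε)) γ).gen (medium (k₀ ^ 2 / (4 * η ^ 2)) R) z f := by
  ext1 v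
  rw [Interaction.gen_apply, h.integral_medium (by positivity), pairOpTranspose,
    ← integral_const_mul]
  refine integral_congr_ae (Eventually.of_forall fun k => ?_)
  simp only [edge_phase_pair]
  simp only [edge, edgeShift_inl_inr]
  rw [show z * η / (k₀ * ε) * ⟪k, v (Sum.inl γ.1) - v (Sum.inr γ.2)⟫ =
    z * (η / (k₀ * ε) * ⟪k, v (Sum.inl γ.1) - v (Sum.inr γ.2)⟫) by ring]
  push_cast
  ring

/-- The solution operator of a pair of blocks is the transpose of `Interaction.prop`. -/
theorem exists_isPairPropagator (hd : 1 ≤ d) (h : IsCovariance reg R) (k₀ η ε : ℝ)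
    (γ : Fin p × Fin q) : ∃ U, IsPairPropagator (d := d) k₀ R η ε γ U := by
  have := h.isFiniteMeasure_medium hd (k₀ ^ 2 / (4 * η ^ 2))
  set ν := medium (k₀ ^ 2 / (4 * η ^ 2)) R with hν
  set I : Interaction (Config p q d) (Lat d) := pair d (η / (k₀ * ε)) γ with hI
  refine ⟨fun z => dual (I.prop ν z) (I.prop_mem ν z), ?_, fun ρ Z => ?_, fun ρ f hf hb z _ => ?_⟩
  · refine LinearMap.ext fun ρ => ext_of_integ fun f => ?_
    rw [integ_dual, I.prop_zero]
    rfl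
  · refine ⟨tv ρ * Real.exp (Z * ν.real univ), fun z hz => (tv_dual_le _ _ _).trans ?_⟩
    refine mul_le_mul_of_nonneg_left ((I.norm_prop_le ν z).trans ?_) (tv_nonneg _)
    rw [abs_of_nonneg hz.1]
    exact Real.exp_le_exp.2 (mul_le_mul_of_nonneg_right hz.2 measureReal_nonneg)
  · have hd := ((I.wDerivAt_prop ν (pair_indep_self γ) z).cint ρ (Bdd.mk f hf hb)).hasDerivWithinAt
      (s := Ici 0)
    have e1 : ∀ s, cint (dual (I.prop ν s) (I.prop_mem ν s) ρ) f =
        cint ρ (I.prop ν s (Bdd.mk f hf hb)) := fun s => integ_dual _ _ ρ (Bdd.mk f hf hb)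
    have e2 : pairOpTranspose k₀ R η ε γ z f = I.gen ν z (Bdd.mk f hf hb) :=
      pairOpTranspose_eq h k₀ η ε γ z (Bdd.mk f hf hb)
    simp only [e1, e2]
    refine hd.congr_deriv ?_
    exact (integ_dual (I.prop ν z) (I.prop_mem ν z) ρ (I.gen ν z (Bdd.mk f hf hb))).symm

/-- Uniqueness of the solution operator of a pair of blocks. -/
theorem IsPairPropagator.integ_eq (h : IsCovariance reg R) {k₀ η ε : ℝ}
    [IsFiniteMeasure (medium (k₀ ^ 2 / (4 * η ^ 2)) R)] {γ : Fin p × Fin q}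
    {U : ℝ → Module.End ℂ (ComplexMeasure (Config p q d))} (hU : IsPairPropagator k₀ R η ε γ U)
    {z : ℝ} (hz : 0 ≤ z) (ρ : ComplexMeasure (Config p q d)) (f : Bdd (Config p q d)) :
    integ (U z ρ) f =
      integ ρ ((pair d (η / (k₀ * ε)) γ).prop (medium (k₀ ^ 2 / (4 * η ^ 2)) R) z f) := by
  set ν := medium (k₀ ^ 2 / (4 * η ^ 2)) R with hν
  set I : Interaction (Config p q d) (Lat d) := pair d (η / (k₀ * ε)) γ with hI
  obtain ⟨C, hC⟩ := hU.bounded ρ z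
  have hpos : (0 : ℝ) ≤ ν.real univ := measureReal_nonneg
  have hC0 : 0 ≤ C := (tv_nonneg _).trans (hC 0 ⟨le_rfl, hz⟩)
  have key := gronwall_functional (e := fun z f => integ (U z ρ) f - integ ρ (I.prop ν z f))
    (L := fun z f => I.gen ν z f) (s := fun _ _ => 0) (D := univ) (G := univ) (Z := z)
    (M := C + tv ρ * Real.exp (z * ν.real univ)) (Λ := ν.real univ) (φ := 0)
    (add_nonneg hC0 (mul_nonneg (tv_nonneg _) (Real.exp_nonneg _))) hpos le_rfl
    (fun f _ => by simp [hU.initial])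
    (fun w hw f _ => ?_) (fun w _ f _ => ⟨mem_univ _, ?_⟩) (fun w _ f _ => by simp)
    (fun f _ w hw => ?_) (fun f _ w _ => ⟨fun _ => f, fun n => ⟨mem_univ _, le_rfl⟩,
      tendsto_const_nhds⟩) z ⟨hz, le_rfl⟩ f (mem_univ _)
  · simp only [zero_mul] at key
    exact sub_eq_zero.1 (norm_le_zero_iff.1 key)
  · rw [add_mul]
    refine (norm_sub_le _ _).trans (add_le_add ((norm_integ_le _ _).trans
      (mul_le_mul_of_nonneg_right (hC w hw) (norm_nonneg _))) ((norm_integ_le _ _).trans ?_))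
    rw [mul_assoc]
    refine mul_le_mul_of_nonneg_left ((Op.le_norm _ _).trans
      (mul_le_mul_of_nonneg_right ((I.norm_prop_le ν w).trans ?_) (norm_nonneg _))) (tv_nonneg _)
    rw [abs_of_nonneg hw.1]
    exact Real.exp_le_exp.2 (mul_le_mul_of_nonneg_right hw.2 hpos)
  · exact (Op.le_norm _ _).trans (mul_le_mul_of_nonneg_right (I.norm_gen_le ν w) (norm_nonneg _))
  · have h1 := hU.equation ρ f f.measurable f.bounded w hw
    have h2 := ((I.wDerivAt_prop ν (pair_indep_self γ) w).cint ρ f).hasDerivWithinAt (s := Ici 0)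
    rw [pairOpTranspose_eq h] at h1
    refine (h1.sub h2).congr_deriv ?_
    rw [add_zero]
    rfl

end Propagators

/-! ### Products over matchings -/

section Matchings

variable {d p q : ℕ}

/-- A set of pairs in which no two different pairs share a component. -/
def IsMatching (s : Finset (Fin p × Fin q)) : Prop :=
  ∀ γ ∈ s, ∀ γ' ∈ s, γ ≠ γ' → γ.1 ≠ γ'.1 ∧ γ.2 ≠ γ'.2

theorem mem_matchings {s : Finset (Fin p × Fin q)} : s ∈ matchings p q ↔ IsMatching s := by
  simp [matchings, IsMatching]

theorem IsMatching.mono {s t : Finset (Fin p × Fin q)} (h : IsMatching t) (hst : s ⊆ t) :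
    IsMatching s := fun γ hγ γ' hγ' => h γ (hst hγ) γ' (hst hγ')

variable (ν : Measure (Lat d)) [IsFiniteMeasure ν] (κ z : ℝ)

/-- The transpose of `U_γ(z) - 𝕀`. -/
def cross (γ : Fin p × Fin q) : Op (Config p q d) := (pair d κ γ).prop ν z - 1

/-- The transpose of the product of `U_γ(z) - 𝕀` over the pairs `γ` of `s`. -/
def crossProd (s : Finset (Fin p × Fin q)) : Op (Config p q d) :=
  ((pairList s).reverse.map (cross ν κ z)).prod

variable {ν κ z}

theorem IsMatching.pairwise {s : Finset (Fin p × Fin q)} (hs : IsMatching s) (z w : ℝ) :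
    (s : Set (Fin p × Fin q)).Pairwise
      fun γ γ' => Commute (cross (d := d) ν κ z γ) (cross ν κ w γ') := by
  intro γ hγ γ' hγ' hne
  have := hs γ hγ γ' hγ' hne
  exact (((pair_indep this.1 this.2).commute_prop ν z w).sub_right (Commute.one_right _)).sub_left
    (Commute.one_left _)

theorem nodup_pairList (s : Finset (Fin p × Fin q)) : (pairList s).Nodup :=
  ((List.nodup_finRange p).product (List.nodup_finRange q)).filter _

theorem mem_pairList {s : Finset (Fin p × Fin q)} {γ : Fin p × Fin q} :
    γ ∈ pairList s ↔ γ ∈ s := by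
  rcases γ with ⟨j, l⟩
  simp [pairList, List.mem_filter, List.pair_mem_product]

theorem crossProd_eq_noncommProd {s : Finset (Fin p × Fin q)} (hs : IsMatching s) :
    crossProd (d := d) ν κ z s = s.noncommProd (cross ν κ z) (hs.pairwise z z) := by
  have hl : (pairList s).reverse.toFinset = s := by
    ext γ; simp [mem_pairList]
  have hc : ((pairList s).reverse.toFinset : Set (Fin p × Fin q)).Pairwise
      fun γ γ' => Commute (cross (d := d) ν κ z γ) (cross ν κ z γ') := by
    rw [hl]; exact hs.pairwise z z
  rw [crossProd, ← Finset.noncommProd_toFinset _ _ hc (List.nodup_reverse.2 (nodup_pairList s))]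
  exact Finset.noncommProd_congr hl (fun _ _ => rfl) _

@[simp] theorem crossProd_empty : crossProd (p := p) (q := q) ν κ z ∅ = 1 := by
  rw [crossProd_eq_noncommProd (fun γ hγ => by simp at hγ)]
  simp

theorem crossProd_insert {s : Finset (Fin p × Fin q)} {γ : Fin p × Fin q} (hγ : γ ∉ s)
    (hs : IsMatching (insert γ s)) :
    crossProd (d := d) ν κ z (insert γ s) = cross ν κ z γ * crossProd ν κ z s := by
  rw [crossProd_eq_noncommProd hs, crossProd_eq_noncommProd (hs.mono (Finset.subset_insert γ s)),
    Finset.noncommProd_insert_of_notMem _ _ _ _ hγ]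

theorem crossProd_insert' {s : Finset (Fin p × Fin q)} {γ : Fin p × Fin q} (hγ : γ ∉ s)
    (hs : IsMatching (insert γ s)) :
    crossProd (d := d) ν κ z (insert γ s) = crossProd ν κ z s * cross ν κ z γ := by
  rw [crossProd_eq_noncommProd hs, crossProd_eq_noncommProd (hs.mono (Finset.subset_insert γ s)),
    Finset.noncommProd_insert_of_notMem' _ _ _ _ hγ]

theorem crossProd_erase {s : Finset (Fin p × Fin q)} {γ : Fin p × Fin q} (hγ : γ ∈ s)
    (hs : IsMatching s) :
    crossProd (d := d) ν κ z s = crossProd ν κ z (s.erase γ) * cross ν κ z γ := by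
  have := crossProd_insert' (d := d) (ν := ν) (κ := κ) (z := z) (Finset.notMem_erase γ s)
    (by rwa [Finset.insert_erase hγ])
  rwa [Finset.insert_erase hγ] at this

variable (ν κ)

/-- The transpose of `N_{p,q}(z)`. -/
def gaussDual (a z : ℝ) : Op (Config p q d) :=
  (Real.exp (-(a * z)) : ℂ) • ∑ s ∈ matchings p q, crossProd ν κ z s

end Matchings

section GaussianOp

variable {d p q : ℕ} {reg : Regime} {R : Lat d → ℝ}

theorem integ_sub_one (h : IsCovariance reg R) {k₀ η ε : ℝ}
    [IsFiniteMeasure (medium (k₀ ^ 2 / (4 * η ^ 2)) R)] {γ : Fin p × Fin q}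
    {U : ℝ → Module.End ℂ (ComplexMeasure (Config p q d))} (hU : IsPairPropagator k₀ R η ε γ U)
    {z : ℝ} (hz : 0 ≤ z) (ρ : ComplexMeasure (Config p q d)) (f : Bdd (Config p q d)) :
    integ ((U z - 1) ρ) f =
      integ ρ (cross (medium (k₀ ^ 2 / (4 * η ^ 2)) R) (η / (k₀ * ε)) z γ f) := by
  rw [cross, Op.sub_apply, map_sub, ← hU.integ_eq h hz]
  have e : integHom ((U z - 1) ρ) = integHom (U z ρ) - integHom ρ := by
    rw [LinearMap.sub_apply, map_sub]; rfl
  exact LinearMap.congr_fun e f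

theorem integ_list_prod (h : IsCovariance reg R) {k₀ η ε : ℝ}
    [IsFiniteMeasure (medium (k₀ ^ 2 / (4 * η ^ 2)) R)]
    {U : Fin p × Fin q → ℝ → Module.End ℂ (ComplexMeasure (Config p q d))}
    (hU : ∀ γ, IsPairPropagator k₀ R η ε γ (U γ)) {z : ℝ} (hz : 0 ≤ z)
    (l : List (Fin p × Fin q)) (ρ : ComplexMeasure (Config p q d)) (f : Bdd (Config p q d)) :
    integ ((l.map fun γ => U γ z - 1).prod ρ) f = integ ρ ((l.reverse.map
      (cross (medium (k₀ ^ 2 / (4 * η ^ 2)) R) (η / (k₀ * ε)) z)).prod f) := by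
  induction l generalizing ρ f with
  | nil => rfl
  | cons γ l ih =>
    rw [List.map_cons, List.prod_cons, Module.End.mul_apply, integ_sub_one h (hU γ) hz, ih,
      List.reverse_cons, List.map_append, List.prod_append, Op.mul_apply, List.map_singleton,
      List.prod_singleton]

theorem integ_gaussDual (ν : Measure (Lat d)) [IsFiniteMeasure ν] (κ a z : ℝ)
    (ρ : ComplexMeasure (Config p q d)) (f : Bdd (Config p q d)) :
    integ ρ (gaussDual (p := p) (q := q) ν κ a z f) =
      (Real.exp (-(a * z)) : ℂ) * ∑ s ∈ matchings p q, integ ρ (crossProd ν κ z s f) := by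
  rw [gaussDual, Op.smul_apply, Op.sum_apply, map_smul, map_sum, smul_eq_mul]

theorem integHom_gaussianOp (k₀ η : ℝ) (z : ℝ)
    (U : Fin p × Fin q → ℝ → Module.End ℂ (ComplexMeasure (Config p q d)))
    (ρ : ComplexMeasure (Config p q d)) :
    integHom (gaussianOp k₀ R η U z ρ) =
      ((Real.exp (-(((p : ℝ) + q) / 2 * (k₀ ^ 2 / (4 * η ^ 2) * R 0) * z)) : ℝ) : ℂ) •
        ∑ s ∈ matchings p q, integHom (((pairList s).map fun γ => U γ z - 1).prod ρ) := by
  have hc : Real.exp (-(k₀ ^ 2 * R 0 / 4 * z / η ^ 2)) ^ (((p : ℝ) + q) / 2) =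
      Real.exp (-(((p : ℝ) + q) / 2 * (k₀ ^ 2 / (4 * η ^ 2) * R 0) * z)) := by
    rw [← Real.exp_mul]
    congr 1
    ring
  rw [gaussianOp, hc, LinearMap.smul_apply, LinearMap.sum_apply, map_smul, map_sum]

theorem integ_gaussianOp (h : IsCovariance reg R) {k₀ η ε : ℝ}
    [IsFiniteMeasure (medium (k₀ ^ 2 / (4 * η ^ 2)) R)]
    {U : Fin p × Fin q → ℝ → Module.End ℂ (ComplexMeasure (Config p q d))}
    (hU : ∀ γ, IsPairPropagator k₀ R η ε γ (U γ))
    {z : ℝ} (hz : 0 ≤ z) (ρ : ComplexMeasure (Config p q d)) (f : Bdd (Config p q d)) :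
    integ (gaussianOp k₀ R η U z ρ) f =
      integ ρ (gaussDual (p := p) (q := q) (medium (k₀ ^ 2 / (4 * η ^ 2)) R) (η / (k₀ * ε))
        (((p : ℝ) + q) / 2 * (k₀ ^ 2 / (4 * η ^ 2) * R 0)) z f) := by
  have e := LinearMap.congr_fun (integHom_gaussianOp (R := R) k₀ η z U ρ) f
  simp only [LinearMap.smul_apply, LinearMap.sum_apply, smul_eq_mul, integHom_apply] at e
  rw [Finset.sum_congr rfl fun s _ => integ_list_prod h hU hz (pairList s) ρ f] at e
  rw [integ_gaussDual]
  exact e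

end GaussianOp

/-! ### The moment equation in the dual variables -/

section DualEquation

open scoped LineDeriv

variable {d p q : ℕ} {reg : Regime} {R : Lat d → ℝ}

instance hasTemperateGrowth_volume :
    (volume : Measure (Config p q d)).HasTemperateGrowth := by
  refine ⟨⟨Module.finrank ℝ (Config p q d) + 1, ?_⟩⟩
  apply integrable_one_add_norm
  norm_num

/-- The transform `v ↦ ∫ e^{i(∑ ξ_j·x_j - ∑ ζ_l·y_l)} Ψ(X, Y) dX dY / (2π)^{(p+q)d}`. -/
def dualTransform (Ψ : Config p q d → ℂ) (v : Config p q d) : ℂ :=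
  ((2 * Real.pi) ^ ((p + q) * d) : ℝ)⁻¹ * ∫ X, Complex.exp (Complex.I * pairing v X) * Ψ X

theorem continuous_wave : Continuous fun x : Config p q d × Config p q d =>
    Complex.exp (Complex.I * pairing x.1 x.2) :=
  Complex.continuous_exp.comp (continuous_const.mul
    (Complex.continuous_ofReal.comp (continuous_pairing continuous_fst continuous_snd)))

theorem integrable_wave_mul (v : Config p q d) {Ψ : Config p q d → ℂ} (hΨ : Integrable Ψ) :
    Integrable fun X => Complex.exp (Complex.I * pairing v X) * Ψ X := by
  refine hΨ.bdd_mul (c := 1) ?_ (Eventually.of_forall fun X => (norm_exp_I_mul _).le)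
  exact (continuous_wave.comp (continuous_const.prodMk continuous_id)).aestronglyMeasurable

theorem norm_dualTransform_le (Ψ : Config p q d → ℂ) (v : Config p q d) :
    ‖dualTransform Ψ v‖ ≤ ‖((((2 * Real.pi) ^ ((p + q) * d) : ℝ) : ℂ)⁻¹)‖ * ∫ X, ‖Ψ X‖ := by
  rw [dualTransform, norm_mul]
  have h : ‖∫ X, Complex.exp (Complex.I * pairing v X) * Ψ X‖ ≤ ∫ X, ‖Ψ X‖ := by
    refine (norm_integral_le_integral_norm _).trans (le_of_eq ?_)
    simp only [norm_mul, norm_exp_I_mul, one_mul]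
  rw [← Complex.ofReal_inv]
  exact mul_le_mul_of_nonneg_left h (norm_nonneg _)

theorem measurable_dualTransform {Ψ : Config p q d → ℂ} (hm : Measurable Ψ) :
    Measurable (dualTransform Ψ) := by
  refine Measurable.const_mul ?_ _
  refine (StronglyMeasurable.integral_prod_right
    (f := fun v X => Complex.exp (Complex.I * pairing v X) * Ψ X) ?_).measurable
  exact (continuous_wave.measurable.mul (hm.comp measurable_snd)).stronglyMeasurable

/-- The inverse Fourier transform of a complex measure, tested against `Ψ`. -/
theorem integral_invFourier_mul (m : ComplexMeasure (Config p q d)) {Ψ : Config p q d → ℂ}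
    (hm : Measurable Ψ) (hΨ : Integrable Ψ) :
    ∫ X, invFourier m X * Ψ X = cint m (dualTransform Ψ) := by
  obtain ⟨μ, g, _, hgm, hg, rfl⟩ := exists_density m
  have hw : ∀ X : Config p q d, Measurable fun v => Complex.exp (Complex.I * pairing v X) :=
    fun X => (continuous_wave.comp (continuous_id.prodMk continuous_const)).measurable
  rw [cint_withDensityᵥ hg (measurable_dualTransform hm) (norm_dualTransform_le Ψ)]
  have e1 : ∀ X, invFourier (μ.withDensityᵥ g) X * Ψ X =
      ((2 * Real.pi) ^ ((p + q) * d) : ℝ)⁻¹ *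
        ∫ v, Complex.exp (Complex.I * pairing v X) * g v * Ψ X ∂μ := by
    intro X
    rw [invFourier, cint_withDensityᵥ hg (hw X) (fun v => (norm_exp_I_mul _).le), mul_assoc,
      integral_mul_const]
  have e2 : ∀ v, dualTransform Ψ v * g v = ((2 * Real.pi) ^ ((p + q) * d) : ℝ)⁻¹ *
      ∫ X, Complex.exp (Complex.I * pairing v X) * g v * Ψ X := by
    intro v
    rw [dualTransform, mul_assoc, ← integral_mul_const]
    congr 2
    ext X
    ring
  simp only [e1, e2]
  rw [integral_const_mul, integral_const_mul, integral_integral_swap]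
  have hF : Integrable (fun x : Config p q d × Config p q d => Ψ x.1 * g x.2) (volume.prod μ) :=
    hΨ.mul_prod hg
  refine (hF.bdd_mul (c := 1) (f := fun x => Complex.exp (Complex.I * pairing x.2 x.1)) ?_
    (Eventually.of_forall fun x => (norm_exp_I_mul _).le)).congr (Eventually.of_forall fun x => ?_)
  · exact (continuous_wave.comp (continuous_snd.prodMk continuous_fst)).aestronglyMeasurable
  · simp only [Function.uncurry]
    ring

/-- The increment of the configuration in the block `a` along a basis vector. -/
def blockVec (a : Fin p ⊕ Fin q) (i : Fin d) : Config p q d :=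
  Pi.single a (EuclideanSpace.basisFun (Fin d) ℝ i)

theorem blockLaplacian_eq (Φ : 𝓢(Config p q d, ℂ)) (a : Fin p ⊕ Fin q) (X : Config p q d) :
    blockLaplacian Φ a X = ∑ i, (∂_{(blockVec a i : Config p q d)}
      (∂_{(blockVec a i : Config p q d)} Φ) : 𝓢(Config p q d, ℂ)) X := by
  rw [blockLaplacian, InnerProductSpace.laplacian_eq_iteratedFDeriv_orthonormalBasis _
    (EuclideanSpace.basisFun (Fin d) ℝ)]
  refine Finset.sum_congr rfl fun i _ => ?_
  set L : Lat d →L[ℝ] Config p q d := ContinuousLinearMap.single ℝ (fun _ => Lat d) a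
  set X₀ : Config p q d := Function.update X a 0
  have hupd : ∀ x, Function.update X a x = X₀ + L x := by
    intro x
    ext1 b
    by_cases hb : b = a
    · subst hb; simp [X₀, L]
    · simp [X₀, L, hb]
  have hf : (fun x : Lat d => Φ (Function.update X a x)) = (fun Y => Φ (X₀ + Y)) ∘ L := by
    ext x; simp [hupd]
  have hsm : ContDiff ℝ 2 fun Y => Φ (X₀ + Y) :=
    (Φ.smooth 2).comp (contDiff_const.add contDiff_id)
  rw [hf, ContinuousLinearMap.iteratedFDeriv_comp_right L hsm _ le_rfl,
    iteratedFDeriv_comp_add_left, ← hupd, Function.update_eq_self]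
  have h2 := SchwartzMap.iteratedLineDerivOp_eq_iteratedFDeriv (n := 2)
    (m := ![blockVec a i, blockVec a i]) (f := Φ) (x := X)
  rw [LineDeriv.iteratedLineDerivOp_succ_left, LineDeriv.iteratedLineDerivOp_succ_left,
    LineDeriv.iteratedLineDerivOp_fin_zero] at h2
  simp only [ContinuousMultilinearMap.compContinuousLinearMap_apply]
  refine Eq.trans ?_ h2.symm
  congr 1
  ext1 k
  fin_cases k <;> rfl

theorem integral_wave_lineDeriv (Ψ : 𝓢(Config p q d, ℂ)) (v e : Config p q d) :
    ∫ X, Complex.exp (Complex.I * pairing v X) * (∂_{e} Ψ : 𝓢(Config p q d, ℂ)) X =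
      -(Complex.I * pairing v e) * ∫ X, Complex.exp (Complex.I * pairing v X) * Ψ X := by
  have h := integral_bilinear_hasLineDerivAt_right_eq_neg_left_of_integrable
    (μ := (volume : Measure (Config p q d))) (B := ContinuousLinearMap.mul ℝ ℂ) (v := e)
    (f := fun X => Complex.exp (Complex.I * pairing v X))
    (f' := fun X => Complex.I * pairing v e * Complex.exp (Complex.I * pairing v X))
    (g := Ψ) (g' := (∂_{e} Ψ : 𝓢(Config p q d, ℂ))) ?_ ?_ ?_ ?_ ?_
  · simp only [ContinuousLinearMap.mul_apply'] at h
    rw [h, ← integral_neg, ← integral_const_mul]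
    congr 1; ext X; ring
  · have := (integrable_wave_mul v Ψ.integrable).const_mul (Complex.I * pairing v e)
    simpa [mul_assoc] using this
  · exact integrable_wave_mul v (∂_{e} Ψ : 𝓢(Config p q d, ℂ)).integrable
  · exact integrable_wave_mul v Ψ.integrable
  · intro X _
    rw [HasLineDerivAt]
    have h1 : ∀ t : ℝ, pairing v (X + t • e) = pairing v X + t * pairing v e := by
      intro t
      rw [pairing_comm, pairing_add_left, pairing_comm X, pairing_eq_sum (t • e),
        pairing_eq_sum v e, Finset.mul_sum]
      congr 1
      refine Finset.sum_congr rfl fun a _ => ?_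
      rw [Pi.smul_apply, inner_smul_left, real_inner_comm]
      simp only [conj_trivial]
      ring
    simp only [h1]
    have h2 : HasDerivAt (fun t : ℝ => pairing v X + t * pairing v e) (pairing v e) 0 := by
      simpa using ((hasDerivAt_id (0 : ℝ)).mul_const (pairing v e)).const_add (pairing v X)
    refine ((h2.ofReal_comp.const_mul Complex.I).cexp).congr_deriv ?_
    simp only [zero_mul, add_zero]
    ring
  · intro X _
    have := (Ψ.differentiable X).hasFDerivAt.hasLineDerivAt e
    rwa [← SchwartzMap.lineDerivOp_apply_eq_fderiv] at this

theorem pairing_blockVec (v : Config p q d) (a : Fin p ⊕ Fin q) (i : Fin d) :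
    pairing v (blockVec a i) = sgn a * v a i := by
  rw [pairing_comm, blockVec, pairing_single, real_inner_comm, EuclideanSpace.basisFun_apply,
    EuclideanSpace.inner_single_right]
  simp

theorem integral_wave_blockLaplacian (Φ : 𝓢(Config p q d, ℂ)) (v : Config p q d)
    (a : Fin p ⊕ Fin q) :
    ∫ X, Complex.exp (Complex.I * pairing v X) * blockLaplacian Φ a X =
      -((‖v a‖ ^ 2 : ℝ) : ℂ) * ∫ X, Complex.exp (Complex.I * pairing v X) * Φ X := by
  simp only [blockLaplacian_eq, Finset.mul_sum]
  rw [integral_finsetSum _ fun i _ => integrable_wave_mul v (SchwartzMap.integrable _)]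
  simp only [integral_wave_lineDeriv, pairing_blockVec]
  rw [EuclideanSpace.norm_sq_eq]
  push_cast
  rw [← Finset.sum_neg_distrib, Finset.sum_mul]
  refine Finset.sum_congr rfl fun i _ => ?_
  have h1 : ((sgn a : ℝ) : ℂ) * (sgn a : ℝ) = 1 := by
    rw [← Complex.ofReal_mul, sgn_mul_self, Complex.ofReal_one]
  have h2 : ((‖v a i‖ : ℝ) : ℂ) ^ 2 = (v a i : ℂ) ^ 2 := by
    rw [← Complex.ofReal_pow, Real.norm_eq_abs, sq_abs, Complex.ofReal_pow]
  rw [h2]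
  push_cast
  have h3 := Complex.I_sq
  generalize ∫ X, Complex.exp (Complex.I * pairing v X) * Φ X = J
  linear_combination ((sgn a : ℝ) : ℂ) ^ 2 * (v a i : ℂ) ^ 2 * J * h3 - (v a i : ℂ) ^ 2 * J * h1

end DualEquation


/-! ### The generator of the moment equation in the dual variables -/

section DualGenerator

open scoped FourierTransform LineDeriv

variable {d p q : ℕ} {reg : Regime} {R : Lat d → ℝ}

/-- The pairs `(a, b)`, `a < b`, of blocks of the same kind. -/
def twins (p q : ℕ) : Finset ((Fin p ⊕ Fin q) × (Fin p ⊕ Fin q)) :=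
  @Finset.filter _ (fun e => e.1 < e.2) (Classical.decPred _) Finset.univ

theorem twins_ne {e : (Fin p ⊕ Fin q) × (Fin p ⊕ Fin q)} (he : e ∈ twins p q) : e.1 ≠ e.2 := by
  simp only [twins, Finset.mem_filter] at he
  exact he.2.ne

theorem twins_sgn {e : (Fin p ⊕ Fin q) × (Fin p ⊕ Fin q)} (he : e ∈ twins p q) :
    sgn e.1 = sgn e.2 := by
  obtain ⟨a, b⟩ := e
  have h : a < b := by
    simp only [twins, Finset.mem_filter] at he
    exact he.2
  rcases a with a | a <;> rcases b with b | b
  · rfl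
  · exact absurd h Sum.not_inl_lt_inr
  · exact absurd h Sum.not_inr_lt_inl
  · rfl

theorem sum_twins {A : Type*} [AddCommMonoid A]
    (F : (Fin p ⊕ Fin q) → (Fin p ⊕ Fin q) → A) :
    ∑ e ∈ twins p q, F e.1 e.2 =
      ∑ j : Fin p, ∑ j' ∈ Finset.Ioi j, F (Sum.inl j) (Sum.inl j') +
        ∑ l : Fin q, ∑ l' ∈ Finset.Ioi l, F (Sum.inr l) (Sum.inr l') := by
  classical
  have h : ∑ e ∈ twins p q, F e.1 e.2 = ∑ e : (Fin p ⊕ Fin q) × (Fin p ⊕ Fin q),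
      if e.1 < e.2 then F e.1 e.2 else 0 := by
    rw [← Finset.sum_filter]
    refine Finset.sum_congr ?_ fun _ _ => rfl
    ext e
    simp [twins]
  rw [h, Fintype.sum_prod_type]
  simp only [Fintype.sum_sum_type, Sum.inl_lt_inl_iff, Sum.inr_lt_inr_iff, Sum.not_inl_lt_inr,
    Sum.not_inr_lt_inl, if_false, Finset.sum_const_zero, add_zero, zero_add]
  simp only [← Finset.sum_filter, Finset.filter_lt_eq_Ioi]

theorem potential_eq (X : Config p q d) :
    potential R X = ∑ γ : Fin p × Fin q, R (X (Sum.inl γ.1) - X (Sum.inr γ.2)) -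
      ∑ e ∈ twins p q, R (X e.1 - X e.2) - ((p : ℝ) + q) / 2 * R 0 := by
  rw [potential, sum_twins (fun a b => R (X a - X b)), Fintype.sum_prod_type]
  ring

theorem IsCovariance.apply_sgn_mul (h : IsCovariance reg R) (a : Fin p ⊕ Fin q)
    (x : Lat d) : R (sgn a • x) = R x := by
  cases a
  · simp
  · simp [h.even]

/-- Multiplication by `R(x_a - x_b)` becomes, in the dual variables, an average of translations. -/
theorem dualTransform_covariance (hd : 1 ≤ d) (h : IsCovariance reg R) {c : ℝ} (hc : 0 ≤ c)
    [IsFiniteMeasure (medium c R)] (a b : Fin p ⊕ Fin q) {Ψ : Config p q d → ℂ}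
    (hΨ : Integrable Ψ) (v : Config p q d) :
    dualTransform (fun X => ((c * R (X a - X b) : ℝ) : ℂ) * Ψ X) v =
      ∫ k, dualTransform Ψ (v + edgeShift a b k) ∂medium c R := by
  have hs : ∀ X : Config p q d, ((c * R (X a - X b) : ℝ) : ℂ) =
      ∫ k, Complex.exp (Complex.I * pairing (edgeShift a b k) X) ∂medium c R := by
    intro X
    rw [← h.apply_sgn_mul a, ← h.integral_exp_medium hd hc]
    simp only [pairing_edgeShift, inner_smul_right]
  simp only [dualTransform]
  rw [integral_const_mul, integral_integral_swap]
  · congr 2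
    ext X
    rw [hs, ← mul_assoc, mul_comm _ (∫ k, _ ∂_), mul_assoc, ← integral_mul_const]
    congr 1
    ext k
    rw [pairing_add_left, Complex.ofReal_add, mul_add, Complex.exp_add]
    ring
  · have hF : Integrable (fun x : Lat d × Config p q d => (1 : ℂ) * Ψ x.2)
        ((medium c R).prod volume) := (integrable_const (1 : ℂ)).mul_prod hΨ
    refine (hF.bdd_mul (c := 1) (f := fun x : Lat d × Config p q d =>
      Complex.exp (Complex.I * pairing (v + edgeShift a b x.1) x.2)) ?_
      (Eventually.of_forall fun x => (norm_exp_I_mul _).le)).congr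
        (Eventually.of_forall fun x => ?_)
    · have hcont : Continuous fun x : Lat d × Config p q d => (v + edgeShift a b x.1, x.2) :=
        (continuous_const.add ((continuous_edgeShift a b).comp continuous_fst)).prodMk
          continuous_snd
      exact (continuous_wave.comp hcont).aestronglyMeasurable
    · simp only [Function.uncurry, one_mul]

theorem IsCovariance.integrable_mul_covariance (h : IsCovariance reg R) (c : ℝ)
    (a b : Fin p ⊕ Fin q) {Ψ : Config p q d → ℂ} (hΨ : Integrable Ψ) :
    Integrable fun X => ((c * R (X a - X b) : ℝ) : ℂ) * Ψ X := by
  obtain ⟨C, hC⟩ := h.bounded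
  have hcont : Continuous fun X : Config p q d => ((c * R (X a - X b) : ℝ) : ℂ) := by
    have := h.continuous
    fun_prop
  refine hΨ.bdd_mul (c := |c| * C) hcont.aestronglyMeasurable (Eventually.of_forall fun X => ?_)
  rw [Complex.norm_real, Real.norm_eq_abs, abs_mul]
  exact mul_le_mul_of_nonneg_left (hC _) (abs_nonneg _)

theorem momentOp_eq (k₀ η ε : ℝ) (Φ : Config p q d → ℂ) (X : Config p q d) :
    momentOp k₀ R η ε Φ X =
      Complex.I * (η / (2 * k₀ * ε) : ℝ) * ∑ a, (sgn a : ℂ) * blockLaplacian Φ a X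
        + ∑ γ : Fin p × Fin q,
          ((k₀ ^ 2 / (4 * η ^ 2) * R (X (Sum.inl γ.1) - X (Sum.inr γ.2)) : ℝ) : ℂ) * Φ X
        - ∑ e ∈ twins p q, ((k₀ ^ 2 / (4 * η ^ 2) * R (X e.1 - X e.2) : ℝ) : ℂ) * Φ X
        - ((((p : ℝ) + q) / 2 * (k₀ ^ 2 / (4 * η ^ 2) * R 0) : ℝ) : ℂ) * Φ X := by
  rw [momentOp, potential_eq, Fintype.sum_sum_type]
  simp only [← Finset.sum_mul, sgn_inl, sgn_inr]
  push_cast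
  rw [← Finset.mul_sum, ← Finset.mul_sum, ← Finset.mul_sum, ← Finset.mul_sum]
  ring

/-- The operator of the moment equation in the dual variables. -/
theorem dualTransform_momentOp (hd : 1 ≤ d) (h : IsCovariance reg R) (k₀ η ε : ℝ)
    [IsFiniteMeasure (medium (k₀ ^ 2 / (4 * η ^ 2)) R)] (Φ : 𝓢(Config p q d, ℂ)) :
    Integrable (momentOp k₀ R η ε Φ) ∧ Measurable (momentOp k₀ R η ε Φ) ∧
    ∀ v, dualTransform (momentOp k₀ R η ε Φ) v =
      -(Complex.I * ((η / (k₀ * ε) * (pairing v v / 2) : ℝ) : ℂ)) * dualTransform Φ v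
        + ∑ γ : Fin p × Fin q, ∫ k, dualTransform Φ (v + edgeShift (Sum.inl γ.1) (Sum.inr γ.2) k)
            ∂medium (k₀ ^ 2 / (4 * η ^ 2)) R
        - ∑ e ∈ twins p q, ∫ k, dualTransform Φ (v + edgeShift e.1 e.2 k)
            ∂medium (k₀ ^ 2 / (4 * η ^ 2)) R
        - ((((p : ℝ) + q) / 2 * (k₀ ^ 2 / (4 * η ^ 2) * R 0) : ℝ) : ℂ) * dualTransform Φ v := by
  have hc : 0 ≤ k₀ ^ 2 / (4 * η ^ 2) := by positivity
  set c := k₀ ^ 2 / (4 * η ^ 2) with hcdef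
  have hL : ∀ a, Integrable (blockLaplacian Φ a) := by
    intro a
    simp only [funext (blockLaplacian_eq Φ a)]
    exact integrable_finsetSum _ fun i _ => SchwartzMap.integrable _
  have hLm : ∀ a, Measurable (blockLaplacian Φ a) := by
    intro a
    simp only [funext (blockLaplacian_eq Φ a)]
    exact Finset.measurable_fun_sum _ fun i _ => (SchwartzMap.continuous _).measurable
  have hR : ∀ a b, Integrable fun X => ((c * R (X a - X b) : ℝ) : ℂ) * Φ X :=
    fun a b => h.integrable_mul_covariance c a b Φ.integrable
  have hRm : ∀ a b : Fin p ⊕ Fin q, Measurable fun X => ((c * R (X a - X b) : ℝ) : ℂ) * Φ X := by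
    intro a b
    have h1 := h.continuous
    have h2 := Φ.continuous
    exact Continuous.measurable (by fun_prop)
  obtain ⟨F₁, hF₁⟩ : ∃ F : Config p q d → ℂ, F = fun X => Complex.I * (η / (2 * k₀ * ε) : ℝ) *
    ∑ a, (sgn a : ℂ) * blockLaplacian Φ a X := ⟨_, rfl⟩
  obtain ⟨F₂, hF₂⟩ : ∃ F : Config p q d → ℂ, F = fun X => ∑ γ : Fin p × Fin q,
    ((c * R (X (Sum.inl γ.1) - X (Sum.inr γ.2)) : ℝ) : ℂ) * Φ X := ⟨_, rfl⟩
  obtain ⟨F₃, hF₃⟩ : ∃ F : Config p q d → ℂ, F = fun X => ∑ e ∈ twins p q,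
    ((c * R (X e.1 - X e.2) : ℝ) : ℂ) * Φ X := ⟨_, rfl⟩
  obtain ⟨F₄, hF₄⟩ : ∃ F : Config p q d → ℂ, F = fun X =>
    ((((p : ℝ) + q) / 2 * (c * R 0) : ℝ) : ℂ) * Φ X := ⟨_, rfl⟩
  have i1 : Integrable F₁ := hF₁ ▸
    (integrable_finsetSum _ fun a _ => (hL a).const_mul _).const_mul _
  have i2 : Integrable F₂ := hF₂ ▸ integrable_finsetSum _ fun γ _ => hR _ _
  have i3 : Integrable F₃ := hF₃ ▸ integrable_finsetSum _ fun γ _ => hR _ _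
  have i4 : Integrable F₄ := hF₄ ▸ Φ.integrable.const_mul _
  have i12 : Integrable fun X => F₁ X + F₂ X := i1.add i2
  have i123 : Integrable fun X => F₁ X + F₂ X - F₃ X := i12.sub i3
  have heq : momentOp k₀ R η ε Φ = fun X => F₁ X + F₂ X - F₃ X - F₄ X := by
    ext X
    rw [hF₁, hF₂, hF₃, hF₄, momentOp_eq]
  refine ⟨?_, ?_, fun v => ?_⟩
  · rw [heq]
    exact i123.sub i4
  · rw [heq, hF₁, hF₂, hF₃, hF₄]
    refine ((Measurable.add ?_ ?_).sub ?_).sub ?_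
    · exact (Finset.measurable_fun_sum _ fun a _ => (hLm a).const_mul _).const_mul _
    · exact Finset.measurable_fun_sum _ fun a _ => hRm _ _
    · exact Finset.measurable_fun_sum _ fun a _ => hRm _ _
    · exact Φ.continuous.measurable.const_mul _
  · have t1 : ∀ Ψ₁ Ψ₂ : Config p q d → ℂ, Integrable Ψ₁ → Integrable Ψ₂ →
        dualTransform (fun X => Ψ₁ X + Ψ₂ X) v = dualTransform Ψ₁ v + dualTransform Ψ₂ v := by
      intro Ψ₁ Ψ₂ h1 h2
      simp only [dualTransform, mul_add]
      rw [integral_add (integrable_wave_mul v h1) (integrable_wave_mul v h2), mul_add]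
    have t2 : ∀ Ψ₁ Ψ₂ : Config p q d → ℂ, Integrable Ψ₁ → Integrable Ψ₂ →
        dualTransform (fun X => Ψ₁ X - Ψ₂ X) v = dualTransform Ψ₁ v - dualTransform Ψ₂ v := by
      intro Ψ₁ Ψ₂ h1 h2
      simp only [dualTransform, mul_sub]
      rw [integral_sub (integrable_wave_mul v h1) (integrable_wave_mul v h2), mul_sub]
    have t3 : ∀ (C : ℂ) (Ψ : Config p q d → ℂ),
        dualTransform (fun X => C * Ψ X) v = C * dualTransform Ψ v := by
      intro C Ψ
      simp only [dualTransform, mul_left_comm _ C]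
      rw [integral_const_mul]
      ring
    have t4 : ∀ {ι : Type} (s : Finset ι) (Ψ : ι → Config p q d → ℂ),
        (∀ i ∈ s, Integrable (Ψ i)) →
        dualTransform (fun X => ∑ i ∈ s, Ψ i X) v = ∑ i ∈ s, dualTransform (Ψ i) v := by
      intro ι s Ψ hΨ
      simp only [dualTransform, Finset.mul_sum]
      rw [integral_finsetSum _ fun i hi => integrable_wave_mul v (hΨ i hi), Finset.mul_sum]
    have t5 : ∀ a, dualTransform (blockLaplacian Φ a) v =
        -((‖v a‖ ^ 2 : ℝ) : ℂ) * dualTransform Φ v := by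
      intro a
      rw [dualTransform, integral_wave_blockLaplacian, dualTransform]
      ring
    rw [heq, t2 _ _ i123 i4, t2 _ _ i12 i3, t1 _ _ i1 i2, hF₁, hF₂, hF₃, hF₄, t3, t3,
      t4 _ _ (fun a _ => (hL a).const_mul _), t4 _ _ (fun a _ => hR _ _),
      t4 _ _ (fun a _ => hR _ _)]
    simp only [t3, t5, dualTransform_covariance hd h hc _ _ Φ.integrable]
    congr 3
    rw [pairing_eq_sum]
    simp only [real_inner_self_eq_norm_sq]
    simp only [← mul_assoc, ← Finset.sum_mul, mul_neg, neg_mul, Finset.sum_neg_distrib]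
    have : η / (2 * k₀ * ε) = η / (k₀ * ε) / 2 := by
      rw [mul_assoc, mul_comm 2, ← div_div]
    rw [this]
    push_cast
    ring

end DualGenerator


/-! ### The equation in the frame of the free propagation -/

section WeakEquation

open scoped FourierTransform

variable {d p q : ℕ} {reg : Regime} {R : Lat d → ℝ}

/-- Every smooth function with compact support is the transform of a Schwartz function. -/
theorem exists_dualTransform_eq {g : Config p q d → ℂ} (hc : HasCompactSupport g)
    (hg : ContDiff ℝ (⊤ : ℕ∞) g) : ∃ Φ : 𝓢(Config p q d, ℂ), ∀ v, dualTransform Φ v = g v := by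
  -- the Fourier transform of Mathlib lives on the Euclidean version `E` of `Config p q d`
  let L : PiLp 2 (fun _ : Fin p ⊕ Fin q => Lat d) ≃L[ℝ] Config p q d :=
    PiLp.continuousLinearEquiv 2 ℝ fun _ => Lat d
  let σ : Config p q d ≃L[ℝ] Config p q d := ContinuousLinearEquiv.piCongrRight fun a =>
    ContinuousLinearEquiv.smulLeft (Units.mk0 (2 * Real.pi * sgn a) (by
      have := abs_sgn a
      have : sgn a ≠ 0 := by rintro h; simp [h] at this
      positivity))
  have hσ : ∀ v a, σ v a = (2 * Real.pi * sgn a) • v a := fun v a => rfl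
  let B := L.trans σ
  have hGc : HasCompactSupport (g ∘ B) := hc.comp_homeomorph B.toHomeomorph
  have hGs : ContDiff ℝ (⊤ : ℕ∞) (g ∘ B) := hg.comp B.contDiff
  let G : 𝓢(PiLp 2 (fun _ : Fin p ⊕ Fin q => Lat d), ℂ) := hGc.toSchwartzMap hGs
  have hGapp : ∀ w, G w = g (B w) := fun w => rfl
  -- the pushforward of Lebesgue measure is a multiple of Lebesgue measure
  let μ : Measure (Config p q d) := Measure.map L volume
  have : μ.IsAddHaarMeasure := L.isAddHaarMeasure_map _
  have hμ : (volume : Measure (Config p q d)) = volume.addHaarScalarFactor μ • μ :=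
    Measure.isAddLeftInvariant_eq_smul _ _
  set K := (volume : Measure (Config p q d)).addHaarScalarFactor μ with hK
  have hK0 : K ≠ 0 := (Measure.addHaarScalarFactor_pos_of_isAddHaarMeasure _ _).ne'
  let C : ℂ := ((2 * Real.pi) ^ ((p + q) * d) : ℝ) * ((K : ℝ) : ℂ)⁻¹
  let Φ₀ : 𝓢(Config p q d, ℂ) := SchwartzMap.compCLMOfContinuousLinearEquiv ℝ L.symm (𝓕 G)
  have hΦ₀ : ∀ X, Φ₀ X = (𝓕 G) (L.symm X) := fun X => rfl
  have hint : ∀ F : Config p q d → ℂ, ∫ X, F X ∂μ = ∫ y, F (L y) :=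
    fun F => integral_map_equiv L.toHomeomorph.toMeasurableEquiv F
  have key : ∀ v, ∫ X, Complex.exp (Complex.I * pairing v X) * Φ₀ X = (K : ℝ) * g v := by
    intro v
    rw [hμ, integral_smul_nnreal_measure, hint]
    have h1 : ∀ y : PiLp 2 (fun _ : Fin p ⊕ Fin q => Lat d),
        pairing v (L y) = 2 * Real.pi * ⟪y, B.symm v⟫ := by
      intro y
      obtain ⟨w, rfl⟩ := B.surjective v
      rw [B.symm_apply_apply, pairing_eq_sum, PiLp.inner_apply, Finset.mul_sum]
      refine Finset.sum_congr rfl fun a _ => ?_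
      have : B w a = (2 * Real.pi * sgn a) • w a := rfl
      rw [this, inner_smul_left, real_inner_comm]
      simp only [conj_trivial]
      have h2 := sgn_mul_self a
      have h3 : (L y) a = y a := rfl
      rw [h3]
      linear_combination (2 * Real.pi * ⟪y a, w a⟫) * h2
    have h4 : 𝓕⁻ (𝓕 G) = G := FourierTransform.fourierInv_fourier_eq G
    have h5 : (𝓕⁻ (𝓕 G)) (B.symm v) = g v := by rw [h4, hGapp, B.apply_symm_apply]
    rw [SchwartzMap.fourierInv_coe, Real.fourierInv_eq'] at h5
    rw [← h5, NNReal.smul_def, Complex.real_smul]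
    congr 2
    ext y
    rw [h1, hΦ₀, L.symm_apply_apply, smul_eq_mul, mul_comm Complex.I]
  refine ⟨C • Φ₀, fun v => ?_⟩
  have h7 : ∀ X, (C • Φ₀) X = C * Φ₀ X := fun X => rfl
  simp only [dualTransform, h7, mul_left_comm _ C]
  rw [integral_const_mul, key]
  have h8 : ((K : ℝ) : ℂ) ≠ 0 := by exact_mod_cast hK0
  have h9 : (((2 * Real.pi) ^ ((p + q) * d) : ℝ) : ℂ) ≠ 0 := by
    rw [Complex.ofReal_ne_zero]; positivity
  simp only [C, Complex.ofReal_inv]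
  generalize (((2 * Real.pi) ^ ((p + q) * d) : ℝ) : ℂ) = P at *
  field_simp

/-- The phase `e^{izκ(∑|ξ_j|² - ∑|ζ_l|²)/2}`, which undoes the free propagation. -/
def freeFactor (κ z : ℝ) (v : Config p q d) : ℂ :=
  Complex.exp (Complex.I * (z * (κ * (pairing v v / 2)) : ℝ))

theorem norm_freeFactor (κ z : ℝ) (v : Config p q d) : ‖freeFactor κ z v‖ = 1 :=
  norm_exp_I_mul _

theorem contDiff_quadratic (κ : ℝ) :
    ContDiff ℝ (⊤ : ℕ∞) fun v : Config p q d => κ * (pairing v v / 2) := by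
  simp only [pairing_eq_sum]
  refine contDiff_const.mul (ContDiff.div_const (ContDiff.sum fun a _ => contDiff_const.mul ?_) 2)
  exact (contDiff_apply ℝ (Lat d) a).inner ℝ (contDiff_apply ℝ (Lat d) a)

theorem contDiff_freeFactor (κ z : ℝ) :
    ContDiff ℝ (⊤ : ℕ∞) (freeFactor κ z : Config p q d → ℂ) := by
  have h : ContDiff ℝ (⊤ : ℕ∞) fun v : Config p q d =>
      ((z * (κ * (pairing v v / 2)) : ℝ) : ℂ) :=
    Complex.ofRealCLM.contDiff.comp (contDiff_const.mul (contDiff_quadratic κ))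
  exact (contDiff_const.mul h).cexp

theorem measurable_freeFactor (κ z : ℝ) : Measurable (freeFactor κ z : Config p q d → ℂ) :=
  (contDiff_freeFactor κ z).continuous.measurable

/-- Multiplication by `freeFactor`. -/
def rotate (κ z : ℝ) (f : Bdd (Config p q d)) : Bdd (Config p q d) :=
  Bdd.mk (fun v => freeFactor κ z v * f v) ((measurable_freeFactor κ z).mul f.measurable)
    ⟨‖f‖, fun v => by rw [norm_mul, norm_freeFactor, one_mul]; exact f.norm_apply_le v⟩

theorem rotate_apply (κ z : ℝ) (f : Bdd (Config p q d)) (v : Config p q d) :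
    rotate κ z f v = freeFactor κ z v * f v := rfl

theorem norm_rotate_le (κ z : ℝ) (f : Bdd (Config p q d)) : ‖rotate κ z f‖ ≤ ‖f‖ :=
  Bdd.norm_le (norm_nonneg _) fun v => by
    rw [rotate_apply, norm_mul, norm_freeFactor, one_mul]; exact f.norm_apply_le v

theorem rotate_zero (κ : ℝ) (f : Bdd (Config p q d)) : rotate κ 0 f = f :=
  Bdd.ext fun v => by simp [rotate_apply, freeFactor]

/-- In the frame of the free propagation, a translation average acquires the phases of the
interaction. -/
theorem freeFactor_mul_gen (ν : Measure (Lat d)) [IsFiniteMeasure ν] (κ z : ℝ)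
    (a b : Fin p ⊕ Fin q) (f : Bdd (Config p q d)) (v : Config p q d) :
    freeFactor κ z v * (edge κ a b).gen ν z f v =
      ∫ k, rotate κ z f (v + edgeShift a b k) ∂ν := by
  rw [Interaction.gen_apply, ← integral_const_mul]
  congr 1
  ext k
  rw [rotate_apply, freeFactor, freeFactor, edge_phase_eq_sub, ← mul_assoc, ← Complex.exp_add,
    ← mul_add, ← Complex.ofReal_add]
  congr 4
  ring

/-- The generator of the moment equation in the dual variables, after the free propagation has been
removed. -/
def momentGen (ν : Measure (Lat d)) [IsFiniteMeasure ν] (κ a z : ℝ) : Op (Config p q d) :=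
  ∑ γ, (pair d κ γ).gen ν z - ∑ e ∈ twins p q, (edge κ e.1 e.2).gen ν z - (a : ℂ) • 1

/-- Smooth functions with compact support, among the bounded measurable functions. -/
def testFunctions (p q d : ℕ) : Set (Bdd (Config p q d)) :=
  {f | HasCompactSupport (f : Config p q d → ℂ) ∧ ContDiff ℝ (⊤ : ℕ∞) (f : Config p q d → ℂ)}

theorem norm_exp_I_sub_le (t : ℝ) :
    ‖Complex.exp (Complex.I * t) - 1 - Complex.I * t‖ ≤ 3 * t ^ 2 := by
  have hn : ‖Complex.I * (t : ℂ)‖ = |t| := by simp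
  rcases le_total |t| 1 with ht | ht
  · have := Complex.norm_exp_sub_one_sub_id_le (x := Complex.I * t) (by rw [hn]; exact ht)
    rw [hn, sq_abs] at this
    nlinarith [sq_nonneg t]
  · have h1 : ‖Complex.exp (Complex.I * t) - 1 - Complex.I * t‖ ≤ 1 + 1 + |t| := by
      refine (norm_sub_le _ _).trans (add_le_add ((norm_sub_le _ _).trans ?_) hn.le)
      rw [norm_exp_I_mul, norm_one]
    rw [← sq_abs t]
    nlinarith

/-- A continuous function with compact support stays bounded when multiplied by a continuous
function. -/
theorem HasCompactSupport.exists_bound_mul {f g : Config p q d → ℂ} (hf : HasCompactSupport f)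
    (hfc : Continuous f) (hg : Continuous g) : ∃ C : ℝ, ∀ v, ‖g v * f v‖ ≤ C :=
  (hf.mul_left (f := g)).exists_bound_of_continuous (hg.mul hfc)

/-- The equation for the dual solution, tested against smooth functions with compact support: these
are the transforms of the Schwartz functions against which the moment equation is tested. -/
theorem IsMomentSolution.hasDerivWithinAt_cint (hd : 1 ≤ d) (h : IsCovariance reg R)
    {k₀ η ε : ℝ} [IsFiniteMeasure (medium (k₀ ^ 2 / (4 * η ^ 2)) R)]
    {m : ℝ → ComplexMeasure (Config p q d)} (hm : IsMomentSolution k₀ R η ε m)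
    {g : Config p q d → ℂ} (hg : HasCompactSupport g) (hgs : ContDiff ℝ (⊤ : ℕ∞) g) {z : ℝ}
    (hz : 0 ≤ z) :
    HasDerivWithinAt (fun s => cint (m s) g)
      (cint (m z) fun v =>
        -(Complex.I * ((η / (k₀ * ε) * (pairing v v / 2) : ℝ) : ℂ)) * g v
        + ∑ γ : Fin p × Fin q, ∫ k, g (v + edgeShift (Sum.inl γ.1) (Sum.inr γ.2) k)
            ∂medium (k₀ ^ 2 / (4 * η ^ 2)) R
        - ∑ e ∈ twins p q, ∫ k, g (v + edgeShift e.1 e.2 k)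
            ∂medium (k₀ ^ 2 / (4 * η ^ 2)) R
        - ((((p : ℝ) + q) / 2 * (k₀ ^ 2 / (4 * η ^ 2) * R 0) : ℝ) : ℂ) * g v) (Ici 0) z := by
  obtain ⟨Φ, hΦ⟩ := exists_dualTransform_eq hg hgs
  obtain ⟨h1, h2, h3⟩ := dualTransform_momentOp hd h k₀ η ε Φ
  have h4 := hm.equation Φ z hz
  simp only [integral_invFourier_mul _ Φ.continuous.measurable Φ.integrable,
    integral_invFourier_mul _ h2 h1] at h4
  have h5 : dualTransform Φ = g := funext hΦ
  rw [funext h3, h5] at h4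
  exact h4

/-- A product rule for pairings `F w` of a family of functionals with a family of test functions: `G`
and `H` are the pairings with the test function at `z` and with its derivative at `z`. -/
theorem hasDerivWithinAt_of_sq_error {F G H : ℝ → ℂ} {D : ℂ} {z C : ℝ} {s : Set ℝ}
    (hG : HasDerivWithinAt G D s z) (hH : ContinuousWithinAt H s z)
    (hF : ∀ w ∈ s, |w - z| ≤ 1 → ‖F w - G w - (w - z) * H w‖ ≤ C * (w - z) ^ 2) (hFz : F z = G z) :
    HasDerivWithinAt F (D + H z) s z := by
  have h1 : HasDerivWithinAt (fun w : ℝ => ((w - z : ℝ) : ℂ) * H w) (H z) s z := by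
    rw [hasDerivWithinAt_iff_tendsto_slope]
    have : Tendsto H (𝓝[s \ {z}] z) (𝓝 (H z)) := hH.mono_left (nhdsWithin_mono _ sdiff_subset)
    refine this.congr' ?_
    filter_upwards [self_mem_nhdsWithin] with w hw
    have hne : w - z ≠ 0 := sub_ne_zero.2 hw.2
    rw [slope_def_module, sub_self, Complex.ofReal_zero, zero_mul, sub_zero, Complex.real_smul,
      ← mul_assoc, ← Complex.ofReal_mul, inv_mul_cancel₀ hne, Complex.ofReal_one, one_mul]
  have h2 : HasDerivWithinAt (fun w : ℝ => F w - G w - ((w - z : ℝ) : ℂ) * H w) 0 s z := by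
    rw [hasDerivWithinAt_iff_isLittleO]
    simp only [hFz, sub_self, Complex.ofReal_zero, zero_mul, smul_zero, sub_zero]
    have hO : (fun w : ℝ => F w - G w - ((w - z : ℝ) : ℂ) * H w) =O[𝓝[s] z]
        fun w => (w - z) ^ 2 := by
      refine Asymptotics.IsBigO.of_bound C ?_
      have hb : ∀ᶠ w in 𝓝[s] z, |w - z| ≤ 1 :=
        nhdsWithin_le_nhds (by
          filter_upwards [Metric.closedBall_mem_nhds z one_pos] with w hw
          simpa [Real.dist_eq] using hw)
      filter_upwards [hb, self_mem_nhdsWithin] with w hw hws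
      have := hF w hws hw
      rw [Real.norm_eq_abs, abs_of_nonneg (sq_nonneg _)]
      push_cast
      exact this
    refine hO.trans_isLittleO ?_
    have ho : (fun w : ℝ => (w - z) ^ 2) =o[𝓝 z] fun w => w - z := by
      have h0 : Tendsto (fun w : ℝ => w - z) (𝓝 z) (𝓝 0) := by
        have : Continuous fun w : ℝ => w - z := by fun_prop
        simpa using this.tendsto z
      have := (Asymptotics.isLittleO_one_iff ℝ (f := fun w : ℝ => w - z)).2 h0
      simpa [pow_two] using this.mul_isBigO (Asymptotics.isBigO_refl (fun w => w - z) (𝓝 z))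
    exact ho.mono nhdsWithin_le_nhds
  have := (hG.add h1).add h2
  refine (this.congr_deriv (by ring)).congr (fun w _ => by simp) (by simp)

/-- The equation for the dual solution in the frame of the free propagation. -/
theorem IsMomentSolution.hasDerivWithinAt_rotate (hd : 1 ≤ d) (h : IsCovariance reg R)
    {k₀ η ε : ℝ} [IsFiniteMeasure (medium (k₀ ^ 2 / (4 * η ^ 2)) R)]
    {m : ℝ → ComplexMeasure (Config p q d)} (hm : IsMomentSolution k₀ R η ε m)
    {f : Bdd (Config p q d)} (hf : f ∈ testFunctions p q d) {z : ℝ} (hz : 0 ≤ z) :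
    HasDerivWithinAt (fun w => integ (m w) (rotate (η / (k₀ * ε)) w f))
      (integ (m z) (rotate (η / (k₀ * ε)) z (momentGen (medium (k₀ ^ 2 / (4 * η ^ 2)) R)
        (η / (k₀ * ε)) (((p : ℝ) + q) / 2 * (k₀ ^ 2 / (4 * η ^ 2) * R 0)) z f))) (Ici 0) z := by
  set ν := medium (k₀ ^ 2 / (4 * η ^ 2)) R with hν
  set κ := η / (k₀ * ε) with hκ
  set a := ((p : ℝ) + q) / 2 * (k₀ ^ 2 / (4 * η ^ 2) * R 0) with ha
  -- on the support of `f` the kinetic phase is bounded, and the rotated test function is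
  -- differentiable in `w` in the supremum norm, with derivative `gQ` at `z`
  have hQc : Continuous fun v : Config p q d => κ * (pairing v v / 2) :=
    (contDiff_quadratic κ).continuous
  have hrc : HasCompactSupport (rotate κ z f : Config p q d → ℂ) :=
    hf.1.mul_left (f := freeFactor κ z)
  have hrs : ContDiff ℝ (⊤ : ℕ∞) (rotate κ z f : Config p q d → ℂ) :=
    (contDiff_freeFactor κ z).mul hf.2
  have hgs : ContDiff ℝ (⊤ : ℕ∞) fun v : Config p q d =>
      Complex.I * ((κ * (pairing v v / 2) : ℝ) : ℂ) * rotate κ z f v := by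
    have h1 : ContDiff ℝ (⊤ : ℕ∞) fun v : Config p q d => ((κ * (pairing v v / 2) : ℝ) : ℂ) :=
      Complex.ofRealCLM.contDiff.comp (contDiff_quadratic κ)
    exact (contDiff_const.mul h1).mul hrs
  have hgc : HasCompactSupport fun v : Config p q d =>
      Complex.I * ((κ * (pairing v v / 2) : ℝ) : ℂ) * rotate κ z f v := hrc.mul_left
  let gQ : Bdd (Config p q d) := Bdd.mk _ hgs.continuous.measurable
    (hgc.exists_bound_of_continuous hgs.continuous)
  have hgQ : ∀ v, gQ v = Complex.I * ((κ * (pairing v v / 2) : ℝ) : ℂ) * rotate κ z f v :=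
    fun v => rfl
  obtain ⟨C₁, hC₁⟩ := HasCompactSupport.exists_bound_mul hf.1 hf.2.continuous
    (g := fun v : Config p q d => (((κ * (pairing v v / 2)) ^ 2 : ℝ) : ℂ))
    (Complex.continuous_ofReal.comp (hQc.pow 2))
  have hC₁0 : 0 ≤ C₁ := (norm_nonneg _).trans (hC₁ 0)
  obtain ⟨C₂, hC₂⟩ := hm.bounded (z + 1)
  have hG := hm.hasDerivWithinAt_cint hd h hrc hrs hz
  have hH := (hm.hasDerivWithinAt_cint hd h hgc hgs hz).continuousWithinAt
  refine (hasDerivWithinAt_of_sq_error (F := fun w => integ (m w) (rotate κ w f)) hG hH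
    (C := 3 * C₁ * C₂) (fun w hw hwz => ?_) rfl).congr_deriv ?_
  · have e1 : integ (m w) (rotate κ w f) - cint (m w) (rotate κ z f) -
        (w - z) * cint (m w) (fun v : Config p q d =>
          Complex.I * ((κ * (pairing v v / 2) : ℝ) : ℂ) * rotate κ z f v) =
        integ (m w) (rotate κ w f - rotate κ z f - ((w - z : ℝ) : ℂ) • gQ) := by
      rw [map_sub, map_sub, map_smul, smul_eq_mul, Complex.ofReal_sub]
      rfl
    have hw1 : w ≤ z + 1 := by linarith [(abs_le.1 hwz).2]
    have e2 : ‖rotate κ w f - rotate κ z f - ((w - z : ℝ) : ℂ) • gQ‖ ≤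
        3 * C₁ * (w - z) ^ 2 := by
      refine Bdd.norm_le (by positivity) fun v => ?_
      rw [Bdd.sub_apply, Bdd.sub_apply, Bdd.smul_apply, hgQ, rotate_apply, rotate_apply]
      set θ := κ * (pairing v v / 2) with hθ
      have e3 : freeFactor κ w v = freeFactor κ z v *
          Complex.exp (Complex.I * ((w - z) * θ : ℝ)) := by
        rw [freeFactor, freeFactor, ← Complex.exp_add, ← mul_add, ← Complex.ofReal_add]
        congr 3
        ring
      have e4 : freeFactor κ w v * f v - freeFactor κ z v * f v -
          ((w - z : ℝ) : ℂ) * (Complex.I * (θ : ℂ) * (freeFactor κ z v * f v)) =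
          freeFactor κ z v * (Complex.exp (Complex.I * ((w - z) * θ : ℝ)) - 1 -
            Complex.I * ((w - z) * θ : ℝ)) * f v := by
        rw [e3]
        push_cast
        ring
      rw [e4, norm_mul, norm_mul, norm_freeFactor, one_mul]
      have e5 := hC₁ v
      rw [norm_mul, Complex.norm_real, Real.norm_eq_abs, abs_of_nonneg (sq_nonneg _)] at e5
      calc _ ≤ 3 * ((w - z) * θ) ^ 2 * ‖f v‖ :=
            mul_le_mul_of_nonneg_right (norm_exp_I_sub_le _) (norm_nonneg _)
        _ = 3 * (w - z) ^ 2 * (θ ^ 2 * ‖f v‖) := by ring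
        _ ≤ 3 * (w - z) ^ 2 * C₁ := mul_le_mul_of_nonneg_left e5 (by positivity)
        _ = _ := by ring
    rw [e1]
    calc _ ≤ tv (m w) * ‖rotate κ w f - rotate κ z f - ((w - z : ℝ) : ℂ) • gQ‖ :=
          norm_integ_le _ _
      _ ≤ C₂ * (3 * C₁ * (w - z) ^ 2) := mul_le_mul (hC₂ w ⟨hw, hw1⟩) e2 (norm_nonneg _)
          ((tv_nonneg _).trans (hC₂ w ⟨hw, hw1⟩))
      _ = _ := by ring
  · have e6 : (fun v : Config p q d =>
        -(Complex.I * ((κ * (pairing v v / 2) : ℝ) : ℂ)) * rotate κ z f v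
        + ∑ γ : Fin p × Fin q, ∫ k, rotate κ z f (v + edgeShift (Sum.inl γ.1) (Sum.inr γ.2) k) ∂ν
        - ∑ e ∈ twins p q, ∫ k, rotate κ z f (v + edgeShift e.1 e.2 k) ∂ν
        - (a : ℂ) * rotate κ z f v) =
        (rotate κ z (momentGen ν κ a z f) - gQ : Bdd (Config p q d)) := by
      ext v
      rw [Bdd.sub_apply, hgQ, rotate_apply _ _ (momentGen ν κ a z f), momentGen, Op.sub_apply,
        Op.sub_apply, Op.sum_apply, Op.sum_apply, Op.smul_apply, Op.one_apply, Bdd.sub_apply,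
        Bdd.sub_apply, Bdd.sum_apply, Bdd.sum_apply, Bdd.smul_apply, mul_sub, mul_sub,
        Finset.mul_sum, Finset.mul_sum]
      simp only [freeFactor_mul_gen, rotate_apply κ z f v]
      ring
    rw [e6, ← integ_apply, map_sub]
    exact sub_add_cancel _ _

/-- Continuous bounded functions are bounded pointwise limits of test functions. -/
theorem exists_testFunctions_tendsto {f : Bdd (Config p q d)}
    (hf : Continuous (f : Config p q d → ℂ)) :
    ∃ F : ℕ → Bdd (Config p q d), (∀ n, F n ∈ testFunctions p q d ∧ ‖F n‖ ≤ ‖f‖) ∧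
      ∀ v, Tendsto (fun n => F n v) atTop (𝓝 (f v)) := by
  -- cut off at radius `n`, smooth up to an error `1 / (n + 1)`, and rescale to the norm of `f`
  let χ : ℕ → Config p q d → ℝ := fun n v => max 0 (min 1 (n + 1 - ‖v‖))
  have hχc : ∀ n, Continuous (χ n) := fun n => by fun_prop
  have hχ0 : ∀ n v, 0 ≤ χ n v := fun n v => le_max_left _ _
  have hχ1 : ∀ n v, χ n v ≤ 1 := fun n v => max_le zero_le_one (min_le_left _ _)
  have hfχ : ∀ n, Continuous fun v => (χ n v : ℂ) * f v := fun n =>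
    (Complex.continuous_ofReal.comp (hχc n)).mul hf
  have hδ : ∀ n : ℕ, (0 : ℝ) < 1 / (n + 1) := fun n => by positivity
  choose g hgs hgd hgsupp using fun n : ℕ => (hfχ n).exists_contDiff_approx (⊤ : ℕ∞)
    (ε := fun _ => 1 / ((n : ℝ) + 1)) continuous_const (fun _ => hδ n)
  have hgc : ∀ n, HasCompactSupport (g n) := by
    intro n
    refine HasCompactSupport.of_support_subset_isCompact
      (isCompact_closedBall (0 : Config p q d) (n + 1)) ((hgsupp n).trans fun v hv => ?_)
    by_contra hv'
    refine hv ?_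
    have : χ n v = 0 := by
      have h1 : (n : ℝ) + 1 < ‖v‖ := by simpa using hv'
      exact max_eq_left ((min_le_right _ _).trans (by linarith))
    simp [this]
  have hgb : ∀ n v, ‖g n v‖ ≤ ‖f‖ + 1 / (n + 1) := by
    intro n v
    have h1 : ‖(χ n v : ℂ) * f v‖ ≤ ‖f‖ := by
      rw [norm_mul, Complex.norm_real, Real.norm_eq_abs, abs_of_nonneg (hχ0 n v)]
      calc _ ≤ 1 * ‖f v‖ := mul_le_mul_of_nonneg_right (hχ1 n v) (norm_nonneg _)
        _ ≤ _ := by rw [one_mul]; exact f.norm_apply_le v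
    have h2 := (hgd n v).le
    rw [dist_eq_norm] at h2
    calc ‖g n v‖ = ‖(χ n v : ℂ) * f v + (g n v - (χ n v : ℂ) * f v)‖ := by ring_nf
      _ ≤ _ := (norm_add_le _ _).trans (add_le_add h1 h2)
  let t : ℕ → ℝ := fun n => ‖f‖ / (‖f‖ + 1 / (n + 1))
  have hpos : ∀ n : ℕ, 0 < ‖f‖ + 1 / ((n : ℝ) + 1) := fun n =>
    add_pos_of_nonneg_of_pos (norm_nonneg _) (hδ n)
  have ht0 : ∀ n, 0 ≤ t n := fun n => div_nonneg (norm_nonneg _) (hpos n).le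
  have hb : ∀ n v, ‖(t n : ℂ) * g n v‖ ≤ ‖f‖ := by
    intro n v
    rw [norm_mul, Complex.norm_real, Real.norm_eq_abs, abs_of_nonneg (ht0 n)]
    calc _ ≤ t n * (‖f‖ + 1 / (n + 1)) := mul_le_mul_of_nonneg_left (hgb n v) (ht0 n)
      _ = ‖f‖ := div_mul_cancel₀ _ (hpos n).ne'
  refine ⟨fun n => Bdd.mk (fun v => (t n : ℂ) * g n v)
    ((hgs n).continuous.measurable.const_mul _) ⟨‖f‖, hb n⟩,
    fun n => ⟨⟨(hgc n).mul_left, contDiff_const.mul (hgs n)⟩,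
      Bdd.norm_le (norm_nonneg _) (hb n)⟩, fun v => ?_⟩
  have hlim : Tendsto (fun n : ℕ => 1 / ((n : ℝ) + 1)) atTop (𝓝 0) :=
    tendsto_one_div_add_atTop_nhds_zero_nat
  rcases eq_or_ne f 0 with rfl | hne
  · simp [t]
  have hfn : ‖f‖ ≠ 0 := norm_ne_zero_iff.2 hne
  have htl : Tendsto t atTop (𝓝 1) := by
    have h1 : Tendsto t atTop (𝓝 (‖f‖ / (‖f‖ + 0))) :=
      (tendsto_const_nhds (x := ‖f‖)).div (hlim.const_add ‖f‖) (by simpa using hfn)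
    rwa [add_zero, div_self hfn] at h1
  have hgl : Tendsto (fun n => g n v) atTop (𝓝 (f v)) := by
    rw [tendsto_iff_norm_sub_tendsto_zero]
    refine squeeze_zero' (Eventually.of_forall fun n => norm_nonneg _) ?_ hlim
    filter_upwards [eventually_ge_atTop ⌈‖v‖⌉₊] with n hn
    have h1 : χ n v = 1 := by
      have h2 : ‖v‖ ≤ n := (Nat.le_ceil _).trans (by exact_mod_cast hn)
      have h3 : min 1 ((n : ℝ) + 1 - ‖v‖) = 1 := min_eq_left (by linarith)
      simp only [χ, h3]
      norm_num
    have h2 := (hgd n v).le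
    rwa [dist_eq_norm, h1, Complex.ofReal_one, one_mul] at h2
  have := ((Complex.continuous_ofReal.tendsto 1).comp htl).mul hgl
  simpa using this

theorem tendsto_integ_rotate (m : ComplexMeasure (Config p q d)) (κ z : ℝ)
    {F : ℕ → Bdd (Config p q d)} {f : Bdd (Config p q d)} (hF : ∀ n, ‖F n‖ ≤ ‖f‖)
    (h : ∀ v, Tendsto (fun n => F n v) atTop (𝓝 (f v))) :
    Tendsto (fun n => integ m (rotate κ z (F n))) atTop (𝓝 (integ m (rotate κ z f))) := by
  refine cint_tendsto m (C := ‖f‖) (Eventually.of_forall fun n => Bdd.measurable _)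
    (Eventually.of_forall fun n v => ?_) fun v => ?_
  · exact (Bdd.norm_apply_le _ v).trans ((norm_rotate_le _ _ _).trans (hF n))
  · exact (h v).const_mul (freeFactor κ z v)

theorem continuous_integral_kernel (ν : Measure (Lat d)) [IsFiniteMeasure ν]
    {A : Config p q d → Lat d → ℂ} (hA : Continuous (Function.uncurry A)) {C : ℝ}
    (hC : ∀ v k, ‖A v k‖ ≤ C) : Continuous fun v => ∫ k, A v k ∂ν := by
  refine continuous_of_dominated (bound := fun _ => C) (fun v => ?_)
    (fun v => Eventually.of_forall (hC v)) (integrable_const _) (Eventually.of_forall fun k => ?_)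
  · exact (hA.uncurry_left v).aestronglyMeasurable
  · exact hA.uncurry_right k

/-- The generators preserve continuity. -/
theorem continuous_gen (ν : Measure (Lat d)) [IsFiniteMeasure ν] (κ z : ℝ)
    (a b : Fin p ⊕ Fin q) {f : Bdd (Config p q d)} (hf : Continuous (f : Config p q d → ℂ)) :
    Continuous ((edge κ a b).gen ν z f : Config p q d → ℂ) := by
  refine continuous_integral_kernel ν (C := ‖f‖) ?_ fun v k => ?_
  · have h1 := continuous_phase (d := d) κ a b
    have h2 := hf.comp (continuous_shift (d := d) a b)
    exact (Complex.continuous_exp.comp (continuous_const.mul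
      (Complex.continuous_ofReal.comp (continuous_const.mul h1)))).mul h2
  · rw [norm_mul, norm_exp_I_mul, one_mul]
    exact f.norm_apply_le _

theorem continuous_momentGen (ν : Measure (Lat d)) [IsFiniteMeasure ν] (κ a z : ℝ)
    {f : Bdd (Config p q d)} (hf : Continuous (f : Config p q d → ℂ)) :
    Continuous (momentGen ν κ a z f : Config p q d → ℂ) := by
  have hg : (momentGen ν κ a z f : Config p q d → ℂ) = fun v =>
      ∑ γ, (pair d κ γ).gen ν z f v - ∑ e ∈ twins p q, (edge κ e.1 e.2).gen ν z f v - a * f v := by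
    ext v
    rw [momentGen, Op.sub_apply, Op.sub_apply, Op.sum_apply, Op.sum_apply, Op.smul_apply,
      Op.one_apply, Bdd.sub_apply, Bdd.sub_apply, Bdd.sum_apply, Bdd.sum_apply, Bdd.smul_apply]
  rw [hg]
  exact ((continuous_finsetSum _ fun γ _ => continuous_gen ν κ z _ _ hf).sub
    (continuous_finsetSum _ fun e _ => continuous_gen ν κ z _ _ hf)).sub
      (continuous_const.mul hf)

end WeakEquation


/-! ### The corrected Gaussian approximation -/

section CorrectedGaussian

variable {d p q : ℕ} (ν : Measure (Lat d)) [IsFiniteMeasure ν] (κ : ℝ)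

/-- The weak derivative of `crossProd`. -/
def crossDeriv (z : ℝ) (s : Finset (Fin p × Fin q)) : Op (Config p q d) :=
  ∑ γ ∈ s, crossProd ν κ z (s.erase γ) * ((pair d κ γ).prop ν z * (pair d κ γ).gen ν z)

theorem wDerivAt_cross (z : ℝ) (γ : Fin p × Fin q) :
    WDerivAt (fun w => cross (d := d) ν κ w γ) ((pair d κ γ).prop ν z * (pair d κ γ).gen ν z) z := by
  have h := ((pair d κ γ).wDerivAt_prop ν (pair_indep_self γ) z).add
    (WDerivAt.const (T := (-1 : Op (Config p q d))) (neg_mem (one_mem _)) z)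
  rw [add_zero] at h
  simpa only [cross, sub_eq_add_neg] using h

theorem IsMatching.commute_cross_prop_gen {γ γ' : Fin p × Fin q} (h1 : γ.1 ≠ γ'.1)
    (h2 : γ.2 ≠ γ'.2) (z : ℝ) : Commute (cross (d := d) ν κ z γ)
      ((pair d κ γ').prop ν z * (pair d κ γ').gen ν z) := by
  have e1 := (pair_indep (d := d) (κ := κ) h1 h2).commute_prop ν z z
  have e2 := ((pair_indep (d := d) (κ := κ) h1.symm h2.symm).commute_gen_prop ν z z).symm
  exact (e1.mul_right e2).sub_left (Commute.one_left _)

theorem IsMatching.wDerivAt_crossProd {s : Finset (Fin p × Fin q)} (hs : IsMatching s) (z : ℝ) :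
    WDerivAt (fun w => crossProd (d := d) ν κ w s) (crossDeriv ν κ z s) z := by
  classical
  induction s using Finset.induction_on with
  | empty =>
    simp only [crossProd_empty, crossDeriv, Finset.sum_empty]
    exact WDerivAt.const (one_mem _) z
  | insert γ s hγ ih =>
    have hs' := hs.mono (Finset.subset_insert γ s)
    have h := (ih hs').mul (wDerivAt_cross ν κ z γ)
    simp only [← crossProd_insert' hγ hs] at h
    refine h.congr_deriv ?_
    rw [crossDeriv, crossDeriv, Finset.sum_insert hγ, Finset.erase_insert hγ, add_comm,
      Finset.sum_mul]
    congr 1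
    refine Finset.sum_congr rfl fun γ' hγ' => ?_
    have hne : γ ≠ γ' := fun e => hγ (e ▸ hγ')
    obtain ⟨h1, h2⟩ := hs γ (Finset.mem_insert_self _ _) γ' (Finset.mem_insert_of_mem hγ') hne
    rw [Finset.erase_insert_of_ne hne, crossProd_insert' (fun h => hγ (Finset.mem_of_mem_erase h))
      (hs.mono (Finset.insert_subset_insert _ (Finset.erase_subset _ _))), mul_assoc,
      mul_assoc _ (cross ν κ z γ), (IsMatching.commute_cross_prop_gen ν κ h1 h2 z).eq]

theorem IsMatching.crossDeriv_eq {s : Finset (Fin p × Fin q)} (hs : IsMatching s) (z : ℝ) :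
    crossDeriv (d := d) ν κ z s = ∑ γ ∈ s, crossProd ν κ z s * (pair d κ γ).gen ν z +
      ∑ γ ∈ s, crossProd ν κ z (s.erase γ) * (pair d κ γ).gen ν z := by
  rw [crossDeriv, ← Finset.sum_add_distrib]
  refine Finset.sum_congr rfl fun γ hγ => ?_
  rw [crossProd_erase hγ hs, cross]
  noncomm_ring

open Classical in
/-- The pairs that cannot be added to `s` as they share a component with a pair of `s`. -/
def conflicts (s : Finset (Fin p × Fin q)) : Finset (Fin p × Fin q) :=
  Finset.univ.filter fun γ => γ ∉ s ∧ ¬ IsMatching (insert γ s)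

/-- A conflicting pair shares exactly one component with some pair of the matching. -/
theorem IsMatching.exists_conflict {s : Finset (Fin p × Fin q)} (hs : IsMatching s)
    {γ : Fin p × Fin q} (hγ : γ ∈ conflicts s) :
    ∃ γ' ∈ s, γ ≠ γ' ∧ (γ.1 = γ'.1 ∨ γ.2 = γ'.2) := by
  classical
  obtain ⟨hγs, hnot⟩ : γ ∉ s ∧ ¬ IsMatching (insert γ s) := by simpa [conflicts] using hγ
  by_contra! hcon
  refine hnot fun a ha b hb hab => ?_
  rcases Finset.mem_insert.1 ha with ha' | ha' <;> rcases Finset.mem_insert.1 hb with hb' | hb'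
  · exact absurd (ha'.trans hb'.symm) hab
  · rw [ha'] at hab ⊢
    exact hcon b hb' hab
  · rw [hb'] at hab ⊢
    exact ⟨(hcon a ha' hab.symm).1.symm, (hcon a ha' hab.symm).2.symm⟩
  · exact hs a ha' b hb' hab

/-- The integrated interactions that the Gaussian approximation misses, for the term with index `s`
of `gaussDual`. -/
def defect (z : ℝ) (s : Finset (Fin p × Fin q)) : Op (Config p q d) :=
  ∑ γ ∈ conflicts s, (pair d κ γ).int ν z - ∑ e ∈ twins p q, (edge κ e.1 e.2).int ν z

/-- The weak derivative of `defect`. -/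
def defectGen (z : ℝ) (s : Finset (Fin p × Fin q)) : Op (Config p q d) :=
  ∑ γ ∈ conflicts s, (pair d κ γ).gen ν z - ∑ e ∈ twins p q, (edge κ e.1 e.2).gen ν z

/-- The sum of the generators of all interactions. -/
def interactionGen (p q : ℕ) (z : ℝ) : Op (Config p q d) :=
  ∑ γ, (pair d κ γ).gen ν z - ∑ e ∈ twins p q, (edge κ e.1 e.2).gen ν z

theorem wDerivAt_defect (z : ℝ) (s : Finset (Fin p × Fin q)) :
    WDerivAt (fun w => defect (d := d) ν κ w s) (defectGen ν κ z s) z := by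
  have h1 := WDerivAt.sum (z := z) (conflicts s) fun γ _ => (pair d κ γ).wDerivAt_int ν z
  have h2 := WDerivAt.sum (z := z) (twins p q)
    fun e _ => (edge (d := d) κ e.1 e.2).wDerivAt_int ν z
  have h3 := h1.add (WDerivAt.smul (hasDerivAt_const z (-1 : ℂ)) h2)
  simp only [zero_smul, zero_add, neg_one_smul] at h3
  simp only [← sub_eq_add_neg] at h3
  exact h3

/-- The derivative of the products over matchings creates each pair that can be added to a matching.
Together with the pairs already present, whose propagators commute with their generators, and with
the conflicting pairs and the twins, which are supplied by `defectGen`, this is the whole generator. -/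
theorem sum_crossDeriv_add (z : ℝ) :
    ∑ s ∈ matchings p q, (crossDeriv (d := d) ν κ z s + crossProd ν κ z s * defectGen ν κ z s) =
      (∑ s ∈ matchings p q, crossProd ν κ z s) * interactionGen ν κ p q z := by
  classical
  have key : ∑ s ∈ matchings p q, ∑ γ ∈ s,
        crossProd (d := d) ν κ z (s.erase γ) * (pair d κ γ).gen ν z =
      ∑ s ∈ matchings p q, ∑ γ ∈ Finset.univ.filter fun γ => γ ∉ s ∧ IsMatching (insert γ s),
        crossProd ν κ z s * (pair d κ γ).gen ν z := by
    rw [Finset.sum_sigma', Finset.sum_sigma']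
    refine Finset.sum_bij' (fun x _ => ⟨x.1.erase x.2, x.2⟩) (fun x _ => ⟨insert x.2 x.1, x.2⟩)
      ?_ ?_ ?_ ?_ ?_
    · rintro ⟨s, γ⟩ hx
      simp only [Finset.mem_sigma, mem_matchings, Finset.mem_filter, Finset.mem_univ,
        true_and] at hx ⊢
      refine ⟨hx.1.mono (Finset.erase_subset _ _), Finset.notMem_erase _ _, ?_⟩
      rw [Finset.insert_erase hx.2]
      exact hx.1
    · rintro ⟨s, γ⟩ hx
      simp only [Finset.mem_sigma, mem_matchings, Finset.mem_filter, Finset.mem_univ,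
        true_and] at hx ⊢
      exact ⟨hx.2.2, Finset.mem_insert_self _ _⟩
    · rintro ⟨s, γ⟩ hx
      simp only [Finset.mem_sigma] at hx
      simp [Finset.insert_erase hx.2]
    · rintro ⟨s, γ⟩ hx
      simp only [Finset.mem_sigma, Finset.mem_filter] at hx
      simp [Finset.erase_insert hx.2.2.1]
    · rintro ⟨s, γ⟩ hx
      rfl
  rw [Finset.sum_add_distrib, Finset.sum_congr rfl fun s hs =>
    (mem_matchings.1 hs).crossDeriv_eq ν κ z, Finset.sum_add_distrib, key, Finset.sum_mul,
    ← Finset.sum_add_distrib, ← Finset.sum_add_distrib]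
  refine Finset.sum_congr rfl fun s _ => ?_
  have split : ∑ γ, (pair d κ γ).gen ν z = ∑ γ ∈ s, (pair d κ γ).gen ν z +
      ∑ γ ∈ Finset.univ.filter fun γ => γ ∉ s ∧ IsMatching (insert γ s), (pair d κ γ).gen ν z +
      ∑ γ ∈ conflicts s, (pair d κ γ).gen ν z := by
    rw [← Finset.sum_filter_add_sum_filter_not Finset.univ (fun γ => γ ∈ s),
      ← Finset.sum_filter_add_sum_filter_not (Finset.univ.filter fun γ => γ ∉ s)
        (fun γ => IsMatching (insert γ s)), Finset.filter_filter, Finset.filter_filter, ← add_assoc]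
    congr 3
    ext γ; simp
  rw [interactionGen, split, defectGen, ← Finset.mul_sum, ← Finset.mul_sum]
  noncomm_ring

/-- The Gaussian approximation, corrected by the interactions that it misses: to first order, the
term with index `s` is followed by one of them, integrated over time. Although the generators of the
missing interactions are not small, their time integrals are small after multiplication by
`crossProd ν κ z s`. -/
def correctedDual (a z : ℝ) : Op (Config p q d) :=
  (Real.exp (-(a * z)) : ℂ) • ∑ s ∈ matchings p q, crossProd ν κ z s * (1 + defect ν κ z s)

/-- The amount by which the corrected approximation fails to solve the equation. -/
def residual (p q : ℕ) (a z : ℝ) : Op (Config p q d) :=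
  (Real.exp (-(a * z)) : ℂ) • ∑ s ∈ matchings p q,
    (crossDeriv ν κ z s * defect ν κ z s - crossProd ν κ z s * defect ν κ z s *
      interactionGen ν κ p q z)

/-- The derivative of the correction `defect` supplies the interactions missed by the Gaussian
approximation, so that the corrected approximation solves the equation up to `residual`. -/
theorem wDerivAt_correctedDual (a z : ℝ) :
    WDerivAt (correctedDual (d := d) (p := p) (q := q) ν κ a)
      (correctedDual ν κ a z * momentGen ν κ a z + residual ν κ p q a z) z := by
  have h1 : ∀ s ∈ matchings p q, WDerivAt (fun w => crossProd (d := d) ν κ w s *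
      (1 + defect ν κ w s)) (crossDeriv ν κ z s * (1 + defect ν κ z s) +
        crossProd ν κ z s * (0 + defectGen ν κ z s)) z := fun s hs =>
    ((mem_matchings.1 hs).wDerivAt_crossProd ν κ z).mul
      ((WDerivAt.const (one_mem _) z).add (wDerivAt_defect ν κ z s))
  have h2 : HasDerivAt (fun w : ℝ => ((Real.exp (-(a * w)) : ℝ) : ℂ))
      ((Real.exp (-(a * z)) * (-a) : ℝ) : ℂ) z := by
    have : HasDerivAt (fun w : ℝ => -(a * w)) (-a) z := by
      simpa only [neg_mul, id, mul_one] using (hasDerivAt_id z).const_mul (-a)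
    exact this.exp.ofReal_comp
  refine (WDerivAt.smul h2 (WDerivAt.sum _ h1)).congr_deriv ?_
  have key := sum_crossDeriv_add (d := d) (p := p) (q := q) ν κ z
  have e1 : ∑ s ∈ matchings p q, (crossDeriv (d := d) ν κ z s * (1 + defect ν κ z s) +
        crossProd ν κ z s * (0 + defectGen ν κ z s)) =
      ∑ s ∈ matchings p q, (crossDeriv ν κ z s + crossProd ν κ z s * defectGen ν κ z s) +
        ∑ s ∈ matchings p q, crossDeriv ν κ z s * defect ν κ z s := by
    rw [← Finset.sum_add_distrib]
    refine Finset.sum_congr rfl fun s _ => ?_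
    noncomm_ring
  have e2 : ∑ s ∈ matchings p q, crossProd (d := d) ν κ z s * (1 + defect ν κ z s) =
      ∑ s ∈ matchings p q, crossProd ν κ z s +
        ∑ s ∈ matchings p q, crossProd ν κ z s * defect ν κ z s := by
    rw [← Finset.sum_add_distrib]
    refine Finset.sum_congr rfl fun s _ => ?_
    noncomm_ring
  have e3 : momentGen (p := p) (q := q) ν κ a z = interactionGen ν κ p q z - (a : ℂ) • 1 := rfl
  rw [e1, key, residual, correctedDual, e3, Finset.sum_sub_distrib, ← Finset.sum_mul, e2]
  generalize ∑ s ∈ matchings p q, crossProd (d := d) ν κ z s = A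
  generalize ∑ s ∈ matchings p q, crossProd (d := d) ν κ z s * defect ν κ z s = B
  generalize ∑ s ∈ matchings p q, crossDeriv (d := d) ν κ z s * defect ν κ z s = C
  generalize interactionGen ν κ p q z = L
  push_cast
  generalize Complex.exp (-(a * z)) = E
  simp only [mul_sub, smul_add, smul_sub, add_mul, smul_mul_assoc, mul_smul_comm, mul_one, mul_neg,
    neg_smul, smul_smul, mul_comm E (a : ℂ)]
  abel

end CorrectedGaussian


/-! ### Operator norm estimates -/

section Estimates

variable {d p q : ℕ} {ν : Measure (Lat d)} [IsFiniteMeasure ν] {κ Z z δ r E : ℝ}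

theorem norm_prop_le_of_mem (hz : z ∈ Icc 0 Z) (hE : Real.exp (Z * ν.real univ) + 1 ≤ E)
    (γ : Fin p × Fin q) : ‖(pair d κ γ).prop ν z‖ ≤ E := by
  refine ((pair d κ γ).norm_prop_le ν z).trans ?_
  rw [abs_of_nonneg hz.1]
  have : Real.exp (z * ν.real univ) ≤ Real.exp (Z * ν.real univ) :=
    Real.exp_le_exp.2 (mul_le_mul_of_nonneg_right hz.2 measureReal_nonneg)
  linarith

theorem norm_cross_le (hz : 0 ≤ z) (γ : Fin p × Fin q) :
    ‖cross (d := d) ν κ z γ‖ ≤ Real.exp (z * ν.real univ) + 1 := by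
  have h := (pair d κ γ).norm_prop_le ν z
  rw [abs_of_nonneg hz] at h
  exact (norm_sub_le _ _).trans (add_le_add h Op.norm_one_le)

theorem norm_cross_le_of_mem (hz : z ∈ Icc 0 Z) (hE : Real.exp (Z * ν.real univ) + 1 ≤ E)
    (γ : Fin p × Fin q) : ‖cross (d := d) ν κ z γ‖ ≤ E := by
  refine (norm_cross_le hz.1 γ).trans ?_
  have : Real.exp (z * ν.real univ) ≤ Real.exp (Z * ν.real univ) :=
    Real.exp_le_exp.2 (mul_le_mul_of_nonneg_right hz.2 measureReal_nonneg)
  linarith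

theorem IsMatching.norm_crossProd_le {s : Finset (Fin p × Fin q)} (hs : IsMatching s)
    (h : ∀ γ : Fin p × Fin q, ‖cross (d := d) ν κ z γ‖ ≤ E) : ‖crossProd (d := d) ν κ z s‖ ≤ E ^ s.card := by
  classical
  induction s using Finset.induction_on with
  | empty => simpa using Op.norm_one_le
  | insert γ s hγ ih =>
    have hE : 0 ≤ E := (norm_nonneg _).trans (h γ)
    rw [crossProd_insert hγ hs, Finset.card_insert_of_notMem hγ, pow_succ']
    exact (norm_mul_le _ _).trans (mul_le_mul (h γ)
      (ih (hs.mono (Finset.subset_insert γ s))) (norm_nonneg _) hE)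

theorem IsMatching.norm_crossProd_le_of_mem {s : Finset (Fin p × Fin q)} (hs : IsMatching s)
    (hz : z ∈ Icc 0 Z) (hE : Real.exp (Z * ν.real univ) + 1 ≤ E) :
    ‖crossProd (d := d) ν κ z s‖ ≤ E ^ (p * q) := by
  refine (hs.norm_crossProd_le fun γ => norm_cross_le_of_mem hz hE γ).trans ?_
  have h1 : 1 ≤ E := by linarith [Real.exp_pos (Z * ν.real univ)]
  refine pow_le_pow_right₀ h1 ?_
  simpa using Finset.card_le_univ s

theorem IsMatching.card_le {s : Finset (Fin p × Fin q)} (hs : IsMatching s) :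
    s.card ≤ p ∧ s.card ≤ q := by
  classical
  constructor
  · have h : s.card = (s.image Prod.fst).card := (Finset.card_image_of_injOn fun a ha b hb hab => by
      by_contra hne
      exact (hs a ha b hb hne).1 hab).symm
    rw [h]
    simpa using Finset.card_le_univ (s.image Prod.fst)
  · have h : s.card = (s.image Prod.snd).card := (Finset.card_image_of_injOn fun a ha b hb hab => by
      by_contra hne
      exact (hs a ha b hb hne).2 hab).symm
    rw [h]
    simpa using Finset.card_le_univ (s.image Prod.snd)

/-- The attenuation of the `p + q` factors compensates the growth of the pairs. -/
theorem norm_gaussDual_le (hz : 0 ≤ z) : ‖gaussDual (d := d) (p := p) (q := q) ν κ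
    (((p : ℝ) + q) / 2 * ν.real univ) z‖ ≤ (matchings p q).card * 2 ^ (p * q) := by
  have hr : 0 ≤ ν.real univ := measureReal_nonneg
  rw [gaussDual, Finset.smul_sum]
  refine (norm_sum_le _ _).trans ?_
  rw [← nsmul_eq_mul]
  refine Finset.sum_le_card_nsmul _ _ _ fun s hs => ?_
  have hs := mem_matchings.1 hs
  set x := Real.exp (z * ν.real univ) with hx
  have hx1 : 1 ≤ x := Real.one_le_exp (mul_nonneg hz hr)
  have h1 := hs.norm_crossProd_le (d := d) (κ := κ) (E := 2 * x) (fun γ =>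
    (norm_cross_le (κ := κ) hz γ).trans (by linarith))
  rw [norm_smul, Complex.norm_real, Real.norm_eq_abs, Real.abs_exp]
  have h2 : x ^ s.card * Real.exp (-(((p : ℝ) + q) / 2 * ν.real univ * z)) ≤ 1 := by
    rw [hx, ← Real.exp_nat_mul, ← Real.exp_add, Real.exp_le_one_iff]
    have h3 : (s.card : ℝ) ≤ ((p : ℝ) + q) / 2 := by
      have h4 : (s.card : ℝ) ≤ p := by exact_mod_cast hs.card_le.1
      have h5 : (s.card : ℝ) ≤ q := by exact_mod_cast hs.card_le.2
      linarith
    have := mul_le_mul_of_nonneg_right h3 (mul_nonneg hz hr)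
    linarith
  have h6 : (2 : ℝ) ^ s.card ≤ 2 ^ (p * q) :=
    pow_le_pow_right₀ (by norm_num) (by simpa using Finset.card_le_univ s)
  calc _ ≤ Real.exp (-(((p : ℝ) + q) / 2 * ν.real univ * z)) * (2 * x) ^ s.card :=
        mul_le_mul_of_nonneg_left h1 (Real.exp_nonneg _)
    _ = 2 ^ s.card * (x ^ s.card * Real.exp (-(((p : ℝ) + q) / 2 * ν.real univ * z))) := by
        rw [mul_pow]; ring
    _ ≤ 2 ^ (p * q) * 1 := mul_le_mul h6 h2 (by positivity) (by positivity)
    _ = _ := mul_one _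

/-- The number of interactions. -/
def edgeCount (p q : ℕ) : ℝ := (p * q : ℕ) + (twins p q).card

theorem edgeCount_nonneg (p q : ℕ) : 0 ≤ edgeCount p q := by unfold edgeCount; positivity

theorem norm_sum_interactions_le {A : Type*} [SeminormedAddCommGroup A]
    (s : Finset (Fin p × Fin q)) (F : Fin p × Fin q → A)
    (G : (Fin p ⊕ Fin q) × (Fin p ⊕ Fin q) → A) {M : ℝ} (hM : 0 ≤ M) (hF : ∀ γ ∈ s, ‖F γ‖ ≤ M)
    (hG : ∀ e ∈ twins p q, ‖G e‖ ≤ M) :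
    ‖∑ γ ∈ s, F γ - ∑ e ∈ twins p q, G e‖ ≤ edgeCount p q * M := by
  have h1 : ‖∑ γ ∈ s, F γ‖ ≤ (p * q : ℕ) * M := by
    refine (norm_sum_le_of_le _ hF).trans ?_
    rw [Finset.sum_const, nsmul_eq_mul]
    refine mul_le_mul_of_nonneg_right ?_ hM
    exact_mod_cast (by simpa using Finset.card_le_univ s : s.card ≤ p * q)
  have h2 : ‖∑ e ∈ twins p q, G e‖ ≤ (twins p q).card * M := by
    refine (norm_sum_le_of_le _ hG).trans ?_
    rw [Finset.sum_const, nsmul_eq_mul]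
  rw [edgeCount, add_mul]
  exact (norm_sub_le _ _).trans (add_le_add h1 h2)

theorem norm_interactionGen_le (z : ℝ) :
    ‖interactionGen (d := d) ν κ p q z‖ ≤ edgeCount p q * ν.real univ :=
  norm_sum_interactions_le _ _ _ measureReal_nonneg (fun γ _ => (pair d κ γ).norm_gen_le ν z)
    fun e _ => (edge κ e.1 e.2).norm_gen_le ν z

theorem norm_momentGen_le {a : ℝ} (ha : 0 ≤ a) (z : ℝ) :
    ‖momentGen (d := d) (p := p) (q := q) ν κ a z‖ ≤ edgeCount p q * ν.real univ + a := by
  have h : ‖(a : ℂ) • (1 : Op (Config p q d))‖ ≤ a := by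
    rw [norm_smul, Complex.norm_real, Real.norm_eq_abs, abs_of_nonneg ha]
    simpa using mul_le_mul_of_nonneg_left Op.norm_one_le ha
  exact (norm_sub_le _ _).trans (add_le_add (norm_interactionGen_le z) h)

variable (ν κ z δ p q) in
/-- The integrated interactions of twins, and the products of interactions that share one block,
are bounded by `δ`. -/
structure Small : Prop where
  twin : ∀ e ∈ twins p q, ‖(edge κ e.1 e.2).int ν z‖ ≤ δ
  gen_int : ∀ γ γ' : Fin p × Fin q, γ ≠ γ' → (γ.1 = γ'.1 ∨ γ.2 = γ'.2) →
    ‖(pair d κ γ').gen ν z * (pair d κ γ).int ν z‖ ≤ δ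
  int_int : ∀ γ γ' : Fin p × Fin q, γ ≠ γ' → (γ.1 = γ'.1 ∨ γ.2 = γ'.2) →
    ‖(pair d κ γ').int ν z * (pair d κ γ).int ν z‖ ≤ δ

/-- The bound of `int_int` carries over from the integrated interaction to its exponential, minus `1`. -/
theorem Small.cross_int (h : Small p q ν κ z δ) (hz : z ∈ Icc 0 Z)
    (hE : Real.exp (Z * ν.real univ) + 1 ≤ E) {γ γ' : Fin p × Fin q} (hne : γ ≠ γ')
    (hs : γ.1 = γ'.1 ∨ γ.2 = γ'.2) :
    ‖cross ν κ z γ' * (pair d κ γ).int ν z‖ ≤ E * δ := by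
  refine (norm_exp_sub_one_mul_le _ _).trans ?_
  have h1 := h.int_int γ γ' hne hs
  have h2 := (pair d κ γ').norm_int_le ν z
  rw [abs_of_nonneg hz.1] at h2
  have h3 : Real.exp ‖(pair d κ γ').int ν z‖ ≤ E := by
    have : Real.exp ‖(pair d κ γ').int ν z‖ ≤ Real.exp (Z * ν.real univ) :=
      Real.exp_le_exp.2 (h2.trans (mul_le_mul_of_nonneg_right hz.2 measureReal_nonneg))
    linarith
  exact mul_le_mul h3 h1 (norm_nonneg _) ((Real.exp_nonneg _).trans h3)

/-- The correction is small: for a twin the integrated interaction is small itself, and an integrated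
conflicting interaction is small next to the factor of a pair with which it shares one block. -/
theorem Small.norm_crossProd_mul_defect_le (h : Small p q ν κ z δ) (hδ : 0 ≤ δ)
    (hz : z ∈ Icc 0 Z) (hE : Real.exp (Z * ν.real univ) + 1 ≤ E) {s : Finset (Fin p × Fin q)}
    (hs : IsMatching s) :
    ‖crossProd (d := d) ν κ z s * defect ν κ z s‖ ≤ edgeCount p q * (E ^ (p * q) * (E * δ)) := by
  have hE1 : 1 ≤ E := by linarith [Real.exp_pos (Z * ν.real univ)]
  rw [defect, mul_sub, Finset.mul_sum, Finset.mul_sum]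
  refine norm_sum_interactions_le _ _ _ (by positivity) (fun γ hγ => ?_) fun e he => ?_
  · obtain ⟨γ', hγ', hne, hsh⟩ := hs.exists_conflict hγ
    rw [crossProd_erase hγ' hs, mul_assoc]
    exact (norm_mul_le _ _).trans (mul_le_mul
      ((hs.mono (Finset.erase_subset _ _)).norm_crossProd_le_of_mem hz hE)
      (h.cross_int hz hE hne hsh) (norm_nonneg _) (by positivity))
  · refine (norm_mul_le _ _).trans (mul_le_mul (hs.norm_crossProd_le_of_mem hz hE)
      ((h.twin e he).trans ?_) (norm_nonneg _) (by positivity))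
    nlinarith

/-- As `norm_crossProd_mul_defect_le`, when one factor of the product is differentiated. If this is the
factor in conflict, its generator takes the place of the factor in the estimate. -/
theorem Small.norm_crossDeriv_mul_defect_le (h : Small p q ν κ z δ) (hδ : 0 ≤ δ)
    (hz : z ∈ Icc 0 Z) (hE : Real.exp (Z * ν.real univ) + 1 ≤ E) {s : Finset (Fin p × Fin q)}
    (hs : IsMatching s) :
    ‖crossDeriv (d := d) ν κ z s * defect ν κ z s‖ ≤
      (p * q : ℕ) * (edgeCount p q * (E ^ (p * q) * (E * ((1 + ν.real univ * E) * δ)))) := by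
  classical
  have hE1 : 1 ≤ E := by linarith [Real.exp_pos (Z * ν.real univ)]
  have hr : 0 ≤ ν.real univ := measureReal_nonneg
  have hec := edgeCount_nonneg p q
  rw [crossDeriv, Finset.sum_mul]
  have hterm : ∀ γ' ∈ s, ‖crossProd (d := d) ν κ z (s.erase γ') *
      ((pair d κ γ').prop ν z * (pair d κ γ').gen ν z) * defect ν κ z s‖ ≤
      edgeCount p q * (E ^ (p * q) * (E * ((1 + ν.real univ * E) * δ))) := by
    intro γ' hγ'
    have hse := hs.mono (Finset.erase_subset γ' s)
    have hP := hse.norm_crossProd_le_of_mem (d := d) (κ := κ) hz hE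
    have hT := norm_prop_le_of_mem (d := d) (κ := κ) hz hE γ'
    have hg := (pair d κ γ').norm_gen_le ν z
    -- the order in which the factors are estimated
    have hassoc : ∀ Y : Op (Config p q d), crossProd ν κ z (s.erase γ') *
        ((pair d κ γ').prop ν z * (pair d κ γ').gen ν z) * Y = crossProd ν κ z (s.erase γ') *
          ((pair d κ γ').prop ν z * ((pair d κ γ').gen ν z * Y)) := fun Y => by
      simp only [mul_assoc]
    have hbound : ∀ Y : Op (Config p q d), ‖(pair d κ γ').gen ν z * Y‖ ≤
        (1 + ν.real univ * E) * δ → ‖crossProd ν κ z (s.erase γ') *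
        ((pair d κ γ').prop ν z * (pair d κ γ').gen ν z) * Y‖ ≤
          E ^ (p * q) * (E * ((1 + ν.real univ * E) * δ)) := fun Y hY => by
      rw [hassoc]
      exact (norm_mul_le _ _).trans (mul_le_mul hP ((norm_mul_le _ _).trans
        (mul_le_mul hT hY (norm_nonneg _) (by positivity))) (norm_nonneg _) (by positivity))
    rw [defect, mul_sub, Finset.mul_sum, Finset.mul_sum]
    refine norm_sum_interactions_le _ _ _ (by positivity) (fun γ hγ => ?_) fun e he => ?_
    · obtain ⟨γ'', hγ'', hne, hsh⟩ := hs.exists_conflict hγ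
      rcases eq_or_ne γ'' γ' with rfl | hne'
      · refine hbound _ ((h.gen_int γ γ'' hne hsh).trans ?_)
        have : 0 ≤ ν.real univ * E * δ := by positivity
        nlinarith
      · -- the factor of the conflicting pair is moved next to the integrated interaction
        have hmem : γ'' ∈ s.erase γ' := Finset.mem_erase.2 ⟨hne', hγ''⟩
        obtain ⟨h1, h2⟩ := hs γ'' hγ'' γ' hγ' hne'
        have hcomm := IsMatching.commute_cross_prop_gen (d := d) ν κ h1 h2 z
        have hre : crossProd (d := d) ν κ z (s.erase γ') *
            ((pair d κ γ').prop ν z * (pair d κ γ').gen ν z) * (pair d κ γ).int ν z =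
            crossProd ν κ z ((s.erase γ').erase γ'') * ((pair d κ γ').prop ν z *
              ((pair d κ γ').gen ν z * (cross ν κ z γ'' * (pair d κ γ).int ν z))) := by
          rw [crossProd_erase hmem hse, mul_assoc _ (cross ν κ z γ''), hcomm.eq]
          simp only [mul_assoc]
        rw [hre]
        have hP' := (hse.mono (Finset.erase_subset γ'' _)).norm_crossProd_le_of_mem (d := d)
          (κ := κ) hz hE
        have hc := h.cross_int hz hE hne hsh
        have hgc : ‖(pair d κ γ').gen ν z * (cross ν κ z γ'' * (pair d κ γ).int ν z)‖ ≤
            (1 + ν.real univ * E) * δ := by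
          refine (norm_mul_le _ _).trans ((mul_le_mul hg hc (norm_nonneg _) hr).trans ?_)
          nlinarith
        exact (norm_mul_le _ _).trans (mul_le_mul hP' ((norm_mul_le _ _).trans
          (mul_le_mul hT hgc (norm_nonneg _) (by positivity))) (norm_nonneg _) (by positivity))
    · refine hbound _ ((norm_mul_le _ _).trans ((mul_le_mul hg (h.twin e he) (norm_nonneg _)
        hr).trans ?_))
      have : 0 ≤ ν.real univ * δ := by positivity
      nlinarith
  refine (norm_sum_le_of_le _ hterm).trans ?_
  rw [Finset.sum_const, nsmul_eq_mul]
  refine mul_le_mul_of_nonneg_right ?_ (by positivity)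
  exact_mod_cast (by simpa using Finset.card_le_univ s : s.card ≤ p * q)

end Estimates


/-! ### The error in the dual variables -/

section ErrorBound

variable {d p q : ℕ} {reg : Regime} {R : Lat d → ℝ}

theorem crossProd_zero_of_nonempty (ν : Measure (Lat d)) [IsFiniteMeasure ν] (κ : ℝ)
    {s : Finset (Fin p × Fin q)} (hs : IsMatching s) (hne : s.Nonempty) :
    crossProd (d := d) ν κ 0 s = 0 := by
  obtain ⟨γ, hγ⟩ := hne
  rw [crossProd_erase hγ hs, cross, Interaction.prop_zero, sub_self, mul_zero]

theorem correctedDual_zero (ν : Measure (Lat d)) [IsFiniteMeasure ν] (κ a : ℝ) :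
    correctedDual (d := d) (p := p) (q := q) ν κ a 0 = 1 := by
  have h0 : ∀ s, defect (d := d) (p := p) (q := q) ν κ 0 s = 0 := fun s => by
    simp [defect]
  rw [correctedDual, Finset.sum_eq_single ∅]
  · simp [h0]
  · intro s hs hne
    rw [crossProd_zero_of_nonempty ν κ (mem_matchings.1 hs) (Finset.nonempty_iff_ne_empty.2 hne),
      zero_mul]
  · intro h
    exact absurd (mem_matchings.2 fun γ hγ => by simp at hγ) h

/-- The bound of `residual`, with `r` the total mass and `δ` the bound of `Small`. -/
def residualBound (p q : ℕ) (E r δ : ℝ) : ℝ :=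
  (matchings p q).card *
    ((p * q : ℕ) * (edgeCount p q * (E ^ (p * q) * (E * ((1 + r * E) * δ)))) +
      edgeCount p q * (E ^ (p * q) * (E * δ)) * (edgeCount p q * r))

/-- Each term of the residual contains a small product. -/
theorem Small.norm_residual_le {ν : Measure (Lat d)} [IsFiniteMeasure ν] {κ Z z δ E a : ℝ}
    (h : Small p q ν κ z δ) (hδ : 0 ≤ δ) (hz : z ∈ Icc 0 Z)
    (hE : Real.exp (Z * ν.real univ) + 1 ≤ E) (ha : 0 ≤ a) :
    ‖residual (d := d) ν κ p q a z‖ ≤ residualBound p q E (ν.real univ) δ := by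
  have hE1 : 1 ≤ E := by linarith [Real.exp_pos (Z * ν.real univ)]
  have hec := edgeCount_nonneg p q
  have hexp : Real.exp (-(a * z)) ≤ 1 :=
    Real.exp_le_one_iff.2 (neg_nonpos.2 (mul_nonneg ha hz.1))
  rw [residual, norm_smul, Complex.norm_real, Real.norm_eq_abs, Real.abs_exp]
  refine (mul_le_of_le_one_left (norm_nonneg _) hexp).trans ((norm_sum_le_of_le (f := fun s =>
    crossDeriv ν κ z s * defect ν κ z s - crossProd ν κ z s * defect ν κ z s *
      interactionGen ν κ p q z) _ fun s hs => ?_).trans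
      (le_of_eq (by rw [Finset.sum_const, nsmul_eq_mul, residualBound])))
  have hs := mem_matchings.1 hs
  refine (norm_sub_le _ _).trans (add_le_add (h.norm_crossDeriv_mul_defect_le hδ hz hE hs) ?_)
  exact (norm_mul_le _ _).trans (mul_le_mul (h.norm_crossProd_mul_defect_le hδ hz hE hs)
    (norm_interactionGen_le z) (norm_nonneg _) (by positivity))

theorem Small.norm_correctedDual_sub_le {ν : Measure (Lat d)} [IsFiniteMeasure ν]
    {κ Z z δ E a : ℝ} (h : Small p q ν κ z δ) (hδ : 0 ≤ δ) (hz : z ∈ Icc 0 Z)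
    (hE : Real.exp (Z * ν.real univ) + 1 ≤ E) (ha : 0 ≤ a) :
    ‖correctedDual (d := d) (p := p) (q := q) ν κ a z - gaussDual ν κ a z‖ ≤
      (matchings p q).card * (edgeCount p q * (E ^ (p * q) * (E * δ))) := by
  have hexp : Real.exp (-(a * z)) ≤ 1 :=
    Real.exp_le_one_iff.2 (neg_nonpos.2 (mul_nonneg ha hz.1))
  rw [correctedDual, gaussDual, ← smul_sub, ← Finset.sum_sub_distrib, norm_smul,
    Complex.norm_real, Real.norm_eq_abs, Real.abs_exp]
  refine (mul_le_of_le_one_left (norm_nonneg _) hexp).trans ((norm_sum_le_of_le (f := fun s =>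
    crossProd ν κ z s * (1 + defect ν κ z s) - crossProd ν κ z s) _ fun s hs => ?_).trans
      (le_of_eq (by rw [Finset.sum_const, nsmul_eq_mul])))
  rw [mul_add, mul_one, add_sub_cancel_left]
  exact h.norm_crossProd_mul_defect_le hδ hz hE (mem_matchings.1 hs)

/-- Comparison of a solution of the moment equation, in the frame of the free propagation, with the
corrected Gaussian approximation. -/
theorem norm_sub_correctedDual_le {ν : Measure (Lat d)} [IsFiniteMeasure ν] {κ Z δ E a : ℝ}
    {m : ℝ → ComplexMeasure (Config p q d)} (hm : ∃ C : ℝ, ∀ z ∈ Icc 0 Z, tv (m z) ≤ C)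
    (hder : ∀ f ∈ testFunctions p q d, ∀ z : ℝ, 0 ≤ z →
      HasDerivWithinAt (fun w => integ (m w) (rotate κ w f))
        (integ (m z) (rotate κ z (momentGen ν κ a z f))) (Ici 0) z)
    (ha : a = ((p : ℝ) + q) / 2 * ν.real univ)
    (hδ : 0 ≤ δ) (hE : Real.exp (Z * ν.real univ) + 1 ≤ E)
    (hsmall : ∀ z ∈ Icc 0 Z, Small (d := d) p q ν κ z δ)
    {z : ℝ} (hz : z ∈ Icc 0 Z) {f : Bdd (Config p q d)} (hf : Continuous (f : Config p q d → ℂ)) :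
    ‖integ (m z) (rotate κ z f) -
        integ (m 0) (correctedDual (p := p) (q := q) ν κ a z f)‖ ≤
      tv (m 0) * residualBound p q E (ν.real univ) δ * z *
        Real.exp ((edgeCount p q * ν.real univ + a) * z) * ‖f‖ := by
  have hr : 0 ≤ ν.real univ := measureReal_nonneg
  have ha0 : 0 ≤ a := by rw [ha]; positivity
  obtain ⟨C, hC⟩ := hm
  have hC0 : 0 ≤ C := (tv_nonneg _).trans (hC z hz)
  have hE1 : 1 ≤ E := by linarith [Real.exp_pos (Z * ν.real univ)]
  have hec := edgeCount_nonneg p q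
  have hres : 0 ≤ residualBound p q E (ν.real univ) δ := by unfold residualBound; positivity
  -- a crude bound of the corrected approximation, only needed to be finite
  have hNb : ∀ w ∈ Icc 0 Z, ‖correctedDual (d := d) (p := p) (q := q) ν κ a w‖ ≤
      (matchings p q).card * (edgeCount p q * (E ^ (p * q) * (E * δ))) +
        (matchings p q).card * 2 ^ (p * q) := by
    intro w hw
    have h1 := (hsmall w hw).norm_correctedDual_sub_le hδ hw hE ha0
    have h2 := norm_gaussDual_le (d := d) (p := p) (q := q) (ν := ν) (κ := κ) hw.1
    rw [← ha] at h2
    have h3 := norm_add_le (correctedDual (d := d) (p := p) (q := q) ν κ a w - gaussDual ν κ a w)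
      (gaussDual ν κ a w)
    rw [sub_add_cancel] at h3
    exact h3.trans (add_le_add h1 h2)
  set K := (matchings p q).card * (edgeCount p q * (E ^ (p * q) * (E * δ))) +
        (matchings p q).card * 2 ^ (p * q) with hK
  have hK0 : 0 ≤ K := by positivity
  refine gronwall_functional (e := fun w f => integ (m w) (rotate κ w f) -
      integ (m 0) (correctedDual (p := p) (q := q) ν κ a w f))
    (L := fun w f => momentGen (p := p) (q := q) ν κ a w f)
    (s := fun w f => -integ (m 0) (residual ν κ p q a w f))
    (D := testFunctions p q d) (G := {f | Continuous (f : Config p q d → ℂ)}) (Z := Z)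
    (M := C + tv (m 0) * K) (Λ := edgeCount p q * ν.real univ + a)
    (φ := tv (m 0) * residualBound p q E (ν.real univ) δ)
    (add_nonneg hC0 (mul_nonneg (tv_nonneg _) hK0)) (by positivity)
    (mul_nonneg (tv_nonneg _) hres) ?_ ?_ ?_ ?_ ?_ ?_ z hz f hf
  · intro f _
    rw [rotate_zero, correctedDual_zero, Op.one_apply, sub_self]
  · intro w hw f _
    rw [add_mul]
    refine (norm_sub_le _ _).trans (add_le_add ((norm_integ_le _ _).trans
      (mul_le_mul (hC w hw) (norm_rotate_le _ _ _) (norm_nonneg _) hC0))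
      ((norm_integ_le _ _).trans ?_))
    rw [mul_assoc]
    exact mul_le_mul_of_nonneg_left ((Op.le_norm _ _).trans
      (mul_le_mul_of_nonneg_right (hNb w hw) (norm_nonneg _))) (tv_nonneg _)
  · intro w _ f hf
    exact ⟨continuous_momentGen ν κ a w hf.2.continuous, (Op.le_norm _ _).trans
      (mul_le_mul_of_nonneg_right (norm_momentGen_le ha0 w) (norm_nonneg _))⟩
  · intro w hw f _
    rw [norm_neg, mul_assoc]
    refine (norm_integ_le _ _).trans (mul_le_mul_of_nonneg_left ((Op.le_norm _ _).trans
      (mul_le_mul_of_nonneg_right ((hsmall w hw).norm_residual_le hδ hw hE ha0)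
        (norm_nonneg _))) (tv_nonneg _))
  · intro f hf w hw
    have h1 := hder f hf w hw
    have h2 := ((wDerivAt_correctedDual (p := p) (q := q) ν κ a w).cint (m 0) f).hasDerivWithinAt
      (s := Ici 0)
    refine (h1.sub h2).congr_deriv ?_
    rw [← integ_apply, Op.add_apply, Op.mul_apply, map_add]
    ring
  · intro f hf w _
    obtain ⟨F, hF, hlim⟩ := exists_testFunctions_tendsto hf
    refine ⟨F, hF, (tendsto_integ_rotate (m w) κ w (fun n => (hF n).2) hlim).sub ?_⟩
    have hmem := (wDerivAt_correctedDual (d := d) (p := p) (q := q) ν κ a w).mem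
    refine cint_tendsto (m 0) (C := ‖correctedDual (d := d) (p := p) (q := q) ν κ a w‖ * ‖f‖)
      (Eventually.of_forall fun n => Bdd.measurable _)
      (Eventually.of_forall fun n v => ?_) (hmem F f ‖f‖ (fun n => (hF n).2) hlim)
    exact (Op.norm_apply_apply_le _ _ v).trans
      (mul_le_mul_of_nonneg_left (hF n).2 (norm_nonneg _))

/-- Nonnegative functions of exponential growth on `[0, ∞)`. -/
def ExpGrowth (F : ℝ → ℝ) : Prop :=
  ∃ A : ℝ, 0 ≤ A ∧ ∀ c, 0 ≤ c → 0 ≤ F c ∧ F c ≤ A * Real.exp (A * c)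

namespace ExpGrowth

theorem const {K : ℝ} (hK : 0 ≤ K) : ExpGrowth fun _ => K :=
  ⟨K, hK, fun _ hc => ⟨hK, le_mul_of_one_le_right hK (Real.one_le_exp (mul_nonneg hK hc))⟩⟩

theorem id : ExpGrowth fun c => c :=
  ⟨1, zero_le_one, fun c hc => ⟨hc, by linarith [Real.add_one_le_exp (1 * c)]⟩⟩

theorem exp {F : ℝ → ℝ} {K : ℝ} (hF : ∀ c, F c = K * c) :
    ExpGrowth fun c => Real.exp (F c) :=
  ⟨max 1 K, by positivity, fun c hc => ⟨Real.exp_nonneg _, by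
    simp only [hF]
    have h1 : Real.exp (K * c) ≤ Real.exp (max 1 K * c) :=
      Real.exp_le_exp.2 (mul_le_mul_of_nonneg_right (le_max_right _ _) hc)
    exact h1.trans (le_mul_of_one_le_left (Real.exp_nonneg _) (le_max_left _ _))⟩⟩

theorem add {F G : ℝ → ℝ} (hF : ExpGrowth F) (hG : ExpGrowth G) :
    ExpGrowth fun c => F c + G c := by
  obtain ⟨A, hA, hF⟩ := hF
  obtain ⟨B, hB, hG⟩ := hG
  refine ⟨A + B, add_nonneg hA hB, fun c hc => ⟨add_nonneg (hF c hc).1 (hG c hc).1, ?_⟩⟩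
  have h1 : Real.exp (A * c) ≤ Real.exp ((A + B) * c) :=
    Real.exp_le_exp.2 (mul_le_mul_of_nonneg_right (by linarith) hc)
  have h2 : Real.exp (B * c) ≤ Real.exp ((A + B) * c) :=
    Real.exp_le_exp.2 (mul_le_mul_of_nonneg_right (by linarith) hc)
  rw [add_mul]
  exact add_le_add ((hF c hc).2.trans (mul_le_mul_of_nonneg_left h1 hA))
    ((hG c hc).2.trans (mul_le_mul_of_nonneg_left h2 hB))

theorem mul {F G : ℝ → ℝ} (hF : ExpGrowth F) (hG : ExpGrowth G) :
    ExpGrowth fun c => F c * G c := by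
  obtain ⟨A, hA, hF⟩ := hF
  obtain ⟨B, hB, hG⟩ := hG
  refine ⟨A + B + A * B, by positivity, fun c hc =>
    ⟨mul_nonneg (hF c hc).1 (hG c hc).1, ?_⟩⟩
  calc F c * G c ≤ A * Real.exp (A * c) * (B * Real.exp (B * c)) :=
        mul_le_mul (hF c hc).2 (hG c hc).2 (hG c hc).1 (by positivity)
    _ = A * B * Real.exp ((A + B) * c) := by rw [add_mul, Real.exp_add]; ring
    _ ≤ (A + B + A * B) * Real.exp ((A + B + A * B) * c) := by
        have hAB := mul_nonneg hA hB
        exact mul_le_mul (by linarith) (Real.exp_le_exp.2 (mul_le_mul_of_nonneg_right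
          (by linarith) hc)) (Real.exp_nonneg _) (by positivity)

theorem pow {F : ℝ → ℝ} (hF : ExpGrowth F) (n : ℕ) : ExpGrowth fun c => F c ^ n := by
  induction n with
  | zero => simpa using const zero_le_one
  | succ n ih => simpa only [pow_succ] using ih.mul hF

end ExpGrowth

/-- The error of the Gaussian approximation, in the dual variables. The constant is of exponential
growth in the strength `k₀² / (4η²)` of the interactions, which is unbounded in the diffusive
regime. -/
theorem exists_dual_error (hd : 1 ≤ d) (h : IsCovariance reg R) (p q : ℕ) {Z : ℝ} (hZ : 0 ≤ Z) :
    ∃ F : ℝ → ℝ, ExpGrowth F ∧ ∀ k₀ η ε : ℝ, 0 < η / (k₀ * ε) →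
      ∀ _ : IsFiniteMeasure (medium (k₀ ^ 2 / (4 * η ^ 2)) R),
      ∀ m : ℝ → ComplexMeasure (Config p q d), IsMomentSolution k₀ R η ε m →
      ∀ z ∈ Icc 0 Z, ∀ f : Bdd (Config p q d), Continuous (f : Config p q d → ℂ) →
      ‖integ (m z) (rotate (η / (k₀ * ε)) z f) - integ (m 0) (gaussDual (p := p) (q := q)
        (medium (k₀ ^ 2 / (4 * η ^ 2)) R) (η / (k₀ * ε))
          (((p : ℝ) + q) / 2 * (k₀ ^ 2 / (4 * η ^ 2) * R 0)) z f)‖ ≤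
      F (k₀ ^ 2 / (4 * η ^ 2)) * (η / (k₀ * ε)) ^ (-(2 / 5) : ℝ) * tv (m 0) * ‖f‖ := by
  obtain ⟨B, hB, hsm⟩ := h.exists_smallness hd p q
  have hR0 := h.apply_zero_nonneg hd
  have hec := edgeCount_nonneg p q
  let E : ℝ → ℝ := fun c => Real.exp (Z * (c * R 0)) + 1
  let D : ℝ → ℝ := fun c => (1 + Z) * (B * (Z + 2)) * (c + c ^ 2)
  let Λ : ℝ → ℝ := fun c => (edgeCount p q * (c * R 0) + ((p : ℝ) + q) / 2 * (c * R 0)) * Z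
  have gE : ExpGrowth E := (ExpGrowth.exp (K := Z * R 0) fun c => by ring).add
    (ExpGrowth.const zero_le_one)
  have gD : ExpGrowth D := (ExpGrowth.const (by positivity)).mul
    (ExpGrowth.id.add (ExpGrowth.id.pow 2))
  have gr : ExpGrowth fun c => c * R 0 := ExpGrowth.id.mul (ExpGrowth.const hR0)
  have gΛ : ExpGrowth fun c => Real.exp (Λ c) :=
    ExpGrowth.exp (K := (edgeCount p q * R 0 + ((p : ℝ) + q) / 2 * R 0) * Z)
      fun c => by ring
  have g1 : ExpGrowth fun c => residualBound p q (E c) (c * R 0) (D c) := by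
    unfold residualBound
    have gk : ∀ {K : ℝ}, 0 ≤ K → ExpGrowth fun _ => K := fun hK => ExpGrowth.const hK
    exact (gk (by positivity)).mul (((gk (by positivity)).mul ((gk hec).mul ((gE.pow _).mul
      (gE.mul (((gk zero_le_one).add (gr.mul gE)).mul gD))))).add
      (((gk hec).mul ((gE.pow _).mul (gE.mul gD))).mul ((gk hec).mul gr)))
  have g2 : ExpGrowth fun c =>
      (matchings p q).card * (edgeCount p q * (E c ^ (p * q) * (E c * D c))) :=
    (ExpGrowth.const (by positivity)).mul ((ExpGrowth.const hec).mul
      ((gE.pow _).mul (gE.mul gD)))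
  refine ⟨fun c => residualBound p q (E c) (c * R 0) (D c) * Z * Real.exp (Λ c) +
    (matchings p q).card * (edgeCount p q * (E c ^ (p * q) * (E c * D c))),
    ((g1.mul (ExpGrowth.const hZ)).mul gΛ).add g2, fun k₀ η ε hκ inst m hm z hz f hf => ?_⟩
  have hc : 0 ≤ k₀ ^ 2 / (4 * η ^ 2) := by positivity
  have hmass : (medium (k₀ ^ 2 / (4 * η ^ 2)) R).real univ = k₀ ^ 2 / (4 * η ^ 2) * R 0 :=
    h.medium_real_univ hd (by positivity)
  have hder := fun (f : Bdd (Config p q d)) (hf : f ∈ testFunctions p q d) (z : ℝ) (hz : 0 ≤ z) =>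
    hm.hasDerivWithinAt_rotate hd h hf hz
  set c := k₀ ^ 2 / (4 * η ^ 2) with hcdef
  set κ := η / (k₀ * ε) with hκdef
  set θ := κ ^ (-(2 / 5) : ℝ) with hθ
  have hθ0 : 0 ≤ θ := Real.rpow_nonneg hκ.le _
  set δ := D c * θ with hδdef
  have hδ : 0 ≤ δ := by positivity
  have hsmall : ∀ w ∈ Icc 0 Z, Small (d := d) p q (medium c R) κ w δ := by
    intro w hw
    obtain ⟨h1, h2⟩ := hsm c hc inst Z w hw κ hκ
    have hBZ : 0 ≤ B * (Z + 2) := by positivity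
    have hX : 0 ≤ B * (Z + 2) * c * θ := by positivity
    have hY : 0 ≤ B * (Z + 2) * c ^ 2 * θ := by positivity
    have hδe : δ = (1 + Z) * (B * (Z + 2) * c * θ) + (1 + Z) * (B * (Z + 2) * c ^ 2 * θ) := by
      simp only [hδdef, D]; ring
    have hZX := mul_nonneg hZ hX
    have hZY := mul_nonneg hZ hY
    refine ⟨fun e he => (h1 e.1 e.2 (twins_ne he) (twins_sgn he)).trans ?_,
      fun γ γ' hne hs => (h2 γ γ' hne hs).1.trans ?_,
      fun γ γ' hne hs => (h2 γ γ' hne hs).2.trans ?_⟩ <;> rw [hδe] <;> linarith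
  set a := ((p : ℝ) + q) / 2 * (c * R 0) with ha
  have ha0 : 0 ≤ a := by positivity
  have hE : Real.exp (Z * (c * R 0)) + 1 ≤ E c := le_rfl
  have e1 := norm_sub_correctedDual_le (hm.bounded Z) hder (by rw [hmass, ha]) hδ
    (by rw [hmass]) hsmall hz hf (E := E c)
  rw [hmass] at e1
  have e2 := (hsmall z hz).norm_correctedDual_sub_le hδ hz (by rw [hmass]) ha0 (E := E c)
  have htv := tv_nonneg (m 0)
  have e3 : ‖integ (m 0) (correctedDual (p := p) (q := q) (medium c R) κ a z f) -
      integ (m 0) (gaussDual (p := p) (q := q) (medium c R) κ a z f)‖ ≤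
      tv (m 0) * ((matchings p q).card * (edgeCount p q * (E c ^ (p * q) * (E c * δ))) * ‖f‖) := by
    rw [← map_sub, ← Op.sub_apply]
    exact (norm_integ_le _ _).trans (mul_le_mul_of_nonneg_left ((Op.le_norm _ _).trans
      (mul_le_mul_of_nonneg_right e2 (norm_nonneg _))) htv)
  have hE0 : 0 ≤ E c := by positivity
  -- `residualBound` is linear in its last argument
  have hresδ : residualBound p q (E c) (c * R 0) δ =
      residualBound p q (E c) (c * R 0) (D c) * θ := by
    simp only [residualBound, hδdef]; ring
  have hres0 : 0 ≤ residualBound p q (E c) (c * R 0) δ := by unfold residualBound; positivity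
  have e4 : tv (m 0) * residualBound p q (E c) (c * R 0) δ * z *
      Real.exp ((edgeCount p q * (c * R 0) + a) * z) * ‖f‖ ≤
      tv (m 0) * residualBound p q (E c) (c * R 0) δ * Z * Real.exp (Λ c) * ‖f‖ := by
    have : Real.exp ((edgeCount p q * (c * R 0) + a) * z) ≤ Real.exp (Λ c) :=
      Real.exp_le_exp.2 (mul_le_mul_of_nonneg_left hz.2 (by positivity))
    have hz0 := hz.1
    have hz2 := hz.2
    gcongr
  calc _ ≤ ‖integ (m z) (rotate κ z f) - integ (m 0) (correctedDual (p := p) (q := q)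
          (medium c R) κ a z f)‖ + ‖integ (m 0) (correctedDual (p := p) (q := q)
          (medium c R) κ a z f) - integ (m 0) (gaussDual (p := p) (q := q)
          (medium c R) κ a z f)‖ := norm_sub_le_norm_sub_add_norm_sub _ _ _
    _ ≤ _ := add_le_add (e1.trans e4) e3
    _ = _ := by rw [hresδ, hδdef]; ring

end ErrorBound


/-! ### Scaling of the error, and the physical variables -/

section Scaling

variable {d p q : ℕ} {reg : Regime} {R : Lat d → ℝ}

theorem Regime.pos_of_mem_range {ε : ℝ} (hε : ε ∈ reg.range) : 0 < ε := by
  cases reg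
  · exact hε.1
  · exact hε.1

theorem Regime.le_one_of_mem_range {ε : ℝ} (hε : ε ∈ reg.range) : ε ≤ 1 := by
  cases reg
  · exact hε.2
  · exact hε.2.le.trans (Real.exp_le_one_iff.2 (by norm_num))

theorem log_abs_log_pos {ε : ℝ} (hε : ε ∈ Ioo 0 (Real.exp (-1))) :
    0 < Real.log |Real.log ε| ∧ Real.exp (Real.log |Real.log ε|) = -Real.log ε := by
  have h1 : Real.log ε < -1 := (Real.log_lt_iff_lt_exp hε.1).2 hε.2
  have h2 : |Real.log ε| = -Real.log ε := abs_of_neg (by linarith)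
  rw [h2]
  exact ⟨Real.log_pos (by linarith), Real.exp_log (by linarith)⟩

theorem Regime.eta_pos {ε : ℝ} (hε : ε ∈ reg.range) : 0 < reg.eta ε := by
  cases reg
  · exact one_pos
  · exact inv_pos.2 (log_abs_log_pos hε).1

theorem mul_sq_le_cube_add {M x : ℝ} (hM : 0 ≤ M) (hx : 0 ≤ x) :
    M * x ^ 2 ≤ x ^ 3 / 180 + M * (180 * M) ^ 2 := by
  rcases le_total x (180 * M) with h | h
  · have : M * x ^ 2 ≤ M * (180 * M) ^ 2 := by gcongr
    have : 0 ≤ x ^ 3 / 180 := by positivity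
    linarith
  · have h1 : M * x ^ 2 ≤ x / 180 * x ^ 2 :=
      mul_le_mul_of_nonneg_right (by linarith) (sq_nonneg x)
    have h2 : 0 ≤ M * (180 * M) ^ 2 := by positivity
    have h3 : x / 180 * x ^ 2 = x ^ 3 / 180 := by ring
    linarith

/-- The double logarithm is slow enough for exponentials of its square to be absorbed by a small
power of `ε`. -/
theorem ExpGrowth.exists_scaling_bound {F : ℝ → ℝ} (hF : ExpGrowth F) (reg : Regime) {k₀ : ℝ}
    (hk : 0 < k₀) : ∃ C : ℝ, 0 ≤ C ∧ ∀ ε ∈ reg.range,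
      F (k₀ ^ 2 / (4 * reg.eta ε ^ 2)) * (reg.eta ε / (k₀ * ε)) ^ (-(2 / 5) : ℝ) ≤
        C * ε ^ (11 / 30 : ℝ) := by
  obtain ⟨A, hA, hF⟩ := hF
  have hε1 : ∀ {ε : ℝ}, ε ∈ reg.range → ε ^ (2 / 5 : ℝ) = ε ^ (11 / 30 : ℝ) * ε ^ (1 / 30 : ℝ) :=
    fun hε => by rw [← Real.rpow_add (Regime.pos_of_mem_range hε)]; norm_num
  cases reg with
  | kinetic =>
    refine ⟨F (k₀ ^ 2 / (4 * 1 ^ 2)) * k₀ ^ (2 / 5 : ℝ),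
      mul_nonneg (hF _ (by positivity)).1 (by positivity), fun ε hε => ?_⟩
    have hε0 : 0 < ε := hε.1
    simp only [Regime.eta]
    rw [one_div, Real.inv_rpow (by positivity), Real.rpow_neg (by positivity), inv_inv,
      Real.mul_rpow hk.le hε0.le, hε1 hε, ← mul_assoc, ← mul_assoc]
    refine mul_le_of_le_one_right (mul_nonneg (mul_nonneg (hF _ (by positivity)).1
      (by positivity)) (by positivity)) (Real.rpow_le_one hε0.le hε.2 (by norm_num))
  | diffusive =>
    set M := A * k₀ ^ 2 / 4 + 1 with hM
    have hM0 : 0 ≤ M := by positivity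
    refine ⟨A * k₀ ^ (2 / 5 : ℝ) * Real.exp (M * (180 * M) ^ 2 + 1), by positivity,
      fun ε hε => ?_⟩
    have hε0 : 0 < ε := hε.1
    obtain ⟨hx0, hx⟩ := log_abs_log_pos hε
    simp only [Regime.eta]
    set x := Real.log |Real.log ε| with hxdef
    have e1 : k₀ ^ 2 / (4 * x⁻¹ ^ 2) = k₀ ^ 2 * x ^ 2 / 4 := by field_simp
    have e2 : (x⁻¹ / (k₀ * ε)) ^ (-(2 / 5) : ℝ) =
        k₀ ^ (2 / 5 : ℝ) * x ^ (2 / 5 : ℝ) * (ε ^ (11 / 30 : ℝ) * ε ^ (1 / 30 : ℝ)) := by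
      have : x⁻¹ / (k₀ * ε) = (k₀ * x * ε)⁻¹ := by field_simp
      rw [this, Real.inv_rpow (by positivity), Real.rpow_neg (by positivity), inv_inv,
        Real.mul_rpow (by positivity) hε0.le, Real.mul_rpow hk.le hx0.le, hε1 hε]
    have e3 : F (k₀ ^ 2 * x ^ 2 / 4) ≤ A * Real.exp ((M - 1) * x ^ 2) := by
      refine (hF _ (by positivity)).2.trans (le_of_eq ?_)
      rw [hM]
      congr 2
      ring
    have e4 : x ^ (2 / 5 : ℝ) ≤ Real.exp x := by
      calc x ^ (2 / 5 : ℝ) ≤ Real.exp x ^ (2 / 5 : ℝ) :=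
            Real.rpow_le_rpow hx0.le (by linarith [Real.add_one_le_exp x]) (by norm_num)
        _ = Real.exp (x * (2 / 5)) := (Real.exp_mul _ _).symm
        _ ≤ Real.exp x := Real.exp_le_exp.2 (by linarith)
    -- `|ln ε| = e^x ≥ x³ / 6`, so that the spare factor `ε^{1/30}` beats the exponential of `x²`
    have e5 : ε ^ (1 / 30 : ℝ) ≤ Real.exp (-(x ^ 3 / 180)) := by
      rw [Real.rpow_def_of_pos hε0]
      refine Real.exp_le_exp.2 ?_
      have h3 := Real.pow_div_factorial_le_exp x hx0.le 3
      rw [hx] at h3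
      norm_num [Nat.factorial] at h3
      linarith
    have e6 : Real.exp ((M - 1) * x ^ 2) * Real.exp x * Real.exp (-(x ^ 3 / 180)) ≤
        Real.exp (M * (180 * M) ^ 2 + 1) := by
      rw [← Real.exp_add, ← Real.exp_add]
      refine Real.exp_le_exp.2 ?_
      have := mul_sq_le_cube_add hM0 hx0.le
      nlinarith [sq_nonneg (x - 1)]
    rw [e1, e2]
    calc _ ≤ A * Real.exp ((M - 1) * x ^ 2) * (k₀ ^ (2 / 5 : ℝ) * Real.exp x *
          (ε ^ (11 / 30 : ℝ) * Real.exp (-(x ^ 3 / 180)))) := by gcongr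
      _ = A * k₀ ^ (2 / 5 : ℝ) * (Real.exp ((M - 1) * x ^ 2) * Real.exp x *
          Real.exp (-(x ^ 3 / 180))) * ε ^ (11 / 30 : ℝ) := by ring
      _ ≤ _ := by gcongr

end Scaling

section PhysicalVariables

variable {d p q : ℕ} {reg : Regime} {R : Lat d → ℝ}

/-- The test function that yields the values at `X` of the inverse Fourier transform, in the frame
of the free propagation. -/
def waveTest (κ z : ℝ) (X : Config p q d) : Bdd (Config p q d) :=
  rotate κ (-z) (Bdd.mk (fun v => Complex.exp (Complex.I * pairing v X))
    (continuous_wave.comp (continuous_id.prodMk continuous_const)).measurable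
    ⟨1, fun _ => (norm_exp_I_mul _).le⟩)

theorem waveTest_apply (κ z : ℝ) (X v : Config p q d) :
    waveTest κ z X v = freeFactor κ (-z) v * Complex.exp (Complex.I * pairing v X) := rfl

theorem norm_waveTest_le (κ z : ℝ) (X : Config p q d) : ‖waveTest κ z X‖ ≤ 1 :=
  (norm_rotate_le _ _ _).trans (Bdd.norm_le zero_le_one fun _ => (norm_exp_I_mul _).le)

theorem continuous_waveTest (κ z : ℝ) (X : Config p q d) :
    Continuous (waveTest κ z X : Config p q d → ℂ) := by
  have h1 : Continuous fun v : Config p q d => Complex.exp (Complex.I * pairing v X) :=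
    Complex.continuous_exp.comp (continuous_const.mul
      (Complex.continuous_ofReal.comp (continuous_pairing continuous_id continuous_const)))
  have h2 : Continuous fun v : Config p q d =>
      freeFactor κ (-z) v * Complex.exp (Complex.I * pairing v X) :=
    (contDiff_freeFactor κ (-z)).continuous.mul h1
  exact h2

theorem rotate_waveTest_apply (κ z : ℝ) (X v : Config p q d) :
    rotate κ z (waveTest κ z X) v = Complex.exp (Complex.I * pairing v X) := by
  rw [rotate_apply, waveTest_apply, freeFactor, freeFactor, ← mul_assoc, ← Complex.exp_add,
    ← mul_add, ← Complex.ofReal_add]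
  simp

theorem waveTest_eq_freePhase (k₀ η ε z : ℝ) (X v : Config p q d) :
    Complex.exp (Complex.I * pairing v X) * freePhase k₀ η ε z v =
      waveTest (η / (k₀ * ε)) z X v := by
  rw [waveTest_apply, freeFactor, freePhase, mul_comm, ← mul_neg, ← Complex.ofReal_neg]
  congr 4
  have : η / (2 * k₀ * ε) = η / (k₀ * ε) / 2 := by rw [mul_assoc, mul_comm 2, ← div_div]
  rw [mul_div_assoc, this]
  ring

/-- The normalization of the inverse Fourier transform. -/
def fourierConst (p q d : ℕ) : ℂ := ((((2 * Real.pi) ^ ((p + q) * d) : ℝ)⁻¹ : ℝ) : ℂ)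

theorem norm_fourierConst_le (p q d : ℕ) : ‖fourierConst p q d‖ ≤ 1 := by
  have h : (1 : ℝ) ≤ (2 * Real.pi) ^ ((p + q) * d) :=
    one_le_pow₀ (by linarith [Real.pi_gt_three])
  rw [fourierConst, Complex.norm_real, Real.norm_eq_abs, abs_of_nonneg (by positivity)]
  exact inv_le_one_of_one_le₀ h

theorem invFourier_eq (m : ComplexMeasure (Config p q d)) (κ z : ℝ) (X : Config p q d) :
    invFourier m X = fourierConst p q d * integ m (rotate κ z (waveTest κ z X)) := by
  rw [invFourier, fourierConst, integ_apply]
  congr 2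
  ext v
  exact (rotate_waveTest_apply κ z X v).symm

theorem mainTerm_eq (h : IsCovariance reg R) {k₀ η ε : ℝ}
    [IsFiniteMeasure (medium (k₀ ^ 2 / (4 * η ^ 2)) R)]
    {U : Fin p × Fin q → ℝ → Module.End ℂ (ComplexMeasure (Config p q d))}
    (hU : ∀ γ, IsPairPropagator k₀ R η ε γ (U γ)) {z : ℝ} (hz : 0 ≤ z)
    (ρ : ComplexMeasure (Config p q d)) (X : Config p q d) :
    mainTerm k₀ R η ε U ρ z X = fourierConst p q d * integ ρ (gaussDual (p := p) (q := q)
      (medium (k₀ ^ 2 / (4 * η ^ 2)) R) (η / (k₀ * ε))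
        (((p : ℝ) + q) / 2 * (k₀ ^ 2 / (4 * η ^ 2) * R 0)) z (waveTest (η / (k₀ * ε)) z X)) := by
  rw [mainTerm, fourierConst, ← integ_gaussianOp h hU hz, integ_apply]
  congr 2
  ext v
  exact waveTest_eq_freePhase k₀ η ε z X v

/-- Uniform bounds of the solution and of the error of the Gaussian approximation. The exponent
`11/30` lies between `1/3` and the exponent `2/5` of the oscillatory estimates. -/
theorem exists_error_bound (hd : 1 ≤ d) (h : IsCovariance reg R) {k₀ : ℝ} (hk : 0 < k₀) (p q : ℕ)
    {Z : ℝ} (hZ : 0 ≤ Z) : ∃ C : ℝ, 0 ≤ C ∧ ∀ ε ∈ reg.range,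
      ∀ m : ℝ → ComplexMeasure (Config p q d), IsMomentSolution k₀ R (reg.eta ε) ε m →
      ∀ z ∈ Icc 0 Z, ∀ X : Config p q d,
        ‖invFourier (m z) X‖ ≤ C * tv (m 0) ∧
        ∀ U : Fin p × Fin q → ℝ → Module.End ℂ (ComplexMeasure (Config p q d)),
          (∀ γ, IsPairPropagator k₀ R (reg.eta ε) ε γ (U γ)) →
          ‖errorTerm k₀ R (reg.eta ε) ε U m z X‖ ≤ C * ε ^ (11 / 30 : ℝ) * tv (m 0) := by
  obtain ⟨F, hF, herr⟩ := exists_dual_error hd h p q hZ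
  obtain ⟨C, hC, hsc⟩ := hF.exists_scaling_bound reg hk
  refine ⟨C + (matchings p q).card * 2 ^ (p * q), by positivity, fun ε hε m hm z hz X => ?_⟩
  have hε0 := Regime.pos_of_mem_range hε
  have hη := Regime.eta_pos hε
  set η := reg.eta ε with hηdef
  have hfin := h.isFiniteMeasure_medium hd (k₀ ^ 2 / (4 * η ^ 2))
  have hmass : (medium (k₀ ^ 2 / (4 * η ^ 2)) R).real univ = k₀ ^ 2 / (4 * η ^ 2) * R 0 :=
    h.medium_real_univ hd (by positivity)
  have htv := tv_nonneg (m 0)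
  have hw := norm_waveTest_le (η / (k₀ * ε)) z X
  have e1 := herr k₀ η ε (by positivity) hfin m hm z hz (waveTest (η / (k₀ * ε)) z X)
    (continuous_waveTest _ _ _)
  have e2 := norm_gaussDual_le (d := d) (p := p) (q := q)
    (ν := medium (k₀ ^ 2 / (4 * η ^ 2)) R) (κ := η / (k₀ * ε)) hz.1
  rw [hmass] at e2
  set G := integ (m 0) (gaussDual (p := p) (q := q) (medium (k₀ ^ 2 / (4 * η ^ 2)) R)
    (η / (k₀ * ε)) (((p : ℝ) + q) / 2 * (k₀ ^ 2 / (4 * η ^ 2) * R 0)) z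
      (waveTest (η / (k₀ * ε)) z X)) with hG
  set Ψ := integ (m z) (rotate (η / (k₀ * ε)) z (waveTest (η / (k₀ * ε)) z X)) with hΨ
  have e3 : ‖G‖ ≤ (matchings p q).card * 2 ^ (p * q) * tv (m 0) := by
    refine (norm_integ_le _ _).trans ?_
    rw [mul_comm]
    refine mul_le_mul_of_nonneg_right ((Op.le_norm _ _).trans ?_) htv
    calc _ ≤ (matchings p q).card * 2 ^ (p * q) * (1 : ℝ) :=
          mul_le_mul e2 hw (norm_nonneg _) (by positivity)
      _ = _ := mul_one _
  have hεp : 0 ≤ ε ^ (11 / 30 : ℝ) := Real.rpow_nonneg hε0.le _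
  have e4 : ‖Ψ - G‖ ≤ C * ε ^ (11 / 30 : ℝ) * tv (m 0) := by
    refine e1.trans ?_
    calc _ ≤ C * ε ^ (11 / 30 : ℝ) * tv (m 0) * ‖waveTest (η / (k₀ * ε)) z X‖ := by
          exact mul_le_mul_of_nonneg_right (mul_le_mul_of_nonneg_right (hsc ε hε) htv)
            (norm_nonneg _)
      _ ≤ _ := mul_le_of_le_one_right (by positivity) hw
  have hpow : ε ^ (11 / 30 : ℝ) ≤ 1 :=
    Real.rpow_le_one hε0.le (Regime.le_one_of_mem_range hε) (by norm_num)
  have hK : (0 : ℝ) ≤ (matchings p q).card * 2 ^ (p * q) := by positivity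
  have hcst : ∀ x : ℂ, ‖fourierConst p q d * x‖ ≤ ‖x‖ := fun x => by
    rw [norm_mul]
    exact mul_le_of_le_one_left (norm_nonneg _) (norm_fourierConst_le p q d)
  refine ⟨?_, fun U hU => ?_⟩
  · rw [invFourier_eq (m z) (η / (k₀ * ε)) z X]
    refine (hcst _).trans ?_
    have e5 : ‖Ψ‖ ≤ ‖Ψ - G‖ + ‖G‖ := by simpa using norm_add_le (Ψ - G) G
    refine e5.trans ((add_le_add e4 e3).trans ?_)
    rw [add_mul]
    gcongr
    exact mul_le_of_le_one_right hC hpow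
  · rw [errorTerm, invFourier_eq (m z) (η / (k₀ * ε)) z X, mainTerm_eq h hU hz.1, ← mul_sub]
    refine (hcst _).trans (e4.trans ?_)
    gcongr
    linarith

end PhysicalVariables


/-! ### Few blocks, and the action on plane waves -/

section Exactness

variable {d p q : ℕ} {reg : Regime} {R : Lat d → ℝ}

/-- The Gaussian approximation is exact if there is at most one block of each kind: there are no
twins and no conflicting pairs, so that the bound of the error holds with `δ = 0`. -/
theorem errorTerm_eq_zero (hd : 1 ≤ d) (h : IsCovariance reg R) {k₀ η ε : ℝ}
    (ht : twins p q = ∅) (hs : ∀ γ γ' : Fin p × Fin q, γ = γ')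
    {m : ℝ → ComplexMeasure (Config p q d)} (hm : IsMomentSolution k₀ R η ε m)
    {U : Fin p × Fin q → ℝ → Module.End ℂ (ComplexMeasure (Config p q d))}
    (hU : ∀ γ, IsPairPropagator k₀ R η ε γ (U γ)) {z : ℝ} (hz : 0 ≤ z) (X : Config p q d) :
    errorTerm k₀ R η ε U m z X = 0 := by
  have hfin := h.isFiniteMeasure_medium hd (k₀ ^ 2 / (4 * η ^ 2))
  have hmass : (medium (k₀ ^ 2 / (4 * η ^ 2)) R).real univ = k₀ ^ 2 / (4 * η ^ 2) * R 0 :=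
    h.medium_real_univ hd (by positivity)
  have hder := fun (f : Bdd (Config p q d)) (hf : f ∈ testFunctions p q d) (z : ℝ) (hz : 0 ≤ z) =>
    hm.hasDerivWithinAt_rotate hd h hf hz
  have hsmall : ∀ w ∈ Icc 0 z, Small (d := d) p q (medium (k₀ ^ 2 / (4 * η ^ 2)) R)
      (η / (k₀ * ε)) w 0 := fun w _ =>
    ⟨fun e he => by simp [ht] at he, fun γ γ' hne => absurd (hs γ γ') hne,
      fun γ γ' hne => absurd (hs γ γ') hne⟩
  have ha0 : 0 ≤ ((p : ℝ) + q) / 2 * (k₀ ^ 2 / (4 * η ^ 2) * R 0) := by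
    rw [← hmass]; positivity
  have hzz : z ∈ Icc 0 z := ⟨hz, le_rfl⟩
  have e1 := norm_sub_correctedDual_le (hm.bounded z) hder (by rw [hmass]) le_rfl le_rfl hsmall hzz
    (continuous_waveTest (η / (k₀ * ε)) z X)
  have e2 := (hsmall z hzz).norm_correctedDual_sub_le le_rfl hzz le_rfl ha0
  rw [errorTerm, invFourier_eq (m z) (η / (k₀ * ε)) z X, mainTerm_eq h hU hz, ← mul_sub]
  simp only [residualBound, mul_zero, zero_mul, add_zero] at e1 e2
  have e3 := sub_eq_zero.1 (norm_le_zero_iff.1 e1)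
  rw [e3, sub_eq_zero.1 (norm_le_zero_iff.1 e2), sub_self, mul_zero]

end Exactness

section Restriction

variable {d p q : ℕ} (ν : Measure (Lat d)) [IsFiniteMeasure ν] (κ z : ℝ)

/-- The configuration `v`, with the blocks of the pair `γ` replaced by those of `u`. -/
def embedPair (γ : Fin p × Fin q) (v : Config p q d) (u : Config 1 1 d) : Config p q d :=
  Function.update (Function.update v (Sum.inl γ.1) (u (Sum.inl 0))) (Sum.inr γ.2) (u (Sum.inr 0))

/-- The blocks of the pair `γ`. -/
def extractPair (γ : Fin p × Fin q) (v : Config p q d) : Config 1 1 d :=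
  Sum.elim (fun _ => v (Sum.inl γ.1)) fun _ => v (Sum.inr γ.2)

theorem embedPair_inl (γ : Fin p × Fin q) (v : Config p q d) (u : Config 1 1 d) :
    embedPair γ v u (Sum.inl γ.1) = u (Sum.inl 0) := by simp [embedPair]

theorem embedPair_inr (γ : Fin p × Fin q) (v : Config p q d) (u : Config 1 1 d) :
    embedPair γ v u (Sum.inr γ.2) = u (Sum.inr 0) := by simp [embedPair]

theorem embedPair_of_ne {γ : Fin p × Fin q} {a : Fin p ⊕ Fin q} (h1 : a ≠ Sum.inl γ.1)
    (h2 : a ≠ Sum.inr γ.2) (v : Config p q d) (u : Config 1 1 d) : embedPair γ v u a = v a := by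
  simp [embedPair, h1, h2]

theorem embedPair_extractPair (γ : Fin p × Fin q) (v : Config p q d) :
    embedPair γ v (extractPair γ v) = v := by
  simp [embedPair, extractPair]

theorem embedPair_add_edgeShift (γ : Fin p × Fin q) (v : Config p q d) (u : Config 1 1 d)
    (k : Lat d) : embedPair γ v u + edgeShift (Sum.inl γ.1) (Sum.inr γ.2) k =
      embedPair γ v (u + edgeShift (Sum.inl 0) (Sum.inr 0) k) := by
  ext1 a
  rw [edgeShift_inl_inr γ, edgeShift_inl_inr ((0, 0) : Fin 1 × Fin 1)]
  rcases eq_or_ne a (Sum.inl γ.1) with rfl | h1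
  · simp [embedPair_inl, pairShift]
  rcases eq_or_ne a (Sum.inr γ.2) with rfl | h2
  · simp [embedPair_inr, pairShift]
  · simp [embedPair_of_ne h1 h2, pairShift, h1, h2]

theorem measurable_embedPair (γ : Fin p × Fin q) (v : Config p q d) :
    Measurable (embedPair γ v) := by
  refine measurable_pi_iff.2 fun a => ?_
  rcases eq_or_ne a (Sum.inl γ.1) with rfl | h1
  · simp only [embedPair_inl]; exact measurable_pi_apply _
  rcases eq_or_ne a (Sum.inr γ.2) with rfl | h2
  · simp only [embedPair_inr]; exact measurable_pi_apply _
  · simp only [embedPair_of_ne h1 h2]; exact measurable_const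

/-- The function `f`, with all blocks of the argument fixed except for those of the pair `γ`. -/
def restrictPair (γ : Fin p × Fin q) (v : Config p q d) (f : Bdd (Config p q d)) :
    Bdd (Config 1 1 d) :=
  Bdd.mk (fun u => f (embedPair γ v u)) (f.measurable.comp (measurable_embedPair γ v))
    ⟨‖f‖, fun _ => f.norm_apply_le _⟩

theorem restrictPair_apply (γ : Fin p × Fin q) (v : Config p q d) (f : Bdd (Config p q d))
    (u : Config 1 1 d) : restrictPair γ v f u = f (embedPair γ v u) := rfl

/-- The interaction of a pair acts on the blocks of this pair only. -/
theorem restrictPair_int (γ : Fin p × Fin q) (v : Config p q d) (f : Bdd (Config p q d)) :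
    restrictPair γ v ((pair d κ γ).int ν z f) = (pair d κ (0, 0)).int ν z (restrictPair γ v f) := by
  refine Bdd.ext fun u => ?_
  rw [restrictPair_apply, Interaction.int_apply, Interaction.int_apply]
  congr 1
  ext k
  rw [restrictPair_apply, edge_phase_pair, edge_phase_pair (p := 1) (q := 1) (0, 0),
    embedPair_inl, embedPair_inr]
  congr 1
  exact congrArg (fun w => f w) (embedPair_add_edgeShift γ v u k)

theorem restrictPair_int_pow (γ : Fin p × Fin q) (v : Config p q d) (n : ℕ)
    (f : Bdd (Config p q d)) : restrictPair γ v (((pair d κ γ).int ν z ^ n) f) =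
      ((pair d κ (0, 0)).int ν z ^ n) (restrictPair γ v f) := by
  induction n generalizing f with
  | zero => rfl
  | succ n ih => rw [pow_succ, pow_succ, Op.mul_apply, ih, restrictPair_int]; rfl

theorem hasSum_exp_apply {Ω : Type*} [MeasurableSpace Ω] (T : Op Ω) (f : Bdd Ω) (x : Ω) :
    HasSum (fun n : ℕ => ((n.factorial : ℂ)⁻¹) * (T ^ n) f x) (NormedSpace.exp T f x) := by
  have h := NormedSpace.exp_series_hasSum_exp' (𝕂 := ℂ) T
  let φ : Op Ω →+ ℂ :=
    { toFun := fun S => S f x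
      map_zero' := rfl
      map_add' := fun _ _ => rfl }
  have hφ : Continuous φ := by
    refine AddMonoidHomClass.continuous_of_bound φ ‖f‖ fun S => ?_
    rw [mul_comm]
    exact S.norm_apply_apply_le f x
  exact h.map φ hφ

theorem prop_apply_eq (γ : Fin p × Fin q) (f : Bdd (Config p q d)) (v : Config p q d) :
    (pair d κ γ).prop ν z f v =
      (pair d κ (0, 0)).prop ν z (restrictPair γ v f) (extractPair γ v) := by
  have h1 := hasSum_exp_apply ((pair d κ γ).int ν z) f v
  have h2 := hasSum_exp_apply ((pair d κ (0, 0)).int ν z) (restrictPair γ v f) (extractPair γ v)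
  simp only [← restrictPair_int_pow, restrictPair_apply, embedPair_extractPair] at h2
  exact h1.unique h2

theorem cross_apply_eq (γ : Fin p × Fin q) (f : Bdd (Config p q d)) (v : Config p q d) :
    cross ν κ z γ f v = cross ν κ z (0, 0) (restrictPair γ v f) (extractPair γ v) := by
  rw [cross, cross, Op.sub_apply, Op.sub_apply, Bdd.sub_apply, Bdd.sub_apply, Op.one_apply,
    Op.one_apply, prop_apply_eq, restrictPair_apply, embedPair_extractPair]

end Restriction

section InsertPair

variable {p q : ℕ} {s : Finset (Fin p × Fin q)} {γ : Fin p × Fin q}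

theorem IsMatching.fst_ne (hs : IsMatching (insert γ s)) (hγ : γ ∉ s) : ∀ γ' ∈ s, γ'.1 ≠ γ.1 :=
  fun γ' hγ' => (hs γ' (Finset.mem_insert_of_mem hγ') γ (Finset.mem_insert_self _ _)
    fun e => hγ (e ▸ hγ')).1

theorem IsMatching.snd_ne (hs : IsMatching (insert γ s)) (hγ : γ ∉ s) : ∀ γ' ∈ s, γ'.2 ≠ γ.2 :=
  fun γ' hγ' => (hs γ' (Finset.mem_insert_of_mem hγ') γ (Finset.mem_insert_self _ _)
    fun e => hγ (e ▸ hγ')).2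

theorem IsMatching.compl_image_fst (hs : IsMatching (insert γ s)) (hγ : γ ∉ s) :
    (s.image Prod.fst)ᶜ = insert γ.1 ((insert γ s).image Prod.fst)ᶜ := by
  have h : γ.1 ∉ s.image Prod.fst := fun h => by
    obtain ⟨γ', h1, h2⟩ := Finset.mem_image.1 h
    exact hs.fst_ne hγ γ' h1 h2
  rw [Finset.image_insert, Finset.compl_insert, Finset.insert_erase (Finset.mem_compl.2 h)]

theorem IsMatching.compl_image_snd (hs : IsMatching (insert γ s)) (hγ : γ ∉ s) :
    (s.image Prod.snd)ᶜ = insert γ.2 ((insert γ s).image Prod.snd)ᶜ := by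
  have h : γ.2 ∉ s.image Prod.snd := fun h => by
    obtain ⟨γ', h1, h2⟩ := Finset.mem_image.1 h
    exact hs.snd_ne hγ γ' h1 h2
  rw [Finset.image_insert, Finset.compl_insert, Finset.insert_erase (Finset.mem_compl.2 h)]

end InsertPair

section WaveFactors

variable {d p q : ℕ} (ν : Measure (Lat d)) [IsFiniteMeasure ν] (κ z : ℝ)

/-- The factor of `waveTest` that belongs to a block of sign `σ`. -/
def blockWave (σ : ℝ) (x ξ : Lat d) : ℂ :=
  Complex.exp (Complex.I * (σ * (⟪ξ, x⟫ - z * κ * ⟪ξ, ξ⟫ / 2) : ℝ))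

theorem waveTest_eq_prod (X v : Config p q d) :
    waveTest κ z X v = ∏ a, blockWave κ z (sgn a) (X a) (v a) := by
  simp only [waveTest_apply, blockWave, freeFactor]
  rw [← Complex.exp_sum, ← Finset.mul_sum, ← Complex.exp_add, ← mul_add, ← Complex.ofReal_add,
    ← Complex.ofReal_sum]
  congr 3
  rw [pairing_eq_sum v v, pairing_eq_sum v X, Finset.sum_div, Finset.mul_sum, Finset.mul_sum,
    ← Finset.sum_add_distrib]
  refine Finset.sum_congr rfl fun a _ => ?_
  ring

/-- The action of `U_γ - 𝕀`, in the dual picture, on the plane waves of two blocks of different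
kind. -/
def pairWave (x y ξ ζ : Lat d) : ℂ :=
  cross ν κ z (0, 0) (waveTest (p := 1) (q := 1) κ z (Sum.elim (fun _ => x) fun _ => y))
    (Sum.elim (fun _ => ξ) fun _ => ζ)

/-- The products over matchings act on plane waves by factors that depend on one or two blocks. -/
theorem IsMatching.crossProd_waveTest {s : Finset (Fin p × Fin q)} (hs : IsMatching s)
    (X v : Config p q d) : crossProd ν κ z s (waveTest κ z X) v =
      (∏ γ ∈ s, pairWave ν κ z (X (Sum.inl γ.1)) (X (Sum.inr γ.2)) (v (Sum.inl γ.1))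
        (v (Sum.inr γ.2))) *
      (∏ j ∈ (s.image Prod.fst)ᶜ, blockWave κ z 1 (X (Sum.inl j)) (v (Sum.inl j))) *
      ∏ l ∈ (s.image Prod.snd)ᶜ, blockWave κ z (-1) (X (Sum.inr l)) (v (Sum.inr l)) := by
  induction s using Finset.induction_on generalizing v with
  | empty =>
    rw [crossProd_empty, Op.one_apply, waveTest_eq_prod, Fintype.prod_sum_type]
    simp
  | insert γ s hγ ih =>
    have hs' := hs.mono (Finset.subset_insert γ s)
    have hj := hs.fst_ne hγ
    have hl := hs.snd_ne hγ
    have cj := hs.compl_image_fst hγ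
    have cl := hs.compl_image_snd hγ
    have nj : γ.1 ∉ ((insert γ s).image Prod.fst)ᶜ := by simp
    have nl : γ.2 ∉ ((insert γ s).image Prod.snd)ᶜ := by simp
    set H : ℂ := (∏ γ ∈ s, pairWave ν κ z (X (Sum.inl γ.1)) (X (Sum.inr γ.2)) (v (Sum.inl γ.1))
        (v (Sum.inr γ.2))) *
      (∏ j ∈ ((insert γ s).image Prod.fst)ᶜ, blockWave κ z 1 (X (Sum.inl j)) (v (Sum.inl j))) *
      ∏ l ∈ ((insert γ s).image Prod.snd)ᶜ, blockWave κ z (-1) (X (Sum.inr l)) (v (Sum.inr l))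
      with hH
    have hres : restrictPair γ v (crossProd ν κ z s (waveTest κ z X)) = H •
        waveTest (p := 1) (q := 1) κ z
          (Sum.elim (fun _ => X (Sum.inl γ.1)) fun _ => X (Sum.inr γ.2)) := by
      refine Bdd.ext fun u => ?_
      rw [restrictPair_apply, ih hs', Bdd.smul_apply, waveTest_eq_prod, cj, cl,
        Finset.prod_insert nj, Finset.prod_insert nl, embedPair_inl, embedPair_inr]
      have p1 : ∏ γ' ∈ s, pairWave ν κ z (X (Sum.inl γ'.1)) (X (Sum.inr γ'.2))
          (embedPair γ v u (Sum.inl γ'.1)) (embedPair γ v u (Sum.inr γ'.2)) =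
          ∏ γ' ∈ s, pairWave ν κ z (X (Sum.inl γ'.1)) (X (Sum.inr γ'.2)) (v (Sum.inl γ'.1))
            (v (Sum.inr γ'.2)) := Finset.prod_congr rfl fun γ' hγ' => by
        rw [embedPair_of_ne (by simpa using hj γ' hγ') (by simp),
          embedPair_of_ne (by simp) (by simpa using hl γ' hγ')]
      have p2 : ∏ j ∈ ((insert γ s).image Prod.fst)ᶜ, blockWave κ z 1 (X (Sum.inl j))
          (embedPair γ v u (Sum.inl j)) = ∏ j ∈ ((insert γ s).image Prod.fst)ᶜ,
            blockWave κ z 1 (X (Sum.inl j)) (v (Sum.inl j)) := Finset.prod_congr rfl fun j hj => by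
        rw [embedPair_of_ne (fun e => nj (Sum.inl_injective e ▸ hj)) (by simp)]
      have p3 : ∏ l ∈ ((insert γ s).image Prod.snd)ᶜ, blockWave κ z (-1) (X (Sum.inr l))
          (embedPair γ v u (Sum.inr l)) = ∏ l ∈ ((insert γ s).image Prod.snd)ᶜ,
            blockWave κ z (-1) (X (Sum.inr l)) (v (Sum.inr l)) :=
        Finset.prod_congr rfl fun l hl => by
          rw [embedPair_of_ne (by simp) (fun e => nl (Sum.inr_injective e ▸ hl))]
      rw [p1, p2, p3, hH, Fintype.prod_sum_type]
      simp only [Finset.univ_unique, Finset.prod_singleton, Sum.elim_inl, Sum.elim_inr, sgn_inl,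
        sgn_inr, Fin.default_eq_zero]
      ring
    rw [crossProd_insert hγ hs, Op.mul_apply, cross_apply_eq, hres, Op.map_smul, Bdd.smul_apply,
      Finset.prod_insert hγ, hH, pairWave]
    simp only [extractPair]
    ring

end WaveFactors


/-! ### Fubini over the pairs of a matching -/

section Fubini

/-- Fubini's theorem for a product of a function of two coordinates and a function of the others. -/
theorem exists_integral_pair_mul {ι E : Type*} [Fintype ι] [Inhabited E]
    [MeasureSpace E] [SigmaFinite (volume : Measure E)] {j l : ι} (hjl : j ≠ l) (H : (ι → E) → ℂ)
    (hH : ∀ v w, (∀ i, i ≠ j → i ≠ l → v i = w i) → H v = H w) :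
    ∃ K : ℂ, ∀ G : E → E → ℂ, ∫ v, G (v j) (v l) * H v =
      (∫ u : Fin 1 ⊕ Fin 1 → E, G (u (Sum.inl 0)) (u (Sum.inr 0))) * K := by
  classical
  let P : ι → Prop := fun i => i = j ∨ i = l
  let H' : ({i // ¬ P i} → E) → ℂ := fun w => H fun i => if h : P i then default else w ⟨i, h⟩
  have mp := volume_preserving_piEquivPiSubtypeProd (fun _ : ι => E) P
  let e : Fin 1 ⊕ Fin 1 ≃ {i // P i} := Equiv.ofBijective
    (Sum.elim (fun _ => ⟨j, Or.inl rfl⟩) fun _ => ⟨l, Or.inr rfl⟩) (by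
      constructor
      · rintro (a | a) (b | b) hab
        · rw [Subsingleton.elim a b]
        · exact absurd (congrArg Subtype.val hab) hjl
        · exact absurd (congrArg Subtype.val hab).symm hjl
        · rw [Subsingleton.elim a b]
      · rintro ⟨i, hi⟩
        rcases hi with rfl | rfl
        · exact ⟨Sum.inl 0, rfl⟩
        · exact ⟨Sum.inr 0, rfl⟩)
  have mp' := volume_measurePreserving_piCongrLeft (fun _ : {i // P i} => E) e
  refine ⟨∫ w, H' w, fun G => ?_⟩
  have h1 : ∫ v, G (v j) (v l) * H v = ∫ x : ({i // P i} → E) × ({i // ¬ P i} → E),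
      G (x.1 ⟨j, Or.inl rfl⟩) (x.1 ⟨l, Or.inr rfl⟩) * H' x.2 := by
    rw [← mp.integral_comp']
    refine integral_congr_ae (Eventually.of_forall fun v => ?_)
    refine congrArg₂ (· * ·) rfl (hH _ _ fun i h1 h2 => ?_)
    have hi : ¬ P i := fun h => h.elim h1 h2
    simp only [hi, dif_neg, not_false_eq_true]
    rfl
  rw [h1]
  refine (integral_prod_mul (fun w : {i // P i} → E => G (w ⟨j, Or.inl rfl⟩) (w ⟨l, Or.inr rfl⟩))
    H').trans (congrArg (· * _) ?_)
  rw [← mp'.integral_comp']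
  refine integral_congr_ae (Eventually.of_forall fun u => ?_)
  have ej : MeasurableEquiv.piCongrLeft (fun _ : {i // P i} => E) e u ⟨j, Or.inl rfl⟩ =
      u (Sum.inl 0) :=
    MeasurableEquiv.piCongrLeft_apply_apply e (β := fun _ => E) u (Sum.inl 0)
  have el : MeasurableEquiv.piCongrLeft (fun _ : {i // P i} => E) e u ⟨l, Or.inr rfl⟩ =
      u (Sum.inr 0) :=
    MeasurableEquiv.piCongrLeft_apply_apply e (β := fun _ => E) u (Sum.inr 0)
  simp only [ej, el]

variable {d p q : ℕ}

theorem exists_integral_eq_one (d : ℕ) : ∃ b : Lat d → ℂ, ∫ ξ, b ξ = 1 := by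
  refine ⟨(Metric.ball 0 1).indicator fun _ => ((volume.real (Metric.ball (0 : Lat d) 1))⁻¹ : ℝ), ?_⟩
  have h : volume.real (Metric.ball (0 : Lat d) 1) ≠ 0 := by
    have h1 := (Metric.measure_ball_pos (volume : Measure (Lat d)) 0 one_pos).ne'
    exact (ENNReal.toReal_pos h1 measure_ball_lt_top.ne).ne'
  rw [integral_indicator_const _ measurableSet_ball, Complex.real_smul, ← Complex.ofReal_mul,
    mul_inv_cancel₀ h, Complex.ofReal_one]

/-- The integral of a function of a pair of blocks. -/
def pairInt (G : Lat d → Lat d → ℂ) : ℂ :=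
  ∫ u : Fin 1 ⊕ Fin 1 → Lat d, G (u (Sum.inl 0)) (u (Sum.inr 0))

theorem pairInt_mul (a b : Lat d → ℂ) :
    pairInt (fun ξ ζ => a ξ * b ζ) = (∫ ξ, a ξ) * ∫ ζ, b ζ := by
  have h := integral_fintype_prod_volume_eq_prod (ι := Fin 1 ⊕ Fin 1) (𝕜 := ℂ)
    (E := fun _ => Lat d) (Sum.elim (fun _ => a) fun _ => b)
  simpa [Fintype.prod_sum_type, pairInt] using h

/-- Fubini's theorem for a product over the pairs of a matching and the remaining blocks. The pairs
are integrated one by one: as the integral over the blocks of a pair is a constant times `pairInt`,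
the constant can be computed by replacing the factor of the pair by a product `b ξ * b ζ` with
`∫ b = 1`, so that the pair disappears from the matching. -/
theorem IsMatching.integral_prod {s : Finset (Fin p × Fin q)} (hs : IsMatching s)
    (G : Fin p × Fin q → Lat d → Lat d → ℂ) (A : Fin p → Lat d → ℂ) (B : Fin q → Lat d → ℂ) :
    ∫ v : Config p q d, (∏ γ ∈ s, G γ (v (Sum.inl γ.1)) (v (Sum.inr γ.2))) *
        (∏ j ∈ (s.image Prod.fst)ᶜ, A j (v (Sum.inl j))) *
        ∏ l ∈ (s.image Prod.snd)ᶜ, B l (v (Sum.inr l)) =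
      (∏ γ ∈ s, pairInt (G γ)) * (∏ j ∈ (s.image Prod.fst)ᶜ, ∫ ξ, A j ξ) *
        ∏ l ∈ (s.image Prod.snd)ᶜ, ∫ ζ, B l ζ := by
  induction s using Finset.induction_on generalizing A B with
  | empty =>
    have h := integral_fintype_prod_volume_eq_prod (ι := Fin p ⊕ Fin q) (𝕜 := ℂ)
      (E := fun _ => Lat d) (Sum.elim A B)
    simpa [Fintype.prod_sum_type] using h
  | insert γ s hγ ih =>
    have hs' := hs.mono (Finset.subset_insert γ s)
    have hj := hs.fst_ne hγ
    have hl := hs.snd_ne hγ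
    have cj := hs.compl_image_fst hγ
    have cl := hs.compl_image_snd hγ
    have nj : γ.1 ∉ ((insert γ s).image Prod.fst)ᶜ := by simp
    have nl : γ.2 ∉ ((insert γ s).image Prod.snd)ᶜ := by simp
    obtain ⟨b, hb⟩ := exists_integral_eq_one d
    have key := exists_integral_pair_mul (E := Lat d) (j := (Sum.inl γ.1 : Fin p ⊕ Fin q))
      (l := Sum.inr γ.2) Sum.inl_ne_inr
      (fun v => (∏ γ ∈ s, G γ (v (Sum.inl γ.1)) (v (Sum.inr γ.2))) *
        (∏ j ∈ ((insert γ s).image Prod.fst)ᶜ, A j (v (Sum.inl j))) *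
        ∏ l ∈ ((insert γ s).image Prod.snd)ᶜ, B l (v (Sum.inr l))) (by
        intro v w hvw
        have p1 : ∀ γ' ∈ s, G γ' (v (Sum.inl γ'.1)) (v (Sum.inr γ'.2)) =
            G γ' (w (Sum.inl γ'.1)) (w (Sum.inr γ'.2)) := fun γ' h' => by
          rw [hvw _ (by simpa using hj γ' h') (by simp), hvw _ (by simp) (by simpa using hl γ' h')]
        have p2 : ∀ j ∈ ((insert γ s).image Prod.fst)ᶜ, A j (v (Sum.inl j)) =
            A j (w (Sum.inl j)) := fun j h' => by
          rw [hvw _ (fun e => nj (Sum.inl_injective e ▸ h')) (by simp)]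
        have p3 : ∀ l ∈ ((insert γ s).image Prod.snd)ᶜ, B l (v (Sum.inr l)) =
            B l (w (Sum.inr l)) := fun l h' => by
          rw [hvw _ (by simp) (fun e => nl (Sum.inr_injective e ▸ h'))]
        rw [Finset.prod_congr rfl p1, Finset.prod_congr rfl p2, Finset.prod_congr rfl p3])
    obtain ⟨K, hK⟩ := key
    have hK1 := hK fun ξ ζ => b ξ * b ζ
    have hKG := hK (G γ)
    have e1 : ∀ Φ : Fin p → (Lat d → ℂ) → ℂ,
        ∏ j ∈ ((insert γ s).image Prod.fst)ᶜ, Φ j (Function.update A γ.1 b j) =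
          ∏ j ∈ ((insert γ s).image Prod.fst)ᶜ, Φ j (A j) := fun Φ =>
      Finset.prod_congr rfl fun j h' => by
        rw [Function.update_of_ne (ne_of_mem_of_not_mem h' nj)]
    have e2 : ∀ Φ : Fin q → (Lat d → ℂ) → ℂ,
        ∏ l ∈ ((insert γ s).image Prod.snd)ᶜ, Φ l (Function.update B γ.2 b l) =
          ∏ l ∈ ((insert γ s).image Prod.snd)ᶜ, Φ l (B l) := fun Φ =>
      Finset.prod_congr rfl fun l h' => by
        rw [Function.update_of_ne (ne_of_mem_of_not_mem h' nl)]
    have hI := ih hs' (Function.update A γ.1 b) (Function.update B γ.2 b)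
    rw [cj, cl] at hI
    simp only [Finset.prod_insert nj, Finset.prod_insert nl, Function.update_self, hb, one_mul] at hI
    rw [e1 fun _ g => ∫ ξ, g ξ, e2 fun _ g => ∫ ζ, g ζ] at hI
    have hbb : (∫ u : Fin 1 ⊕ Fin 1 → Lat d, b (u (Sum.inl 0)) * b (u (Sum.inr 0))) = 1 := by
      have := pairInt_mul b b
      rwa [hb, one_mul] at this
    rw [hbb, one_mul] at hK1
    have hKval : K = (∏ γ ∈ s, pairInt (G γ)) *
        (∏ j ∈ ((insert γ s).image Prod.fst)ᶜ, ∫ ξ, A j ξ) *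
        ∏ l ∈ ((insert γ s).image Prod.snd)ᶜ, ∫ ζ, B l ζ := by
      rw [← hI, ← hK1]
      refine integral_congr_ae (Eventually.of_forall fun v => ?_)
      simp only
      rw [e1 fun j g => g (v (Sum.inl j)), e2 fun l g => g (v (Sum.inr l))]
      ring
    have hfin : ∫ v : Config p q d, G γ (v (Sum.inl γ.1)) (v (Sum.inr γ.2)) *
        ((∏ γ ∈ s, G γ (v (Sum.inl γ.1)) (v (Sum.inr γ.2))) *
        (∏ j ∈ ((insert γ s).image Prod.fst)ᶜ, A j (v (Sum.inl j))) *
        ∏ l ∈ ((insert γ s).image Prod.snd)ᶜ, B l (v (Sum.inr l))) = pairInt (G γ) * K := hKG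
    simp only [Finset.prod_insert hγ, mul_assoc] at hfin hKval ⊢
    rw [hfin, hKval]

end Fubini


/-! ### Product incident data -/

section ProductData

variable {d p q : ℕ}

theorem productDensity_eq_prod (f : Lat d → ℂ) (v : Config p q d) : productDensity f p q v =
    ∏ a, (Sum.elim (fun _ => f) (fun _ ξ => conj (f ξ)) a : Lat d → ℂ) (v a) := by
  simp [productDensity, Fintype.prod_sum_type]

theorem integrable_productDensity {f : Lat d → ℂ} (hf : Integrable f) (p q : ℕ) :
    Integrable (productDensity f p q : Config p q d → ℂ) := by
  have hc : Integrable fun ξ => conj (f ξ) :=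
    Complex.conjLIE.integrable_comp_iff.2 hf
  have h := Integrable.fintype_prod (ι := Fin p ⊕ Fin q) (μ := fun _ => (volume : Measure (Lat d)))
    (f := Sum.elim (fun _ => f) fun _ ξ => conj (f ξ)) (by
      rintro (j | l)
      exacts [hf, hc])
  exact h.congr (Eventually.of_forall fun v => (productDensity_eq_prod f v).symm)

theorem tv_productDensity {f : Lat d → ℂ} (hf : Integrable f) (p q : ℕ) :
    tv ((volume : Measure (Config p q d)).withDensityᵥ (productDensity f p q)) =
      (∫ ξ, ‖f ξ‖) ^ (p + q) := by
  rw [tv_withDensityᵥ (integrable_productDensity hf p q)]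
  have h : ∀ v : Config p q d, ‖productDensity f p q v‖ = ∏ a, ‖f (v a)‖ := fun v => by
    simp [productDensity, Fintype.prod_sum_type]
  simp only [h]
  rw [integral_fintype_prod_volume_eq_pow (fun ξ => ‖f ξ‖)]
  simp

theorem IsMatching.prod_eq_fst {s : Finset (Fin p × Fin q)} (hs : IsMatching s) (F : Fin p → ℂ) :
    ∏ j, F j = (∏ γ ∈ s, F γ.1) * ∏ j ∈ (s.image Prod.fst)ᶜ, F j := by
  rw [← Finset.prod_mul_prod_compl (s.image Prod.fst), Finset.prod_image]
  intro γ hγ γ' hγ' e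
  by_contra hne
  exact (hs γ hγ γ' hγ' hne).1 e

theorem IsMatching.prod_eq_snd {s : Finset (Fin p × Fin q)} (hs : IsMatching s) (F : Fin q → ℂ) :
    ∏ l, F l = (∏ γ ∈ s, F γ.2) * ∏ l ∈ (s.image Prod.snd)ᶜ, F l := by
  rw [← Finset.prod_mul_prod_compl (s.image Prod.snd), Finset.prod_image]
  intro γ hγ γ' hγ' e
  by_contra hne
  exact (hs γ hγ γ' hγ' hne).2 e

/-- The mean of the field at `x`, for `σ = 1` and the incident density `g`, or the mean of its complex
conjugate, for `σ = -1` and the conjugate density. The constant `c` stands for the normalization of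
the Fourier transform and the damping. -/
def meanField (κ z : ℝ) (c : ℂ) (σ : ℝ) (g : Lat d → ℂ) (x : Lat d) : ℂ :=
  c * ∫ ξ, blockWave κ z σ x ξ * g ξ

/-- The covariance `𝔼[(u - 𝔼u)(x) (u - 𝔼u)^*(y)]` of the field. -/
def covField (ν : Measure (Lat d)) [IsFiniteMeasure ν] (κ z : ℝ) (c : ℂ) (f : Lat d → ℂ)
    (x y : Lat d) : ℂ :=
  c ^ 2 * pairInt fun ξ ζ => pairWave ν κ z x y ξ ζ * (f ξ * conj (f ζ))

/-- For product data, the terms of the main term factorize over the pairs of a matching and the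
remaining blocks. -/
theorem IsMatching.integ_crossProd_waveTest {s : Finset (Fin p × Fin q)} (hs : IsMatching s)
    (ν : Measure (Lat d)) [IsFiniteMeasure ν] (κ z : ℝ) (c : ℂ) {f : Lat d → ℂ}
    (hf : Integrable f) (X : Config p q d) :
    c ^ (p + q) * integ ((volume : Measure (Config p q d)).withDensityᵥ (productDensity f p q))
        (crossProd (p := p) (q := q) ν κ z s (waveTest κ z X)) =
      (∏ γ ∈ s, covField ν κ z c f (X (Sum.inl γ.1)) (X (Sum.inr γ.2))) *
        (∏ j ∈ (s.image Prod.fst)ᶜ, meanField κ z c 1 f (X (Sum.inl j))) *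
        ∏ l ∈ (s.image Prod.snd)ᶜ,
          meanField κ z c (-1) (fun ζ => conj (f ζ)) (X (Sum.inr l)) := by
  have e1 : integ ((volume : Measure (Config p q d)).withDensityᵥ (productDensity f p q))
        (crossProd (p := p) (q := q) ν κ z s (waveTest κ z X)) =
      ∫ v, crossProd (p := p) (q := q) ν κ z s (waveTest κ z X) v * productDensity f p q v := by
    rw [integ_apply]
    exact cint_withDensityᵥ (integrable_productDensity hf p q) (Bdd.measurable _)
      (fun v => Bdd.norm_apply_le _ v)
  have e2 : ∀ v : Config p q d,
      crossProd (p := p) (q := q) ν κ z s (waveTest κ z X) v * productDensity f p q v =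
      (∏ γ ∈ s, (pairWave ν κ z (X (Sum.inl γ.1)) (X (Sum.inr γ.2)) (v (Sum.inl γ.1))
        (v (Sum.inr γ.2)) * (f (v (Sum.inl γ.1)) * conj (f (v (Sum.inr γ.2)))))) *
      (∏ j ∈ (s.image Prod.fst)ᶜ, blockWave κ z 1 (X (Sum.inl j)) (v (Sum.inl j)) *
        f (v (Sum.inl j))) *
      ∏ l ∈ (s.image Prod.snd)ᶜ, blockWave κ z (-1) (X (Sum.inr l)) (v (Sum.inr l)) *
        conj (f (v (Sum.inr l))) := fun v => by
    refine (congrArg (· * productDensity f p q v) (hs.crossProd_waveTest ν κ z X v)).trans ?_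
    rw [productDensity, hs.prod_eq_fst fun j => f (v (Sum.inl j)),
      hs.prod_eq_snd fun l => conj (f (v (Sum.inr l)))]
    simp only [Finset.prod_mul_distrib]
    ring
  have e3 := hs.integral_prod
    (fun γ ξ ζ => pairWave ν κ z (X (Sum.inl γ.1)) (X (Sum.inr γ.2)) ξ ζ * (f ξ * conj (f ζ)))
    (fun j ξ => blockWave κ z 1 (X (Sum.inl j)) ξ * f ξ)
    (fun l ζ => blockWave κ z (-1) (X (Sum.inr l)) ζ * conj (f ζ))
  have ec : c ^ (p + q) = (∏ _γ ∈ s, c ^ 2) * (∏ _j ∈ (s.image Prod.fst)ᶜ, c) *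
      ∏ _l ∈ (s.image Prod.snd)ᶜ, c := by
    have h1 := hs.prod_eq_fst fun _ => c
    have h2 := hs.prod_eq_snd fun _ => c
    rw [Finset.prod_const, Finset.card_univ, Fintype.card_fin] at h1 h2
    rw [pow_add, h1, h2]
    simp only [Finset.prod_pow]
    ring
  rw [e1]
  simp only [e2]
  rw [e3, ec]
  simp only [covField, meanField, Finset.prod_mul_distrib]
  ring

theorem fourierConst_eq_pow (p q d : ℕ) : fourierConst p q d = fourierConst 1 0 d ^ (p + q) := by
  have h : (((2 * Real.pi) ^ ((p + q) * d) : ℝ)⁻¹ : ℝ) =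
      (((2 * Real.pi) ^ ((1 + 0) * d) : ℝ)⁻¹) ^ (p + q) := by
    rw [inv_pow, ← pow_mul]
    ring_nf
  rw [fourierConst, fourierConst, h, Complex.ofReal_pow]

/-- The constant in the mean field: it includes the damping by the medium. -/
def fieldConst (d : ℕ) (θ r z : ℝ) : ℂ := fourierConst 1 0 d * Real.exp (-(1 / 2 * (θ * r) * z))

variable {reg : Regime} {R : Lat d → ℝ}

/-- For product data, the main term is the Gaussian functional of the mean field and the
covariance. -/
theorem mainTerm_productDensity (h : IsCovariance reg R) {k₀ η ε : ℝ}
    [IsFiniteMeasure (medium (k₀ ^ 2 / (4 * η ^ 2)) R)]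
    {U : Fin p × Fin q → ℝ → Module.End ℂ (ComplexMeasure (Config p q d))}
    (hU : ∀ γ, IsPairPropagator k₀ R η ε γ (U γ)) {z : ℝ} (hz : 0 ≤ z) {f : Lat d → ℂ}
    (hf : Integrable f) (X : Config p q d) :
    mainTerm k₀ R η ε U (volume.withDensityᵥ (productDensity f p q)) z X =
      ∑ s ∈ matchings p q,
        (∏ γ ∈ s, covField (medium (k₀ ^ 2 / (4 * η ^ 2)) R) (η / (k₀ * ε)) z
          (fieldConst d (k₀ ^ 2 / (4 * η ^ 2)) (R 0) z) f (X (Sum.inl γ.1)) (X (Sum.inr γ.2))) *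
        (∏ j ∈ (s.image Prod.fst)ᶜ, meanField (η / (k₀ * ε)) z
          (fieldConst d (k₀ ^ 2 / (4 * η ^ 2)) (R 0) z) 1 f (X (Sum.inl j))) *
        ∏ l ∈ (s.image Prod.snd)ᶜ, meanField (η / (k₀ * ε)) z
          (fieldConst d (k₀ ^ 2 / (4 * η ^ 2)) (R 0) z) (-1) (fun ζ => conj (f ζ))
          (X (Sum.inr l)) := by
  rw [mainTerm_eq h hU hz, integ_gaussDual, Finset.mul_sum, Finset.mul_sum]
  refine Finset.sum_congr rfl fun s hs => ?_
  rw [← (mem_matchings.1 hs).integ_crossProd_waveTest _ _ _ _ hf, ← mul_assoc]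
  congr 1
  rw [fieldConst, mul_pow, ← fourierConst_eq_pow, ← Complex.ofReal_pow, ← Real.exp_nat_mul]
  congr 3
  push_cast
  ring

end ProductData

section Moments

variable {d : ℕ} {reg : Regime} {R : Lat d → ℝ}

theorem matchings_of_isEmpty (p q : ℕ) (h : IsEmpty (Fin p × Fin q)) : matchings p q = {∅} := by
  ext s
  rw [Finset.mem_singleton, mem_matchings]
  exact ⟨fun _ => Finset.eq_empty_of_isEmpty s, fun e => by subst e; simp [IsMatching]⟩

theorem matchings_one_one : matchings 1 1 = {∅, {(0, 0)}} := by
  ext s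
  rw [mem_matchings, Finset.mem_insert, Finset.mem_singleton]
  constructor
  · intro _
    by_cases h : ((0, 0) : Fin 1 × Fin 1) ∈ s
    · right
      ext γ
      simp [Subsingleton.elim γ (0, 0), h]
    · left
      refine Finset.eq_empty_of_forall_notMem fun γ hγ => h ?_
      rwa [Subsingleton.elim (0, 0) γ]
  · rintro - γ - γ' - hne
    exact absurd (Subsingleton.elim γ γ') hne

variable {k₀ η ε : ℝ} {f : Lat d → ℂ} {M : ∀ p q : ℕ, ℝ → ComplexMeasure (Config p q d)}

theorem twins_eq_empty {p q : ℕ} (hp : p ≤ 1) (hq : q ≤ 1) : twins p q = ∅ := by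
  have : Subsingleton (Fin p) := Fin.subsingleton_iff_le_one.2 hp
  have : Subsingleton (Fin q) := Fin.subsingleton_iff_le_one.2 hq
  refine Finset.eq_empty_of_forall_notMem ?_
  rintro ⟨a | a, b | b⟩ he <;> simp [twins] at he
  · exact absurd (Subsingleton.elim a b) he.ne
  · exact absurd (Subsingleton.elim a b) he.ne

/-- Moments with at most one block of each kind are given by the main term. -/
theorem IsMomentFamily.moment_eq_sum (hM : IsMomentFamily k₀ R η ε f M) (hd : 1 ≤ d)
    (h : IsCovariance reg R) [IsFiniteMeasure (medium (k₀ ^ 2 / (4 * η ^ 2)) R)]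
    (hf : Integrable f) {z : ℝ} (hz : 0 ≤ z) {p q : ℕ} (hp : p ≤ 1) (hq : q ≤ 1)
    (X : Fin p → Lat d) (Y : Fin q → Lat d) :
    moment M z p q X Y = ∑ s ∈ matchings p q,
        (∏ γ ∈ s, covField (medium (k₀ ^ 2 / (4 * η ^ 2)) R) (η / (k₀ * ε)) z
          (fieldConst d (k₀ ^ 2 / (4 * η ^ 2)) (R 0) z) f (X γ.1) (Y γ.2)) *
        (∏ j ∈ (s.image Prod.fst)ᶜ, meanField (η / (k₀ * ε)) z
          (fieldConst d (k₀ ^ 2 / (4 * η ^ 2)) (R 0) z) 1 f (X j)) *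
        ∏ l ∈ (s.image Prod.snd)ᶜ, meanField (η / (k₀ * ε)) z
          (fieldConst d (k₀ ^ 2 / (4 * η ^ 2)) (R 0) z) (-1) (fun ζ => conj (f ζ)) (Y l) := by
  have : Subsingleton (Fin p) := Fin.subsingleton_iff_le_one.2 hp
  have : Subsingleton (Fin q) := Fin.subsingleton_iff_le_one.2 hq
  choose U hU using fun γ : Fin p × Fin q => exists_isPairPropagator hd h k₀ η ε γ
  have e := errorTerm_eq_zero hd h (twins_eq_empty hp hq) (fun γ γ' => Subsingleton.elim γ γ')
    (hM p q).1 hU hz (Sum.elim X Y)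
  rw [errorTerm, (hM p q).2, mainTerm_productDensity h hU hz hf, sub_eq_zero] at e
  exact e

theorem IsMomentFamily.moment10_eq (hM : IsMomentFamily k₀ R η ε f M) (hd : 1 ≤ d)
    (h : IsCovariance reg R) [IsFiniteMeasure (medium (k₀ ^ 2 / (4 * η ^ 2)) R)]
    (hf : Integrable f) {z : ℝ} (hz : 0 ≤ z) (x : Lat d) :
    moment10 M z x = meanField (η / (k₀ * ε)) z
      (fieldConst d (k₀ ^ 2 / (4 * η ^ 2)) (R 0) z) 1 f x := by
  rw [moment10, hM.moment_eq_sum hd h hf hz le_rfl zero_le_one,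
    matchings_of_isEmpty 1 0 inferInstance]
  simp

theorem IsMomentFamily.moment01_eq (hM : IsMomentFamily k₀ R η ε f M) (hd : 1 ≤ d)
    (h : IsCovariance reg R) [IsFiniteMeasure (medium (k₀ ^ 2 / (4 * η ^ 2)) R)]
    (hf : Integrable f) {z : ℝ} (hz : 0 ≤ z) (y : Lat d) :
    moment01 M z y = meanField (η / (k₀ * ε)) z
      (fieldConst d (k₀ ^ 2 / (4 * η ^ 2)) (R 0) z) (-1) (fun ζ => conj (f ζ)) y := by
  rw [moment01, hM.moment_eq_sum hd h hf hz zero_le_one le_rfl,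
    matchings_of_isEmpty 0 1 inferInstance]
  simp

theorem IsMomentFamily.moment11_eq (hM : IsMomentFamily k₀ R η ε f M) (hd : 1 ≤ d)
    (h : IsCovariance reg R) [IsFiniteMeasure (medium (k₀ ^ 2 / (4 * η ^ 2)) R)]
    (hf : Integrable f) {z : ℝ} (hz : 0 ≤ z) (x y : Lat d) :
    moment11 M z x y = covField (medium (k₀ ^ 2 / (4 * η ^ 2)) R) (η / (k₀ * ε)) z
      (fieldConst d (k₀ ^ 2 / (4 * η ^ 2)) (R 0) z) f x y + moment10 M z x * moment01 M z y := by
  rw [hM.moment10_eq hd h hf hz, hM.moment01_eq hd h hf hz, moment11,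
    hM.moment_eq_sum hd h hf hz le_rfl le_rfl, matchings_one_one,
    Finset.sum_insert (by simp), Finset.sum_singleton, add_comm]
  have e : ({0} : Finset (Fin 1))ᶜ = ∅ := by decide
  simp [e]

/-- For product data, the moments are the Gaussian functional of the first and second moments, up
to the error term. -/
theorem IsMomentFamily.moment_eq_gaussianF_add (hM : IsMomentFamily k₀ R η ε f M) (hd : 1 ≤ d)
    (h : IsCovariance reg R) (hf : Integrable f) {z : ℝ} (hz : 0 ≤ z) {p q : ℕ}
    {U : Fin p × Fin q → ℝ → Module.End ℂ (ComplexMeasure (Config p q d))}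
    (hU : ∀ γ, IsPairPropagator k₀ R η ε γ (U γ)) (X : Fin p → Lat d) (Y : Fin q → Lat d) :
    moment M z p q X Y = gaussianF (fun j => moment10 M z (X j)) (fun l => moment01 M z (Y l))
        (fun j l => moment11 M z (X j) (Y l)) +
      errorTerm k₀ R η ε U (M p q) z (Sum.elim X Y) := by
  have hfin := h.isFiniteMeasure_medium hd (k₀ ^ 2 / (4 * η ^ 2))
  rw [errorTerm, (hM p q).2, mainTerm_productDensity h hU hz hf, gaussianF]
  simp only [hM.moment11_eq hd h hf hz, add_sub_cancel_right, hM.moment10_eq hd h hf hz,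
    hM.moment01_eq hd h hf hz, Sum.elim_inl, Sum.elim_inr]
  rw [add_sub_cancel]
  rfl

end Moments


/-! ### Centering of the Gaussian functional -/

section Combinatorics

variable {p q : ℕ}

/-- The Gaussian functional of a selection of the variables, as a sum over the matchings of the
selected indices. -/
theorem gaussianF_comp {m n : ℕ} (e : Fin m ↪ Fin p) (e' : Fin n ↪ Fin q) (h : Fin p → ℂ)
    (h' : Fin q → ℂ) (g : Fin p → Fin q → ℂ) :
    gaussianF (fun j => h (e j)) (fun l => h' (e' l)) (fun j l => g (e j) (e' l)) =
      ∑ s ∈ matchings p q,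
        if s.image Prod.fst ⊆ Finset.univ.map e ∧ s.image Prod.snd ⊆ Finset.univ.map e' then
          (∏ γ ∈ s, (g γ.1 γ.2 - h γ.1 * h' γ.2)) *
            (∏ j ∈ Finset.univ.map e \ s.image Prod.fst, h j) *
            ∏ l ∈ Finset.univ.map e' \ s.image Prod.snd, h' l
        else 0 := by
  rw [← Finset.sum_filter, gaussianF]
  have i1 : ∀ s : Finset (Fin m × Fin n),
      (s.map (e.prodMap e')).image Prod.fst = (s.image Prod.fst).map e := fun s => by
    ext j; simp
  have i2 : ∀ s : Finset (Fin m × Fin n),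
      (s.map (e.prodMap e')).image Prod.snd = (s.image Prod.snd).map e' := fun s => by
    ext l
    simp only [Finset.mem_image, Finset.mem_map, exists_exists_and_eq_and]
    rfl
  refine Finset.sum_bij (fun s _ => s.map (e.prodMap e')) ?_ ?_ ?_ ?_
  · intro s hs
    rw [mem_matchings] at hs
    rw [Finset.mem_filter, mem_matchings, i1, i2]
    refine ⟨?_, Finset.map_subset_map.2 (Finset.subset_univ _),
      Finset.map_subset_map.2 (Finset.subset_univ _)⟩
    intro γ hγ γ' hγ' hne
    obtain ⟨δ, hδ, rfl⟩ := Finset.mem_map.1 hγ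
    obtain ⟨δ', hδ', rfl⟩ := Finset.mem_map.1 hγ'
    have hd := hs δ hδ δ' hδ' fun e => hne (by rw [e])
    exact ⟨fun h => hd.1 (e.injective h), fun h => hd.2 (e'.injective h)⟩
  · intro s _ t _ hst
    exact Finset.map_injective _ hst
  · intro t ht
    rw [Finset.mem_filter, mem_matchings] at ht
    refine ⟨Finset.univ.filter fun γ => e.prodMap e' γ ∈ t, ?_, ?_⟩
    · rw [mem_matchings]
      intro γ hγ γ' hγ' hne
      have hd := ht.1 _ (Finset.mem_filter.1 hγ).2 _ (Finset.mem_filter.1 hγ').2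
        fun h => hne ((e.prodMap e').injective h)
      exact ⟨fun h => hd.1 (congrArg e h), fun h => hd.2 (congrArg e' h)⟩
    · ext ⟨j, l⟩
      rw [Finset.mem_map]
      constructor
      · rintro ⟨γ, hγ, h⟩
        rw [← h]
        exact (Finset.mem_filter.1 hγ).2
      · intro hjl
        obtain ⟨a, -, rfl⟩ := Finset.mem_map.1 (ht.2.1 (Finset.mem_image_of_mem Prod.fst hjl))
        obtain ⟨b, -, rfl⟩ := Finset.mem_map.1 (ht.2.2 (Finset.mem_image_of_mem Prod.snd hjl))
        exact ⟨(a, b), Finset.mem_filter.2 ⟨Finset.mem_univ _, hjl⟩, rfl⟩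
  · intro s _
    have c1 : Finset.univ.map e \ (s.image Prod.fst).map e = ((s.image Prod.fst)ᶜ).map e := by
      rw [Finset.compl_eq_univ_sdiff, Finset.map_sdiff]
    have c2 : Finset.univ.map e' \ (s.image Prod.snd).map e' = ((s.image Prod.snd)ᶜ).map e' := by
      rw [Finset.compl_eq_univ_sdiff, Finset.map_sdiff]
    rw [i1, i2, c1, c2, Finset.prod_map, Finset.prod_map, Finset.prod_map]
    rfl

/-- Inclusion–exclusion: the contributions of the sets `S` that contain `A` cancel unless `A` is
everything. This is the expansion of a product that has a factor `h j - h j` for each `j ∉ A`. -/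
theorem sum_superset_alternating (A : Finset (Fin p)) (h : Fin p → ℂ) :
    ∑ S : Finset (Fin p), (if A ⊆ S then (-1) ^ Sᶜ.card * ((∏ j ∈ S \ A, h j) * ∏ j ∈ Sᶜ, h j)
      else 0) = if A = Finset.univ then 1 else 0 := by
  have e := Fintype.prod_add (fun j => if j ∈ A then 1 else h j) fun j => if j ∈ A then 0 else -h j
  have e1 : ∏ j, ((if j ∈ A then 1 else h j) + if j ∈ A then 0 else -h j) =
      if A = Finset.univ then (1 : ℂ) else 0 := by
    split_ifs with hA
    · simp [hA]
    · obtain ⟨j, hj⟩ : ∃ j, j ∉ A := by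
        by_contra! hc
        exact hA (Finset.eq_univ_of_forall hc)
      exact Finset.prod_eq_zero (Finset.mem_univ j) (by simp [hj])
  rw [← e1, e]
  refine Finset.sum_congr rfl fun S _ => ?_
  split_ifs with hAS
  · have s1 : ∏ j ∈ S, (if j ∈ A then 1 else h j) = ∏ j ∈ S \ A, h j := by
      rw [← Finset.prod_sdiff hAS]
      rw [Finset.prod_congr rfl fun j hj => if_neg (Finset.mem_sdiff.1 hj).2,
        Finset.prod_congr (s₁ := A) rfl fun j hj => if_pos hj, Finset.prod_const_one, mul_one]
    have s2 : ∏ j ∈ Sᶜ, (if j ∈ A then 0 else -h j) = (-1) ^ Sᶜ.card * ∏ j ∈ Sᶜ, h j := by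
      rw [← Finset.prod_neg]
      exact Finset.prod_congr rfl fun j hj => if_neg fun hjA => Finset.mem_compl.1 hj (hAS hjA)
    rw [s1, s2]
    ring
  · obtain ⟨j, hj, hjS⟩ := Finset.not_subset.1 hAS
    have s0 : ∏ j ∈ Sᶜ, (if j ∈ A then 0 else -h j) = 0 :=
      Finset.prod_eq_zero (Finset.mem_compl.2 hjS) (if_pos hj)
    rw [s0, mul_zero]

/-- The perfect matchings are the graphs of the permutations. -/
theorem centeredF_eq_sum_matchings (c : Fin p → Fin q → ℂ) : centeredF c =
    ∑ s ∈ matchings p q, (∏ γ ∈ s, c γ.1 γ.2) * ((if s.image Prod.fst = Finset.univ then 1 else 0) *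
      if s.image Prod.snd = Finset.univ then 1 else 0) := by
  have e : ∀ s : Finset (Fin p × Fin q), (∏ γ ∈ s, c γ.1 γ.2) *
      (((if s.image Prod.fst = Finset.univ then 1 else 0) : ℂ) *
      if s.image Prod.snd = Finset.univ then 1 else 0) =
      if s.image Prod.fst = Finset.univ ∧ s.image Prod.snd = Finset.univ then
        ∏ γ ∈ s, c γ.1 γ.2 else 0 := fun s => by
    by_cases h1 : s.image Prod.fst = Finset.univ <;>
      by_cases h2 : s.image Prod.snd = Finset.univ <;> simp [h1, h2]
  simp only [e]
  rw [← Finset.sum_filter]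
  by_cases hpq : p = q
  · subst hpq
    rw [centeredF, dif_pos rfl]
    let gr : Equiv.Perm (Fin p) → Fin p ↪ Fin p × Fin p := fun π =>
      ⟨fun j => (j, π j), fun j j' h => congrArg Prod.fst h⟩
    refine Finset.sum_bij (fun π _ => Finset.univ.map (gr π)) ?_ ?_ ?_ ?_
    · intro π _
      rw [Finset.mem_filter, mem_matchings]
      refine ⟨?_, ?_, ?_⟩
      · intro γ hγ γ' hγ' hne
        obtain ⟨j, -, rfl⟩ := Finset.mem_map.1 hγ
        obtain ⟨j', -, rfl⟩ := Finset.mem_map.1 hγ'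
        have hj : j ≠ j' := fun h => hne (by rw [h])
        exact ⟨hj, fun h => hj (π.injective h)⟩
      · refine Finset.eq_univ_of_forall fun j => Finset.mem_image.2 ⟨(j, π j), ?_, rfl⟩
        exact Finset.mem_map.2 ⟨j, Finset.mem_univ _, rfl⟩
      · refine Finset.eq_univ_of_forall fun l => Finset.mem_image.2 ⟨(π.symm l, l), ?_, rfl⟩
        exact Finset.mem_map.2 ⟨π.symm l, Finset.mem_univ _, Prod.ext rfl (π.apply_symm_apply l)⟩
    · intro π _ π' _ h
      refine Equiv.ext fun j => ?_
      have hj : (j, π j) ∈ Finset.univ.map (gr π') := by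
        rw [← h]
        exact Finset.mem_map.2 ⟨j, Finset.mem_univ _, rfl⟩
      obtain ⟨j', -, h'⟩ := Finset.mem_map.1 hj
      have h1 : j' = j := congrArg Prod.fst h'
      have h2 : π' j' = π j := congrArg Prod.snd h'
      rw [← h2, h1]
    · intro s hs
      rw [Finset.mem_filter, mem_matchings] at hs
      obtain ⟨hs, h1, -⟩ := hs
      have hex : ∀ j, ∃ l, (j, l) ∈ s := fun j => by
        obtain ⟨γ, hγ, rfl⟩ := Finset.mem_image.1 (h1 ▸ Finset.mem_univ j)
        exact ⟨γ.2, hγ⟩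
      choose w hw using hex
      have hinj : Function.Injective w := fun j j' h => by
        by_contra hne
        exact (hs _ (hw j) _ (hw j') fun e => hne (congrArg Prod.fst e)).2 h
      refine ⟨Equiv.ofBijective w (Finite.injective_iff_bijective.1 hinj), Finset.mem_univ _, ?_⟩
      ext γ
      rw [Finset.mem_map]
      constructor
      · rintro ⟨j, -, rfl⟩
        exact hw j
      · intro hγ
        refine ⟨γ.1, Finset.mem_univ _, ?_⟩
        by_contra hne
        exact (hs _ (hw γ.1) _ hγ hne).1 rfl
    · intro π _
      rw [Finset.prod_map]
      rfl
  · rw [centeredF, dif_neg hpq]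
    refine (Finset.sum_eq_zero fun s hs => ?_).symm
    rw [Finset.mem_filter, mem_matchings] at hs
    obtain ⟨hs, h1, h2⟩ := hs
    have c1 : (s.image Prod.fst).card = s.card := Finset.card_image_of_injOn
      fun γ hγ γ' hγ' e => by
        by_contra hne
        exact (hs γ hγ γ' hγ' hne).1 e
    have c2 : (s.image Prod.snd).card = s.card := Finset.card_image_of_injOn
      fun γ hγ γ' hγ' e => by
        by_contra hne
        exact (hs γ hγ γ' hγ' hne).2 e
    rw [h1, Finset.card_univ, Fintype.card_fin] at c1
    rw [h2, Finset.card_univ, Fintype.card_fin] at c2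
    exact absurd (c1.trans c2.symm) hpq

/-- Centering of the Gaussian functional: in the alternating sum only the perfect matchings remain. -/
theorem sum_gaussianF_centered (h : Fin p → ℂ) (h' : Fin q → ℂ) (g : Fin p → Fin q → ℂ) :
    ∑ S : Finset (Fin p), ∑ T : Finset (Fin q), (-1) ^ (Sᶜ.card + Tᶜ.card) *
        gaussianF (fun j => h (S.orderEmbOfFin rfl j)) (fun l => h' (T.orderEmbOfFin rfl l))
          (fun j l => g (S.orderEmbOfFin rfl j) (T.orderEmbOfFin rfl l)) *
        (∏ j ∈ Sᶜ, h j) * ∏ l ∈ Tᶜ, h' l =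
      centeredF fun j l => g j l - h j * h' l := by
  have hG : ∀ (S : Finset (Fin p)) (T : Finset (Fin q)),
      gaussianF (fun j => h (S.orderEmbOfFin rfl j)) (fun l => h' (T.orderEmbOfFin rfl l))
          (fun j l => g (S.orderEmbOfFin rfl j) (T.orderEmbOfFin rfl l)) =
      ∑ s ∈ matchings p q, if s.image Prod.fst ⊆ S ∧ s.image Prod.snd ⊆ T then
          (∏ γ ∈ s, (g γ.1 γ.2 - h γ.1 * h' γ.2)) * (∏ j ∈ S \ s.image Prod.fst, h j) *
            ∏ l ∈ T \ s.image Prod.snd, h' l else 0 := fun S T => by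
    have e := gaussianF_comp (S.orderEmbOfFin rfl).toEmbedding (T.orderEmbOfFin rfl).toEmbedding
      h h' g
    simp only [Finset.map_orderEmbOfFin_univ] at e
    exact e
  simp only [hG, Finset.mul_sum, Finset.sum_mul]
  rw [centeredF_eq_sum_matchings]
  simp only [← sum_superset_alternating _ h, ← sum_superset_alternating _ h',
    Finset.mul_sum]
  simp only [Finset.sum_mul, Finset.mul_sum]
  rw [Finset.sum_congr rfl fun S _ => Finset.sum_comm, Finset.sum_comm]
  refine Finset.sum_congr rfl fun s _ => ?_
  rw [Finset.sum_comm]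
  refine Finset.sum_congr rfl fun T _ => Finset.sum_congr rfl fun S _ => ?_
  by_cases h1 : s.image Prod.fst ⊆ S
  · by_cases h2 : s.image Prod.snd ⊆ T
    · rw [if_pos ⟨h1, h2⟩, if_pos h1, if_pos h2, pow_add]
      ring
    · rw [if_neg fun hc => h2 hc.2, if_neg h2]
      ring
  · rw [if_neg fun hc => h1 hc.1, if_neg h1]
    ring

end Combinatorics


/-! ### Centered moments and random fields -/

section CenteredMoments

variable {d : ℕ} {reg : Regime} {R : Lat d → ℝ} {k₀ η ε : ℝ} {f : Lat d → ℂ}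
  {M : ∀ p q : ℕ, ℝ → ComplexMeasure (Config p q d)}

theorem centeredF_one_one (c : Fin 1 → Fin 1 → ℂ) : centeredF c = c 0 0 := by
  rw [centeredF, dif_pos rfl, Fintype.sum_subsingleton _ (1 : Equiv.Perm (Fin 1))]
  simp

/-- The deviation of the centered moments from the Gaussian values, in terms of the error terms. -/
theorem IsMomentFamily.centeredMoment_eq_add (hM : IsMomentFamily k₀ R η ε f M) (hd : 1 ≤ d)
    (h : IsCovariance reg R) (hf : Integrable f) {z : ℝ} (hz : 0 ≤ z)
    {U : ∀ p q : ℕ, Fin p × Fin q → ℝ → Module.End ℂ (ComplexMeasure (Config p q d))}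
    (hU : ∀ p q γ, IsPairPropagator k₀ R η ε γ (U p q γ)) {p q : ℕ}
    (X : Fin p → Lat d) (Y : Fin q → Lat d) :
    centeredMoment M z p q X Y =
      centeredF (fun j l => moment11 M z (X j) (Y l) - moment10 M z (X j) * moment01 M z (Y l)) +
      ∑ S : Finset (Fin p), ∑ T : Finset (Fin q), (-1) ^ (Sᶜ.card + Tᶜ.card) *
        errorTerm k₀ R η ε (U S.card T.card) (M S.card T.card) z
          (Sum.elim (X ∘ S.orderEmbOfFin rfl) (Y ∘ T.orderEmbOfFin rfl)) *
        (∏ j ∈ Sᶜ, moment10 M z (X j)) * ∏ l ∈ Tᶜ, moment01 M z (Y l) := by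
  rw [centeredMoment, ← sum_gaussianF_centered (fun j => moment10 M z (X j))
    (fun l => moment01 M z (Y l)) (fun j l => moment11 M z (X j) (Y l)),
    ← Finset.sum_add_distrib]
  refine Finset.sum_congr rfl fun S _ => ?_
  rw [← Finset.sum_add_distrib]
  refine Finset.sum_congr rfl fun T _ => ?_
  rw [submoment, hM.moment_eq_gaussianF_add hd h hf hz (hU S.card T.card)]
  simp only [Function.comp_apply]
  ring

theorem IsMomentFamily.centeredMoment11_eq (hM : IsMomentFamily k₀ R η ε f M) (hd : 1 ≤ d)
    (h : IsCovariance reg R) (hf : Integrable f) {z : ℝ} (hz : 0 ≤ z) (x y : Lat d) :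
    centeredMoment11 M z x y = moment11 M z x y - moment10 M z x * moment01 M z y := by
  choose U hU using fun (p q : ℕ) (γ : Fin p × Fin q) => exists_isPairPropagator hd h k₀ η ε γ
  rw [centeredMoment11, hM.centeredMoment_eq_add hd h hf hz hU, centeredF_one_one]
  refine add_eq_left.2 (Finset.sum_eq_zero fun S _ => Finset.sum_eq_zero fun T _ => ?_)
  have hS : S.card ≤ 1 := (Finset.card_le_univ S).trans (by simp)
  have hT : T.card ≤ 1 := (Finset.card_le_univ T).trans (by simp)
  have : Subsingleton (Fin S.card) := Fin.subsingleton_iff_le_one.2 hS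
  have : Subsingleton (Fin T.card) := Fin.subsingleton_iff_le_one.2 hT
  rw [errorTerm_eq_zero hd h (twins_eq_empty hS hT) (fun γ γ' => Subsingleton.elim γ γ')
    (hM S.card T.card).1 (hU S.card T.card) hz]
  ring

/-- The centered moments are close to the Gaussian values. A bound `C ε^{11/30}` of the error terms
leaves room for the constant: it is absorbed if `ε` is small. -/
theorem exists_centeredMoment_bound (hd : 1 ≤ d) (h : IsCovariance reg R) (hk : 0 < k₀) (p q : ℕ)
    {Z : ℝ} (hZ : 0 ≤ Z) : ∃ ε₀ : ℝ, 0 < ε₀ ∧ ∀ ε ∈ reg.range, ε < ε₀ →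
      ∀ f : Lat d → ℂ, Integrable f →
      ∀ M : ∀ p q : ℕ, ℝ → ComplexMeasure (Config p q d),
      IsMomentFamily k₀ R (reg.eta ε) ε f M →
      ∀ z ∈ Icc 0 Z, ∀ (X : Fin p → Lat d) (Y : Fin q → Lat d),
        ‖centeredMoment M z p q X Y
            - centeredF (fun j l => centeredMoment11 M z (X j) (Y l))‖ ≤
          tv (M p q 0) * ε ^ (1 / 3 : ℝ) := by
  choose C hC0 hC using fun p q : ℕ => exists_error_bound hd h hk p q hZ
  set K : ℝ := ∑ S : Finset (Fin p), ∑ T : Finset (Fin q),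
    C S.card T.card * C 1 0 ^ Sᶜ.card * C 0 1 ^ Tᶜ.card with hK
  have hK0 : 0 ≤ K := Finset.sum_nonneg fun S _ => Finset.sum_nonneg fun T _ =>
    mul_nonneg (mul_nonneg (hC0 _ _) (pow_nonneg (hC0 _ _) _)) (pow_nonneg (hC0 _ _) _)
  refine ⟨((K + 1)⁻¹) ^ 30, by positivity, fun ε hε hlt f hf M hM z hz X Y => ?_⟩
  have hε0 := Regime.pos_of_mem_range hε
  choose U hU using fun (p q : ℕ) (γ : Fin p × Fin q) =>
    exists_isPairPropagator hd h k₀ (reg.eta ε) ε γ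
  simp only [hM.centeredMoment11_eq hd h hf hz.1]
  rw [hM.centeredMoment_eq_add hd h hf hz.1 hU, add_sub_cancel_left]
  set N : ℝ := ∫ ξ, ‖f ξ‖ with hN
  have hN0 : 0 ≤ N := integral_nonneg fun _ => norm_nonneg _
  have htv : ∀ p q, tv (M p q 0) = N ^ (p + q) := fun p q => by
    rw [(hM p q).2, tv_productDensity hf]
  have h10 : ∀ x, ‖moment10 M z x‖ ≤ C 1 0 * N := fun x => by
    have := (hC 1 0 ε hε _ (hM 1 0).1 z hz (Sum.elim ![x] ![])).1
    rwa [htv, add_zero, pow_one] at this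
  have h01 : ∀ y, ‖moment01 M z y‖ ≤ C 0 1 * N := fun y => by
    have := (hC 0 1 ε hε _ (hM 0 1).1 z hz (Sum.elim ![] ![y])).1
    rwa [htv, zero_add, pow_one] at this
  have hterm : ∀ (S : Finset (Fin p)) (T : Finset (Fin q)),
      ‖(-1) ^ (Sᶜ.card + Tᶜ.card) *
        errorTerm k₀ R (reg.eta ε) ε (U S.card T.card) (M S.card T.card) z
          (Sum.elim (X ∘ S.orderEmbOfFin rfl) (Y ∘ T.orderEmbOfFin rfl)) *
        (∏ j ∈ Sᶜ, moment10 M z (X j)) * ∏ l ∈ Tᶜ, moment01 M z (Y l)‖ ≤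
      C S.card T.card * C 1 0 ^ Sᶜ.card * C 0 1 ^ Tᶜ.card * (N ^ (p + q) * ε ^ (11 / 30 : ℝ)) := by
    intro S T
    have e1 := (hC S.card T.card ε hε _ (hM S.card T.card).1 z hz
      (Sum.elim (X ∘ S.orderEmbOfFin rfl) (Y ∘ T.orderEmbOfFin rfl))).2 _ (hU S.card T.card)
    have e2 : ‖∏ j ∈ Sᶜ, moment10 M z (X j)‖ ≤ (C 1 0 * N) ^ Sᶜ.card := by
      rw [norm_prod]
      exact (Finset.prod_le_prod (fun _ _ => norm_nonneg _) fun j _ => h10 _).trans_eq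
        (Finset.prod_const _)
    have e3 : ‖∏ l ∈ Tᶜ, moment01 M z (Y l)‖ ≤ (C 0 1 * N) ^ Tᶜ.card := by
      rw [norm_prod]
      exact (Finset.prod_le_prod (fun _ _ => norm_nonneg _) fun l _ => h01 _).trans_eq
        (Finset.prod_const _)
    rw [htv] at e1
    have hS : S.card + Sᶜ.card = p := by simp
    have hT : T.card + Tᶜ.card = q := by simp
    have hpow : N ^ (p + q) = N ^ (S.card + T.card) * N ^ Sᶜ.card * N ^ Tᶜ.card := by
      rw [← pow_add, ← pow_add]
      congr 1
      omega
    rw [norm_mul, norm_mul, norm_mul, norm_pow, norm_neg, norm_one, one_pow, one_mul]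
    have hc1 := hC0 1 0
    have hc2 := hC0 0 1
    have hc3 := hC0 S.card T.card
    calc _ ≤ C S.card T.card * ε ^ (11 / 30 : ℝ) * N ^ (S.card + T.card) * (C 1 0 * N) ^ Sᶜ.card *
          (C 0 1 * N) ^ Tᶜ.card := by gcongr
      _ = _ := by rw [hpow, mul_pow, mul_pow]; ring
  refine (norm_sum_le _ _).trans ((Finset.sum_le_sum fun S _ => (norm_sum_le _ _).trans
    (Finset.sum_le_sum fun T _ => hterm S T)).trans ?_)
  simp only [← Finset.sum_mul]
  rw [← hK, htv]
  have hsmall : K * ε ^ (1 / 30 : ℝ) ≤ 1 := by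
    have e1 : ε ^ (1 / 30 : ℝ) ≤ (K + 1)⁻¹ := by
      have := Real.rpow_le_rpow hε0.le hlt.le (by norm_num : (0 : ℝ) ≤ 1 / 30)
      refine this.trans_eq ?_
      rw [← Real.rpow_natCast, ← Real.rpow_mul (by positivity)]
      norm_num
    calc K * ε ^ (1 / 30 : ℝ) ≤ K * (K + 1)⁻¹ := mul_le_mul_of_nonneg_left e1 hK0
      _ ≤ 1 := by rw [← div_eq_mul_inv, div_le_one (by positivity)]; linarith
  have hsplit : ε ^ (11 / 30 : ℝ) = ε ^ (1 / 30 : ℝ) * ε ^ (1 / 3 : ℝ) := by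
    rw [← Real.rpow_add hε0]
    norm_num
  calc K * (N ^ (p + q) * ε ^ (11 / 30 : ℝ)) =
        (K * ε ^ (1 / 30 : ℝ)) * (N ^ (p + q) * ε ^ (1 / 3 : ℝ)) := by rw [hsplit]; ring
    _ ≤ 1 * (N ^ (p + q) * ε ^ (1 / 3 : ℝ)) := by
        refine mul_le_mul_of_nonneg_right hsmall ?_
        have := Real.rpow_nonneg hε0.le (1 / 3)
        positivity
    _ = _ := one_mul _

end CenteredMoments

section RandomField

variable {d p q : ℕ} {M : ∀ p q : ℕ, ℝ → ComplexMeasure (Config p q d)} {z : ℝ}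
  {Ω : Type*} [MeasurableSpace Ω] {P : Measure Ω} {X : Fin p → Lat d} {Y : Fin q → Lat d}
  {a : Fin p → Ω → ℂ} {b : Fin q → Ω → ℂ}

theorem submoment_eq (M : ∀ p q : ℕ, ℝ → ComplexMeasure (Config p q d)) (z : ℝ)
    (X : Fin p → Lat d) (Y : Fin q → Lat d) {S : Finset (Fin p)} {T : Finset (Fin q)} {m n : ℕ}
    (hS : S.card = m) (hT : T.card = n) : submoment M z X Y S T =
      moment M z m n (X ∘ S.orderEmbOfFin hS) (Y ∘ T.orderEmbOfFin hT) := by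
  subst hS hT
  rfl

theorem submoment_singleton_empty (j : Fin p) :
    submoment M z X Y {j} ∅ = moment10 M z (X j) := by
  rw [submoment_eq M z X Y (Finset.card_singleton j) Finset.card_empty, moment10]
  congr 1
  · funext i
    rw [Function.comp_apply, Finset.orderEmbOfFin_singleton]
    simp
  · exact Subsingleton.elim _ _

theorem submoment_empty_singleton (l : Fin q) :
    submoment M z X Y ∅ {l} = moment01 M z (Y l) := by
  rw [submoment_eq M z X Y Finset.card_empty (Finset.card_singleton l), moment01]
  congr 1
  · exact Subsingleton.elim _ _
  · funext i
    rw [Function.comp_apply, Finset.orderEmbOfFin_singleton]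
    simp

theorem submoment_singleton_singleton (j : Fin p) (l : Fin q) :
    submoment M z X Y {j} {l} = moment11 M z (X j) (Y l) := by
  rw [submoment_eq M z X Y (Finset.card_singleton j) (Finset.card_singleton l), moment11]
  congr 1
  · funext i
    rw [Function.comp_apply, Finset.orderEmbOfFin_singleton]
    simp
  · funext i
    rw [Function.comp_apply, Finset.orderEmbOfFin_singleton]
    simp

theorem HasFieldMoments.integral_fst (h : HasFieldMoments P M z X Y a b) (j : Fin p) :
    ∫ ω, a j ω ∂P = moment10 M z (X j) := by
  have := (h {j} ∅).2
  rw [submoment_singleton_empty] at this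
  simpa using this

theorem HasFieldMoments.integral_snd (h : HasFieldMoments P M z X Y a b) (l : Fin q) :
    conj (∫ ω, b l ω ∂P) = moment01 M z (Y l) := by
  have := (h ∅ {l}).2
  rw [submoment_empty_singleton] at this
  rw [← integral_conj]
  simpa using this

/-- The centered moments of a random field with the given moments are the alternating sums
`centeredMoment`. -/
theorem HasFieldMoments.integral_centered (h : HasFieldMoments P M z X Y a b) :
    ∫ ω, (∏ j, centered P (a j) ω) * ∏ l, conj (centered P (b l) ω) ∂P =
      centeredMoment M z p q X Y := by
  have e : ∀ ω, (∏ j, centered P (a j) ω) * ∏ l, conj (centered P (b l) ω) =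
      ∑ S : Finset (Fin p), ∑ T : Finset (Fin q),
        ((∏ j ∈ S, a j ω) * ∏ l ∈ T, conj (b l ω)) * ((-1) ^ (Sᶜ.card + Tᶜ.card) *
          (∏ j ∈ Sᶜ, moment10 M z (X j)) * ∏ l ∈ Tᶜ, moment01 M z (Y l)) := fun ω => by
    simp only [centered, map_sub, h.integral_fst, h.integral_snd]
    simp only [sub_eq_add_neg]
    rw [Fintype.prod_add, Fintype.prod_add, Finset.sum_mul_sum]
    refine Finset.sum_congr rfl fun S _ => Finset.sum_congr rfl fun T _ => ?_
    rw [Finset.prod_neg, Finset.prod_neg, pow_add]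
    ring
  simp only [e]
  have hint : ∀ (S : Finset (Fin p)) (T : Finset (Fin q)), Integrable (fun ω =>
      ((∏ j ∈ S, a j ω) * ∏ l ∈ T, conj (b l ω)) * ((-1) ^ (Sᶜ.card + Tᶜ.card) *
          (∏ j ∈ Sᶜ, moment10 M z (X j)) * ∏ l ∈ Tᶜ, moment01 M z (Y l))) P :=
    fun S T => (h S T).1.mul_const _
  rw [integral_finsetSum _ fun S _ => integrable_finsetSum _ fun T _ => hint S T, centeredMoment]
  refine Finset.sum_congr rfl fun S _ => ?_
  rw [integral_finsetSum _ fun T _ => hint S T]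
  refine Finset.sum_congr rfl fun T _ => ?_
  rw [integral_mul_const, (h S T).2]
  ring

theorem HasFieldMoments.integral_centered_mul [IsProbabilityMeasure P]
    (h : HasFieldMoments P M z X Y a b) (j : Fin p) (l : Fin q) :
    ∫ ω, centered P (a j) ω * conj (centered P (b l) ω) ∂P =
      moment11 M z (X j) (Y l) - moment10 M z (X j) * moment01 M z (Y l) := by
  have hab := h {j} {l}
  have ha := (h {j} ∅).1
  have hb := (h ∅ {l}).1
  have hb' := h.integral_snd l
  rw [← integral_conj] at hb'
  rw [submoment_singleton_singleton] at hab
  simp only [Finset.prod_singleton, Finset.prod_empty, mul_one, one_mul] at hab ha hb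
  have e : ∀ ω, centered P (a j) ω * conj (centered P (b l) ω) =
      a j ω * conj (b l ω) - a j ω * moment01 M z (Y l) - moment10 M z (X j) * conj (b l ω) +
        moment10 M z (X j) * moment01 M z (Y l) := fun ω => by
    simp only [centered, map_sub, h.integral_fst, h.integral_snd]
    ring
  simp only [e]
  have i1 : Integrable (fun ω => a j ω * conj (b l ω) - a j ω * moment01 M z (Y l)) P :=
    hab.1.sub (ha.mul_const _)
  have i2 : Integrable (fun ω => a j ω * conj (b l ω) - a j ω * moment01 M z (Y l) -
      moment10 M z (X j) * conj (b l ω)) P := i1.sub (hb.const_mul _)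
  rw [integral_add i2 (integrable_const _), integral_sub i1 (hb.const_mul _),
    integral_sub hab.1 (ha.mul_const _), hab.2, integral_mul_const, integral_const_mul,
    h.integral_fst, hb', integral_const]
  simp

end RandomField

end Speckle

end

theorem theorem4p9 {d : ℕ} (hd : 1 ≤ d) (reg : Speckle.Regime) (k₀ : ℝ) (hk₀ : 0 < k₀)
    (R : Speckle.Lat d → ℝ) (hR : Speckle.IsCovariance reg R) (p q : ℕ) (Z : ℝ) (hZ : 0 ≤ Z) :
    -- the solution operators that enter the main term exist
    (∀ ε ∈ reg.range, ∀ γ : Fin p × Fin q,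
      ∃ U, Speckle.IsPairPropagator (d := d) k₀ R (reg.eta ε) ε γ U) ∧
    -- general incident conditions: uniform bound of the solution and of the error term
    (∃ c : ℝ, ∀ ε ∈ reg.range,
      ∀ U : Fin p × Fin q → ℝ → Module.End ℂ (ComplexMeasure (Speckle.Config p q d)),
      (∀ γ, Speckle.IsPairPropagator k₀ R (reg.eta ε) ε γ (U γ)) →
      ∀ m : ℝ → ComplexMeasure (Speckle.Config p q d),
      Speckle.IsMomentSolution k₀ R (reg.eta ε) ε m →
      ∀ z ∈ Icc 0 Z, ∀ X : Speckle.Config p q d,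
        ‖Speckle.invFourier (m z) X‖ ≤ c * Speckle.tv (m 0) ∧
        ‖Speckle.errorTerm k₀ R (reg.eta ε) ε U m z X‖ ≤
          c * ε ^ (1 / 3 : ℝ) * Speckle.tv (m 0)) ∧
    -- product incident conditions: the main term is the Gaussian functional
    (∀ ε ∈ reg.range,
      ∀ U : Fin p × Fin q → ℝ → Module.End ℂ (ComplexMeasure (Speckle.Config p q d)),
      (∀ γ, Speckle.IsPairPropagator k₀ R (reg.eta ε) ε γ (U γ)) →
      ∀ f : Speckle.Lat d → ℂ, Integrable f →
      ∀ M : ∀ p q : ℕ, ℝ → ComplexMeasure (Speckle.Config p q d),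
      Speckle.IsMomentFamily k₀ R (reg.eta ε) ε f M →
      ∀ z ∈ Icc 0 Z, ∀ (X : Fin p → Speckle.Lat d) (Y : Fin q → Speckle.Lat d),
        Speckle.moment M z p q X Y =
          Speckle.gaussianF (fun j => Speckle.moment10 M z (X j))
              (fun l => Speckle.moment01 M z (Y l))
              (fun j l => Speckle.moment11 M z (X j) (Y l))
            + Speckle.errorTerm k₀ R (reg.eta ε) ε U (M p q) z (Sum.elim X Y)) ∧
    -- centered moments
    (∃ ε₀ : ℝ, 0 < ε₀ ∧ ∀ ε ∈ reg.range, ε < ε₀ →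
      ∀ f : Speckle.Lat d → ℂ, Integrable f →
      ∀ M : ∀ p q : ℕ, ℝ → ComplexMeasure (Speckle.Config p q d),
      Speckle.IsMomentFamily k₀ R (reg.eta ε) ε f M →
      ∀ z ∈ Icc 0 Z, ∀ (X : Fin p → Speckle.Lat d) (Y : Fin q → Speckle.Lat d),
        ‖Speckle.centeredMoment M z p q X Y
            - Speckle.centeredF (fun j l => Speckle.centeredMoment11 M z (X j) (Y l))‖ ≤
          Speckle.tv (M p q 0) * ε ^ (1 / 3 : ℝ) ∧
        ∀ (Ω : Type u) [MeasurableSpace Ω] (P : Measure Ω) [IsProbabilityMeasure P]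
          (a : Fin p → Ω → ℂ) (b : Fin q → Ω → ℂ), Speckle.HasFieldMoments P M z X Y a b →
          ‖(∫ ω, (∏ j, Speckle.centered P (a j) ω) * ∏ l, conj (Speckle.centered P (b l) ω) ∂P)
              - Speckle.centeredF (fun j l =>
                  ∫ ω, Speckle.centered P (a j) ω * conj (Speckle.centered P (b l) ω) ∂P)‖ ≤
            Speckle.tv (M p q 0) * ε ^ (1 / 3 : ℝ)) := by
  refine ⟨fun ε _ γ => Speckle.exists_isPairPropagator hd hR k₀ (reg.eta ε) ε γ, ?_, ?_, ?_⟩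
  · obtain ⟨C, hC0, hC⟩ := Speckle.exists_error_bound hd hR hk₀ p q hZ
    refine ⟨C, fun ε hε U hU m hm z hz X => ?_⟩
    obtain ⟨h1, h2⟩ := hC ε hε m hm z hz X
    refine ⟨h1, (h2 U hU).trans ?_⟩
    have hpow : ε ^ (11 / 30 : ℝ) ≤ ε ^ (1 / 3 : ℝ) :=
      Real.rpow_le_rpow_of_exponent_ge (Speckle.Regime.pos_of_mem_range hε)
        (Speckle.Regime.le_one_of_mem_range hε) (by norm_num)
    exact mul_le_mul_of_nonneg_right (mul_le_mul_of_nonneg_left hpow hC0) (Speckle.tv_nonneg _)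
  · intro ε _ U hU f hf M hM z hz X Y
    exact hM.moment_eq_gaussianF_add hd hR hf hz.1 hU X Y
  · obtain ⟨ε₀, hε₀, hb⟩ := Speckle.exists_centeredMoment_bound hd hR hk₀ p q hZ
    refine ⟨ε₀, hε₀, fun ε hε hlt f hf M hM z hz X Y => ?_⟩
    have h1 := hb ε hε hlt f hf M hM z hz X Y
    refine ⟨h1, fun Ω _ P _ a b hab => ?_⟩
    simp only [hM.centeredMoment11_eq hd hR hf hz.1] at h1
    rw [hab.integral_centered]
    simp only [hab.integral_centered_mul]
    exact h1
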